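/- \textbf{Setting.} Let $S$ be a noetherian scheme and $S\hookrightarrow\widetilde S$ a closed immersion whose ideal sheaf $\mathfrak a$ satisfies $\mathfrak a^2=0$. Let $\widetilde X\to\widetilde S$ be smooth and let $\widetilde D\subset\widetilde X$ be a simple normal crossings divisor relative to $\widetilde S$; that is, Zariski-locally on $\widetilde X$ there are étale coordinates $t_1,\dots,t_n$ over $\widetilde S$ such that $\widetilde D$ is the zero scheme of a product of distinct $t_i$ (of the empty product away from $\widetilde D$). Put $(X,D)=(\widetilde X,\widetilde D)\times_{\widetilde S}S$ and let $\mathcal I=\mathfrak a\,\mathcal O_{\widetilde X}$ be the ideal of $X$ in $\widetilde X$; since $\mathcal I^2=0$ it is an $\mathcal O_X$-module, and the derivation of $\mathcal O_{\widetilde X}$ induces an integrable connection $d:\mathcal I\to\mathcal I\otimes\Omega^1_{X/S}(\log D)$. A \emph{de Rham bundle} $(V,\nabla)$ on $(X,D)/S$ is a vector bundle $V$ of finite rank with an integrable connection $\nabla:V\to V\otimes\Omega^1_{X/S}(\log D)$. A \emph{filtered de Rham bundle} $(V,\nabla,\mathrm{Fil})$ has in addition a decreasing filtration $(\mathrm{Fil}^pV)_{p\in\mathbb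 Z}$ by subbundles (locally direct summands), with $\mathrm{Fil}^aV=V$ and $\mathrm{Fil}^bV=0$ for some integers $a,b$, such that $\nabla(\mathrm{Fil}^p)\subset\mathrm{Fil}^{p-1}\otimes\Omega^1_{X/S}(\log D)$; such a filtration is called a Hodge filtration. The same definitions apply to $(\widetilde X,\widetilde D)/\widetilde S$. A \emph{lift} of $(V,\nabla)$ (resp. of $(V,\nabla,\mathrm{Fil})$) is a de Rham bundle (resp. filtered de Rham bundle) on $(\widetilde X,\widetilde D)/\widetilde S$ together with an isomorphism of its restriction to $X$ with $(V,\nabla)$ (resp. $(V,\nabla,\mathrm{Fil})$). Isomorphisms of lifts are isomorphisms of de Rham bundles (resp. filtered de Rham bundles) which restrict to the identity of $V$. Write $\mathrm{Def}_{(V,\nabla)}$ and $\mathrm{Def}_{(V,\nabla,\mathrm{Fil})}$ for the sets of isomorphism classes of lifts. Let $\mathrm{DR}=\mathrm{DR}(\mathcal{E}nd(V,\nabla)_{\mathcal I})$ be the de Rham complex of $\mathcal{E}nd(V)\otimes_{\mathcal O_X}\mathcal I$ with the connection induced by $\nabla$ and $d$, filtered by the subcomplexes $\mathrm{Fil}^p\,\mathrm{DR}$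 with terms $$\mathrm{Fil}^p\,\mathrm{DR}^n=\mathrm{Fil}^{p-n}\mathcal{E}nd(V)\otimes\mathcal I\otimes\Omega^n_{X/S}(\log D),\qquad \mathrm{Fil}^{\ell}\mathcal{E}nd(V)=\{f : f(\mathrm{Fil}^aV)\subset\mathrm{Fil}^{a+\ell}V\ \text{for all } a\}.$$ The Hodge--de Rham spectral sequence is the spectral sequence of this filtered complex in hypercohomology, $$E_1^{p,q}=\mathbb H^{p+q}(X,\mathrm{Gr}^p_{\mathrm{Fil}}\mathrm{DR})\Rightarrow\mathbb H^{p+q}(X,\mathrm{DR}).$$ \textbf{Theorem.} Let $(V,\nabla,\mathrm{Fil})$ be a filtered de Rham bundle on $(X,D)/S$ whose Hodge--de Rham spectral sequence degenerates at $E_1$ (all differentials $d_r$, $r\ge1$, vanish). Then: (1) If $(V,\nabla)$ has a lift to $(\widetilde X,\widetilde D)/\widetilde S$, then $(V,\nabla,\mathrm{Fil})$ has a lift to $(\widetilde X,\widetilde D)/\widetilde S$ (whose underlying de Rham bundle need not be the given lift of $(V,\nabla)$). (2) The forgetful map $\mathrm{Def}_{(V,\nabla,\mathrm{Fil})}\to\mathrm{Def}_{(V,\nabla)}$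 is injective. In particular, for a lift $(\widetilde V,\widetilde\nabla)$ of $(V,\nabla)$ and any two Hodge filtrations $\widetilde{\mathrm{Fil}},\widetilde{\mathrm{Fil}}'$ on it which lift $\mathrm{Fil}$, there is an isomorphism $(\widetilde V,\widetilde\nabla,\widetilde{\mathrm{Fil}})\cong(\widetilde V,\widetilde\nabla,\widetilde{\mathrm{Fil}}')$ of filtered de Rham bundles on $(\widetilde X,\widetilde D)/\widetilde S$ which restricts to the identity of $V$. -/

import Mathlib

open CategoryTheory AlgebraicGeometry TopologicalSpace Opposite Limits
open scoped TensorProduct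

universe u

noncomputable section

namespace FilteredDeRham

/-! ### Alternating forms on a Lie–Rinehart algebra -/

/-- Functions of `n` variables in `L` with values in `M`, in curried form `L → ⋯ → L → M`. -/
def Cochain (L M : Type u) : ℕ → Type u
  | 0 => M
  | n + 1 => L → Cochain L M n

instance Cochain.addCommGroup (L M : Type u) [inst : AddCommGroup M] :
    ∀ n, AddCommGroup (Cochain L M n)
  | 0 => inst
  | n + 1 => @Pi.addCommGroup L (fun _ => Cochain L M n) (fun _ => Cochain.addCommGroup L M n)

instance Cochain.module (R L M : Type u) [CommRing R] [AddCommGroup M] [inst : Module R M] :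
    ∀ n, Module R (Cochain L M n)
  | 0 => inst
  | n + 1 => @Pi.module L (fun _ => Cochain L M n) R _ _ (fun _ => Cochain.module R L M n)

section

variable {R L M : Type u} [AddCommGroup M]

lemma Cochain.add_apply {n : ℕ} (ω η : Cochain L M (n + 1)) (x : L) :
    (ω + η : Cochain L M (n + 1)) x = ω x + η x := rfl

lemma Cochain.sub_apply {n : ℕ} (ω η : Cochain L M (n + 1)) (x : L) :
    (ω - η : Cochain L M (n + 1)) x = ω x - η x := rfl

lemma Cochain.neg_apply {n : ℕ} (ω : Cochain L M (n + 1)) (x : L) :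
    (-ω : Cochain L M (n + 1)) x = -ω x := rfl

lemma Cochain.zero_apply {n : ℕ} (x : L) : (0 : Cochain L M (n + 1)) x = 0 := rfl

lemma Cochain.smul_apply [CommRing R] [Module R M] {n : ℕ} (a : R) (ω : Cochain L M (n + 1))
    (x : L) : (a • ω : Cochain L M (n + 1)) x = a • ω x := rfl

end

/-- A module with an integrable connection over a Lie–Rinehart algebra `(R, L)`: integrability
is part of `LieRingModule`, the two axioms here are linearity in `L` and the Leibniz rule. -/
class IsLieRinehartModule (R L M : Type u) [CommRing R] [LieRing L] [Module R L]
    [LieRingModule L R] [AddCommGroup M] [Module R M] [LieRingModule L M] : Prop where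
  smul_lie (a : R) (x : L) (m : M) : ⁅a • x, m⁆ = a • ⁅x, m⁆
  lie_smul (x : L) (a : R) (m : M) : ⁅x, a • m⁆ = a • ⁅x, m⁆ + ⁅x, a⁆ • m

section

variable {L M : Type u} [LieRing L] [AddCommGroup M] [LieRingModule L M]

/-- The Lie derivative:
`(𝓛ₓ ω)(y₁, …, yₙ) = x ω(y₁, …, yₙ) - ∑ᵢ ω(y₁, …, [x, yᵢ], …, yₙ)`. -/
def lieDer : ∀ n, L → Cochain L M n → Cochain L M n
  | 0, x, m => Bracket.bracket (M := M) x m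
  | n + 1, x, ω => fun y => lieDer n x (ω y) - ω ⁅x, y⁆

/-- The de Rham (Chevalley–Eilenberg) differential, given by `(d m)(x) = x m` in degree `0` and by
Cartan's formula `ιₓ d ω = 𝓛ₓ ω - d (ιₓ ω)` in positive degrees; explicitly,
`(d ω)(x₀, …, xₙ) = ∑ᵢ (-1)ⁱ xᵢ ω(…, x̂ᵢ, …) + ∑_{i<j} (-1)^{i+j} ω([xᵢ, xⱼ], …, x̂ᵢ, …, x̂ⱼ, …)`
for alternating `ω`. -/
def ceDiff : ∀ n, Cochain L M n → Cochain L M (n + 1)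
  | 0, m => fun x => Bracket.bracket (M := M) x m
  | n + 1, ω => fun x => lieDer (n + 1) x ω - ceDiff n (ω x)

lemma lieDer_succ {n : ℕ} (x y : L) (ω : Cochain L M (n + 1)) :
    lieDer (n + 1) x ω y = lieDer n x (ω y) - ω ⁅x, y⁆ := rfl

lemma ceDiff_zero_apply (x : L) (ω : Cochain L M 0) : ceDiff 0 ω x = lieDer 0 x ω := rfl

lemma ceDiff_succ {n : ℕ} (x : L) (ω : Cochain L M (n + 1)) :
    ceDiff (n + 1) ω x = lieDer (n + 1) x ω - ceDiff n (ω x) := rfl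

lemma lieDer_add : ∀ n (x : L) (ω η : Cochain L M n),
    lieDer n x (ω + η) = lieDer n x ω + lieDer n x η
  | 0, x, ω, η => lie_add (L := L) (M := M) x ω η
  | n + 1, x, ω, η => by
    funext y
    simp only [lieDer_succ, Cochain.add_apply, lieDer_add n]
    abel

/-- The Lie derivative as an additive map. -/
def lieDerHom (n : ℕ) (x : L) : Cochain L M n →+ Cochain L M n :=
  AddMonoidHom.mk' (lieDer n x) (lieDer_add n x)

lemma lieDer_sub (n : ℕ) (x : L) (ω η : Cochain L M n) :
    lieDer n x (ω - η) = lieDer n x ω - lieDer n x η := map_sub (lieDerHom n x) ω η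

lemma lieDer_neg (n : ℕ) (x : L) (ω : Cochain L M n) :
    lieDer n x (-ω) = -lieDer n x ω := map_neg (lieDerHom n x) ω

lemma lieDer_zero (n : ℕ) (x : L) : lieDer n x (0 : Cochain L M n) = 0 := map_zero (lieDerHom n x)

lemma ceDiff_add : ∀ n (ω η : Cochain L M n), ceDiff n (ω + η) = ceDiff n ω + ceDiff n η
  | 0, ω, η => by
    funext x
    exact lie_add (L := L) (M := M) x ω η
  | n + 1, ω, η => by
    funext x
    simp only [ceDiff_succ, Cochain.add_apply, lieDer_add, ceDiff_add n]
    abel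

/-- The differential as an additive map. -/
def ceDiffHom (n : ℕ) : Cochain L M n →+ Cochain L M (n + 1) :=
  AddMonoidHom.mk' (ceDiff n) (ceDiff_add n)

lemma ceDiff_sub (n : ℕ) (ω η : Cochain L M n) :
    ceDiff n (ω - η) = ceDiff n ω - ceDiff n η := map_sub (ceDiffHom n) ω η

lemma ceDiff_zero (n : ℕ) : ceDiff n (0 : Cochain L M n) = 0 := map_zero (ceDiffHom n)

lemma ceDiff_neg (n : ℕ) (ω : Cochain L M n) :
    ceDiff n (-ω) = -ceDiff n ω := map_neg (ceDiffHom n) ω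

end

section

variable (R : Type u) {L M : Type u} [CommRing R] [LieRing L] [Module R L]
  [AddCommGroup M] [Module R M]

/-- `ω` is an alternating `R`-multilinear form: it is linear in the first variable, `ω(x, x, …)`
vanishes, and recursively `ω(x, …)` is alternating multilinear for each `x`. -/
def IsForm : ∀ n, Cochain L M n → Prop
  | 0, _ => True
  | 1, ω => (∀ x y, ω (x + y) = ω x + ω y) ∧ (∀ (a : R) x, ω (a • x) = a • ω x)
  | n + 2, ω => (∀ x y, ω (x + y) = ω x + ω y) ∧ (∀ (a : R) x, ω (a • x) = a • ω x) ∧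
      (∀ x, ω x x = 0) ∧ ∀ x, IsForm (n + 1) (ω x)

variable {R}

lemma IsForm.map_add {n : ℕ} {ω : Cochain L M (n + 1)} (h : IsForm R (n + 1) ω) (x y : L) :
    ω (x + y) = ω x + ω y := by
  cases n with
  | zero => exact h.1 x y
  | succ n => exact h.1 x y

lemma IsForm.map_smul {n : ℕ} {ω : Cochain L M (n + 1)} (h : IsForm R (n + 1) ω) (a : R) (x : L) :
    ω (a • x) = a • ω x := by
  cases n with
  | zero => exact h.2 a x
  | succ n => exact h.2.1 a x

lemma IsForm.apply {n : ℕ} {ω : Cochain L M (n + 1)} (h : IsForm R (n + 1) ω) (x : L) :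
    IsForm R n (ω x) := by
  cases n with
  | zero => trivial
  | succ n => exact h.2.2.2 x

lemma IsForm.self {n : ℕ} {ω : Cochain L M (n + 2)} (h : IsForm R (n + 2) ω) (x : L) :
    ω x x = 0 := h.2.2.1 x

lemma IsForm.swap {n : ℕ} {ω : Cochain L M (n + 2)} (h : IsForm R (n + 2) ω) (x y : L) :
    ω x y = -ω y x := by
  have h1 := h.self (x + y)
  rw [h.map_add, Cochain.add_apply, (h.apply x).map_add, (h.apply y).map_add, h.self, h.self,
    zero_add, add_zero] at h1
  exact eq_neg_of_add_eq_zero_left h1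

lemma IsForm.map_zero {n : ℕ} {ω : Cochain L M (n + 1)} (h : IsForm R (n + 1) ω) : ω 0 = 0 := by
  have := h.map_smul 0 0
  rwa [zero_smul, zero_smul] at this

lemma IsForm.map_neg {n : ℕ} {ω : Cochain L M (n + 1)} (h : IsForm R (n + 1) ω) (x : L) :
    ω (-x) = -ω x := by
  have := h.map_add x (-x)
  rw [add_neg_cancel, h.map_zero] at this
  exact (neg_eq_of_add_eq_zero_right this.symm).symm

lemma IsForm.map_sub {n : ℕ} {ω : Cochain L M (n + 1)} (h : IsForm R (n + 1) ω) (x y : L) :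
    ω (x - y) = ω x - ω y := by
  rw [sub_eq_add_neg, h.map_add, h.map_neg, sub_eq_add_neg]

lemma isForm_zero : ∀ n, IsForm R n (0 : Cochain L M n)
  | 0 => trivial
  | 1 => ⟨fun _ _ => (add_zero (0 : Cochain L M 0)).symm,
      fun a _ => (smul_zero (A := Cochain L M 0) a).symm⟩
  | n + 2 => ⟨fun _ _ => (add_zero (0 : Cochain L M (n + 1))).symm,
      fun a _ => (smul_zero (A := Cochain L M (n + 1)) a).symm, fun _ => rfl,
      fun _ => isForm_zero (n + 1)⟩

/-- Vanishing when the first two arguments agree. -/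
def VanishDiag : ∀ {n : ℕ}, Cochain L M (n + 1) → Prop
  | 0, _ => True
  | _ + 1, ω => ∀ x, ω x x = 0

lemma IsForm.mk' {n : ℕ} {ω : Cochain L M (n + 1)} (h1 : ∀ x y, ω (x + y) = ω x + ω y)
    (h2 : ∀ (a : R) x, ω (a • x) = a • ω x) (h3 : ∀ x, IsForm R n (ω x)) (h4 : VanishDiag ω) :
    IsForm R (n + 1) ω := by
  cases n with
  | zero => exact ⟨h1, h2⟩
  | succ n => exact ⟨h1, h2, h4, h3⟩

lemma IsForm.add : ∀ {n : ℕ} {ω η : Cochain L M n}, IsForm R n ω → IsForm R n η →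
    IsForm R n (ω + η)
  | 0, _, _, _, _ => trivial
  | n + 1, ω, η, h, h' => by
    refine IsForm.mk' (fun x y => ?_) (fun a x => ?_) (fun x => (h.apply x).add (h'.apply x)) ?_
    · simp only [Cochain.add_apply, h.map_add, h'.map_add]; abel
    · simp only [Cochain.add_apply, h.map_smul, h'.map_smul, smul_add]
    · cases n with
      | zero => trivial
      | succ n =>
        intro x
        rw [Cochain.add_apply, Cochain.add_apply, h.self, h'.self, add_zero]

lemma IsForm.neg : ∀ {n : ℕ} {ω : Cochain L M n}, IsForm R n ω → IsForm R n (-ω)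
  | 0, _, _ => trivial
  | n + 1, ω, h => by
    refine IsForm.mk' (fun x y => ?_) (fun a x => ?_) (fun x => (h.apply x).neg) ?_
    · simp only [Cochain.neg_apply, h.map_add]; abel
    · simp only [Cochain.neg_apply, h.map_smul, smul_neg]
    · cases n with
      | zero => trivial
      | succ n =>
        intro x
        rw [Cochain.neg_apply, Cochain.neg_apply, h.self, neg_zero]

lemma IsForm.sub {n : ℕ} {ω η : Cochain L M n} (h : IsForm R n ω) (h' : IsForm R n η) :
    IsForm R n (ω - η) := by
  rw [sub_eq_add_neg]; exact h.add h'.neg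

lemma IsForm.smul (a : R) : ∀ {n : ℕ} {ω : Cochain L M n}, IsForm R n ω → IsForm R n (a • ω)
  | 0, _, _ => trivial
  | n + 1, ω, h => by
    refine IsForm.mk' (fun x y => ?_) (fun b x => ?_) (fun x => IsForm.smul a (h.apply x)) ?_
    · simp only [Cochain.smul_apply, h.map_add, smul_add]
    · simp only [Cochain.smul_apply, h.map_smul, smul_comm a b]
    · cases n with
      | zero => trivial
      | succ n =>
        intro x
        rw [Cochain.smul_apply, Cochain.smul_apply, h.self, smul_zero]

section Additivity

variable [LieRingModule L M]

lemma lieDer_add_left : ∀ {n : ℕ} {ω : Cochain L M n} (_ : IsForm R n ω) (x y : L),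
    lieDer n (x + y) ω = lieDer n x ω + lieDer n y ω
  | 0, ω, _, x, y => add_lie (L := L) (M := M) x y ω
  | n + 1, ω, h, x, y => by
    funext z
    simp only [lieDer_succ, Cochain.add_apply, lieDer_add_left (h.apply z), add_lie, h.map_add]
    abel

lemma lieDer_lie : ∀ {n : ℕ} {ω : Cochain L M n} (_ : IsForm R n ω) (x y : L),
    lieDer n ⁅x, y⁆ ω = lieDer n x (lieDer n y ω) - lieDer n y (lieDer n x ω)
  | 0, ω, _, x, y => lie_lie (L := L) (M := M) x y ω
  | n + 1, ω, h, x, y => by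
    funext z
    simp only [lieDer_succ, Cochain.sub_apply, lieDer_lie (h.apply z), lieDer_sub, lie_lie,
      h.map_sub]
    abel

end Additivity

variable [LieRingModule L R] [LieRinehartRing R L] [LieRingModule L M] [IsLieRinehartModule R L M]

lemma lieDer_smul : ∀ (n : ℕ) (ω : Cochain L M n) (x : L) (a : R),
    lieDer n x (a • ω) = a • lieDer n x ω + ⁅x, a⁆ • ω
  | 0, ω, x, a => IsLieRinehartModule.lie_smul (M := M) x a ω
  | n + 1, ω, x, a => by
    funext z
    simp only [lieDer_succ, Cochain.add_apply, Cochain.smul_apply, lieDer_smul n, smul_sub]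
    abel

lemma IsForm.lieDer : ∀ {n : ℕ} {ω : Cochain L M n} (_ : IsForm R n ω) (x : L),
    IsForm R n (lieDer n x ω)
  | 0, _, _, _ => trivial
  | n + 1, ω, h, x => by
    refine IsForm.mk' (fun y z => ?_) (fun a y => ?_)
      (fun y => ((h.apply y).lieDer x).sub (h.apply _)) ?_
    · simp only [lieDer_succ, h.map_add, lieDer_add, lie_add]; abel
    · simp only [lieDer_succ, h.map_smul, lieDer_smul, LieRinehartRing.leibniz_smul_right,
        h.map_add, smul_sub]
      abel
    · cases n with
      | zero => trivial
      | succ n =>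
        intro y
        rw [lieDer_succ, Cochain.sub_apply, lieDer_succ, h.self, lieDer_zero, h.swap y]
        abel

lemma lieDer_smul_left : ∀ {n : ℕ} {ω : Cochain L M (n + 1)} (_ : IsForm R (n + 1) ω) (x : L)
    (a : R), lieDer (n + 1) (a • x) ω - a • lieDer (n + 1) x ω =
      ceDiff n (a • ω x) - a • ceDiff n (ω x)
  | 0, ω, h, x, a => by
    funext y
    have e (z : L) : ⁅a • x, z⁆ = a • ⁅x, z⁆ - ⁅z, a⁆ • x := by
      rw [← lie_skew, LieRinehartRing.leibniz_smul_right, ← lie_skew x z, smul_neg]; abel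
    have h0 : lieDer 0 (a • x) (ω y) = a • lieDer 0 x (ω y) :=
      IsLieRinehartModule.smul_lie (M := M) a x (ω y)
    simp only [lieDer_succ, Cochain.sub_apply, Cochain.smul_apply, ceDiff_zero_apply,
      lieDer_smul, e, h.map_sub, h.map_smul, h0, smul_sub]
    abel
  | n + 1, ω, h, x, a => by
    funext y
    have e (z : L) : ⁅a • x, z⁆ = a • ⁅x, z⁆ - ⁅z, a⁆ • x := by
      rw [← lie_skew, LieRinehartRing.leibniz_smul_right, ← lie_skew x z, smul_neg]; abel
    have h0 := lieDer_smul_left (h.apply y) x a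
    have h1 : lieDer (n + 1) (a • x) (ω y) = a • lieDer (n + 1) x (ω y) +
      (ceDiff n (a • ω y x) - a • ceDiff n (ω y x)) := by rw [← h0]; abel
    rw [h.swap y x, smul_neg, ceDiff_neg, ceDiff_neg] at h1
    simp only [lieDer_succ (n := n + 1), Cochain.sub_apply, Cochain.smul_apply, ceDiff_succ,
      lieDer_smul, e, h.map_sub, h.map_smul, h1, smul_sub, smul_neg]
    abel

lemma IsForm.ceDiff : ∀ {n : ℕ} {ω : Cochain L M n} (_ : IsForm R n ω),
    IsForm R (n + 1) (ceDiff n ω)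
  | 0, ω, _ => ⟨fun x y => add_lie (L := L) (M := M) x y ω,
      fun a x => IsLieRinehartModule.smul_lie (M := M) a x ω⟩
  | n + 1, ω, h => by
    refine IsForm.mk' (fun x y => ?_) (fun a x => ?_)
      (fun x => (h.lieDer x).sub (h.apply x).ceDiff) ?_
    · simp only [ceDiff_succ, lieDer_add_left h, h.map_add, ceDiff_add]; abel
    · have h1 := lieDer_smul_left h x a
      have h2 : FilteredDeRham.lieDer (n + 1) (a • x) ω = a • FilteredDeRham.lieDer (n + 1) x ω +
        (FilteredDeRham.ceDiff n (a • ω x) - a • FilteredDeRham.ceDiff n (ω x)) := by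
        rw [← h1]; abel
      rw [ceDiff_succ, ceDiff_succ, h2, h.map_smul, smul_sub]; abel
    · intro x
      rw [ceDiff_succ, Cochain.sub_apply, lieDer_succ, lie_self, h.map_zero, sub_zero]
      cases n with
      | zero => rw [ceDiff_zero_apply, sub_self]
      | succ n => rw [ceDiff_succ, h.self, ceDiff_zero, sub_zero, sub_self]

lemma lieDer_ceDiff : ∀ {n : ℕ} {ω : Cochain L M n} (_ : IsForm R n ω) (x : L),
    lieDer (n + 1) x (ceDiff n ω) = ceDiff n (lieDer n x ω)
  | 0, ω, h, x => by
    funext y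
    rw [lieDer_succ, ceDiff_zero_apply, ceDiff_zero_apply, ceDiff_zero_apply, lieDer_lie h]
    abel
  | n + 1, ω, h, x => by
    funext y
    rw [lieDer_succ, ceDiff_succ, ceDiff_succ, ceDiff_succ, lieDer_lie h, lieDer_sub,
      lieDer_ceDiff (h.apply y), lieDer_succ (n := n), ceDiff_sub]
    abel

/-- The differential squares to zero on forms. -/
lemma ceDiff_ceDiff : ∀ {n : ℕ} {ω : Cochain L M n} (_ : IsForm R n ω),
    ceDiff (n + 1) (ceDiff n ω) = 0
  | 0, ω, h => by
    funext x
    rw [ceDiff_succ, lieDer_ceDiff h, ceDiff_zero_apply, sub_self, Cochain.zero_apply]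
  | n + 1, ω, h => by
    funext x
    rw [ceDiff_succ, lieDer_ceDiff h, ceDiff_succ, ceDiff_sub, ceDiff_ceDiff (h.apply x),
      sub_zero, sub_self, Cochain.zero_apply]

end


/-! ### Compatible families of forms -/

section

variable {L L' M M' : Type u}

/-- Compatibility of two cochains with maps `ρ : L → L'` and `σ : M → M'`:
`σ (ω(x₁, …, xₙ)) = ω'(ρ x₁, …, ρ xₙ)`. -/
def Compat (ρ : L → L') (σ : M → M') : ∀ n, Cochain L M n → Cochain L' M' n → Prop
  | 0, ω, ω' => σ ω = ω'
  | n + 1, ω, ω' => ∀ x, Compat ρ σ n (ω x) (ω' (ρ x))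

/-- All values `ω(x₁, …, xₙ)` lie in `A`. -/
def ValuedIn (A : Set M) : ∀ n, Cochain L M n → Prop
  | 0, ω => ω ∈ A
  | n + 1, ω => ∀ x, ValuedIn A n (ω x)

lemma ValuedIn.mono {A B : Set M} (h : A ⊆ B) : ∀ {n : ℕ} {ω : Cochain L M n},
    ValuedIn A n ω → ValuedIn B n ω
  | 0, _, hω => h hω
  | _ + 1, _, hω => fun x => (hω x).mono h

variable [AddCommGroup M] [AddCommGroup M']

lemma compat_zero {ρ : L → L'} {σ : M →+ M'} : ∀ n, Compat ρ σ n 0 0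
  | 0 => σ.map_zero
  | n + 1 => fun _ => compat_zero n

lemma Compat.add {ρ : L → L'} {σ : M →+ M'} : ∀ {n : ℕ} {ω η : Cochain L M n}
    {ω' η' : Cochain L' M' n}, Compat ρ σ n ω ω' → Compat ρ σ n η η' →
    Compat ρ σ n (ω + η) (ω' + η')
  | 0, ω, η, ω', η', h, h' => by
    have h : σ ω = ω' := h
    have h' : σ η = η' := h'
    exact (σ.map_add ω η).trans (by rw [h, h']; rfl)
  | _ + 1, _, _, _, _, h, h' => fun x => (h x).add (h' x)

lemma Compat.neg {ρ : L → L'} {σ : M →+ M'} : ∀ {n : ℕ} {ω : Cochain L M n}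
    {ω' : Cochain L' M' n}, Compat ρ σ n ω ω' → Compat ρ σ n (-ω) (-ω')
  | 0, ω, ω', h => by
    have h : σ ω = ω' := h
    exact (σ.map_neg ω).trans (by rw [h]; rfl)
  | _ + 1, _, _, h => fun x => (h x).neg

lemma Compat.sub {ρ : L → L'} {σ : M →+ M'} {n : ℕ} {ω η : Cochain L M n}
    {ω' η' : Cochain L' M' n} (h : Compat ρ σ n ω ω') (h' : Compat ρ σ n η η') :
    Compat ρ σ n (ω - η) (ω' - η') := by
  rw [sub_eq_add_neg, sub_eq_add_neg]; exact h.add h'.neg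

lemma valuedIn_zero (A : AddSubgroup M) : ∀ n, ValuedIn (A : Set M) n (0 : Cochain L M n)
  | 0 => A.zero_mem
  | n + 1 => fun _ => valuedIn_zero A n

lemma ValuedIn.add {A : AddSubgroup M} : ∀ {n : ℕ} {ω η : Cochain L M n},
    ValuedIn (A : Set M) n ω → ValuedIn (A : Set M) n η → ValuedIn (A : Set M) n (ω + η)
  | 0, _, _, h, h' => A.add_mem h h'
  | _ + 1, _, _, h, h' => fun x => (h x).add (h' x)

lemma ValuedIn.neg {A : AddSubgroup M} : ∀ {n : ℕ} {ω : Cochain L M n},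
    ValuedIn (A : Set M) n ω → ValuedIn (A : Set M) n (-ω)
  | 0, _, h => A.neg_mem h
  | _ + 1, _, h => fun x => (h x).neg

lemma ValuedIn.sub {A : AddSubgroup M} {n : ℕ} {ω η : Cochain L M n}
    (h : ValuedIn (A : Set M) n ω) (h' : ValuedIn (A : Set M) n η) :
    ValuedIn (A : Set M) n (ω - η) := by
  rw [sub_eq_add_neg]; exact h.add h'.neg

variable [LieRing L] [LieRing L'] [LieRingModule L M] [LieRingModule L' M']

lemma Compat.lieDer {ρ : L → L'} {σ : M →+ M'} (hρ : ∀ x y, ρ ⁅x, y⁆ = ⁅ρ x, ρ y⁆)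
    (hσ : ∀ (x : L) (m : M), σ ⁅x, m⁆ = ⁅ρ x, σ m⁆) (x : L) :
    ∀ {n : ℕ} {ω : Cochain L M n} {ω' : Cochain L' M' n}, Compat ρ σ n ω ω' →
      Compat ρ σ n (lieDer n x ω) (lieDer n (ρ x) ω')
  | 0, ω, ω', h => by
    have h : σ ω = ω' := h
    exact (hσ x ω).trans (by rw [h]; rfl)
  | n + 1, ω, ω', h => fun y => by
    rw [lieDer_succ, lieDer_succ, ← hρ]
    exact (Compat.lieDer hρ hσ x (h y)).sub (h _)

lemma Compat.ceDiff {ρ : L → L'} {σ : M →+ M'} (hρ : ∀ x y, ρ ⁅x, y⁆ = ⁅ρ x, ρ y⁆)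
    (hσ : ∀ (x : L) (m : M), σ ⁅x, m⁆ = ⁅ρ x, σ m⁆) :
    ∀ {n : ℕ} {ω : Cochain L M n} {ω' : Cochain L' M' n}, Compat ρ σ n ω ω' →
      Compat ρ σ (n + 1) (ceDiff n ω) (ceDiff n ω')
  | 0, _, _, h => fun x => h.lieDer hρ hσ x
  | _ + 1, _, _, h => fun x => (h.lieDer hρ hσ x).sub (Compat.ceDiff hρ hσ (h x))

lemma ValuedIn.lieDer {A B : AddSubgroup M} (hAB : A ≤ B)
    (hL : ∀ (x : L), ∀ m ∈ A, ⁅x, m⁆ ∈ B) (x : L) : ∀ {n : ℕ} {ω : Cochain L M n},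
    ValuedIn (A : Set M) n ω → ValuedIn (B : Set M) n (lieDer n x ω)
  | 0, ω, h => hL x ω h
  | _ + 1, _, h => fun y => ((h y).lieDer hAB hL x).sub ((h _).mono hAB)

lemma ValuedIn.ceDiff {A B : AddSubgroup M} (hAB : A ≤ B)
    (hL : ∀ (x : L), ∀ m ∈ A, ⁅x, m⁆ ∈ B) : ∀ {n : ℕ} {ω : Cochain L M n},
    ValuedIn (A : Set M) n ω → ValuedIn (B : Set M) (n + 1) (ceDiff n ω)
  | 0, _, h => fun x => h.lieDer hAB hL x
  | _ + 1, _, h => fun x => (h.lieDer hAB hL x).sub ((h x).ceDiff hAB hL)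

end

/-! ### Logarithmic derivations -/

section LogDer

variable {X S : Scheme.{u}}

/-- Restriction of functions. -/
abbrev resO {U W : X.Opens} (h : W ≤ U) : Γ(X, U) →+* Γ(X, W) :=
  (X.presheaf.map (homOfLE h).op).hom

lemma resO_self {U : X.Opens} (a : Γ(X, U)) : resO le_rfl a = a := by
  change (X.presheaf.map (𝟙 _)).hom a = a
  rw [X.presheaf.map_id]; rfl

lemma resO_resO {U W W' : X.Opens} (h : W ≤ U) (h' : W' ≤ W) (a : Γ(X, U)) :
    resO h' (resO h a) = resO (h'.trans h) a := by
  change ((X.presheaf.map (homOfLE h).op) ≫ (X.presheaf.map (homOfLE h').op)).hom a = _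
  rw [← X.presheaf.map_comp]; rfl

/-- The group `Γ(U, T_{X/S}(-log D))` of logarithmic vector fields, that is, of derivations of
`𝒪_X` on `U` which are linear over `S` and preserve the ideal sheaf of `D`. -/
def logDer (f : X ⟶ S) (D : X.IdealSheafData) (U : X.Opens) :
    AddSubgroup (∀ W : {W : X.Opens // W ≤ U}, Derivation ℤ Γ(X, W.1) Γ(X, W.1)) where
  carrier := {δ |
    (∀ (W W' : {W : X.Opens // W ≤ U}) (h : W'.1 ≤ W.1) (a : Γ(X, W.1)),
      resO h (δ W a) = δ W' (resO h a)) ∧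
    (∀ (W : {W : X.Opens // W ≤ U}) (V : S.Opens) (h : W.1 ≤ f ⁻¹ᵁ V) (s : Γ(S, V)),
      δ W ((f.appLE V W.1 h).hom s) = 0) ∧
    ∀ (W : X.affineOpens) (h : W.1 ≤ U), ∀ a ∈ D.ideal W, δ ⟨W.1, h⟩ a ∈ D.ideal W}
  zero_mem' := ⟨fun _ _ _ _ => map_zero _, fun _ _ _ _ => rfl, fun _ _ _ _ => zero_mem _⟩
  add_mem' {x y} hx hy := by
    refine ⟨fun W W' h a => ?_, fun W V h s => ?_, fun W h a ha => ?_⟩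
    · simp only [Pi.add_apply, Derivation.add_apply, map_add, hx.1 W W' h, hy.1 W W' h]
    · simp only [Pi.add_apply, Derivation.add_apply, hx.2.1, hy.2.1, add_zero]
    · exact add_mem (hx.2.2 W h a ha) (hy.2.2 W h a ha)
  neg_mem' {x} hx := by
    refine ⟨fun W W' h a => ?_, fun W V h s => ?_, fun W h a ha => ?_⟩
    · simp only [Pi.neg_apply, Derivation.neg_apply, map_neg, hx.1 W W' h]
    · simp only [Pi.neg_apply, Derivation.neg_apply, hx.2.1, neg_zero]
    · exact neg_mem (hx.2.2 W h a ha)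

/-- The type of logarithmic vector fields. -/
def LogDer (f : X ⟶ S) (D : X.IdealSheafData) (U : X.Opens) : Type u := logDer f D U

instance (f : X ⟶ S) (D : X.IdealSheafData) (U : X.Opens) : AddCommGroup (LogDer f D U) :=
  inferInstanceAs (AddCommGroup (logDer f D U))

namespace LogDer

variable {f : X ⟶ S} {D : X.IdealSheafData} {U : X.Opens}

/-- The value of a vector field on a function on a smaller open set. -/
def ev (x : LogDer f D U) (W : X.Opens) (h : W ≤ U) : Derivation ℤ Γ(X, W) Γ(X, W) := x.1 ⟨W, h⟩

@[ext]
lemma ext {x y : LogDer f D U} (H : ∀ W h a, x.ev W h a = y.ev W h a) :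
    x = y :=
  Subtype.ext (funext fun W => Derivation.ext fun a => H W.1 W.2 a)

lemma res_ev (x : LogDer f D U) {W W' : X.Opens} (h : W ≤ U) (h' : W' ≤ W) (a : Γ(X, W)) :
    resO h' (x.ev W h a) = x.ev W' (h'.trans h) (resO h' a) := x.2.1 ⟨W, h⟩ ⟨W', _⟩ h' a

instance : Bracket (LogDer f D U) (LogDer f D U) where
  bracket x y := ⟨fun W => ⁅x.1 W, y.1 W⁆, by
    refine ⟨fun W W' h a => ?_, fun W V h s => ?_, fun W h a ha => ?_⟩
    · simp only [Derivation.commutator_apply, map_sub, x.2.1 W W' h, y.2.1 W W' h]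
    · simp only [Derivation.commutator_apply, x.2.2.1, y.2.2.1, map_zero, sub_zero]
    · exact sub_mem (x.2.2.2 W h _ (y.2.2.2 W h a ha)) (y.2.2.2 W h _ (x.2.2.2 W h a ha))⟩

@[simp] lemma add_ev (x y : LogDer f D U) (W h a) :
    (x + y).ev W h a = x.ev W h a + y.ev W h a := rfl
@[simp] lemma zero_ev (W : X.Opens) (h : W ≤ U) (a : Γ(X, W)) : (0 : LogDer f D U).ev W h a = 0 := rfl
@[simp] lemma lie_ev (x y : LogDer f D U) (W h a) :
    ⁅x, y⁆.ev W h a = x.ev W h (y.ev W h a) - y.ev W h (x.ev W h a) := rfl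

instance : LieRing (LogDer f D U) where
  add_lie x y z := by ext; simp; abel
  lie_add x y z := by ext; simp; abel
  lie_self x := by ext; simp
  leibniz_lie x y z := by ext; simp; abel

instance : SMul Γ(X, U) (LogDer f D U) where
  smul a x := ⟨fun W => resO W.2 a • x.1 W, by
    refine ⟨fun W W' h b => ?_, fun W V h s => ?_, fun W h b hb => ?_⟩
    · simp only [Derivation.smul_apply, smul_eq_mul, map_mul, x.2.1 W W' h, resO_resO]
    · simp only [Derivation.smul_apply, x.2.2.1, smul_zero]
    · exact Ideal.mul_mem_left _ _ (x.2.2.2 W h b hb)⟩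

@[simp] lemma smul_ev (b : Γ(X, U)) (x : LogDer f D U) (W) (h : W ≤ U) (a) :
    (b • x).ev W h a = resO h b * x.ev W h a := rfl

instance : Module Γ(X, U) (LogDer f D U) where
  one_smul x := by ext; simp
  mul_smul a b x := by ext; simp [mul_assoc]
  smul_zero a := by ext; simp
  smul_add a x y := by ext; simp [mul_add]
  add_smul a b x := by ext; simp [add_mul]
  zero_smul x := by ext; simp

/-- Restriction of vector fields. -/
def res {U W : X.Opens} (h : W ≤ U) (x : LogDer f D U) : LogDer f D W :=
  ⟨fun W' => x.1 ⟨W'.1, W'.2.trans h⟩,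
    fun W₁ W₂ => x.2.1 ⟨W₁.1, W₁.2.trans h⟩ ⟨W₂.1, W₂.2.trans h⟩,
    fun W' => x.2.2.1 ⟨W'.1, W'.2.trans h⟩, fun W' h' => x.2.2.2 W' (h'.trans h)⟩

@[simp] lemma ev_res {U W : X.Opens} (h : W ≤ U) (x : LogDer f D U) (W') (h' : W' ≤ W) (a) :
    (x.res h).ev W' h' a = x.ev W' (h'.trans h) a := rfl

lemma res_add {U W : X.Opens} (h : W ≤ U) (x y : LogDer f D U) :
    (x + y).res h = x.res h + y.res h := rfl

lemma res_lie {U W : X.Opens} (h : W ≤ U) (x y : LogDer f D U) :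
    (⁅x, y⁆ : LogDer f D U).res h = ⁅x.res h, y.res h⁆ := rfl

lemma res_smul {U W : X.Opens} (h : W ≤ U) (a : Γ(X, U)) (x : LogDer f D U) :
    (a • x).res h = resO h a • x.res h := by
  ext; simp [resO_resO]

end LogDer

end LogDer

/-! ### Pairs and their thickenings -/

/-- `D` is a simple normal crossings divisor in the smooth `S`-scheme `X`, relative to `S`:
Zariski-locally on `X` there are étale coordinates `t₁, …, tₙ` over an open set of `S` such that
`D` is the zero scheme of a product of distinct coordinates (an empty product away from `D`). -/
def IsRelSNC {X S : Scheme.{u}} (f : X ⟶ S) (D : X.IdealSheafData) : Prop :=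
  ∀ x : X, ∃ (V : S.affineOpens) (U : X.affineOpens) (h : U.1 ≤ f ⁻¹ᵁ V.1) (n : ℕ)
    (t : Fin n → Γ(X, U.1)) (A : Finset (Fin n)), x ∈ U.1 ∧
      (MvPolynomial.eval₂Hom (f.appLE V.1 U.1 h).hom t).Etale ∧
      D.ideal U = Ideal.span {∏ k ∈ A, t k}

/-- A square-zero thickening `S ↪ S'` of a noetherian scheme, a smooth pair `(X', D')` over `S'`,
and the base change `X` of `X'` to `S`. -/
structure ThickenedPair : Type (u + 1) where
  /-- the base -/
  S : Scheme.{u}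
  /-- the thickened base -/
  S' : Scheme.{u}
  /-- the scheme over `S` -/
  X : Scheme.{u}
  /-- the scheme over `S'` -/
  X' : Scheme.{u}
  noetherian : IsNoetherian S
  /-- the thickening -/
  j : S ⟶ S'
  isClosedImmersion : IsClosedImmersion j
  sq_zero : j.ker ^ 2 = ⊥
  /-- the structure morphism of `X'` -/
  g' : X' ⟶ S'
  smooth : Smooth g'
  /-- the ideal sheaf of `D'` -/
  D' : X'.IdealSheafData
  snc : IsRelSNC g' D'
  /-- the structure morphism of `X` -/
  g : X ⟶ S
  /-- the inclusion of `X` -/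
  i : X ⟶ X'
  isPullback : IsPullback i g g' j

namespace ThickenedPair

variable (T : ThickenedPair.{u})

/-- The ideal sheaf of `D = D' ×_{S'} S`. -/
def D : T.X.IdealSheafData := T.D'.comap T.i

variable {T}

lemma pre_mono {U W : T.X'.Opens} (h : W ≤ U) : T.i ⁻¹ᵁ W ≤ T.i ⁻¹ᵁ U := fun _ hx => h hx

/-- Restriction of functions on `X'` to `X`. -/
def red (U : T.X'.Opens) : Γ(T.X', U) →+* Γ(T.X, T.i ⁻¹ᵁ U) := (T.i.app U).hom

lemma red_resO {U W : T.X'.Opens} (h : W ≤ U) (a : Γ(T.X', U)) :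
    red W (resO h a) = resO (pre_mono h) (red U a) :=
  congr($(T.i.naturality (homOfLE h).op).hom a)

variable (T) in
/-- Logarithmic vector fields on `X'` over `U`, together with the (unique) logarithmic vector field
on `X` to which they restrict. -/
def vf (U : T.X'.Opens) :
    AddSubgroup (LogDer T.g' T.D' U × LogDer T.g T.D (T.i ⁻¹ᵁ U)) where
  carrier := {x | ∀ (W : T.X'.Opens) (h : W ≤ U) (a : Γ(T.X', W)),
    red W (x.1.ev W h a) = x.2.ev (T.i ⁻¹ᵁ W) (pre_mono h) (red W a)}
  zero_mem' := fun W h a => map_zero (red W)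
  add_mem' {x y} hx hy := fun W h a => by
    simp only [Prod.fst_add, Prod.snd_add, LogDer.add_ev, map_add, hx W h, hy W h]
  neg_mem' {x} hx := fun W h a => (map_neg (red W) _).trans (congrArg _ (hx W h a))

variable (T) in
/-- The type of logarithmic vector fields on `X'` over `U`. -/
def VF (U : T.X'.Opens) : Type u := T.vf U

instance (U : T.X'.Opens) : AddCommGroup (T.VF U) := inferInstanceAs (AddCommGroup (T.vf U))

namespace VF

variable {U W : T.X'.Opens}

/-- The vector field on `X'`. -/
def fst (x : T.VF U) : LogDer T.g' T.D' U := x.1.1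

/-- The vector field on `X`. -/
def snd (x : T.VF U) : LogDer T.g T.D (T.i ⁻¹ᵁ U) := x.1.2

lemma red_fst (x : T.VF U) (W : T.X'.Opens) (h : W ≤ U) (a : Γ(T.X', W)) :
    red W (x.fst.ev W h a) = x.snd.ev (T.i ⁻¹ᵁ W) (pre_mono h) (red W a) := x.2 W h a

lemma ext {x y : T.VF U} (h : x.fst = y.fst) (h' : x.snd = y.snd) : x = y :=
  Subtype.ext (Prod.ext h h')

@[simp] lemma add_fst (x y : T.VF U) : (x + y).fst = x.fst + y.fst := rfl
@[simp] lemma add_snd (x y : T.VF U) : (x + y).snd = x.snd + y.snd := rfl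
@[simp] lemma zero_fst : (0 : T.VF U).fst = 0 := rfl
@[simp] lemma zero_snd : (0 : T.VF U).snd = 0 := rfl

instance : Bracket (T.VF U) (T.VF U) where
  bracket x y := ⟨(⁅x.fst, y.fst⁆, ⁅x.snd, y.snd⁆), fun W h a => by
    simp only [LogDer.lie_ev, map_sub, red_fst]⟩

@[simp] lemma lie_fst (x y : T.VF U) : ⁅x, y⁆.fst = ⁅x.fst, y.fst⁆ := rfl
@[simp] lemma lie_snd (x y : T.VF U) : ⁅x, y⁆.snd = ⁅x.snd, y.snd⁆ := rfl

instance : LieRing (T.VF U) where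
  add_lie x y z := VF.ext (by simp) (by simp)
  lie_add x y z := VF.ext (by simp) (by simp)
  lie_self x := VF.ext (by simp) (by simp)
  leibniz_lie x y z := VF.ext (by simp) (by simp)

instance : SMul Γ(T.X', U) (T.VF U) where
  smul a x := ⟨(a • x.fst, red U a • x.snd), fun W h b => by
    simp only [LogDer.smul_ev, map_mul, red_fst, red_resO]⟩

@[simp] lemma smul_fst (a : Γ(T.X', U)) (x : T.VF U) : (a • x).fst = a • x.fst := rfl
@[simp] lemma smul_snd (a : Γ(T.X', U)) (x : T.VF U) : (a • x).snd = red U a • x.snd := rfl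

instance : Module Γ(T.X', U) (T.VF U) where
  one_smul x := VF.ext (by simp) (by simp)
  mul_smul a b x := VF.ext (by simp [mul_smul]) (by simp [mul_smul])
  smul_zero a := VF.ext (by simp) (by simp)
  smul_add a x y := VF.ext (by simp) (by simp)
  add_smul a b x := VF.ext (by simp [add_smul]) (by simp [add_smul])
  zero_smul x := VF.ext (by simp) (by simp)

/-- Restriction of vector fields. -/
def res (h : W ≤ U) (x : T.VF U) : T.VF W :=
  ⟨(x.fst.res h, x.snd.res (pre_mono h)), fun W' h' a => x.2 W' (h'.trans h) a⟩

lemma res_fst (h : W ≤ U) (x : T.VF U) : (x.res h).fst = x.fst.res h := rfl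
lemma res_snd (h : W ≤ U) (x : T.VF U) : (x.res h).snd = x.snd.res (pre_mono h) := rfl

lemma res_lie (h : W ≤ U) (x y : T.VF U) : (⁅x, y⁆ : T.VF U).res h = ⁅x.res h, y.res h⁆ := rfl

/-- The action of vector fields on functions on `X'`. -/
instance : LieRingModule (T.VF U) Γ(T.X', U) where
  bracket x a := x.fst.ev U le_rfl a
  add_lie _ _ _ := rfl
  lie_add x a b := map_add (x.fst.ev U le_rfl) a b
  leibniz_lie x y a := by
    change _ = x.fst.ev U le_rfl (y.fst.ev U le_rfl a) - y.fst.ev U le_rfl (x.fst.ev U le_rfl a) + _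
    abel

lemma lie_def (x : T.VF U) (a : Γ(T.X', U)) : ⁅x, a⁆ = x.fst.ev U le_rfl a := rfl

instance : LieRinehartRing Γ(T.X', U) (T.VF U) where
  lie_smul_eq_mul' a x b := by simp [lie_def, resO_self]
  leibniz_mul_right' x a b := by simp [lie_def, mul_comm]
  leibniz_smul_right' x a y := by
    refine VF.ext ?_ ?_
    · ext W h b
      simp [lie_def, LogDer.res_ev]; ring
    · ext W h b
      simp [lie_def, LogDer.res_ev, red_fst]; ring

end VF

end ThickenedPair

/-! ### De Rham bundles and Hodge filtrations -/

section Bundles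

variable {X S : Scheme.{u}}

/-- Restriction of sections of a module. -/
abbrev resM (V : X.Modules) {U W : X.Opens} (h : W ≤ U) : Γ(V, U) →+ Γ(V, W) :=
  (V.presheaf.map (homOfLE h).op).hom

lemma resM_self (V : X.Modules) {U : X.Opens} (v : Γ(V, U)) : resM V le_rfl v = v := by
  change (V.presheaf.map (𝟙 _)).hom v = v
  rw [V.presheaf.map_id]; rfl

lemma resM_resM (V : X.Modules) {U W W' : X.Opens} (h : W ≤ U) (h' : W' ≤ W) (v : Γ(V, U)) :
    resM V h' (resM V h v) = resM V (h'.trans h) v := by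
  change ((V.presheaf.map (homOfLE h).op) ≫ (V.presheaf.map (homOfLE h').op)).hom v = _
  rw [← V.presheaf.map_comp]; rfl

lemma resM_smul (V : X.Modules) {U W : X.Opens} (h : W ≤ U) (a : Γ(X, U)) (v : Γ(V, U)) :
    resM V h (a • v) = resO h a • resM V h v := Scheme.Modules.map_smul V (homOfLE h) a v

/-- `e` is a frame of `V` over `U`: an isomorphism `𝒪_Uⁿ ≅ V|_U`. -/
def IsFrame (V : X.Modules) (U : X.Opens) {n : ℕ} (e : Fin n → Γ(V, U)) : Prop :=
  ∀ (W : X.Opens) (h : W ≤ U), LinearIndependent Γ(X, W) (fun k => resM V h (e k)) ∧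
    Submodule.span Γ(X, W) (Set.range fun k => resM V h (e k)) = ⊤

/-- `V` is locally free of finite rank. -/
def IsVectorBundle (V : X.Modules) : Prop :=
  ∀ x : X, ∃ (U : X.Opens) (n : ℕ) (e : Fin n → Γ(V, U)), x ∈ U ∧ IsFrame V U e

/-- `F` is a subbundle, that is, a subsheaf which is locally spanned by a part of a frame. -/
structure IsSubbundle (V : X.Modules) (F : ∀ U : X.Opens, Submodule Γ(X, U) Γ(V, U)) : Prop where
  res {U W : X.Opens} (h : W ≤ U) (v : Γ(V, U)) : v ∈ F U → resM V h v ∈ F W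
  glue (U : X.Opens) (v : Γ(V, U)) :
    (∀ x ∈ U, ∃ (W : X.Opens) (h : W ≤ U), x ∈ W ∧ resM V h v ∈ F W) → v ∈ F U
  adapted (x : X) : ∃ (U : X.Opens) (n : ℕ) (e : Fin n → Γ(V, U)) (A : Set (Fin n)),
    x ∈ U ∧ IsFrame V U e ∧ ∀ (W : X.Opens) (h : W ≤ U),
      F W = Submodule.span Γ(X, W) ((fun k => resM V h (e k)) '' A)

/-- A de Rham bundle on `(X, D)` over `S`: a vector bundle `V` with an integrable logarithmic
connection `V → V ⊗ Ω_{X/S}(log D)`, given by its contractions with logarithmic vector fields. -/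
structure DeRhamBundle (f : X ⟶ S) (D : X.IdealSheafData) : Type (u + 1) where
  /-- the vector bundle -/
  V : X.Modules
  isVectorBundle : IsVectorBundle V
  /-- the covariant derivative -/
  nabla (U : X.Opens) : LogDer f D U → Γ(V, U) →+ Γ(V, U)
  nabla_add (U : X.Opens) (x y : LogDer f D U) (v : Γ(V, U)) :
    nabla U (x + y) v = nabla U x v + nabla U y v
  nabla_smul (U : X.Opens) (a : Γ(X, U)) (x : LogDer f D U) (v : Γ(V, U)) :
    nabla U (a • x) v = a • nabla U x v
  leibniz (U : X.Opens) (x : LogDer f D U) (a : Γ(X, U)) (v : Γ(V, U)) :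
    nabla U x (a • v) = a • nabla U x v + x.ev U le_rfl a • v
  res_nabla {U W : X.Opens} (h : W ≤ U) (x : LogDer f D U) (v : Γ(V, U)) :
    resM V h (nabla U x v) = nabla W (x.res h) (resM V h v)
  flat (U : X.Opens) (x y : LogDer f D U) (v : Γ(V, U)) :
    nabla U ⁅x, y⁆ v = nabla U x (nabla U y v) - nabla U y (nabla U x v)

variable {f : X ⟶ S} {D : X.IdealSheafData}

/-- A Hodge filtration on a de Rham bundle: a finite decreasing filtration by subbundles which
satisfies Griffiths transversality. -/
structure HodgeFiltration (E : DeRhamBundle f D) : Type u where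
  /-- the filtration -/
  Fil (p : ℤ) (U : X.Opens) : Submodule Γ(X, U) Γ(E.V, U)
  isSubbundle (p : ℤ) : IsSubbundle E.V (Fil p)
  antitone (U : X.Opens) {p q : ℤ} (h : p ≤ q) : Fil q U ≤ Fil p U
  finite : ∃ a b : ℤ, ∀ U, Fil a U = ⊤ ∧ Fil b U = ⊥
  griffiths (p : ℤ) (U : X.Opens) (x : LogDer f D U) (v : Γ(E.V, U)) :
    v ∈ Fil p U → E.nabla U x v ∈ Fil (p - 1) U

/-- Sections over `U` of the sheaf of `𝒪_X`-linear endomorphisms of `V`. -/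
def endSec (V : X.Modules) (U : X.Opens) :
    AddSubgroup (∀ W : {W : X.Opens // W ≤ U}, Module.End Γ(X, W.1) Γ(V, W.1)) where
  carrier := {g | ∀ (W W' : {W : X.Opens // W ≤ U}) (h : W'.1 ≤ W.1) (v : Γ(V, W.1)),
    resM V h (g W v) = g W' (resM V h v)}
  zero_mem' := fun W W' h v => map_zero (resM V h)
  add_mem' {g g'} hg hg' := fun W W' h v => by
    simp only [Pi.add_apply, LinearMap.add_apply, map_add, hg W W' h, hg' W W' h]
  neg_mem' {g} hg := fun W W' h v => by
    simp only [Pi.neg_apply, LinearMap.neg_apply, map_neg, hg W W' h]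

/-- The type of sections of the endomorphism sheaf. -/
def EndSec (V : X.Modules) (U : X.Opens) : Type u := endSec V U

instance (V : X.Modules) (U : X.Opens) : AddCommGroup (EndSec V U) :=
  inferInstanceAs (AddCommGroup (endSec V U))

namespace EndSec

variable {V : X.Modules} {U W : X.Opens}

/-- The value of an endomorphism on a section over a smaller open set. -/
def ev (g : EndSec V U) (W : X.Opens) (h : W ≤ U) : Module.End Γ(X, W) Γ(V, W) := g.1 ⟨W, h⟩

@[ext]
lemma ext {g g' : EndSec V U} (H : ∀ W h v, g.ev W h v = g'.ev W h v) : g = g' :=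
  Subtype.ext (funext fun W => LinearMap.ext fun v => H W.1 W.2 v)

lemma res_ev (g : EndSec V U) {W W' : X.Opens} (h : W ≤ U) (h' : W' ≤ W) (v : Γ(V, W)) :
    resM V h' (g.ev W h v) = g.ev W' (h'.trans h) (resM V h' v) := g.2 ⟨W, h⟩ ⟨W', _⟩ h' v

@[simp] lemma add_ev (g g' : EndSec V U) (W : X.Opens) (h : W ≤ U) (v : Γ(V, W)) :
    (g + g').ev W h v = g.ev W h v + g'.ev W h v := rfl
@[simp] lemma sub_ev (g g' : EndSec V U) (W : X.Opens) (h : W ≤ U) (v : Γ(V, W)) :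
    (g - g').ev W h v = g.ev W h v - g'.ev W h v := rfl
@[simp] lemma neg_ev (g : EndSec V U) (W : X.Opens) (h : W ≤ U) (v : Γ(V, W)) :
    (-g).ev W h v = -g.ev W h v := rfl
@[simp] lemma zero_ev (W : X.Opens) (h : W ≤ U) (v : Γ(V, W)) :
    (0 : EndSec V U).ev W h v = 0 := rfl

instance : SMul Γ(X, U) (EndSec V U) where
  smul a g := ⟨fun W => resO W.2 a • g.1 W, fun W W' h v => by
    simp only [LinearMap.smul_apply, resM_smul, g.2 W W' h, resO_resO]⟩

@[simp] lemma smul_ev (a : Γ(X, U)) (g : EndSec V U) (W : X.Opens) (h : W ≤ U) (v : Γ(V, W)) :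
    (a • g).ev W h v = resO h a • g.ev W h v := rfl

instance : Module Γ(X, U) (EndSec V U) where
  one_smul g := by ext; simp
  mul_smul a b g := by ext; simp [mul_smul]
  smul_zero a := by ext; simp
  smul_add a _ _ := by ext; simp
  add_smul a b _ := by ext; simp [add_smul]
  zero_smul g := by ext; simp

/-- Restriction of endomorphisms. -/
def res (h : W ≤ U) : EndSec V U →+ EndSec V W where
  toFun g := ⟨fun W' => g.1 ⟨W'.1, W'.2.trans h⟩,
    fun W₁ W₂ => g.2 ⟨W₁.1, W₁.2.trans h⟩ ⟨W₂.1, W₂.2.trans h⟩⟩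
  map_zero' := rfl
  map_add' _ _ := rfl

@[simp] lemma ev_res (h : W ≤ U) (g : EndSec V U) (W' : X.Opens) (h' : W' ≤ W) (v : Γ(V, W')) :
    (g.res h).ev W' h' v = g.ev W' (h'.trans h) v := rfl

end EndSec

/-- The connection on the endomorphism bundle: `(∇_x g)(v) = ∇_x (g v) - g (∇_x v)`. -/
def DeRhamBundle.nablaEnd (E : DeRhamBundle f D) (U : X.Opens) (x : LogDer f D U)
    (g : EndSec E.V U) : EndSec E.V U :=
  ⟨fun W =>
    { toFun := fun v => E.nabla W.1 (x.res W.2) (g.ev W.1 W.2 v) -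
        g.ev W.1 W.2 (E.nabla W.1 (x.res W.2) v)
      map_add' := fun v w => by simp only [map_add]; abel
      map_smul' := fun a v => by
        simp only [map_smul, E.leibniz, map_add, RingHom.id_apply, smul_sub]; abel },
    fun W W' h v => by
      simp only [LinearMap.coe_mk, AddHom.coe_mk, map_sub, E.res_nabla, EndSec.res_ev]; rfl⟩

@[simp] lemma DeRhamBundle.nablaEnd_ev (E : DeRhamBundle f D) (U : X.Opens) (x : LogDer f D U)
    (g : EndSec E.V U) (W : X.Opens) (h : W ≤ U) (v : Γ(E.V, W)) :
    (E.nablaEnd U x g).ev W h v =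
      E.nabla W (x.res h) (g.ev W h v) - g.ev W h (E.nabla W (x.res h) v) := rfl

section

variable (E : DeRhamBundle f D) {U : X.Opens}

lemma DeRhamBundle.nablaEnd_add_right (x : LogDer f D U) (g g' : EndSec E.V U) :
    E.nablaEnd U x (g + g') = E.nablaEnd U x g + E.nablaEnd U x g' := by
  ext W h v
  simp only [DeRhamBundle.nablaEnd_ev, EndSec.add_ev, map_add]
  abel

lemma DeRhamBundle.nablaEnd_add_left (x y : LogDer f D U) (g : EndSec E.V U) :
    E.nablaEnd U (x + y) g = E.nablaEnd U x g + E.nablaEnd U y g := by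
  ext W h v
  simp only [DeRhamBundle.nablaEnd_ev, EndSec.add_ev, LogDer.res_add, E.nabla_add, map_add]
  abel

lemma DeRhamBundle.nablaEnd_smul_left (a : Γ(X, U)) (x : LogDer f D U) (g : EndSec E.V U) :
    E.nablaEnd U (a • x) g = a • E.nablaEnd U x g := by
  ext W h v
  simp only [DeRhamBundle.nablaEnd_ev, EndSec.smul_ev, LogDer.res_smul, E.nabla_smul, map_smul,
    smul_sub]

lemma DeRhamBundle.nablaEnd_smul_right (a : Γ(X, U)) (x : LogDer f D U) (g : EndSec E.V U) :
    E.nablaEnd U x (a • g) = a • E.nablaEnd U x g + x.ev U le_rfl a • g := by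
  ext W h v
  simp only [DeRhamBundle.nablaEnd_ev, EndSec.smul_ev, EndSec.add_ev, E.leibniz, LogDer.res_ev,
    LogDer.ev_res, smul_sub]
  abel

lemma DeRhamBundle.nablaEnd_lie (x y : LogDer f D U) (g : EndSec E.V U) :
    E.nablaEnd U x (E.nablaEnd U y g) =
      E.nablaEnd U ⁅x, y⁆ g + E.nablaEnd U y (E.nablaEnd U x g) := by
  ext W h v
  simp only [DeRhamBundle.nablaEnd_ev, EndSec.add_ev, LogDer.res_lie, E.flat, map_sub]
  abel

end

/-- The filtration `Fil^p End(V) = {g | g(Fil^a) ⊆ Fil^{a+p} for all a}`. -/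
def HodgeFiltration.filEnd {E : DeRhamBundle f D} (F : HodgeFiltration E) (p : ℤ) (U : X.Opens) :
    AddSubgroup (EndSec E.V U) where
  carrier := {g | ∀ (a : ℤ) (W : X.Opens) (h : W ≤ U), ∀ v ∈ F.Fil a W,
    g.ev W h v ∈ F.Fil (a + p) W}
  zero_mem' := fun _ _ _ _ _ => zero_mem _
  add_mem' {g g'} hg hg' := fun a W h v hv => add_mem (hg a W h v hv) (hg' a W h v hv)
  neg_mem' {g} hg := fun a W h v hv => neg_mem (hg a W h v hv)

lemma HodgeFiltration.filEnd_antitone {E : DeRhamBundle f D} (F : HodgeFiltration E) {p q : ℤ}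
    (h : p ≤ q) (U : X.Opens) : F.filEnd q U ≤ F.filEnd p U :=
  fun _ hg a W hW v hv => F.antitone W (by lia) (hg a W hW v hv)

lemma HodgeFiltration.nablaEnd_mem {E : DeRhamBundle f D} (F : HodgeFiltration E) {p : ℤ}
    {U : X.Opens} (x : LogDer f D U) {g : EndSec E.V U} (hg : g ∈ F.filEnd p U) :
    E.nablaEnd U x g ∈ F.filEnd (p - 1) U := fun a W h v hv => by
  rw [DeRhamBundle.nablaEnd_ev]
  refine sub_mem ?_ ?_
  · have := F.griffiths (a + p) W (x.res h) _ (hg a W h v hv)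
    rwa [show a + p - 1 = a + (p - 1) by ring] at this
  · have := hg (a - 1) W h _ (F.griffiths a W (x.res h) v hv)
    rwa [show a - 1 + p = a + (p - 1) by ring] at this

end Bundles

/-! ### The filtered de Rham complex of `End(V, ∇)_I` -/

namespace ThickenedPair

variable {T : ThickenedPair.{u}}

variable (T) in
/-- The ideal `I` of `X` in `X'`. -/
def I (U : T.X'.Opens) : Ideal Γ(T.X', U) := RingHom.ker (red U)

/-- The action of vector fields on `I`. -/
def derI {U : T.X'.Opens} (x : T.VF U) : T.I U →+ T.I U where
  toFun r := ⟨x.fst.ev U le_rfl r.1, by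
    have h : red U r.1 = 0 := r.2
    change red U _ = 0
    rw [VF.red_fst, h, map_zero]⟩
  map_zero' := Subtype.ext (map_zero _)
  map_add' r s := Subtype.ext (map_add _ r.1 s.1)

lemma derI_val {U : T.X'.Opens} (x : T.VF U) (r : T.I U) :
    (derI x r).1 = x.fst.ev U le_rfl r.1 := rfl

/-- Restriction of sections of `I`. -/
def resI {U W : T.X'.Opens} (h : W ≤ U) : T.I U →+ T.I W where
  toFun r := ⟨resO h r.1, by
    have h : red U r.1 = 0 := r.2
    change red W _ = 0
    rw [red_resO, h, map_zero]⟩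
  map_zero' := Subtype.ext (map_zero _)
  map_add' r s := Subtype.ext (map_add _ r.1 s.1)

lemma resI_val {U W : T.X'.Opens} (h : W ≤ U) (r : T.I U) : (resI h r).1 = resO h r.1 := rfl

instance (V : T.X.Modules) (U : T.X'.Opens) : Module Γ(T.X', U) (EndSec V (T.i ⁻¹ᵁ U)) :=
  Module.compHom _ (red U)

lemma smul_endSec {V : T.X.Modules} {U : T.X'.Opens} (a : Γ(T.X', U))
    (g : EndSec V (T.i ⁻¹ᵁ U)) : a • g = red U a • g := rfl

/-- The presheaf `U ↦ End(V)(U ∩ X) ⊗ I(U)` on `X'`, whose sheafification is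
`End(V)_I = End(V) ⊗ I`. -/
def Coeff (V : T.X.Modules) (U : T.X'.Opens) : Type u :=
  EndSec V (T.i ⁻¹ᵁ U) ⊗[Γ(T.X', U)] T.I U

namespace Coeff

variable {V : T.X.Modules} {U W : T.X'.Opens}

instance : AddCommGroup (Coeff V U) :=
  inferInstanceAs (AddCommGroup (EndSec V (T.i ⁻¹ᵁ U) ⊗[Γ(T.X', U)] T.I U))

instance : Module Γ(T.X', U) (Coeff V U) :=
  inferInstanceAs (Module Γ(T.X', U) (EndSec V (T.i ⁻¹ᵁ U) ⊗[Γ(T.X', U)] T.I U))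

/-- Pure tensors. -/
def tmul (g : EndSec V (T.i ⁻¹ᵁ U)) (r : T.I U) : Coeff V U := g ⊗ₜ[Γ(T.X', U)] r

lemma induction {P : Coeff V U → Prop} (h : ∀ g r, P (tmul g r))
    (h' : ∀ m m', P m → P m' → P (m + m')) (m : Coeff V U) : P m := by
  refine TensorProduct.induction_on m ?_ h (fun _ _ => h' _ _)
  have := h 0 0
  rwa [show tmul (0 : EndSec V (T.i ⁻¹ᵁ U)) (0 : T.I U) = 0 from TensorProduct.zero_tmul _ _]
    at this

lemma add_tmul (g g' : EndSec V (T.i ⁻¹ᵁ U)) (r : T.I U) :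
    tmul (g + g') r = tmul g r + tmul g' r := TensorProduct.add_tmul _ _ _

lemma tmul_add (g : EndSec V (T.i ⁻¹ᵁ U)) (r r' : T.I U) :
    tmul g (r + r') = tmul g r + tmul g r' := TensorProduct.tmul_add _ _ _

lemma smul_tmul (a : Γ(T.X', U)) (g : EndSec V (T.i ⁻¹ᵁ U)) (r : T.I U) :
    tmul (a • g) r = tmul g (a • r) := TensorProduct.smul_tmul _ _ _

lemma smul_tmul' (a : Γ(T.X', U)) (g : EndSec V (T.i ⁻¹ᵁ U)) (r : T.I U) :
    a • tmul g r = tmul (a • g) r := TensorProduct.smul_tmul' _ _ _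

/-- Additive maps out of the tensor product. -/
def lift {A : Type u} [AddCommGroup A] (b : EndSec V (T.i ⁻¹ᵁ U) →+ T.I U →+ A)
    (hb : ∀ (a : Γ(T.X', U)) g r, b (a • g) r = b g (a • r)) : Coeff V U →+ A :=
  TensorProduct.liftAddHom b hb

lemma lift_tmul {A : Type u} [AddCommGroup A] (b : EndSec V (T.i ⁻¹ᵁ U) →+ T.I U →+ A)
    (hb : ∀ (a : Γ(T.X', U)) g r, b (a • g) r = b g (a • r)) (g : EndSec V (T.i ⁻¹ᵁ U))
    (r : T.I U) : lift b hb (tmul g r) = b g r := TensorProduct.liftAddHom_tmul b hb g r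

/-- Restriction. -/
def res (h : W ≤ U) : Coeff V U →+ Coeff V W :=
  lift
    (AddMonoidHom.mk' (fun g => AddMonoidHom.mk'
        (fun r => tmul (g.res (pre_mono h)) (resI h r)) fun r r' => by rw [map_add, tmul_add])
      fun g g' => by
        ext r
        simp only [AddMonoidHom.mk'_apply, AddMonoidHom.add_apply, map_add, add_tmul])
    (fun a g r => by
      have h1 : (a • g).res (pre_mono h) = resO h a • g.res (pre_mono h) := by
        ext W' h' v
        simp only [smul_endSec, red_resO, EndSec.ev_res, EndSec.smul_ev, resO_resO]
      have h2 : resI h (a • r) = resO h a • resI h r := Subtype.ext (map_mul (resO h) a r.1)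
      simp only [AddMonoidHom.mk'_apply, h1, h2, smul_tmul])

lemma res_tmul (h : W ≤ U) (g : EndSec V (T.i ⁻¹ᵁ U)) (r : T.I U) :
    res h (tmul g r) = tmul (g.res (pre_mono h)) (resI h r) := lift_tmul _ _ _ _

end Coeff

variable {E : DeRhamBundle T.g T.D}

namespace Coeff

variable {U W : T.X'.Opens}

lemma nablaEnd_smul (x : T.VF U) (a : Γ(T.X', U)) (g : EndSec E.V (T.i ⁻¹ᵁ U)) :
    E.nablaEnd _ x.snd (a • g) = a • E.nablaEnd _ x.snd g + ⁅x, a⁆ • g := by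
  rw [smul_endSec, smul_endSec, smul_endSec, E.nablaEnd_smul_right, VF.lie_def, VF.red_fst]

/-- The connection of `End(V)_I`, `∇_x (g ⊗ r) = ∇_x g ⊗ r + g ⊗ x(r)`. -/
def nabla (x : T.VF U) : Coeff E.V U →+ Coeff E.V U :=
  lift
    (AddMonoidHom.mk' (fun g => AddMonoidHom.mk'
        (fun r => tmul (E.nablaEnd _ x.snd g) r + tmul g (derI x r)) fun r r' => by
          rw [map_add, tmul_add, tmul_add]; abel)
      fun g g' => by
        ext r
        simp only [AddMonoidHom.mk'_apply, AddMonoidHom.add_apply, E.nablaEnd_add_right, add_tmul]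
        abel)
    (fun a g r => by
      have h : derI x (a • r) = a • derI x r + ⁅x, a⁆ • r := Subtype.ext (by
        change x.fst.ev U le_rfl (a * r.1) = a * x.fst.ev U le_rfl r.1 + x.fst.ev U le_rfl a * r.1
        rw [Derivation.leibniz, smul_eq_mul, smul_eq_mul, mul_comm r.1])
      simp only [AddMonoidHom.mk'_apply, h, nablaEnd_smul, add_tmul, tmul_add, smul_tmul]
      abel)

lemma nabla_tmul (x : T.VF U) (g : EndSec E.V (T.i ⁻¹ᵁ U)) (r : T.I U) :
    nabla x (tmul g r) = tmul (E.nablaEnd _ x.snd g) r + tmul g (derI x r) := lift_tmul _ _ _ _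

lemma nabla_add (x y : T.VF U) (m : Coeff E.V U) : nabla (x + y) m = nabla x m + nabla y m := by
  induction m using Coeff.induction with
  | h g r =>
    have h1 : E.nablaEnd _ (x + y).snd g = E.nablaEnd _ x.snd g + E.nablaEnd _ y.snd g :=
      E.nablaEnd_add_left _ _ g
    have h2 : derI (x + y) r = derI x r + derI y r := rfl
    simp only [nabla_tmul, h1, h2, add_tmul, tmul_add]
    abel
  | h' m m' h h' => simp only [map_add, h, h']; abel

lemma nabla_lie (x y : T.VF U) (m : Coeff E.V U) :
    nabla x (nabla y m) = nabla ⁅x, y⁆ m + nabla y (nabla x m) := by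
  induction m using Coeff.induction with
  | h g r =>
    have h1 : E.nablaEnd _ x.snd (E.nablaEnd _ y.snd g) =
        E.nablaEnd _ ⁅x, y⁆.snd g + E.nablaEnd _ y.snd (E.nablaEnd _ x.snd g) :=
      E.nablaEnd_lie _ _ g
    have h2 : derI x (derI y r) = derI ⁅x, y⁆ r + derI y (derI x r) := Subtype.ext (by
      change x.fst.ev U le_rfl (y.fst.ev U le_rfl r.1) = ⁅x, y⁆.fst.ev U le_rfl r.1 +
        y.fst.ev U le_rfl (x.fst.ev U le_rfl r.1)
      rw [VF.lie_fst, LogDer.lie_ev]; abel)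
    simp only [nabla_tmul, map_add, h1, h2, add_tmul, tmul_add]
    abel
  | h' m m' h h' => simp only [map_add, h, h']; abel

instance : LieRingModule (T.VF U) (Coeff E.V U) where
  bracket x m := nabla x m
  add_lie := nabla_add
  lie_add x m m' := map_add _ m m'
  leibniz_lie := nabla_lie

lemma lie_def (x : T.VF U) (m : Coeff E.V U) : ⁅x, m⁆ = nabla x m := rfl

instance : IsLieRinehartModule Γ(T.X', U) (T.VF U) (Coeff E.V U) where
  smul_lie a x m := by
    change nabla (a • x) m = a • nabla x m
    induction m using Coeff.induction with
    | h g r =>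
      have h1 : E.nablaEnd _ (a • x).snd g = a • E.nablaEnd _ x.snd g :=
        E.nablaEnd_smul_left _ _ g
      have h2 : derI (a • x) r = a • derI x r := Subtype.ext (by
        change (a • x).fst.ev U le_rfl r.1 = a * x.fst.ev U le_rfl r.1
        rw [VF.smul_fst, LogDer.smul_ev, resO_self])
      simp only [nabla_tmul, h1, h2, smul_add, smul_tmul', smul_tmul]
    | h' m m' h h' => simp only [map_add, h, h', smul_add]
  lie_smul x a m := by
    change nabla x (a • m) = a • nabla x m + ⁅x, a⁆ • m
    induction m using Coeff.induction with
    | h g r =>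
      simp only [nabla_tmul, smul_tmul', nablaEnd_smul, smul_add, add_tmul]
      abel
    | h' m m' h h' => simp only [map_add, h, h', smul_add]; abel

lemma res_lie (h : W ≤ U) (x : T.VF U) (m : Coeff E.V U) :
    res h ⁅x, m⁆ = ⁅x.res h, res h m⁆ := by
  change res h (nabla x m) = nabla (x.res h) (res h m)
  induction m using Coeff.induction with
  | h g r =>
    have h1 : (E.nablaEnd _ x.snd g).res (pre_mono h) =
      E.nablaEnd _ (x.res h).snd (g.res (pre_mono h)) := rfl
    have h2 : resI h (derI x r) = derI (x.res h) (resI h r) :=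
      Subtype.ext (x.fst.res_ev le_rfl h r.1)
    simp only [nabla_tmul, map_add, res_tmul, h1, h2]
  | h' m m' h h' => simp only [map_add, h, h']

/-- The filtration `Fil^p End(V)_I = Fil^p End(V) ⊗ I`. -/
def fil (F : HodgeFiltration E) (p : ℤ) (U : T.X'.Opens) : AddSubgroup (Coeff E.V U) :=
  AddSubgroup.closure {m | ∃ g ∈ F.filEnd p (T.i ⁻¹ᵁ U), ∃ r, m = tmul g r}

lemma fil_antitone (F : HodgeFiltration E) {p q : ℤ} (h : p ≤ q) (U : T.X'.Opens) :
    fil F q U ≤ fil F p U :=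
  AddSubgroup.closure_mono fun _ ⟨g, hg, r, hm⟩ => ⟨g, F.filEnd_antitone h _ hg, r, hm⟩

lemma lie_mem_fil (F : HodgeFiltration E) (p : ℤ) (U : T.X'.Opens) (x : T.VF U) :
    ∀ m ∈ fil F p U, ⁅x, m⁆ ∈ fil F (p - 1) U := by
  change fil F p U ≤ (fil F (p - 1) U).comap (nabla x)
  refine (AddSubgroup.closure_le _).2 ?_
  rintro _ ⟨g, hg, r, rfl⟩
  change nabla x (tmul g r) ∈ fil F (p - 1) U
  rw [nabla_tmul]
  exact add_mem (AddSubgroup.subset_closure ⟨_, F.nablaEnd_mem _ hg, r, rfl⟩)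
    (AddSubgroup.subset_closure ⟨_, F.filEnd_antitone (by lia) _ hg, _, rfl⟩)

end Coeff

end ThickenedPair

namespace ThickenedPair

variable {T : ThickenedPair.{u}} {E : DeRhamBundle T.g T.D}

/-- Sections over `U` of `Fil^p DR^n = Fil^{p-n} End(V)_I ⊗ Ωⁿ(log D)`: compatible families of
alternating `n`-forms on logarithmic vector fields with values in `Fil^{p-n} End(V)_I`. -/
def formSec (F : HodgeFiltration E) (p : ℤ) (n : ℕ) (U : T.X'.Opens) :
    AddSubgroup (∀ W : {W : T.X'.Opens // W ≤ U}, Cochain (T.VF W.1) (Coeff E.V W.1) n) where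
  carrier := {ω | (∀ W, IsForm Γ(T.X', W.1) n (ω W)) ∧
    (∀ (W W' : {W : T.X'.Opens // W ≤ U}) (h : W'.1 ≤ W.1),
      Compat (VF.res h) (Coeff.res h) n (ω W) (ω W')) ∧
    ∀ W, ValuedIn (Coeff.fil F (p - n) W.1 : Set (Coeff E.V W.1)) n (ω W)}
  zero_mem' := ⟨fun _ => isForm_zero n, fun _ _ _ => compat_zero n, fun _ => valuedIn_zero _ n⟩
  add_mem' hω hη := ⟨fun W => (hω.1 W).add (hη.1 W),
    fun W W' h => (hω.2.1 W W' h).add (hη.2.1 W W' h), fun W => (hω.2.2 W).add (hη.2.2 W)⟩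
  neg_mem' hω := ⟨fun W => (hω.1 W).neg, fun W W' h => (hω.2.1 W W' h).neg,
    fun W => (hω.2.2 W).neg⟩

/-- The type of sections of `Fil^p DR^n`. -/
def FormSec (F : HodgeFiltration E) (p : ℤ) (n : ℕ) (U : T.X'.Opens) : Type u := formSec F p n U

instance (F : HodgeFiltration E) (p : ℤ) (n : ℕ) (U : T.X'.Opens) :
    AddCommGroup (FormSec F p n U) := inferInstanceAs (AddCommGroup (formSec F p n U))

namespace FormSec

variable (F : HodgeFiltration E) (p : ℤ) (n : ℕ)

/-- Restriction of forms. -/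
def res {U W : T.X'.Opens} (h : W ≤ U) : FormSec F p n U →+ FormSec F p n W where
  toFun ω := ⟨fun W' => ω.1 ⟨W'.1, W'.2.trans h⟩, fun W' => ω.2.1 ⟨W'.1, W'.2.trans h⟩,
    fun W₁ W₂ => ω.2.2.1 ⟨W₁.1, W₁.2.trans h⟩ ⟨W₂.1, W₂.2.trans h⟩,
    fun W' => ω.2.2.2 ⟨W'.1, W'.2.trans h⟩⟩
  map_zero' := rfl
  map_add' _ _ := rfl

/-- The de Rham differential. -/
def d (U : T.X'.Opens) : FormSec F p n U →+ FormSec F p (n + 1) U where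
  toFun ω := ⟨fun W => ceDiff n (ω.1 W), fun W => (ω.2.1 W).ceDiff,
    fun W W' h => (ω.2.2.1 W W' h).ceDiff (VF.res_lie h) (Coeff.res_lie h), fun W => by
      refine (ω.2.2.2 W).ceDiff (Coeff.fil_antitone F (by push_cast; lia) W.1) fun x m hm => ?_
      have := Coeff.lie_mem_fil F _ W.1 x m hm
      rwa [show p - ↑n - 1 = p - ↑(n + 1) by push_cast; ring] at this⟩
  map_zero' := Subtype.ext (funext fun _ => ceDiff_zero n)
  map_add' ω η := Subtype.ext (funext fun W => ceDiff_add n (ω.1 W) (η.1 W))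

lemma d_d (U : T.X'.Opens) (ω : FormSec F p n U) : d F p (n + 1) U (d F p n U ω) = 0 :=
  Subtype.ext (funext fun W => ceDiff_ceDiff (ω.2.1 W))

lemma formSec_le {p q : ℤ} (h : p ≤ q) (U : T.X'.Opens) : formSec F q n U ≤ formSec F p n U :=
  fun _ hω => ⟨hω.1, hω.2.1, fun W => (hω.2.2 W).mono (Coeff.fil_antitone F (by lia) W.1)⟩

/-- The inclusion `Fil^q DR^n ⊆ Fil^p DR^n` for `p ≤ q`. -/
def incl {p q : ℤ} (h : p ≤ q) (U : T.X'.Opens) : FormSec F q n U →+ FormSec F p n U :=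
  AddSubgroup.inclusion (formSec_le F n h U)

lemma incl_injective {p q : ℤ} (h : p ≤ q) (U : T.X'.Opens) :
    Function.Injective (incl F n h U) := AddSubgroup.inclusion_injective (formSec_le F n h U)

end FormSec

/-- The presheaf of sections of `Fil^p DR^n`. -/
def formPresheaf (F : HodgeFiltration E) (p : ℤ) (n : ℕ) : T.X'.Opensᵒᵖ ⥤ AddCommGrpCat.{u} where
  obj U := AddCommGrpCat.of (FormSec F p n U.unop)
  map h := AddCommGrpCat.ofHom (FormSec.res F p n h.unop.le)

/-- The de Rham differential as a morphism of presheaves. -/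
def formD (F : HodgeFiltration E) (p : ℤ) (n : ℕ) :
    formPresheaf F p n ⟶ formPresheaf F p (n + 1) where
  app U := AddCommGrpCat.ofHom (FormSec.d F p n U.unop)

lemma formD_formD (F : HodgeFiltration E) (p : ℤ) (n : ℕ) :
    formD F p n ≫ formD F p (n + 1) = 0 := by
  ext U ω
  exact FormSec.d_d F p n U.unop ω

/-- The inclusion `Fil^q DR^n ⊆ Fil^p DR^n` as a morphism of presheaves. -/
def formIncl (F : HodgeFiltration E) {p q : ℤ} (h : p ≤ q) (n : ℕ) :
    formPresheaf F q n ⟶ formPresheaf F p n where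
  app U := AddCommGrpCat.ofHom (FormSec.incl F n h U.unop)

lemma formIncl_formD (F : HodgeFiltration E) {p q : ℤ} (h : p ≤ q) (n : ℕ) :
    formIncl F h n ≫ formD F p n = formD F q n ≫ formIncl F h (n + 1) := by
  ext U ω
  rfl

instance formIncl_mono (F : HodgeFiltration E) {p q : ℤ} (h : p ≤ q) (n : ℕ) :
    Mono (formIncl F h n) := by
  have (U : T.X'.Opensᵒᵖ) : Mono ((formIncl F h n).app U) :=
    (AddCommGrpCat.mono_iff_injective
      (AddCommGrpCat.ofHom (FormSec.incl F n h U.unop))).2 (FormSec.incl_injective F n h U.unop)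
  exact NatTrans.mono_of_mono_app _

/-- The complex of presheaves `Fil^p DR(End(V, ∇)_I)`. -/
def presheafComplex (F : HodgeFiltration E) (p : ℤ) :
    CochainComplex (T.X'.Opensᵒᵖ ⥤ AddCommGrpCat.{u}) ℕ :=
  CochainComplex.of (formPresheaf F p) (formD F p) (formD_formD F p)

/-- The inclusion of complexes `Fil^q ⊆ Fil^p` for `p ≤ q`. -/
def presheafIncl (F : HodgeFiltration E) {p q : ℤ} (h : p ≤ q) :
    presheafComplex F q ⟶ presheafComplex F p :=
  CochainComplex.ofHom (X := presheafComplex F q) (Y := presheafComplex F p) (formIncl F h)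
    (fun n => by
      change _ ≫ CochainComplex.of.d _ _ _ _ = CochainComplex.of.d _ _ _ _ ≫ _
      rw [CochainComplex.of_d, CochainComplex.of_d]
      exact formIncl_formD F h n)

lemma presheafIncl_f (F : HodgeFiltration E) {p q : ℤ} (h : p ≤ q) (n : ℕ) :
    (presheafIncl F h).f n = formIncl F h n := rfl

variable (T) in
/-- Sheaves of abelian groups on `X'` (which has the same underlying space as `X`). -/
abbrev Sh : Type (u + 1) := Sheaf (Opens.grothendieckTopology T.X') AddCommGrpCat.{u}

/-- The filtered de Rham complex `Fil^p DR(End(V, ∇)_I)`, as a complex of sheaves in degrees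
`0, 1, 2, …`. -/
def DR (F : HodgeFiltration E) (p : ℤ) : CochainComplex T.Sh ℤ :=
  (((presheafToSheaf (Opens.grothendieckTopology T.X') AddCommGrpCat.{u}).mapHomologicalComplex
    (ComplexShape.up ℕ)).obj (presheafComplex F p)).extend ComplexShape.embeddingUpNat

/-- The inclusion `Fil^q DR ⊆ Fil^p DR` for `p ≤ q`. -/
def DRIncl (F : HodgeFiltration E) {p q : ℤ} (h : p ≤ q) : DR F q ⟶ DR F p :=
  HomologicalComplex.extendMap
    (((presheafToSheaf (Opens.grothendieckTopology T.X') AddCommGrpCat.{u}).mapHomologicalComplex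
      (ComplexShape.up ℕ)).map (presheafIncl F h)) ComplexShape.embeddingUpNat

lemma mono_extendMap {C : Type*} [Category C] [Abelian C] {K L : CochainComplex C ℕ} (φ : K ⟶ L)
    (hφ : ∀ n, Mono (φ.f n)) :
    Mono (HomologicalComplex.extendMap φ ComplexShape.embeddingUpNat) := by
  refine HomologicalComplex.mono_of_mono_f _ fun n => ?_
  by_cases hn : ∃ k, ComplexShape.embeddingUpNat.f k = n
  · obtain ⟨k, hk⟩ := hn
    have := hφ k
    rw [HomologicalComplex.extendMap_f _ _ hk]
    infer_instance
  · refine ⟨fun a b _ => ?_⟩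
    exact (HomologicalComplex.isZero_extend_X _ _ _ fun k hk => hn ⟨k, hk⟩).eq_of_tgt a b

instance DRIncl_mono (F : HodgeFiltration E) {p q : ℤ} (h : p ≤ q) : Mono (DRIncl F h) := by
  refine mono_extendMap _ fun n => ?_
  rw [Functor.mapHomologicalComplex_map_f]
  exact @Functor.map_mono _ _ _ _ (presheafToSheaf (Opens.grothendieckTopology T.X')
    AddCommGrpCat.{u}) _ _ _ _ (formIncl_mono F h n)

/-- The graded pieces `Gr^p DR = Fil^p DR / Fil^{p+1} DR`. -/
def Gr (F : HodgeFiltration E) (p : ℤ) : CochainComplex T.Sh ℤ :=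
  cokernel (DRIncl F (show p ≤ p + 1 by lia))

/-- The short exact sequence `0 → Fil^{p+1} DR → Fil^p DR → Gr^p DR → 0`. -/
def grSequence (F : HodgeFiltration E) (p : ℤ) : ShortComplex (CochainComplex T.Sh ℤ) :=
  ShortComplex.mk (DRIncl F (show p ≤ p + 1 by lia)) (cokernel.π _) (cokernel.condition _)

lemma shortExact_cokernel {C : Type*} [Category C] [Abelian C] {A B : C} (φ : A ⟶ B) [Mono φ] :
    (ShortComplex.mk φ (cokernel.π φ) (cokernel.condition φ)).ShortExact :=
  .mk' (ShortComplex.exact_cokernel φ) inferInstance inferInstance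

lemma grSequence_shortExact (F : HodgeFiltration E) (p : ℤ) : (grSequence F p).ShortExact :=
  shortExact_cokernel (DRIncl F (show p ≤ p + 1 by lia))

/-! ### Hypercohomology and the Hodge–de Rham spectral sequence -/

attribute [local instance] HasDerivedCategory.standard

variable (T) in
/-- The constant sheaf `ℤ` on `X'`. -/
def constZ : T.Sh :=
  (constantSheaf (Opens.grothendieckTopology T.X') AddCommGrpCat.{u}).obj
    (AddCommGrpCat.of (ULift.{u} ℤ))

/-- The hypercohomology group `ℍⁿ(X, K) = Hom_{D(X)}(ℤ, K[n])`. -/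
def HH (K : CochainComplex T.Sh ℤ) (n : ℤ) : Type (u + 1) :=
  ShiftedHom ((DerivedCategory.singleFunctor T.Sh 0).obj T.constZ) (DerivedCategory.Q.obj K) n

instance (K : CochainComplex T.Sh ℤ) (n : ℤ) : AddCommGroup (HH K n) := by
  unfold HH ShiftedHom
  infer_instance

/-- Functoriality of hypercohomology. -/
def HH.map {K L : CochainComplex T.Sh ℤ} (φ : K ⟶ L) {n : ℤ} (x : HH K n) : HH L n :=
  ShiftedHom.comp x (ShiftedHom.mk₀ (0 : ℤ) rfl (DerivedCategory.Q.map φ)) (zero_add n)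

/-- The connecting map of the long exact sequence of a short exact sequence of complexes. -/
def HH.connecting {C : ShortComplex (CochainComplex T.Sh ℤ)} (hC : C.ShortExact) {n : ℤ}
    (x : HH C.X₃ n) : HH C.X₁ (n + 1) :=
  ShiftedHom.comp (b := (1 : ℤ)) x (DerivedCategory.triangleOfSESδ hC) (add_comm 1 n)

/-- Degeneration at `E₁` of the Hodge–de Rham spectral sequence
`E₁^{p, n-p} = ℍⁿ(Gr^p DR(End(V, ∇)_I)) ⇒ ℍⁿ(DR(End(V, ∇)_I))`, the spectral sequence of the
filtered complex `Fil^• DR(End(V, ∇)_I)`. It is the spectral sequence of the exact couple with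
`D^{p, n} = ℍⁿ(Fil^p)` and `E^{p, n} = ℍⁿ(Gr^p)`: for `q = p + r` with `r ≥ 1`, the differential
`d_r` is defined on the classes of those `x ∈ ℍⁿ(Gr^p)` whose image in `ℍⁿ⁺¹(Fil^{p+1})` under the
connecting map comes from some `y ∈ ℍⁿ⁺¹(Fil^q)`, and `d_r x` is the image of `y` in `ℍⁿ⁺¹(Gr^q)`,
modulo the images of those `z ∈ ℍⁿ⁺¹(Fil^q)` which vanish in `ℍⁿ⁺¹(Fil^{p+1})`. Degeneration means
that all `d_r` with `r ≥ 1` vanish. -/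
def HodgeDeRhamDegenerates (F : HodgeFiltration E) : Prop :=
  ∀ (p q : ℤ) (h : p + 1 ≤ q) (n : ℤ) (x : HH (Gr F p) n) (y : HH (DR F q) (n + 1)),
    HH.map (DRIncl F h) y = HH.connecting (grSequence_shortExact F p) x →
      ∃ z : HH (DR F q) (n + 1), HH.map (DRIncl F h) z = 0 ∧
        HH.map (grSequence F q).g y = HH.map (grSequence F q).g z

end ThickenedPair

/-! ### Lifts -/

section Lifts

variable {T : ThickenedPair.{u}}

/-- The restriction map on sections which corresponds to a morphism `V'|_X → V`. -/
def restrictTo {V' : T.X'.Modules} {V : T.X.Modules}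
    (φ : (Scheme.Modules.pullback T.i).obj V' ⟶ V) (U : T.X'.Opens) :
    Γ(V', U) →+ Γ(V, T.i ⁻¹ᵁ U) :=
  (((Scheme.Modules.pullbackPushforwardAdjunction T.i).homEquiv V' V φ).app U).hom

/-- A lift of the de Rham bundle `(V, ∇)` to `(X', D')`: a de Rham bundle over `(X', D')`, together
with an isomorphism of its restriction to `X` with `(V, ∇)`. -/
structure Lift (E : DeRhamBundle T.g T.D) : Type (u + 1) where
  /-- the de Rham bundle over `(X', D')` -/
  E' : DeRhamBundle T.g' T.D'
  φ : (Scheme.Modules.pullback T.i).obj E'.V ≅ E.V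
  parallel (U : T.X'.Opens) (x : T.VF U) (v : Γ(E'.V, U)) :
    restrictTo φ.hom U (E'.nabla U x.fst v) =
      E.nabla (T.i ⁻¹ᵁ U) x.snd (restrictTo φ.hom U v)

/-- An isomorphism of lifts of `(V, ∇)`: an isomorphism of de Rham bundles which restricts to the
identity of `V`. -/
structure Lift.Iso {E : DeRhamBundle T.g T.D} (L₁ L₂ : Lift E) : Type u where
  /-- the isomorphism of bundles -/
  e : L₁.E'.V ≅ L₂.E'.V
  parallel (U : T.X'.Opens) (x : LogDer T.g' T.D' U) (v : Γ(L₁.E'.V, U)) :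
    e.hom.app U (L₁.E'.nabla U x v) = L₂.E'.nabla U x (e.hom.app U v)
  restrict : (Scheme.Modules.pullback T.i).map e.hom ≫ L₂.φ.hom = L₁.φ.hom

/-- A Hodge filtration `F'` on a lift `L` of `(V, ∇)` lifts the Hodge filtration `F` on `(V, ∇)`:
the isomorphism `V'|_X ≅ V` identifies `(F'^p)|_X` with `F^p`. -/
structure LiftsFil {E : DeRhamBundle T.g T.D} (F : HodgeFiltration E) (L : Lift E)
    (F' : HodgeFiltration L.E') : Prop where
  le (p : ℤ) (U : T.X'.Opens) (v : Γ(L.E'.V, U)) :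
    v ∈ F'.Fil p U → restrictTo L.φ.hom U v ∈ F.Fil p (T.i ⁻¹ᵁ U)
  surj (p : ℤ) (U : T.X'.Opens) (v : Γ(E.V, T.i ⁻¹ᵁ U)) : v ∈ F.Fil p (T.i ⁻¹ᵁ U) →
    ∀ x ∈ U, ∃ (W : T.X'.Opens) (h : W ≤ U), x ∈ W ∧
      ∃ w ∈ F'.Fil p W, restrictTo L.φ.hom W w = resM E.V (ThickenedPair.pre_mono h) v

/-- A lift of the filtered de Rham bundle `(V, ∇, Fil)`. -/
structure FilLift {E : DeRhamBundle T.g T.D} (F : HodgeFiltration E) : Type (u + 1) where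
  /-- the underlying lift of `(V, ∇)` -/
  L : Lift E
  /-- the Hodge filtration on the lift -/
  F' : HodgeFiltration L.E'
  lifts : LiftsFil F L F'

/-- An isomorphism of lifts of `(V, ∇, Fil)`: an isomorphism of the underlying lifts of `(V, ∇)`
which identifies the filtrations. -/
structure FilLift.Iso {E : DeRhamBundle T.g T.D} {F : HodgeFiltration E} (L₁ L₂ : FilLift F) :
    Type u extends Lift.Iso L₁.L L₂.L where
  fil (p : ℤ) (U : T.X'.Opens) (v : Γ(L₁.L.E'.V, U)) :
    v ∈ L₁.F'.Fil p U ↔ e.hom.app U v ∈ L₂.F'.Fil p U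

namespace Lift.Iso

variable {E : DeRhamBundle T.g T.D}

lemma hom_inv {L₁ L₂ : Lift E} (e : L₁.Iso L₂) (U : T.X'.Opens) (v : Γ(L₂.E'.V, U)) :
    e.e.hom.app U (e.e.inv.app U v) = v :=
  congr((Scheme.Modules.Hom.app $(e.e.inv_hom_id) U).hom v)

lemma inv_hom {L₁ L₂ : Lift E} (e : L₁.Iso L₂) (U : T.X'.Opens) (v : Γ(L₁.E'.V, U)) :
    e.e.inv.app U (e.e.hom.app U v) = v :=
  congr((Scheme.Modules.Hom.app $(e.e.hom_inv_id) U).hom v)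

/-- The identity. -/
def refl (L : Lift E) : L.Iso L where
  e := CategoryTheory.Iso.refl _
  parallel _ _ _ := rfl
  restrict := by simp

/-- The inverse. -/
def symm {L₁ L₂ : Lift E} (e : L₁.Iso L₂) : L₂.Iso L₁ where
  e := e.e.symm
  parallel U x v := by
    have := e.parallel U x (e.e.inv.app U v)
    rw [hom_inv] at this
    rw [Iso.symm_hom, ← this, inv_hom]
  restrict := by
    rw [← e.restrict, Iso.symm_hom, ← Category.assoc, ← Functor.map_comp, e.e.inv_hom_id,
      CategoryTheory.Functor.map_id, Category.id_comp]

/-- The composition. -/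
def trans {L₁ L₂ L₃ : Lift E} (e : L₁.Iso L₂) (e' : L₂.Iso L₃) : L₁.Iso L₃ where
  e := e.e ≪≫ e'.e
  parallel U x v := by
    change e'.e.hom.app U (e.e.hom.app U _) = _
    rw [e.parallel, e'.parallel]; rfl
  restrict := by
    rw [Iso.trans_hom, Functor.map_comp, Category.assoc, e'.restrict, e.restrict]

end Lift.Iso

variable {E : DeRhamBundle T.g T.D}

instance liftSetoid (E : DeRhamBundle T.g T.D) : Setoid (Lift E) where
  r L₁ L₂ := Nonempty (L₁.Iso L₂)
  iseqv :=
    { refl := fun L => ⟨.refl L⟩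
      symm := fun ⟨e⟩ => ⟨e.symm⟩
      trans := fun ⟨e⟩ ⟨e'⟩ => ⟨e.trans e'⟩ }

instance filLiftSetoid (F : HodgeFiltration E) : Setoid (FilLift F) where
  r L₁ L₂ := Nonempty (L₁.Iso L₂)
  iseqv :=
    { refl := fun L => ⟨{ Lift.Iso.refl L.L with fil := fun _ _ _ => Iff.rfl }⟩
      symm := fun {L₁ L₂} ⟨e⟩ => ⟨{ e.toIso.symm with
        fil := fun p U v => by
          change v ∈ L₂.F'.Fil p U ↔ e.e.inv.app U v ∈ L₁.F'.Fil p U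
          rw [e.fil, e.toIso.hom_inv] }⟩
      trans := fun ⟨e⟩ ⟨e'⟩ => ⟨{ e.toIso.trans e'.toIso with
        fil := fun p U v => (e.fil p U v).trans (e'.fil p U _) }⟩ }

/-- The set `Def(V, ∇)` of isomorphism classes of lifts of `(V, ∇)` to `(X', D')`. -/
def Def (E : DeRhamBundle T.g T.D) : Type (u + 1) := _root_.Quotient (liftSetoid E)

/-- The set `Def(V, ∇, Fil)` of isomorphism classes of lifts of `(V, ∇, Fil)` to `(X', D')`. -/
def DefFil (F : HodgeFiltration E) : Type (u + 1) := _root_.Quotient (filLiftSetoid F)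

/-- The map `Def(V, ∇, Fil) → Def(V, ∇)` which forgets the filtration. -/
def DefFil.forget (F : HodgeFiltration E) : DefFil F → Def E :=
  _root_.Quotient.map (fun L : FilLift F => L.L) fun _ _ ⟨e⟩ => ⟨e.toIso⟩

end Lifts

end FilteredDeRham

end

/-! Let `DR` be the de Rham complex of End(V) ⊗ I. The filtration is finite, so `Fil^p DR` is all of
`DR` for very negative p and vanishes in any bounded range of degrees for large p. Degeneration at
`E₁` therefore says that `ℍⁿ(Fil^q) → ℍⁿ(Fil^p)` is injective for p ≤ q (`map_DRIncl_injective`),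
hence that `ℍⁿ(Fil^p) → ℍⁿ(Fil^p/Fil^q)` is surjective (`map_DRProj_surjective`). Only this
surjectivity is used, for q = 0, p very negative and n = 0, 1; the rest is deformation theory.

Fix a lift V' of (V, ∇). The endomorphisms of V' that vanish on X form an ideal N of square zero,
and where V' is trivial N is End(V) ⊗ I (`Lift.act`, `Lift.coeff`). A Hodge filtration is handled
locally through a decreasing chain of idempotents in End(V'); membership in a filtration step,
Griffiths transversality and comparison of filtrations all become identities in a ring with a
square-zero ideal.

Existence. Locally the filtration lifts to such a chain (`exists_splitting`). Two chains are
exchanged by some 1 + φ with φ in N, unique modulo Fil⁰, and the failure of transversality of one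
chain is an N-valued 1-form (`Splitting.griff`), unique modulo Fil⁻¹. Together these data form a
Čech hypercocycle of degree 1 in `DR/Fil⁰`. Surjectivity on ℍ¹ lifts it, after refinement and up to
a coboundary t, to a hypercocycle (n, k) in `DR` (`exists_cech_lift`). Regluing V' by 1 + n and
replacing ∇ by ∇ − k gives another lift of (V, ∇) (`Gluing.lift`). On it the chains, conjugated by 1
+ t, glue to a transversal filtration (`Gluing.Adapted.filLift`). This twisting is why the
underlying de Rham bundle may change.

Uniqueness. Two Hodge filtrations on the same lift are locally exchanged by 1 + φ. Modulo Fil⁰ the φ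
agree on overlaps and are horizontal, so they define a horizontal global section of `DR/Fil⁰`.
Surjectivity on ℍ⁰ lifts it to a horizontal b in N, and 1 + b is the required automorphism
(`nonempty_iso_of_lifts`). Injectivity of the forgetful map follows by transporting a filtration
along an isomorphism of lifts.

Čech data meet the derived category as follows. Embed K⁰ in an injective sheaf M placed in degree 0.
A Čech hypercocycle of degree 1 in K becomes a global section of the sheaf H⁰(cone(K → M)), that is,
a map from ℤ, and such maps come from the derived category because the cone has no homology in
negative degrees. -/

noncomputable section

section

namespace FilteredDeRham

/-! ### Gluing sections of sheaves -/

section Glue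

/-- Restriction of sections of a presheaf of abelian groups. -/
abbrev resP {X : TopCat.{u}} (F : TopCat.Presheaf AddCommGrpCat.{u} X) {U W : Opens X}
    (h : W ≤ U) : F.obj (op U) →+ F.obj (op W) := (F.map (homOfLE h).op).hom

variable {X : TopCat.{u}}

lemma resP_self (F : TopCat.Presheaf AddCommGrpCat.{u} X) {U : Opens X} (v : F.obj (op U)) :
    resP F le_rfl v = v := by
  change (F.map (𝟙 _)).hom v = v
  rw [F.map_id]; rfl

lemma resP_resP (F : TopCat.Presheaf AddCommGrpCat.{u} X) {U W W' : Opens X} (h : W ≤ U)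
    (h' : W' ≤ W) (v : F.obj (op U)) : resP F h' (resP F h v) = resP F (h'.trans h) v := by
  change ((F.map (homOfLE h).op) ≫ (F.map (homOfLE h').op)).hom v = _
  rw [← F.map_comp]; rfl

lemma resP_app {F G : TopCat.Presheaf AddCommGrpCat.{u} X} (f : F ⟶ G) {U W : Opens X}
    (h : W ≤ U) (v : F.obj (op U)) :
    resP G h ((f.app (op U)).hom v) = (f.app (op W)).hom (resP F h v) :=
  congr(($(f.naturality (homOfLE h).op)).hom v).symm

section

universe v w

variable {C : Type w} [Category.{v} C] {FC : C → C → Type*} {CC : C → Type u}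
  [∀ X Y, FunLike (FC X Y) (CC X) (CC Y)] [ConcreteCategory.{u} C FC]
  [HasLimitsOfSize.{u, u} C] [(CategoryTheory.forget C).ReflectsIsomorphisms]
  [PreservesLimitsOfSize.{u, u} (CategoryTheory.forget C)]

/-- Two sections of a sheaf which agree locally are equal. -/
lemma eq_of_locally_eq {F : TopCat.Presheaf C X} (hF : F.IsSheaf) {U : Opens X}
    (s t : ToType (F.obj (op U)))
    (H : ∀ x ∈ U, ∃ (W : Opens X) (h : W ≤ U), x ∈ W ∧
      F.map (homOfLE h).op s = F.map (homOfLE h).op t) : s = t := by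
  choose W hW hx e using H
  refine TopCat.Sheaf.eq_of_locally_eq' ⟨F, hF⟩ (fun x : U => W x.1 x.2) U
    (fun x => homOfLE (hW x.1 x.2)) (fun x hxU => ?_) s t (fun x => e x.1 x.2)
  exact Opens.mem_iSup.2 ⟨⟨x, hxU⟩, hx x hxU⟩

/-- Sections of a sheaf which are characterized locally by a predicate glue. -/
lemma exists_glue {F : TopCat.Presheaf C X} (hF : F.IsSheaf) (U : Opens X)
    (P : ∀ W : Opens X, ToType (F.obj (op W)) → Prop)
    (hloc : ∀ x ∈ U, ∃ W : Opens X, W ≤ U ∧ x ∈ W ∧ ∃ s, P W s)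
    (hres : ∀ (W W' : Opens X) (h : W' ≤ W) s, W ≤ U → P W s → P W' (F.map (homOfLE h).op s))
    (huniq : ∀ (W : Opens X), W ≤ U → ∀ s t, P W s → P W t → s = t) :
    ∃ s : ToType (F.obj (op U)), ∀ (W : Opens X) (h : W ≤ U) t, P W t →
      F.map (homOfLE h).op s = t := by
  choose W hW hx s hs using hloc
  obtain ⟨s₀, hs₀, -⟩ := TopCat.Sheaf.existsUnique_gluing' ⟨F, hF⟩ (fun x : U => W x.1 x.2) U
    (fun x => homOfLE (hW x.1 x.2))
    (fun x hxU => Opens.mem_iSup.2 ⟨⟨x, hxU⟩, hx x hxU⟩) (fun x => s x.1 x.2) (fun x y => by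
      refine huniq _ (inf_le_left.trans (hW x.1 x.2)) _ _ ?_ ?_
      · exact hres _ _ inf_le_left _ (hW _ _) (hs x.1 x.2)
      · exact hres _ _ inf_le_right _ (hW _ _) (hs y.1 y.2))
  -- An arbitrary `W₁` need not belong to the chosen cover, so `s₀` and `t` are compared on `W₁ ⊓ W
  -- x`, where both restrict to sections satisfying `P`.
  refine ⟨s₀, fun W₁ h₁ t ht => ?_⟩
  refine eq_of_locally_eq hF _ _ fun x hxW => ?_
  refine ⟨W₁ ⊓ W x (h₁ hxW), inf_le_left, ⟨hxW, hx _ _⟩, ?_⟩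
  have e : F.map (homOfLE (inf_le_right : W₁ ⊓ W x (h₁ hxW) ≤ _)).op (s x (h₁ hxW)) =
      F.map (homOfLE (inf_le_left : W₁ ⊓ W x (h₁ hxW) ≤ _)).op t :=
    huniq _ (inf_le_left.trans h₁) _ _ (hres _ _ _ _ (hW _ _) (hs _ _)) (hres _ _ _ _ h₁ ht)
  rw [← e, ← hs₀ ⟨x, h₁ hxW⟩, ← ConcreteCategory.comp_apply, ← ConcreteCategory.comp_apply,
    ← F.map_comp, ← F.map_comp]
  rfl

end

variable (X) in
/-- Sheaves of abelian groups. -/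
abbrev AbSh : Type (u + 1) := CategoryTheory.Sheaf (Opens.grothendieckTopology X) AddCommGrpCat.{u}

lemma AbSh.isSheaf (F : AbSh X) : TopCat.Presheaf.IsSheaf F.obj := F.property

/-- Sections of a sheaf. -/
abbrev AbSh.sec (F : AbSh X) (U : Opens X) : Type u := F.obj.obj (op U)

/-- Restriction of sections. -/
abbrev AbSh.res (F : AbSh X) {U W : Opens X} (h : W ≤ U) : F.sec U →+ F.sec W := resP F.obj h

/-- The map on sections. -/
abbrev shApp {F G : AbSh X} (f : F ⟶ G) (U : Opens X) : F.sec U →+ G.sec U :=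
  (f.hom.app (op U)).hom

lemma shApp_res {F G : AbSh X} (f : F ⟶ G) {U W : Opens X} (h : W ≤ U) (v : F.sec U) :
    G.res h (shApp f U v) = shApp f W (F.res h v) := resP_app f.hom h v

lemma shApp_neg {F G : AbSh X} (f : F ⟶ G) (U : Opens X) (v : F.sec U) :
    shApp (-f) U v = -shApp f U v := rfl

lemma shApp_comp {F G H : AbSh X} (f : F ⟶ G) (g : G ⟶ H) (U : Opens X) (v : F.sec U) :
    shApp (f ≫ g) U v = shApp g U (shApp f U v) := rfl

lemma shApp_id {F : AbSh X} (U : Opens X) (v : F.sec U) : shApp (𝟙 F) U v = v := rfl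

lemma shApp_zero {F G : AbSh X} (U : Opens X) (v : F.sec U) : shApp (0 : F ⟶ G) U v = 0 := rfl

lemma shApp_sub {F G : AbSh X} (f g : F ⟶ G) (U : Opens X) (v : F.sec U) :
    shApp (f - g) U v = shApp f U v - shApp g U v := rfl

lemma AbSh.hom_ext {F G : AbSh X} {f g : F ⟶ G} (h : ∀ U v, shApp f U v = shApp g U v) :
    f = g := by
  ext U v
  exact h U.unop v

lemma exists_local_lift {F G : AbSh X} (f : F ⟶ G) [Epi f] {U : Opens X} (s : G.sec U) (x : X)
    (hx : x ∈ U) : ∃ (W : Opens X) (h : W ≤ U), x ∈ W ∧ ∃ t, shApp f W t = G.res h s := by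
  have := (TopCat.Sheaf.isLocallySurjective_iff_epi f).2 ‹Epi f›
  obtain ⟨W, h, ⟨t, ht⟩, hxW⟩ := (TopCat.Presheaf.isLocallySurjective_iff f.hom).1 this U s x hx
  exact ⟨W, h, hxW, t, ht⟩

lemma shApp_injective {F G : AbSh X} (f : F ⟶ G) [Mono f] (U : Opens X) :
    Function.Injective (shApp f U) := by
  have : Mono ((sheafToPresheaf _ _).map f) := inferInstance
  have := (NatTrans.mono_iff_mono_app _).1 this (op U)
  exact (AddCommGrpCat.mono_iff_injective _).1 this

lemma exists_lift_of_exact {S : ShortComplex (AbSh X)} (hS : S.Exact) [Mono S.f] {U : Opens X}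
    (s : S.X₂.sec U) (hs : shApp S.g U s = 0) : ∃ t, shApp S.f U t = s :=
  TopCat.Sheaf.sections_exact_of_left_exact hS ‹Mono S.f› s hs

/-- Taking sections is left exact, so `s` is a section of the kernel sheaf over all of `U`. Only the
epimorphism from `S.X₁` onto that kernel forces a shrinking of `U`. -/
lemma exists_local_lift_of_exact {S : ShortComplex (AbSh X)} (hS : S.Exact) {U : Opens X}
    (s : S.X₂.sec U) (hs : shApp S.g U s = 0) (x : X) (hx : x ∈ U) :
    ∃ (W : Opens X) (h : W ≤ U), x ∈ W ∧ ∃ t, shApp S.f W t = S.X₂.res h s := by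
  obtain ⟨t, ht⟩ := exists_lift_of_exact (S := ShortComplex.mk (kernel.ι S.g) S.g (by simp))
    (ShortComplex.exact_kernel S.g) s hs
  have : Epi (kernel.lift S.g S.f S.zero) := hS.epi_kernelLift
  obtain ⟨W, h, hxW, t', ht'⟩ := exists_local_lift (kernel.lift S.g S.f S.zero) t x hx
  refine ⟨W, h, hxW, t', ?_⟩
  dsimp only at ht
  rw [← ht, shApp_res, ← ht', ← shApp_comp, kernel.lift_ι]

/-- Every section of a sheafification locally comes from the presheaf. -/
lemma exists_local_presheaf_lift (P : TopCat.Presheaf AddCommGrpCat.{u} X) {U : Opens X}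
    (s : AbSh.sec ((presheafToSheaf (Opens.grothendieckTopology X) AddCommGrpCat.{u}).obj P) U)
    (x : X) (hx : x ∈ U) : ∃ (W : Opens X) (h : W ≤ U), x ∈ W ∧ ∃ t : P.obj (op W),
      ((toSheafify (Opens.grothendieckTopology X) P).app (op W)).hom t = AbSh.res _ h s := by
  have h1 : TopCat.Presheaf.IsLocallySurjective (toSheafify (Opens.grothendieckTopology X) P) :=
    inferInstanceAs (CategoryTheory.Presheaf.IsLocallySurjective _ _)
  obtain ⟨W, h, ⟨t, ht⟩, hxW⟩ := (TopCat.Presheaf.isLocallySurjective_iff _).1 h1 U s x hx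
  exact ⟨W, h, hxW, t, ht⟩

/-- A section of a presheaf which vanishes in the sheafification vanishes locally. -/
lemma local_eq_zero (P : TopCat.Presheaf AddCommGrpCat.{u} X) {U : Opens X} (t : P.obj (op U))
    (ht : ((toSheafify (Opens.grothendieckTopology X) P).app (op U)).hom t = 0)
    (x : X) (hx : x ∈ U) : ∃ (W : Opens X) (h : W ≤ U), x ∈ W ∧ resP P h t = 0 := by
  have h1 : CategoryTheory.Presheaf.IsLocallyInjective (Opens.grothendieckTopology X)
    (toSheafify (Opens.grothendieckTopology X) P) := inferInstance
  obtain ⟨W, f, hf, hxW⟩ := h1.equalizerSieve_mem t 0 (ht.trans (map_zero _).symm) x hx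
  exact ⟨W, f.le, hxW, hf.trans (map_zero _)⟩

end Glue

end FilteredDeRham

end

section

namespace FilteredDeRham
open DerivedCategory Pretriangulated HomologicalComplex

/-! ### Long exact Hom sequences and maps into H⁰ in the derived category. -/

section Derived
universe v w w'
variable {C : Type w} [Category.{v} C] [Abelian C]

variable [HasDerivedCategory.{w'} C]

lemma exact_of_distTriang₂ {T : Triangle (DerivedCategory C)} (hT : T ∈ distTriang _)
    {A : DerivedCategory C} {n : ℤ} (x : A ⟶ T.obj₂⟦n⟧) (hx : x ≫ T.mor₂⟦n⟧' = 0) :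
    ∃ y : A ⟶ T.obj₁⟦n⟧, y ≫ T.mor₁⟦n⟧' = x := by
  have := (preadditiveCoyoneda.obj (op A)).homologySequence_exact₂ T hT n
  rw [ShortComplex.ab_exact_iff] at this
  exact this x hx

/-- Exactness of Hom(A, –) on the triangle. The boundary map is written as a `ShiftedHom.comp` with
`T.mor₃` in order to match `HH.connecting`. -/
lemma exact_of_distTriang₁ {T : Triangle (DerivedCategory C)} (hT : T ∈ distTriang _)
    {A : DerivedCategory C} {n : ℤ} (x : A ⟶ T.obj₁⟦n + 1⟧) (hx : x ≫ T.mor₁⟦n + 1⟧' = 0) :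
    ∃ y : A ⟶ T.obj₃⟦n⟧,
      ShiftedHom.comp (X := A) (Y := T.obj₃) (Z := T.obj₁) (b := (1 : ℤ)) y T.mor₃ (add_comm 1 n) =
        x := by
  have := (preadditiveCoyoneda.obj (op A)).homologySequence_exact₁ T hT n (n + 1) rfl
  rw [ShortComplex.ab_exact_iff] at this
  obtain ⟨y, hy⟩ := this x hx
  refine ⟨y, ?_⟩
  refine Eq.trans ?_ hy
  exact (preadditiveCoyoneda_homologySequenceδ_apply T n (n + 1) rfl (A := op A) y).symm

lemma exact_of_distTriang₃ {T : Triangle (DerivedCategory C)} (hT : T ∈ distTriang _)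
    {A : DerivedCategory C} {n : ℤ} (x : A ⟶ T.obj₃⟦n⟧)
    (hx : ShiftedHom.comp (X := A) (Y := T.obj₃) (Z := T.obj₁) (b := (1 : ℤ)) x T.mor₃
      (add_comm 1 n) = 0) : ∃ y : A ⟶ T.obj₂⟦n⟧, y ≫ T.mor₂⟦n⟧' = x := by
  have := (preadditiveCoyoneda.obj (op A)).homologySequence_exact₃ T hT n (n + 1) rfl
  rw [ShortComplex.ab_exact_iff] at this
  refine this x (Eq.trans ?_ hx)
  exact (preadditiveCoyoneda_homologySequenceδ_apply T n (n + 1) rfl (A := op A) x)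

/-- The homology of a complex in terms of the derived category. -/
def homologyIso (K : CochainComplex C ℤ) :
    (DerivedCategory.homologyFunctor C 0).obj (Q.obj K) ≅ K.homology 0 :=
  (homologyFunctorFactors C 0).app K

lemma homologyIso_naturality {K L : CochainComplex C ℤ} (f : K ⟶ L) :
    (DerivedCategory.homologyFunctor C 0).map (Q.map f) ≫ (homologyIso L).hom =
      (homologyIso K).hom ≫ homologyMap f 0 :=
  (homologyFunctorFactors C 0).hom.naturality f

/-- The object `Z` in degree `0` of the derived category. -/
def singleQIso (Z : C) : (DerivedCategory.singleFunctor C 0).obj Z ≅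
    Q.obj ((HomologicalComplex.single C (ComplexShape.up ℤ) 0).obj Z) :=
  (singleFunctorIsoCompQ C 0).app Z

/-- The map `Hom(Z, K) → Hom(Z, H⁰(K))`. -/
def homologyHom {Z : C} {K : CochainComplex C ℤ}
    (x : (DerivedCategory.singleFunctor C 0).obj Z ⟶ Q.obj K) : Z ⟶ K.homology 0 :=
  (singleObjHomologySelfIso (ComplexShape.up ℤ) 0 Z).inv ≫ (homologyIso _).inv ≫
    (DerivedCategory.homologyFunctor C 0).map ((singleQIso Z).inv ≫ x) ≫ (homologyIso K).hom

lemma homologyHom_comp {Z : C} {K L : CochainComplex C ℤ}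
    (x : (DerivedCategory.singleFunctor C 0).obj Z ⟶ Q.obj K) (f : K ⟶ L) :
    homologyHom (x ≫ Q.map f) = homologyHom x ≫ homologyMap f 0 := by
  simp only [homologyHom, Functor.map_comp, Category.assoc, homologyIso_naturality]

lemma homologyHom_sub {Z : C} {K : CochainComplex C ℤ}
    (x y : (DerivedCategory.singleFunctor C 0).obj Z ⟶ Q.obj K) :
    homologyHom (x - y) = homologyHom x - homologyHom y := by
  simp only [homologyHom, Functor.map_sub, Preadditive.sub_comp, Preadditive.comp_sub]

lemma homologyHom_single {Z : C} {K : CochainComplex C ℤ}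
    (g : (HomologicalComplex.single C (ComplexShape.up ℤ) 0).obj Z ⟶ K) :
    homologyHom ((singleQIso Z).hom ≫ Q.map g) =
      (singleObjHomologySelfIso (ComplexShape.up ℤ) 0 Z).inv ≫ homologyMap g 0 := by
  simp only [homologyHom, Iso.inv_hom_id_assoc, homologyIso_naturality]

/-- Truncation makes the complex start in degree 0 without changing it in the derived category.
There H⁰ is the object of 0-cycles, so `τ` is an actual chain map from `Z` placed in degree 0;
inverting the truncation map brings it back to `K`. -/
lemma exists_homologyHom_eq {Z : C} {K : CochainComplex C ℤ} [K.IsGE 0] (τ : Z ⟶ K.homology 0) :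
    ∃ x : (DerivedCategory.singleFunctor C 0).obj Z ⟶ Q.obj K, homologyHom x = τ := by
  let K' := K.truncGE 0
  let π := K.πTruncGE 0
  have h0 : IsZero (K'.X (-1)) := K'.isZero_of_isStrictlyGE 0 (-1) (by simp)
  -- The truncation has no boundaries in degree 0.
  have : IsIso (K'.homologyπ 0) := K'.isIso_homologyπ (-1) 0 (by simp) (h0.eq_of_src _ _)
  let α : Z ⟶ K'.cycles 0 := τ ≫ homologyMap π 0 ≫ inv (K'.homologyπ 0)
  let g : (HomologicalComplex.single C (ComplexShape.up ℤ) 0).obj Z ⟶ K' :=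
    mkHomFromSingle (α ≫ K'.iCycles 0) (by intro k _; simp)
  have hg : (singleObjHomologySelfIso (ComplexShape.up ℤ) 0 Z).inv ≫ homologyMap g 0 =
      τ ≫ homologyMap π 0 := by
    rw [← singleObjCyclesSelfIso_inv_homologyπ_assoc, homologyπ_naturality]
    have : (singleObjCyclesSelfIso (ComplexShape.up ℤ) 0 Z).inv ≫ cyclesMap g 0 = α := by
      rw [← cancel_mono (K'.iCycles 0), Category.assoc, cyclesMap_i]
      simp [g]
    rw [reassoc_of% this]
    simp [α]
  refine ⟨(singleQIso Z).hom ≫ Q.map g ≫ inv (Q.map π), ?_⟩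
  have h2 := homologyHom_comp ((singleQIso Z).hom ≫ Q.map g ≫ inv (Q.map π)) π
  have : IsIso (homologyMap π 0) := inferInstance
  rw [← cancel_mono (homologyMap π 0), ← h2, ← hg, ← homologyHom_single]
  rw [Category.assoc, Category.assoc, IsIso.inv_hom_id, Category.comp_id]
end Derived
end FilteredDeRham

end

section

namespace FilteredDeRham
open DerivedCategory Pretriangulated HomologicalComplex

/-! ### Homology sheaves, representing cycles, and Čech cocycles in injective sheaves. -/

section Sections

variable {X : TopCat.{u}}

variable (X) in
/-- The constant sheaf `ℤ`. -/
def intSheaf : AbSh X :=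
  (constantSheaf (Opens.grothendieckTopology X) AddCommGrpCat.{u}).obj
    (AddCommGrpCat.of (ULift.{u} ℤ))

variable (X) in
/-- The section `1` of the constant sheaf. -/
def intOne : (intSheaf X).sec ⊤ :=
  ((constantSheafAdj (Opens.grothendieckTopology X) AddCommGrpCat.{u} isTerminalTop).unit.app
    (AddCommGrpCat.of (ULift.{u} ℤ))).hom ⟨1⟩

/-- The constant sheaf is left adjoint to global sections. This turns a global section of a homology
sheaf into a map out of ℤ, the source in the definition of `HH`. -/
lemma exists_intSheaf_hom {F : AbSh X} (s : F.sec ⊤) : ∃ f : intSheaf X ⟶ F,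
    shApp f ⊤ (intOne X) = s := by
  let adj := constantSheafAdj (Opens.grothendieckTopology X) AddCommGrpCat.{u}
    (isTerminalTop (α := Opens X))
  let a : AddCommGrpCat.of (ULift.{u} ℤ) ⟶ ((sheafSections (Opens.grothendieckTopology X)
      AddCommGrpCat.{u}).obj (op ⊤)).obj F :=
    AddCommGrpCat.ofHom (((zmultiplesHom (F.sec ⊤)) s).comp AddEquiv.ulift.toAddMonoidHom)
  refine ⟨(adj.homEquiv _ _).symm a, ?_⟩
  have h : adj.homEquiv _ _ ((adj.homEquiv _ _).symm a) = a := Equiv.apply_symm_apply _ _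
  rw [Adjunction.homEquiv_unit] at h
  have h2 : a.hom ⟨1⟩ = s := by
    change (1 : ℤ) • s = s
    exact one_smul _ _
  exact Eq.trans congr(($h).hom ⟨1⟩) h2

/-- The cycle `z` represents the section `s` of the homology sheaf. -/
def IsRep (K : CochainComplex (AbSh X) ℤ) (i : ℤ) (W : Opens X) (z : (K.X i).sec W)
    (s : (K.homology i).sec W) : Prop :=
  ∃ c : (K.cycles i).sec W, shApp (K.iCycles i) W c = z ∧ shApp (K.homologyπ i) W c = s

namespace IsRep

variable {K L : CochainComplex (AbSh X) ℤ} {i : ℤ} {W W' : Opens X} {z z' : (K.X i).sec W}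
  {s s' : (K.homology i).sec W}

lemma sub (h : IsRep K i W z s) (h' : IsRep K i W z' s') : IsRep K i W (z - z') (s - s') := by
  obtain ⟨c, rfl, rfl⟩ := h
  obtain ⟨c', rfl, rfl⟩ := h'
  exact ⟨c - c', map_sub _ _ _, map_sub _ _ _⟩

lemma res (h : IsRep K i W z s) (hW : W' ≤ W) :
    IsRep K i W' ((K.X i).res hW z) ((K.homology i).res hW s) := by
  obtain ⟨c, rfl, rfl⟩ := h
  exact ⟨(K.cycles i).res hW c, (shApp_res _ _ _).symm, (shApp_res _ _ _).symm⟩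

lemma map (f : K ⟶ L) (h : IsRep K i W z s) :
    IsRep L i W (shApp (f.f i) W z) (shApp (homologyMap f i) W s) := by
  obtain ⟨c, rfl, rfl⟩ := h
  refine ⟨shApp (cyclesMap f i) W c, ?_, ?_⟩
  · rw [← shApp_comp, ← shApp_comp, cyclesMap_i]
  · rw [← shApp_comp, ← shApp_comp, homologyπ_naturality]

lemma d_eq_zero (h : IsRep K i W z s) (j : ℤ) : shApp (K.d i j) W z = 0 := by
  obtain ⟨c, rfl, rfl⟩ := h
  rw [← shApp_comp, iCycles_d, shApp_zero]

lemma unique (h : IsRep K i W z s) (h' : IsRep K i W z s') : s = s' := by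
  obtain ⟨c, rfl, rfl⟩ := h
  obtain ⟨c', h1, rfl⟩ := h'
  rw [shApp_injective (K.iCycles i) W h1]

lemma exists_of_d_eq_zero (z : (K.X i).sec W) (hz : shApp (K.d i (i + 1)) W z = 0) :
    ∃ s, IsRep K i W z s := by
  let S := ShortComplex.mk (K.iCycles i) (K.d i (i + 1)) (by simp)
  have hS : S.Exact := S.exact_of_f_is_kernel (K.cyclesIsKernel i (i + 1) (by simp))
  have : Mono S.f := inferInstanceAs (Mono (K.iCycles i))
  obtain ⟨c, hc⟩ := exists_lift_of_exact hS z hz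
  exact ⟨_, c, hc, rfl⟩

lemma exists_local (s : (K.homology i).sec W) (x : X) (hx : x ∈ W) :
    ∃ (W' : Opens X) (h : W' ≤ W), x ∈ W' ∧ ∃ z, IsRep K i W' z ((K.homology i).res h s) := by
  obtain ⟨W', h, hx', c, hc⟩ := exists_local_lift (K.homologyπ i) s x hx
  exact ⟨W', h, hx', _, c, rfl, hc⟩

lemma local_boundary (h : IsRep K i W z 0) (x : X) (hx : x ∈ W) :
    ∃ (W' : Opens X) (hW : W' ≤ W), x ∈ W' ∧ ∃ y, shApp (K.d (i - 1) i) W' y =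
      (K.X i).res hW z := by
  obtain ⟨c, rfl, h⟩ := h
  let S := ShortComplex.mk (K.toCycles (i - 1) i) (K.homologyπ i) (by simp)
  have hS : S.Exact := S.exact_of_g_is_cokernel
    (K.homologyIsCokernel (i - 1) i (by simp))
  obtain ⟨W', hW, hx', y, hy⟩ := exists_local_lift_of_exact hS c h x hx
  refine ⟨W', hW, hx', y, ?_⟩
  rw [shApp_res, ← (show shApp (K.toCycles (i - 1) i) W' y = _ from hy), ← shApp_comp,
    toCycles_i]

lemma exists_of_isZero (h0 : IsZero (K.X (i - 1))) (s : (K.homology i).sec W) :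
    ∃ z, IsRep K i W z s := by
  have : IsIso (K.homologyπ i) := K.isIso_homologyπ (i - 1) i (by simp) (h0.eq_of_src _ _)
  refine ⟨_, shApp (inv (K.homologyπ i)) W s, rfl, ?_⟩
  rw [← shApp_comp, IsIso.inv_hom_id, shApp_id]

lemma eq_of_isZero (h0 : IsZero (K.X (i - 1))) (h : IsRep K i W z s) (h' : IsRep K i W z' s) :
    z = z' := by
  have : IsIso (K.homologyπ i) := K.isIso_homologyπ (i - 1) i (by simp) (h0.eq_of_src _ _)
  obtain ⟨c, rfl, h⟩ := h
  obtain ⟨c', rfl, h'⟩ := h'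
  rw [shApp_injective (K.homologyπ i) W (h.trans h'.symm)]

end IsRep

/-- A Čech cocycle becomes a coboundary in an injective sheaf. -/
lemma exists_trivialization {F G : AbSh X} (f : F ⟶ G) [Mono f] [Injective G] {ι : Type u}
    (U : ι → Opens X) (hU : ∀ x, ∃ i, x ∈ U i) (q : ∀ i j, F.sec (U i ⊓ U j))
    (hq : ∀ i j k, F.res (le_inf (inf_le_left.trans inf_le_left) (inf_le_left.trans inf_le_right))
        (q i j) + F.res (le_inf (inf_le_left.trans inf_le_right) inf_le_right) (q j k) =
      F.res (W := U i ⊓ U j ⊓ U k) (le_inf (inf_le_left.trans inf_le_left) inf_le_right) (q i k)) :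
    ∃ γ : ∀ i, G.sec (U i), ∀ i j, G.res inf_le_left (γ i) - G.res inf_le_right (γ j) =
      shApp f (U i ⊓ U j) (q i j) := by
  -- `P` is the first term of the Čech resolution of `F` for the cover `U`. Extending `f` along the
  -- embedding of `F` in `P` plays the role of a partition of unity.
  let P : TopCat.Presheaf AddCommGrpCat.{u} X :=
    { obj := fun W => AddCommGrpCat.of (∀ i, F.sec (W.unop ⊓ U i))
      map := fun {W W'} h => AddCommGrpCat.ofHom
        { toFun := fun s i => F.res (inf_le_inf_right _ h.unop.le) (s i)
          map_zero' := by ext i; simp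
          map_add' := fun s t => by ext i; simp }
      map_id := fun W => by
        ext s i
        exact resP_self F.obj _
      map_comp := fun {W W' W''} g h => by
        ext s i
        exact (resP_resP F.obj _ _ _).symm }
  let ρ : F.obj ⟶ P :=
    { app := fun W => AddCommGrpCat.ofHom
        { toFun := fun s i => F.res inf_le_left s
          map_zero' := by ext i; simp
          map_add' := fun s t => by ext i; simp }
      naturality := fun W W' h => by
        ext s i
        exact (resP_resP F.obj h.unop.le inf_le_left s).trans
          (resP_resP F.obj inf_le_left (inf_le_inf_right _ h.unop.le) s).symm }
  have hρ : Mono ρ := by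
    have (W : (Opens X)ᵒᵖ) : Mono (ρ.app W) := by
      refine (AddCommGrpCat.mono_iff_injective _).2 fun s t h => ?_
      refine eq_of_locally_eq F.isSheaf s t fun x hx => ?_
      obtain ⟨i, hi⟩ := hU x
      exact ⟨W.unop ⊓ U i, inf_le_left, ⟨hx, hi⟩, congrFun h i⟩
    exact NatTrans.mono_of_mono_app _
  -- The extension problem lives in presheaves. An injective sheaf is also injective there, because
  -- its inclusion is right adjoint to the exact sheafification.
  have hG : Injective G.obj := by
    have := Injective.injective_of_adjoint
      (sheafificationAdjunction (Opens.grothendieckTopology X) AddCommGrpCat.{u}) G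
    exact this
  let r : P ⟶ G.obj := Injective.factorThru f.hom ρ
  have hr : ρ ≫ r = f.hom := Injective.comp_factorThru _ _
  have hr' (W : Opens X) (s : F.sec W) :
      (r.app (op W)).hom (fun i => F.res inf_le_left s) = shApp f W s :=
    congr((NatTrans.app $hr (op W)).hom s)
  -- The row j ↦ `q i j` is a section of `P` over `U i`. By the cocycle identity, the rows of i and
  -- j differ over the overlap by the image of `q i j` itself.
  refine ⟨fun i => (r.app (op (U i))).hom (fun j => q i j), fun i j => ?_⟩
  have e1 : G.res (W := U i ⊓ U j) inf_le_left ((r.app (op (U i))).hom (fun j => q i j)) = _ :=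
    resP_app r _ _
  have e2 : G.res (W := U i ⊓ U j) inf_le_right ((r.app (op (U j))).hom (fun k => q j k)) = _ :=
    resP_app r _ _
  rw [e1, e2, ← map_sub, ← hr']
  congr 1
  funext k
  exact sub_eq_of_eq_add (hq i j k).symm

end Sections
end FilteredDeRham

end

section

namespace FilteredDeRham
open DerivedCategory Pretriangulated HomologicalComplex CochainComplex

/-! ### Degree-0 sections of a mapping cone as pairs in K¹ ⊕ M⁰. -/

section Cone

variable {X : TopCat.{u}} {K M L N : CochainComplex (AbSh X) ℤ} (f : K ⟶ M) (f' : L ⟶ N)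

/-- First component of a section of the mapping cone in degree `0`. -/
def coneFst (W : Opens X) : ((mappingCone f).X 0).sec W →+ (K.X 1).sec W :=
  shApp ((mappingCone.fst f).1.v 0 1 rfl) W

/-- Second component of a section of the mapping cone in degree `0`. -/
def coneSnd (W : Opens X) : ((mappingCone f).X 0).sec W →+ (M.X 0).sec W :=
  shApp ((mappingCone.snd f).v 0 0 rfl) W

variable {W : Opens X}

lemma cone_ext {z z' : ((mappingCone f).X 0).sec W} (h : coneFst f W z = coneFst f W z')
    (h' : coneSnd f W z = coneSnd f W z') : z = z' := by
  have e (y : ((mappingCone f).X 0).sec W) : y =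
      shApp ((mappingCone.inl f).v 1 0 rfl) W (coneFst f W y) +
        shApp ((mappingCone.inr f).f 0) W (coneSnd f W y) := by
    have := mappingCone.id_X f 0 1 rfl
    conv_lhs => rw [← shApp_id W y, ← this]
    rfl
  rw [e z, e z', h, h']

lemma exists_cone_sec (a : (K.X 1).sec W) (b : (M.X 0).sec W) :
    ∃ z, coneFst f W z = a ∧ coneSnd f W z = b := by
  refine ⟨shApp ((mappingCone.inl f).v 1 0 rfl) W a + shApp ((mappingCone.inr f).f 0) W b,
    ?_, ?_⟩
  · rw [map_add, coneFst, ← shApp_comp, ← shApp_comp, mappingCone.inl_v_fst_v,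
      mappingCone.inr_f_fst_v, shApp_zero, add_zero, shApp_id]
  · rw [map_add, coneSnd, ← shApp_comp, ← shApp_comp, mappingCone.inl_v_snd_v,
      mappingCone.inr_f_snd_v, shApp_zero, zero_add, shApp_id]

lemma cone_res {W' : Opens X} (h : W' ≤ W) (z : ((mappingCone f).X 0).sec W) :
    coneFst f W' (((mappingCone f).X 0).res h z) = (K.X 1).res h (coneFst f W z) ∧
    coneSnd f W' (((mappingCone f).X 0).res h z) = (M.X 0).res h (coneSnd f W z) :=
  ⟨(shApp_res _ _ _).symm, (shApp_res _ _ _).symm⟩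

lemma cone_map (a : K ⟶ L) (b : M ⟶ N) (comm : f ≫ b = a ≫ f')
    (z : ((mappingCone f).X 0).sec W) :
    coneFst f' W (shApp ((mappingCone.map f f' a b comm).f 0) W z) =
      shApp (a.f 1) W (coneFst f W z) ∧
    coneSnd f' W (shApp ((mappingCone.map f f' a b comm).f 0) W z) =
      shApp (b.f 0) W (coneSnd f W z) := by
  have h1 : (mappingCone.map f f' a b comm).f 0 ≫ (mappingCone.fst f').1.v 0 1 rfl =
      (mappingCone.fst f).1.v 0 1 rfl ≫ a.f 1 := by
    simp [mappingCone.ext_from_iff _ 1 0 rfl, mappingCone.map]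
  have h2 : (mappingCone.map f f' a b comm).f 0 ≫ (mappingCone.snd f').v 0 0 rfl =
      (mappingCone.snd f).v 0 0 rfl ≫ b.f 0 := by
    simp [mappingCone.ext_from_iff _ 1 0 rfl, mappingCone.map]
  constructor
  · rw [coneFst, ← shApp_comp, h1]; rfl
  · rw [coneSnd, ← shApp_comp, h2]; rfl

lemma cone_inr (b : (M.X 0).sec W) :
    coneFst f W (shApp ((mappingCone.inr f).f 0) W b) = 0 ∧
    coneSnd f W (shApp ((mappingCone.inr f).f 0) W b) = b := by
  constructor
  · rw [coneFst, ← shApp_comp, mappingCone.inr_f_fst_v, shApp_zero]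
  · rw [coneSnd, ← shApp_comp, mappingCone.inr_f_snd_v, shApp_id]

lemma cone_d_fst {z : ((mappingCone f).X 0).sec W} {s} (h : IsRep (mappingCone f) 0 W z s) :
    shApp (K.d 1 2) W (coneFst f W z) = 0 := by
  have h1 := mappingCone.d_fst_v f 0 1 2 rfl rfl
  have h3 : -shApp (K.d 1 2) W (coneFst f W z) =
      shApp ((mappingCone.fst f).1.v 1 2 rfl) W (shApp ((mappingCone f).d 0 1) W z) :=
    congr(shApp $h1 W z).symm
  rw [h.d_eq_zero 1, map_zero, neg_eq_zero] at h3
  exact h3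

/-- In degree 1 the cone is K² ⊕ M¹ with M¹ = 0, so being a cycle is a condition on the K¹-component
alone. -/
lemma exists_cone_rep (hM : IsZero (M.X 1)) (a : (K.X 1).sec W) (b : (M.X 0).sec W)
    (ha : shApp (K.d 1 2) W a = 0) :
    ∃ z s, IsRep (mappingCone f) 0 W z s ∧ coneFst f W z = a ∧ coneSnd f W z = b := by
  obtain ⟨z, h1, h2⟩ := exists_cone_sec f a b
  obtain ⟨s, hs⟩ := IsRep.exists_of_d_eq_zero (K := mappingCone f) (i := 0) z (by
    have : Mono ((mappingCone.fst f).1.v 1 2 rfl) := by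
      refine ⟨fun {Z} g g' h => ?_⟩
      rw [mappingCone.ext_to_iff f 1 2 rfl]
      exact ⟨h, hM.eq_of_tgt _ _⟩
    apply shApp_injective ((mappingCone.fst f).1.v 1 2 rfl) W
    rw [map_zero]
    have h3 : shApp ((mappingCone.fst f).1.v 1 2 rfl) W (shApp ((mappingCone f).d 0 1) W z) =
        -shApp (K.d 1 2) W (coneFst f W z) :=
      congr(shApp $(mappingCone.d_fst_v f 0 1 2 rfl rfl) W z)
    exact h3.trans (by rw [h1, ha, neg_zero]))
  exact ⟨z, s, hs, h1, h2⟩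

/-- The boundary of n, seen in degree −1 of the cone, is (−dn, f n). This turns the Čech relations
on overlaps into equality of sections of the homology sheaf, and it is the source of the signs
below. -/
lemma cone_rep_eq_zero {z : ((mappingCone f).X 0).sec W} {s} (h : IsRep (mappingCone f) 0 W z s)
    (n : (K.X 0).sec W) (h1 : coneFst f W z = -shApp (K.d 0 1) W n)
    (h2 : coneSnd f W z = shApp (f.f 0) W n) : s = 0 := by
  have e : z = shApp ((mappingCone f).d (-1) 0) W
      (shApp ((mappingCone.inl f).v 0 (-1) rfl) W n) := by
    refine cone_ext f ?_ ?_
    · rw [h1, ← shApp_comp, coneFst, ← shApp_comp, mappingCone.inl_v_d f 0 (-1) 1 rfl rfl]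
      simp [shApp_neg]
    · rw [h2, ← shApp_comp, coneSnd, ← shApp_comp, mappingCone.inl_v_d f 0 (-1) 1 rfl rfl]
      simp
  have : IsRep (mappingCone f) 0 W z 0 := by
    refine ⟨shApp ((mappingCone f).toCycles (-1) 0) W
      (shApp ((mappingCone.inl f).v 0 (-1) rfl) W n), ?_, ?_⟩
    · rw [e, ← shApp_comp, toCycles_i]
    · rw [← shApp_comp, toCycles_comp_homologyπ, shApp_zero]
  exact h.unique this

variable [Mono (f.f 0)]

/-- A section of the image sheaf is only locally a boundary. Here the local primitives lie in K⁰,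
since M⁻¹ = 0, and are unique, since `f` is injective in degree 0; so they glue over all of `W`. -/
lemma exists_cone_boundary (hM : IsZero (M.X (-1))) {z : ((mappingCone f).X 0).sec W}
    (h : IsRep (mappingCone f) 0 W z 0) :
    ∃ n, coneFst f W z = -shApp (K.d 0 1) W n ∧ coneSnd f W z = shApp (f.f 0) W n := by
  have loc (x) (hx : x ∈ W) : ∃ W' : Opens X, W' ≤ W ∧ x ∈ W' ∧
      ∃ n : (K.X 0).sec W', ∃ h : W' ≤ W,
        coneFst f W' (((mappingCone f).X 0).res h z) = -shApp (K.d 0 1) W' n ∧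
        coneSnd f W' (((mappingCone f).X 0).res h z) = shApp (f.f 0) W' n := by
    obtain ⟨W', hW, hx', y, hy⟩ := h.local_boundary x hx
    refine ⟨W', hW, hx', shApp ((mappingCone.fst f).1.v (-1) 0 rfl) W' y, hW, ?_, ?_⟩
    · rw [← hy]
      have h3 : coneFst f W' (shApp ((mappingCone f).d (-1) 0) W' y) =
          -shApp (K.d 0 1) W' (shApp ((mappingCone.fst f).1.v (-1) 0 rfl) W' y) :=
        congr(shApp $(mappingCone.d_fst_v f (-1) 0 1 rfl rfl) W' y)
      exact h3
    · rw [← hy]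
      have h4 := mappingCone.d_snd_v f (-1) 0 rfl
      rw [hM.eq_of_src (M.d (-1) 0) 0, comp_zero, add_zero] at h4
      exact congr(shApp $h4 W' y)
  have hinj (W') := shApp_injective (f.f 0) W'
  obtain ⟨n, hn⟩ := exists_glue (K.X 0).isSheaf W (fun W' n => ∃ h : W' ≤ W,
        coneFst f W' (((mappingCone f).X 0).res h z) = -shApp (K.d 0 1) W' n ∧
        coneSnd f W' (((mappingCone f).X 0).res h z) = shApp (f.f 0) W' n) loc
    (fun W' W'' h n hW ⟨h', h1, h2⟩ => ⟨h.trans h', by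
      have e : ((mappingCone f).X 0).res (h.trans h') z =
        ((mappingCone f).X 0).res h (((mappingCone f).X 0).res h' z) := (resP_resP _ h' h z).symm
      rw [e, (cone_res f h _).1, h1, map_neg, shApp_res, (cone_res f h _).2, h2, shApp_res]
      exact ⟨rfl, rfl⟩⟩)
    (fun W' _ n n' ⟨_, h1, h2⟩ ⟨_, h1', h2'⟩ => hinj W' (h2.symm.trans h2'))
  refine ⟨n, ?_, ?_⟩
  · refine eq_of_locally_eq (K.X 1).isSheaf _ _ fun x hx => ?_
    obtain ⟨W', hW, hx', n', h', h1, h2⟩ := loc x hx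
    refine ⟨W', hW, hx', ?_⟩
    have := hn W' hW n' ⟨h', h1, h2⟩
    rw [(cone_res f h' _).1] at h1
    refine h1.trans ?_
    rw [← this]
    change _ = (K.X 1).res hW _
    rw [map_neg, shApp_res]
  · refine eq_of_locally_eq (M.X 0).isSheaf _ _ fun x hx => ?_
    obtain ⟨W', hW, hx', n', h', h1, h2⟩ := loc x hx
    refine ⟨W', hW, hx', ?_⟩
    have := hn W' hW n' ⟨h', h1, h2⟩
    rw [(cone_res f h' _).2] at h2
    refine h2.trans ?_
    rw [← this]
    change _ = (M.X 0).res hW _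
    rw [shApp_res]

/-- The cone has the term K⁰ in degree −1, but its differential contains the monomorphism `f.f 0`,
so no homology survives there. -/
lemma cone_isGE (hK : ∀ i < 0, IsZero (K.X i)) (hM : ∀ i < 0, IsZero (M.X i)) :
    (mappingCone f).IsGE 0 := by
  rw [isGE_iff]
  intro i hi
  by_cases h : i = -1
  · subst h
    rw [exactAt_iff' _ (-2) (-1) 0 (by simp) (by simp)]
    have h2 : IsZero ((mappingCone f).X (-2)) :=
      (mappingCone.isZero_X_iff f (-2)).2 ⟨hK _ (by lia), hM _ (by lia)⟩
    rw [ShortComplex.exact_iff_mono _ (h2.eq_of_src _ _)]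
    refine Preadditive.mono_of_cancel_zero _ fun {A} (g : A ⟶ (mappingCone f).X (-1)) hg => ?_
    change g = 0
    have hg : g ≫ (mappingCone f).d (-1) 0 = 0 := hg
    refine (mappingCone.ext_to_iff f (-1) 0 rfl g 0).2 ⟨?_, (hM _ (by lia)).eq_of_tgt _ _⟩
    rw [zero_comp, ← cancel_mono (f.f 0), zero_comp, Category.assoc]
    have h3 := mappingCone.d_snd_v f (-1) 0 rfl
    rw [(hM (-1) (by lia)).eq_of_src (M.d (-1) 0) 0, comp_zero, add_zero] at h3
    rw [← h3, reassoc_of% hg, zero_comp]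
  · rw [exactAt_iff_isZero_homology]
    refine ShortComplex.isZero_homology_of_isZero_X₂ _ ?_
    exact (mappingCone.isZero_X_iff f i).2 ⟨hK _ (by lia), hM _ (by lia)⟩

end Cone

section
universe v w w'
variable {C : Type w} [Category.{v} C] [Abelian C] [HasDerivedCategory.{w'} C]

/-- This is Ext¹(Z, G) = 0 for an injective object. -/
lemma shift_single_injective_hom_eq_zero {Z G : C} [Injective G]
    (x : (DerivedCategory.singleFunctor C 0).obj Z ⟶
      (Q.obj ((HomologicalComplex.single C (ComplexShape.up ℤ) 0).obj G))⟦(1 : ℤ)⟧) : x = 0 := by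
  rw [← cancel_mono ((singleQIso G).inv⟦(1 : ℤ)⟧'),
    ← cancel_mono (((DerivedCategory.singleFunctors C).shiftIso (1 : ℤ) (-1) 0
    (by lia)).hom.app G), zero_comp, zero_comp, ← cancel_epi (singleQIso Z).inv, comp_zero]
  have := ((HomologicalComplex.single C (ComplexShape.up ℤ) 0).obj Z)
  let K := (CochainComplex.singleFunctor C 0).obj Z
  have := K.isStrictlyGE_of_ge 0 0 (by lia)
  exact to_singleFunctor_obj_eq_zero_of_injective (K := K) (n := 0) (i := -1) _ (by lia)
end

end FilteredDeRham

end

section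

namespace FilteredDeRham
open DerivedCategory Pretriangulated HomologicalComplex CochainComplex

/-! ### Lifting Čech hypercocycles along a map that is surjective on hypercohomology. -/

section
universe v w w'
variable {C : Type w} [Category.{v} C] [Abelian C] [HasDerivedCategory.{w'} C]

/-- Lifting classes in the hypercohomology of mapping cones. -/
lemma exists_mappingCone_lift {K L M N : CochainComplex C ℤ} (f : K ⟶ M) (f' : L ⟶ N)
    (π : K ⟶ L) (g : M ⟶ N) (comm : f ≫ g = π ≫ f') {A : DerivedCategory C}
    (h₀ : ∀ x : A ⟶ (Q.obj M)⟦(1 : ℤ)⟧, x = 0)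
    (h : ∀ x : A ⟶ (Q.obj L)⟦(1 : ℤ)⟧, ∃ y, y ≫ (Q.map π)⟦(1 : ℤ)⟧' = x)
    (t : A ⟶ Q.obj (mappingCone f')) :
    ∃ (t' : A ⟶ Q.obj (mappingCone f)) (y : A ⟶ Q.obj N),
      t' ≫ Q.map (mappingCone.map f f' π g comm) - t = y ≫ Q.map (mappingCone.inr f') := by
  let TK := DerivedCategory.Q.mapTriangle.obj (mappingCone.triangle f)
  let TL := DerivedCategory.Q.mapTriangle.obj (mappingCone.triangle f')
  let mK : Q.obj (mappingCone f) ⟶ (Q.obj K)⟦(1 : ℤ)⟧ := TK.mor₃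
  let mL : Q.obj (mappingCone f') ⟶ (Q.obj L)⟦(1 : ℤ)⟧ := TL.mor₃
  -- The degree-1 class of `L` underlying `t` lifts to `K` by hypothesis. The lift dies in `M` by
  -- `h₀`, hence comes from the cone of `f`; what remains of the difference comes from `N`.
  obtain ⟨b, hb⟩ := h (t ≫ mL)
  obtain ⟨t', ht'⟩ : ∃ t' : A ⟶ Q.obj (mappingCone f), b = t' ≫ mK :=
    Triangle.coyoneda_exact₁ TK (mappingCone_triangle_distinguished f) b (h₀ _)
  have nat : mK ≫ (Q.map π)⟦(1 : ℤ)⟧' = Q.map (mappingCone.map f f' π g comm) ≫ mL :=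
    (DerivedCategory.Q.mapTriangle.map (mappingCone.triangleMap f f' π g comm)).comm₃
  have e : (t' ≫ Q.map (mappingCone.map f f' π g comm) - t) ≫ mL = 0 := by
    rw [Preadditive.sub_comp, ← hb, ht', Category.assoc, Category.assoc, nat, sub_self]
  obtain ⟨y, hy⟩ := Triangle.coyoneda_exact₃ TL (mappingCone_triangle_distinguished f') _ e
  exact ⟨t', y, hy⟩

end

lemma AbSh.exists_gluing {X : TopCat.{u}} (F : AbSh X) {ι : Type u} (U : ι → Opens X)
    (hU : ∀ x, ∃ i, x ∈ U i) (s : ∀ i, F.sec (U i))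
    (hs : ∀ i j, F.res inf_le_left (s i) = F.res (W := U i ⊓ U j) inf_le_right (s j)) :
    ∃ s₀ : F.sec ⊤, ∀ i, F.res le_top s₀ = s i := by
  obtain ⟨s₀, hs₀, -⟩ := TopCat.Sheaf.existsUnique_gluing' (⟨_, F.isSheaf⟩) U ⊤
    (fun i => homOfLE le_top) (fun x _ => Opens.mem_iSup.2 (hU x)) s hs
  exact ⟨s₀, hs₀⟩

section Hyper

variable {X : TopCat.{u}} {K L : CochainComplex (AbSh X) ℤ} (π : K ⟶ L)

universe w'
variable [HasDerivedCategory.{w'} (AbSh X)]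

/-- Horizontal sections lift along a map which is surjective on `ℍ⁰`. -/
lemma exists_cycle_lift (hK : ∀ i < 0, IsZero (K.X i)) (hL : ∀ i < 0, IsZero (L.X i))
    (h : ∀ x : (DerivedCategory.singleFunctor (AbSh X) 0).obj (intSheaf X) ⟶ Q.obj L,
      ∃ y, y ≫ Q.map π = x)
    (σ : (L.X 0).sec ⊤) (hσ : shApp (L.d 0 1) ⊤ σ = 0) :
    ∃ β : (K.X 0).sec ⊤, shApp (K.d 0 1) ⊤ β = 0 ∧ shApp (π.f 0) ⊤ β = σ := by
  -- As `L` and `K` start in degree 0, closed sections are the same as sections of H⁰, and these are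
  -- induced by maps from ℤ in the derived category.
  obtain ⟨s, hs⟩ := IsRep.exists_of_d_eq_zero σ hσ
  obtain ⟨τ, hτ⟩ := exists_intSheaf_hom s
  have : L.IsStrictlyGE 0 := (L.isStrictlyGE_iff 0).2 hL
  obtain ⟨x, hx⟩ := exists_homologyHom_eq τ
  obtain ⟨y, hy⟩ := h x
  obtain ⟨β, hβ⟩ := IsRep.exists_of_isZero (hK (0 - 1) (by lia))
    (shApp (homologyHom y) ⊤ (intOne X))
  refine ⟨β, hβ.d_eq_zero 1, ?_⟩
  refine IsRep.eq_of_isZero (hL (0 - 1) (by lia)) (hβ.map π) ?_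
  rwa [← shApp_comp, ← homologyHom_comp, hy, hx, hτ]

-- Here the injective targets of the two cones are parameters. The pair (ω, q) is encoded as a
-- global section of H⁰ of the cone of `f'`, its class is lifted to the cone of `f`, and the lift is
-- decoded on a finer cover indexed by points.
set_option maxHeartbeats 1000000 in
lemma exists_cech_lift_aux {MK ML : CochainComplex (AbSh X) ℤ} (f : K ⟶ MK) (f' : L ⟶ ML) [Mono (f.f 0)]
    [Mono (f'.f 0)] (g : MK ⟶ ML) (comm : f ≫ g = π ≫ f') [Injective (ML.X 0)]
    (hMK : ∀ i, i ≠ 0 → IsZero (MK.X i)) (hML : ∀ i, i ≠ 0 → IsZero (ML.X i))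
    (h₀ : ∀ x : (DerivedCategory.singleFunctor (AbSh X) 0).obj (intSheaf X) ⟶
      (Q.obj MK)⟦(1 : ℤ)⟧, x = 0)
    (hK : ∀ i < 0, IsZero (K.X i)) (hL : ∀ i < 0, IsZero (L.X i))
    (h : ∀ x : (DerivedCategory.singleFunctor (AbSh X) 0).obj (intSheaf X) ⟶ (Q.obj L)⟦(1 : ℤ)⟧,
      ∃ y, y ≫ (Q.map π)⟦(1 : ℤ)⟧' = x) {ι : Type u}
    (U : ι → Opens X) (hU : ∀ x, ∃ i, x ∈ U i) (q : ∀ i j, (L.X 0).sec (U i ⊓ U j))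
    (hq : ∀ i j k, (L.X 0).res (le_inf (inf_le_left.trans inf_le_left)
          (inf_le_left.trans inf_le_right)) (q i j) +
        (L.X 0).res (le_inf (inf_le_left.trans inf_le_right) inf_le_right) (q j k) =
      (L.X 0).res (W := U i ⊓ U j ⊓ U k) (le_inf (inf_le_left.trans inf_le_left) inf_le_right)
        (q i k))
    (ω : ∀ i, (L.X 1).sec (U i)) (hω : ∀ i, shApp (L.d 1 2) (U i) (ω i) = 0)
    (hωq : ∀ i j, (L.X 1).res inf_le_left (ω i) - (L.X 1).res inf_le_right (ω j) =
      shApp (L.d 0 1) (U i ⊓ U j) (q i j)) :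
    ∃ (W : X → Opens X) (i : X → ι) (_ : ∀ x, x ∈ W x) (hW : ∀ x, W x ≤ U (i x))
      (k : ∀ x, (K.X 1).sec (W x)) (n : ∀ x y, (K.X 0).sec (W x ⊓ W y))
      (t : ∀ x, (L.X 0).sec (W x)),
      (∀ x, shApp (K.d 1 2) (W x) (k x) = 0) ∧
      (∀ x y z, (K.X 0).res (le_inf (inf_le_left.trans inf_le_left)
          (inf_le_left.trans inf_le_right)) (n x y) +
        (K.X 0).res (le_inf (inf_le_left.trans inf_le_right) inf_le_right) (n y z) =
        (K.X 0).res (W := W x ⊓ W y ⊓ W z) (le_inf (inf_le_left.trans inf_le_left) inf_le_right)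
          (n x z)) ∧
      (∀ x y, (K.X 1).res inf_le_left (k x) - (K.X 1).res inf_le_right (k y) =
        shApp (K.d 0 1) (W x ⊓ W y) (n x y)) ∧
      (∀ x, shApp (π.f 1) (W x) (k x) = (L.X 1).res (hW x) (ω (i x)) +
        shApp (L.d 0 1) (W x) (t x)) ∧
      ∀ x y, shApp (π.f 0) (W x ⊓ W y) (n x y) =
        (L.X 0).res (inf_le_inf (hW x) (hW y)) (q (i x) (i y)) +
          ((L.X 0).res inf_le_left (t x) - (L.X 0).res inf_le_right (t y)) := by
  -- In the injective sheaf `ML⁰` the cocycle `q` is the coboundary of some `γ`, and the cone cycle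
  -- over `U i` is (−ω i, γ i). The sign matches the boundary formula (−dn, f n).
  obtain ⟨γ, hγ⟩ := exists_trivialization (f'.f 0) U hU q hq
  choose z s hzs hz₁ hz₂ using fun i => exists_cone_rep f' (W := U i) (hML 1 (by simp)) (-ω i) (γ i)
    (by rw [map_neg, hω, neg_zero])
  have hs (i j) : AbSh.res _ inf_le_left (s i) =
      AbSh.res ((mappingCone f').homology 0) (W := U i ⊓ U j) inf_le_right (s j) := by
    rw [← sub_eq_zero]
    refine cone_rep_eq_zero f' (((hzs i).res inf_le_left).sub ((hzs j).res inf_le_right))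
      (q i j) ?_ ?_
    · rw [map_sub, (cone_res f' _ _).1, (cone_res f' _ _).1, hz₁, hz₁, map_neg, map_neg, ← hωq]
      abel
    · rw [map_sub, (cone_res f' _ _).2, (cone_res f' _ _).2, hz₂, hz₂, ← hγ]
  obtain ⟨s₀, hs₀⟩ := AbSh.exists_gluing ((mappingCone f').homology 0) U hU s hs
  obtain ⟨τ, hτ⟩ := exists_intSheaf_hom s₀
  have : (mappingCone f).IsGE 0 := cone_isGE f hK fun i hi => hMK i (by lia)
  have : (mappingCone f').IsGE 0 := cone_isGE f' hL fun i hi => hML i (by lia)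
  obtain ⟨tL, htL⟩ := exists_homologyHom_eq τ
  obtain ⟨tK, y, hy⟩ := exists_mappingCone_lift f f' π g comm
    h₀ h tL
  let Φ := mappingCone.map f f' π g comm
  -- The lifted class agrees with the given one only up to a class from `ML`. That class is
  -- represented by one global section of `ML⁰`, so it cancels in all differences over overlaps.
  obtain ⟨y₀, hy₀⟩ := IsRep.exists_of_isZero (hML (0 - 1) (by lia))
    (shApp (homologyHom y) ⊤ (intOne X))
  let b₀ : ((mappingCone f).homology 0).sec ⊤ := shApp (homologyHom tK) ⊤ (intOne X)
  have hb₀ : shApp (homologyMap Φ 0) ⊤ b₀ - s₀ =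
      shApp (homologyMap (mappingCone.inr f') 0) ⊤ (shApp (homologyHom y) ⊤ (intOne X)) := by
    have := congr(shApp (homologyHom $hy) ⊤ (intOne X))
    rwa [homologyHom_sub, homologyHom_comp, homologyHom_comp, shApp_sub, shApp_comp, shApp_comp,
      htL, hτ] at this
  have loc (x : X) : ∃ (W : Opens X) (_ : x ∈ W) (i : ι) (hW : W ≤ U i) (ζ : _),
      IsRep (mappingCone f) 0 W ζ (AbSh.res _ le_top b₀) := by
    obtain ⟨i, hi⟩ := hU x
    obtain ⟨W, h, hx, ζ, hζ⟩ := IsRep.exists_local b₀ x trivial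
    refine ⟨W ⊓ U i, ⟨hx, hi⟩, i, inf_le_right, AbSh.res _ inf_le_left ζ, ?_⟩
    have := hζ.res (inf_le_left : W ⊓ U i ≤ W)
    rwa [resP_resP] at this
  choose W hxW i hW ζ hζ using loc
  -- Two local representatives of the same global class differ by a boundary. Its primitive `n x y`
  -- is the new Čech cochain.
  have hn (x y : X) := exists_cone_boundary f (hMK (-1) (by simp))
    (z := AbSh.res _ inf_le_left (ζ x) - AbSh.res _ (W := W x ⊓ W y) inf_le_right (ζ y)) (by
      have := ((hζ x).res (inf_le_left : W x ⊓ W y ≤ _)).sub ((hζ y).res inf_le_right)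
      rwa [resP_resP, resP_resP, sub_self] at this)
  choose n hn₁ hn₂ using hn
  -- The images of the new representatives differ from the old ones, and from `y₀`, by boundaries;
  -- the primitives `t` form the Čech coboundary relating the two hypercocycles.
  have ht (x : X) := exists_cone_boundary f' (hML (-1) (by simp))
    (z := shApp (Φ.f 0) (W x) (ζ x) - AbSh.res _ (hW x) (z (i x)) -
      shApp ((mappingCone.inr f').f 0) (W x) (AbSh.res _ le_top y₀)) (by
      have := (((hζ x).map Φ).sub ((hzs (i x)).res (hW x))).sub
        ((hy₀.res (le_top : W x ≤ _)).map (mappingCone.inr f'))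
      rwa [← hs₀, resP_resP, ← shApp_res (homologyMap Φ 0),
        ← shApp_res (homologyMap (mappingCone.inr f') 0), ← map_sub, hb₀, sub_self] at this)
  choose t ht₁ ht₂ using ht
  refine ⟨W, i, hxW, hW, fun x => -coneFst f (W x) (ζ x), n, t, fun x => ?_, fun x y z => ?_,
    fun x y => ?_, fun x => ?_, fun x y => ?_⟩
  · rw [map_neg, cone_d_fst f (hζ x), neg_zero]
  · apply shApp_injective (f.f 0)
    rw [map_add, ← shApp_res, ← shApp_res, ← shApp_res, ← hn₂, ← hn₂, ← hn₂, ← (cone_res f _ _).2,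
      ← (cone_res f _ _).2, ← (cone_res f _ _).2, ← map_add]
    congr 1
    simp only [map_sub, resP_resP]
    abel
  · rw [map_neg, map_neg, ← (cone_res f _ _).1, ← (cone_res f _ _).1, ← neg_eq_iff_eq_neg.2 (hn₁ x y),
      map_sub]
    abel
  · have := ht₁ x
    rw [map_sub, map_sub, (cone_map f f' π g comm (ζ x)).1, (cone_res f' (hW x) _).1, hz₁,
      (cone_inr f' _).1, sub_zero, map_neg] at this
    rw [map_neg, ← neg_eq_iff_eq_neg.2 this]
    abel
  · apply shApp_injective (f'.f 0)
    have e (x : X) : shApp (f'.f 0) (W x) (t x) = shApp (g.f 0) (W x) (coneSnd f (W x) (ζ x)) -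
        AbSh.res _ (hW x) (γ (i x)) - AbSh.res _ le_top y₀ := by
      rw [← ht₂, map_sub, map_sub, (cone_map f f' π g comm (ζ x)).2, (cone_res f' (hW x) _).2, hz₂,
        (cone_inr f' _).2]
    have e2 : shApp (f'.f 0) (W x ⊓ W y) (shApp (π.f 0) (W x ⊓ W y) (n x y)) =
        shApp (g.f 0) (W x ⊓ W y) (shApp (f.f 0) (W x ⊓ W y) (n x y)) :=
      congr(shApp (HomologicalComplex.Hom.f $comm 0) _ (n x y)).symm
    rw [e2, map_add, ← shApp_res, ← hγ, map_sub, map_sub, ← shApp_res, ← shApp_res, e, e, ← hn₂, map_sub,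
      map_sub, (cone_res f _ _).2, (cone_res f _ _).2, ← shApp_res, ← shApp_res]
    simp only [map_sub, resP_resP]
    abel

/-- Čech–hypercohomology classes in degree `1` lift along a map which is surjective on `ℍ¹`. -/
lemma exists_cech_lift (hK : ∀ i < 0, IsZero (K.X i)) (hL : ∀ i < 0, IsZero (L.X i))
    (h : ∀ x : (DerivedCategory.singleFunctor (AbSh X) 0).obj (intSheaf X) ⟶ (Q.obj L)⟦(1 : ℤ)⟧,
      ∃ y, y ≫ (Q.map π)⟦(1 : ℤ)⟧' = x) {ι : Type u}
    (U : ι → Opens X) (hU : ∀ x, ∃ i, x ∈ U i) (q : ∀ i j, (L.X 0).sec (U i ⊓ U j))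
    (hq : ∀ i j k, (L.X 0).res (le_inf (inf_le_left.trans inf_le_left)
          (inf_le_left.trans inf_le_right)) (q i j) +
        (L.X 0).res (le_inf (inf_le_left.trans inf_le_right) inf_le_right) (q j k) =
      (L.X 0).res (W := U i ⊓ U j ⊓ U k) (le_inf (inf_le_left.trans inf_le_left) inf_le_right)
        (q i k))
    (ω : ∀ i, (L.X 1).sec (U i)) (hω : ∀ i, shApp (L.d 1 2) (U i) (ω i) = 0)
    (hωq : ∀ i j, (L.X 1).res inf_le_left (ω i) - (L.X 1).res inf_le_right (ω j) =
      shApp (L.d 0 1) (U i ⊓ U j) (q i j)) :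
    ∃ (W : X → Opens X) (i : X → ι) (_ : ∀ x, x ∈ W x) (hW : ∀ x, W x ≤ U (i x))
      (k : ∀ x, (K.X 1).sec (W x)) (n : ∀ x y, (K.X 0).sec (W x ⊓ W y))
      (t : ∀ x, (L.X 0).sec (W x)),
      (∀ x, shApp (K.d 1 2) (W x) (k x) = 0) ∧
      (∀ x y z, (K.X 0).res (le_inf (inf_le_left.trans inf_le_left)
          (inf_le_left.trans inf_le_right)) (n x y) +
        (K.X 0).res (le_inf (inf_le_left.trans inf_le_right) inf_le_right) (n y z) =
        (K.X 0).res (W := W x ⊓ W y ⊓ W z) (le_inf (inf_le_left.trans inf_le_left) inf_le_right)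
          (n x z)) ∧
      (∀ x y, (K.X 1).res inf_le_left (k x) - (K.X 1).res inf_le_right (k y) =
        shApp (K.d 0 1) (W x ⊓ W y) (n x y)) ∧
      (∀ x, shApp (π.f 1) (W x) (k x) = (L.X 1).res (hW x) (ω (i x)) +
        shApp (L.d 0 1) (W x) (t x)) ∧
      ∀ x y, shApp (π.f 0) (W x ⊓ W y) (n x y) =
        (L.X 0).res (inf_le_inf (hW x) (hW y)) (q (i x) (i y)) +
          ((L.X 0).res inf_le_left (t x) - (L.X 0).res inf_le_right (t y)) := by
  -- An embedding of K⁰ in an injective sheaf in degree 0 is a chain map because K⁻¹ = 0.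
  -- Injectivity gives both the vanishing of the degree-1 classes of `MK` and, below, a map `g₀`
  -- compatible with π.
  let MK := (HomologicalComplex.single (AbSh X) (ComplexShape.up ℤ) 0).obj (Injective.under (K.X 0))
  let ML := (HomologicalComplex.single (AbSh X) (ComplexShape.up ℤ) 0).obj (Injective.under (L.X 0))
  let f : K ⟶ MK := mkHomToSingle (Injective.ι (K.X 0)) fun i hi =>
    (hK i (by have : i + 1 = 0 := hi; lia)).eq_of_src _ _
  let f' : L ⟶ ML := mkHomToSingle (Injective.ι (L.X 0)) fun i hi =>
    (hL i (by have : i + 1 = 0 := hi; lia)).eq_of_src _ _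
  have hf : Mono (f.f 0) := by
    rw [show f.f 0 = _ from mkHomToSingle_f _ _]; infer_instance
  have hf' : Mono (f'.f 0) := by
    rw [show f'.f 0 = _ from mkHomToSingle_f _ _]; infer_instance
  let g₀ : Injective.under (K.X 0) ⟶ Injective.under (L.X 0) :=
    Injective.factorThru (π.f 0 ≫ Injective.ι (L.X 0)) (Injective.ι (K.X 0))
  let g : MK ⟶ ML := (HomologicalComplex.single (AbSh X) (ComplexShape.up ℤ) 0).map g₀
  have comm : f ≫ g = π ≫ f' := by
    apply to_single_hom_ext
    rw [comp_f, comp_f, show f.f 0 = _ from mkHomToSingle_f _ _,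
      show f'.f 0 = _ from mkHomToSingle_f _ _, Category.assoc]
    simp only [g, single_map_f_self, Iso.inv_hom_id_assoc]
    rw [← Category.assoc, Injective.comp_factorThru, Category.assoc]
  have hMK (i : ℤ) (hi : i ≠ 0) : IsZero (MK.X i) := isZero_single_obj_X _ _ _ _ hi
  have hML (i : ℤ) (hi : i ≠ 0) : IsZero (ML.X i) := isZero_single_obj_X _ _ _ _ hi
  have : Injective (ML.X 0) := Injective.of_iso (singleObjXSelf (ComplexShape.up ℤ) 0
    (Injective.under (L.X 0))).symm inferInstance
  exact exists_cech_lift_aux π f f' g comm hMK hML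
    (fun x => shift_single_injective_hom_eq_zero x) hK hL h U hU q hq ω hω hωq

end Hyper

end FilteredDeRham

end

section

namespace FilteredDeRham
namespace ThickenedPair
open DerivedCategory Pretriangulated HomologicalComplex CochainComplex

variable {T : ThickenedPair.{u}} {E : DeRhamBundle T.g T.D}

/-! ### Sections of the de Rham complex -/

section DRSections

/-- The terms of the complex of sheaves. -/
def DRIso (F : HodgeFiltration E) (p : ℤ) (n : ℕ) (i : ℤ) (h : (n : ℤ) = i) : (DR F p).X i ≅
    (presheafToSheaf (Opens.grothendieckTopology T.X') AddCommGrpCat.{u}).obj (formPresheaf F p n) :=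
  extendXIso (((presheafToSheaf (Opens.grothendieckTopology T.X')
      AddCommGrpCat.{u}).mapHomologicalComplex (ComplexShape.up ℕ)).obj (presheafComplex F p))
      ComplexShape.embeddingUpNat (i := n) h

lemma DR_d_eq (F : HodgeFiltration E) (p : ℤ) (n : ℕ) (i j : ℤ) (h : (n : ℤ) = i)
    (h' : ((n + 1 : ℕ) : ℤ) = j) : (DR F p).d i j = (DRIso F p n i h).hom ≫
      (presheafToSheaf (Opens.grothendieckTopology T.X') AddCommGrpCat.{u}).map (formD F p n) ≫
      (DRIso F p (n + 1) j h').inv :=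
  (extend_d_eq (((presheafToSheaf (Opens.grothendieckTopology T.X')
      AddCommGrpCat.{u}).mapHomologicalComplex (ComplexShape.up ℕ)).obj (presheafComplex F p))
      ComplexShape.embeddingUpNat (i := n) (j := n + 1) h h').trans
    (congrArg (fun x => (DRIso F p n i h).hom ≫
      (presheafToSheaf (Opens.grothendieckTopology T.X') AddCommGrpCat.{u}).map x ≫
      (DRIso F p (n + 1) j h').inv) (CochainComplex.of_d _ _ _))

lemma DRIncl_f_eq (F : HodgeFiltration E) {p q : ℤ} (hq : p ≤ q) (n : ℕ) (i : ℤ)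
    (h : (n : ℤ) = i) : (DRIncl F hq).f i = (DRIso F q n i h).hom ≫
      (presheafToSheaf (Opens.grothendieckTopology T.X') AddCommGrpCat.{u}).map (formIncl F hq n) ≫
      (DRIso F p n i h).inv :=
  extendMap_f (((presheafToSheaf (Opens.grothendieckTopology T.X')
    AddCommGrpCat.{u}).mapHomologicalComplex (ComplexShape.up ℕ)).map (presheafIncl F hq))
    ComplexShape.embeddingUpNat (i := n) h

lemma shApp_presheafToSheaf {P P' : TopCat.Presheaf AddCommGrpCat.{u} T.X'.carrier} (f : P ⟶ P')
    (U : T.X'.Opens) (s : P.obj (op U)) :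
    shApp ((presheafToSheaf (Opens.grothendieckTopology T.X') AddCommGrpCat.{u}).map f) U
      (((toSheafify (Opens.grothendieckTopology T.X') P).app (op U)).hom s) =
    ((toSheafify (Opens.grothendieckTopology T.X') P').app (op U)).hom ((f.app (op U)).hom s) :=
  congr((NatTrans.app $(toSheafify_naturality (Opens.grothendieckTopology T.X') f) (op U)).hom
    s).symm

/-- A form as a section of the complex of sheaves. -/
def toDR (F : HodgeFiltration E) (p : ℤ) (n : ℕ) (i : ℤ) (h : (n : ℤ) = i) (U : T.X'.Opens) :
    FormSec F p n U →+ AbSh.sec ((DR F p).X i) U :=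
  (shApp (DRIso F p n i h).inv U).comp
    ((toSheafify (Opens.grothendieckTopology T.X') (formPresheaf F p n)).app (op U)).hom

variable (F : HodgeFiltration E) {p : ℤ} {n : ℕ} {i : ℤ} (h : (n : ℤ) = i) {U W : T.X'.Opens}

lemma toDR_res (hW : W ≤ U) (ω : FormSec F p n U) :
    AbSh.res ((DR F p).X i) hW (toDR F p n i h U ω) = toDR F p n i h W (FormSec.res F p n hW ω) :=
  resP_app (F := formPresheaf F p n)
    (toSheafify (Opens.grothendieckTopology T.X') (formPresheaf F p n) ≫ (DRIso F p n i h).inv.hom)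
    hW ω

lemma toDR_d {j : ℤ} (h' : ((n + 1 : ℕ) : ℤ) = j) (ω : FormSec F p n U) :
    shApp ((DR F p).d i j) U (toDR F p n i h U ω) = toDR F p (n + 1) j h' U (FormSec.d F p n U ω) := by
  rw [DR_d_eq F p n i j h h', shApp_comp, shApp_comp]
  refine congrArg (shApp (DRIso F p (n + 1) j h').inv U) ?_
  refine Eq.trans (congrArg _ ?_) (shApp_presheafToSheaf (formD F p n) U ω)
  exact congr(shApp $((DRIso F p n i h).inv_hom_id) U _)

lemma toDR_incl {q : ℤ} (hq : p ≤ q) (ω : FormSec F q n U) :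
    shApp ((DRIncl F hq).f i) U (toDR F q n i h U ω) =
      toDR F p n i h U (FormSec.incl F n hq U ω) := by
  rw [DRIncl_f_eq F hq n i h, shApp_comp, shApp_comp]
  refine congrArg (shApp (DRIso F p n i h).inv U) ?_
  refine Eq.trans (congrArg _ ?_) (shApp_presheafToSheaf (formIncl F hq n) U ω)
  exact congr(shApp $((DRIso F q n i h).inv_hom_id) U _)

lemma exists_local_toDR (s : AbSh.sec ((DR F p).X i) U) (x : T.X') (hx : x ∈ U) :
    ∃ (W : T.X'.Opens) (hW : W ≤ U), x ∈ W ∧ ∃ ω, toDR F p n i h W ω = AbSh.res _ hW s := by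
  let a := DRIso F p n i h
  obtain ⟨W, hW, hx', ω, hω⟩ := exists_local_presheaf_lift (X := T.X'.carrier)
    (formPresheaf F p n) (shApp a.hom U s) x hx
  refine ⟨W, hW, hx', ω, ?_⟩
  have e : shApp a.inv W (shApp a.hom W (AbSh.res _ hW s)) = AbSh.res _ hW s := by
    rw [← shApp_comp, Iso.hom_inv_id, shApp_id]
  refine Eq.trans ?_ e
  refine congrArg (shApp a.inv W) (hω.trans ?_)
  exact shApp_res _ _ _

lemma local_eq_zero_of_toDR_eq_zero (ω : FormSec F p n U) (hω : toDR F p n i h U ω = 0)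
    (x : T.X') (hx : x ∈ U) : ∃ (W : T.X'.Opens) (hW : W ≤ U), x ∈ W ∧
      FormSec.res F p n hW ω = 0 := by
  let a := DRIso F p n i h
  refine local_eq_zero (X := T.X'.carrier) (formPresheaf F p n) ω ?_ x hx
  apply shApp_injective a.inv U
  exact hω.trans (map_zero _).symm

lemma isZero_DR_neg (p i : ℤ) (hi : i < 0) : IsZero ((DR F p).X i) :=
  isZero_extend_X _ _ _ fun k hk => by
    have : (k : ℤ) = i := hk
    lia

lemma FormSec.incl_val {q : ℤ} (hq : p ≤ q) (ω : FormSec F q n U) (W) :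
    (FormSec.incl F n hq U ω).1 W = ω.1 W := rfl

lemma formIncl_comp {p q r : ℤ} (hq : p ≤ q) (hr : q ≤ r) (n : ℕ) :
    formIncl F hr n ≫ formIncl F hq n = formIncl F (hq.trans hr) n :=
  NatTrans.ext (funext fun U => AddCommGrpCat.hom_ext (AddMonoidHom.ext
    fun (ω : FormSec F r n U.unop) => Subtype.ext (funext fun W =>
      (FormSec.incl_val F hq (FormSec.incl F n hr U.unop ω) W).trans
        ((FormSec.incl_val F hr ω W).trans (FormSec.incl_val F (hq.trans hr) ω W).symm))))

lemma formIncl_refl (p : ℤ) (n : ℕ) : formIncl F (le_refl p) n = 𝟙 (formPresheaf F p n) :=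
  NatTrans.ext (funext fun U => AddCommGrpCat.hom_ext (AddMonoidHom.ext
    fun (ω : FormSec F p n U.unop) => Subtype.ext (funext fun W =>
      FormSec.incl_val F (le_refl p) ω W)))

lemma presheafIncl_comp {p q r : ℤ} (hq : p ≤ q) (hr : q ≤ r) :
    presheafIncl F hr ≫ presheafIncl F hq = presheafIncl F (hq.trans hr) :=
  HomologicalComplex.hom_ext _ _ fun n => formIncl_comp F hq hr n

lemma presheafIncl_refl (p : ℤ) : presheafIncl F (le_refl p) = 𝟙 (presheafComplex F p) :=
  HomologicalComplex.hom_ext _ _ fun n => formIncl_refl F p n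

lemma DRIncl_comp {p q r : ℤ} (hq : p ≤ q) (hr : q ≤ r) :
    DRIncl F hr ≫ DRIncl F hq = DRIncl F (hq.trans hr) :=
  (extendMap_comp _ _ _).symm.trans
    (congrArg (fun f => extendMap f ComplexShape.embeddingUpNat)
      ((Functor.map_comp _ _ _).symm.trans (congrArg _ (presheafIncl_comp F hq hr))))

lemma DRIncl_refl (p : ℤ) : DRIncl F (le_refl p) = 𝟙 (DR F p) :=
  (congrArg (fun f => extendMap f ComplexShape.embeddingUpNat)
    ((congrArg _ (presheafIncl_refl F p)).trans (CategoryTheory.Functor.map_id _ _))).trans (extendMap_id _ _)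

lemma exists_fil_eq_bot : ∃ N : ℤ, ∀ p, N ≤ p → ∀ U, Coeff.fil F p U = ⊥ := by
  obtain ⟨a, b, hab⟩ := F.finite
  -- An endomorphism of degree at least b − a sends V = Fil^a into Fil^b = 0.
  refine ⟨b - a, fun p hp U => ?_⟩
  rw [eq_bot_iff, Coeff.fil, AddSubgroup.closure_le]
  rintro _ ⟨g, hg, r, rfl⟩
  have : g = 0 := by
    ext W h v
    have h1 := hg a W h v (by rw [(hab W).1]; trivial)
    have h2 := F.antitone W (show b ≤ a + p by lia) h1
    rw [(hab W).2] at h2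
    exact h2
  rw [this]
  exact TensorProduct.zero_tmul _ _

lemma valuedIn_bot {L M : Type u} [AddCommGroup M] : ∀ {n : ℕ} {ω : Cochain L M n},
    ValuedIn ((⊥ : AddSubgroup M) : Set M) n ω → ω = 0
  | 0, _, h => h
  | _ + 1, _, h => funext fun x => valuedIn_bot (h x)

/-- The term in degree i involves `Fil^(p-i)` of End(V), so the bound on p moves with i. This is
what stops the descent in `map_DRIncl_succ_injective`. -/
lemma isZero_DR : ∃ N : ℤ, ∀ p i, N + i ≤ p → IsZero ((DR F p).X i) := by
  obtain ⟨N, hN⟩ := exists_fil_eq_bot F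
  refine ⟨N, fun p i hp => ?_⟩
  by_cases hi : i < 0
  · exact isZero_DR_neg F p i hi
  · obtain ⟨n, hn⟩ := Int.eq_ofNat_of_zero_le (not_lt.1 hi)
    rw [IsZero.iff_id_eq_zero]
    refine AbSh.hom_ext fun U s => ?_
    rw [shApp_id, shApp_zero]
    refine eq_of_locally_eq (AbSh.isSheaf _) _ _ fun x hx => ?_
    obtain ⟨W, hW, hx', ω, hω⟩ := exists_local_toDR F hn.symm s x hx
    refine ⟨W, hW, hx', ?_⟩
    have : ω = 0 := Subtype.ext (funext fun W' => valuedIn_bot (by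
      have := ω.2.2.2 W'
      rwa [hN _ (by lia)] at this))
    exact hω.symm.trans (by rw [this, map_zero]; exact (map_zero (AbSh.res _ hW)).symm)

end DRSections

attribute [local instance] HasDerivedCategory.standard

/-! ### Degeneration -/

section Degeneration

variable {K L M : CochainComplex T.Sh ℤ} {n : ℤ}

lemma HH.map_eq (φ : K ⟶ L) (x : HH K n) :
    HH.map φ x = (x : _ ⟶ (Q.obj K)⟦n⟧) ≫ (DerivedCategory.Q.map φ)⟦n⟧' :=
  ShiftedHom.comp_mk₀ _ _ _ _

lemma HH.map_sub (φ : K ⟶ L) (x y : HH K n) : HH.map φ (x - y) = HH.map φ x - HH.map φ y := by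
  rw [HH.map_eq, HH.map_eq, HH.map_eq]
  exact Preadditive.sub_comp ..

lemma HH.map_zero (φ : K ⟶ L) : HH.map φ (0 : HH K n) = 0 := by
  have := HH.map_sub φ (0 : HH K n) 0
  rwa [sub_self, sub_self] at this

lemma HH.map_comp (φ : K ⟶ L) (ψ : L ⟶ M) (x : HH K n) :
    HH.map (φ ≫ ψ) x = HH.map ψ (HH.map φ x) := by
  rw [HH.map_eq, HH.map_eq, HH.map_eq, Functor.map_comp, Functor.map_comp]
  exact (Category.assoc _ _ _).symm

lemma HH.map_id (x : HH K n) : HH.map (𝟙 K) x = x := by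
  rw [HH.map_eq]
  refine (congrArg (fun f => (x : _ ⟶ (Q.obj K)⟦n⟧) ≫ f⟦n⟧') (CategoryTheory.Functor.map_id Q K)).trans ?_
  refine (congrArg (fun f => (x : _ ⟶ (Q.obj K)⟦n⟧) ≫ f) (CategoryTheory.Functor.map_id _ _)).trans ?_
  exact Category.comp_id _

variable {C : ShortComplex (CochainComplex T.Sh ℤ)} (hC : C.ShortExact)
include hC

lemma HH.exact₁ (x : HH C.X₁ (n + 1)) (hx : HH.map C.f x = 0) :
    ∃ y, HH.connecting hC (n := n) y = x := by
  rw [HH.map_eq] at hx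
  exact exact_of_distTriang₁ (triangleOfSES_distinguished hC) x hx

lemma HH.exact₂ (x : HH C.X₂ n) (hx : HH.map C.g x = 0) : ∃ y, HH.map C.f y = x := by
  rw [HH.map_eq] at hx
  obtain ⟨y, hy⟩ := exact_of_distTriang₂ (triangleOfSES_distinguished hC) x hx
  exact ⟨y, (HH.map_eq _ _).trans hy⟩

lemma HH.map_connecting (y : HH C.X₃ n) : HH.map C.f (HH.connecting hC y) = 0 := by
  refine (ShiftedHom.comp_assoc (y : ShiftedHom _ (Q.obj C.X₃) n) (triangleOfSESδ hC)
    (ShiftedHom.mk₀ (0 : ℤ) rfl (Q.map C.f)) (add_comm 1 n) (zero_add 1) (by lia)).trans ?_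
  have : triangleOfSESδ hC ≫ (Q.map C.f)⟦(1 : ℤ)⟧' = 0 :=
    comp_distTriang_mor_zero₃₁ _ (triangleOfSES_distinguished hC)
  refine (congrArg (fun f => ShiftedHom.comp (y : ShiftedHom _ (Q.obj C.X₃) n) f (add_comm 1 n))
    ((ShiftedHom.comp_mk₀ (triangleOfSESδ hC) (0 : ℤ) rfl (Q.map C.f)).trans this)).trans ?_
  exact ShiftedHom.comp_zero _ _ _

lemma HH.exact₃ (x : HH C.X₃ n) (hx : HH.connecting hC x = 0) : ∃ y, HH.map C.g y = x := by
  obtain ⟨y, hy⟩ := exact_of_distTriang₃ (triangleOfSES_distinguished hC) x hx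
  exact ⟨y, (HH.map_eq _ _).trans hy⟩

-- The source ℤ sits in degree 0, while `K` shifted by n lives in degrees at least m − n > 0; the
-- t-structure allows no maps between them.
omit hC in
lemma HH.eq_zero_of_isZero (m : ℤ) (hm : n < m) (hK : ∀ i < m, IsZero (K.X i)) (x : HH K n) :
    x = 0 := by
  have : K.IsStrictlyGE m := (K.isStrictlyGE_iff m).2 hK
  have h1 := (TStructure.t (C := T.Sh)).isGE_shift (Q.obj K) m n (m - n)
  exact (TStructure.t (C := T.Sh)).zero (x : _ ⟶ (Q.obj K)⟦n⟧) 0 (m - n)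

-- A class killed in `Fil^p` is the connecting image of some x on `Gr^p`. Vanishing of all d_r on x
-- lets the class be moved into `Fil^q` for ever larger q, until the complex is zero in the relevant
-- degrees.
omit hC in
lemma map_DRIncl_succ_injective {F : HodgeFiltration E} (hF : HodgeDeRhamDegenerates F) (p : ℤ)
    (y : HH (DR F (p + 1)) (n + 1)) (hy : HH.map (DRIncl F (show p ≤ p + 1 by lia)) y = 0) :
    y = 0 := by
  obtain ⟨x, hx⟩ := HH.exact₁ (grSequence_shortExact F p) y hy
  have key (k : ℕ) : ∃ y' : HH (DR F (p + 1 + k)) (n + 1),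
      HH.map (DRIncl F (show p + 1 ≤ p + 1 + k by lia)) y' = y := by
    induction k with
    | zero =>
      have (q : ℤ) (hq : p + 1 = q) : ∃ y' : HH (DR F q) (n + 1), HH.map (DRIncl F hq.le) y' = y := by
        subst hq
        refine ⟨y, ?_⟩
        rw [DRIncl_refl, HH.map_id]
      exact this _ (by simp)
    | succ k ih =>
      obtain ⟨y', hy'⟩ := ih
      -- The correction `z` has the same symbol in the graded piece as `y'` but is invisible in
      -- `Fil^(p+1)`. So `y' - z` drops one step deeper and still maps to `y`.
      obtain ⟨z, hz, hz'⟩ := hF p (p + 1 + k) (by lia) n x y' (hy'.trans hx.symm)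
      obtain ⟨w, hw⟩ := HH.exact₂ (grSequence_shortExact F (p + 1 + k)) (y' - z)
        ((HH.map_sub _ _ _).trans (by rw [hz', sub_self]))
      have hw : HH.map (DRIncl F (show p + 1 + k ≤ p + 1 + k + 1 by lia)) w = y' - z := hw
      have (q : ℤ) (hq : p + 1 + k + 1 = q) :
          ∃ y' : HH (DR F q) (n + 1), HH.map (DRIncl F (by lia)) y' = y := by
        subst hq
        refine ⟨w, ?_⟩
        rw [← DRIncl_comp F (show p + 1 ≤ p + 1 + k by lia) (show p + 1 + k ≤ p + 1 + k + 1 by lia)]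
        refine (HH.map_comp _ _ _).trans ?_
        rw [hw, HH.map_sub, hz, hy', sub_zero]
      exact this _ (by push_cast; ring)
  obtain ⟨N, hN⟩ := isZero_DR F
  -- For this k the complex `Fil^(p+1+k) DR` vanishes in all degrees up to n + 1.
  obtain ⟨y', hy'⟩ := key (N + n + 1 - p).toNat
  rw [← hy', HH.eq_zero_of_isZero (n + 2) (by lia) (fun i hi => hN _ i (by lia)) y', HH.map_zero]

omit hC in
lemma map_DRIncl_injective {F : HodgeFiltration E} (hF : HodgeDeRhamDegenerates F) {p q : ℤ}
    (h : p ≤ q) (y : HH (DR F q) (n + 1)) (hy : HH.map (DRIncl F h) y = 0) : y = 0 := by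
  induction q, h using Int.leInduction with
  | base =>
    rwa [DRIncl_refl, HH.map_id] at hy
  | succ q h ih =>
    refine map_DRIncl_succ_injective hF q y (ih _ ?_)
    rwa [← HH.map_comp, DRIncl_comp]

end Degeneration

/-- The quotient `Fil^p DR / Fil^q DR`. -/
def DRQuot (F : HodgeFiltration E) {p q : ℤ} (h : p ≤ q) : CochainComplex T.Sh ℤ :=
  cokernel (DRIncl F h)

/-- The projection `Fil^p DR → Fil^p DR / Fil^q DR`. -/
def DRProj (F : HodgeFiltration E) {p q : ℤ} (h : p ≤ q) : DR F p ⟶ DRQuot F h := cokernel.π _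

instance (F : HodgeFiltration E) {p q : ℤ} (h : p ≤ q) : Epi (DRProj F h) :=
  inferInstanceAs (Epi (cokernel.π _))

/-- By the long exact sequence the obstruction to lifting lies in the kernel of `ℍⁿ⁺¹(Fil^q) →
ℍⁿ⁺¹(Fil^p)`, which is zero. Degeneration enters the deformation argument only through this
statement. -/
lemma map_DRProj_surjective {F : HodgeFiltration E} (hF : HodgeDeRhamDegenerates F) {p q : ℤ}
    (h : p ≤ q) {n : ℤ} (x : HH (DRQuot F h) n) : ∃ y, HH.map (DRProj F h) y = x :=
  HH.exact₃ (shortExact_cokernel (DRIncl F h)) x (map_DRIncl_injective hF h _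
    (HH.map_connecting (shortExact_cokernel (DRIncl F h)) x))

lemma Q_map_DRProj_surjective_one {F : HodgeFiltration E} (hF : HodgeDeRhamDegenerates F) {p q : ℤ}
    (h : p ≤ q) (x : (DerivedCategory.singleFunctor T.Sh 0).obj T.constZ ⟶
      (Q.obj (DRQuot F h))⟦(1 : ℤ)⟧) : ∃ y, y ≫ (Q.map (DRProj F h))⟦(1 : ℤ)⟧' = x := by
  obtain ⟨y, hy⟩ := map_DRProj_surjective hF h (n := 1) x
  exact ⟨y, (HH.map_eq _ _).symm.trans hy⟩

lemma Q_map_DRProj_surjective_zero {F : HodgeFiltration E} (hF : HodgeDeRhamDegenerates F)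
    {p q : ℤ} (h : p ≤ q) (x : (DerivedCategory.singleFunctor T.Sh 0).obj T.constZ ⟶
      Q.obj (DRQuot F h)) : ∃ y, y ≫ Q.map (DRProj F h) = x := by
  obtain ⟨y, hy⟩ := map_DRProj_surjective hF h (n := 0) (ShiftedHom.mk₀ 0 rfl x)
  obtain ⟨y, rfl⟩ := (ShiftedHom.homEquiv (0 : ℤ) rfl).surjective y
  refine ⟨y, (ShiftedHom.homEquiv (0 : ℤ) rfl).injective ?_⟩
  refine Eq.trans ?_ hy
  exact (ShiftedHom.mk₀_comp_mk₀ y (Q.map (DRProj F h)) (zero_add 0) rfl rfl).symm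

/-! ### Degreewise exactness of the quotient complexes. -/

section Quot

variable (F : HodgeFiltration E) {p q : ℤ} (h : p ≤ q)

lemma DRQuot_exact (i : ℤ) : (ShortComplex.mk ((DRIncl F h).f i) ((DRProj F h).f i) (by
    rw [← comp_f, show DRIncl F h ≫ DRProj F h = 0 from cokernel.condition _]; rfl)).Exact :=
  ((shortExact_cokernel (DRIncl F h)).map_of_exact (HomologicalComplex.eval _ _ i)).exact

instance (i : ℤ) : Epi ((DRProj F h).f i) :=
  CategoryTheory.Functor.map_epi (HomologicalComplex.eval T.Sh (ComplexShape.up ℤ) i) (DRProj F h)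

instance (i : ℤ) : Mono ((DRIncl F h).f i) :=
  CategoryTheory.Functor.map_mono (HomologicalComplex.eval T.Sh (ComplexShape.up ℤ) i) (DRIncl F h)

lemma isZero_DRQuot_neg (i : ℤ) (hi : i < 0) : IsZero ((DRQuot F h).X i) := by
  rw [IsZero.iff_id_eq_zero, ← cancel_epi ((DRProj F h).f i)]
  exact (isZero_DR_neg F p i hi).eq_of_src _ _

end Quot

end ThickenedPair
end FilteredDeRham

end

section

namespace FilteredDeRham

/-! ### Modules given by their sections -/

/-- A sheaf of modules, given by its sections and restriction maps. -/
structure ModData (X : Scheme.{u}) : Type (u + 1) where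
  /-- the sections -/
  obj : X.Opens → Type u
  [addCommGroup (U : X.Opens) : AddCommGroup (obj U)]
  [module (U : X.Opens) : Module Γ(X, U) (obj U)]
  /-- the restriction maps -/
  res {U W : X.Opens} (h : W ≤ U) : obj U →+ obj W
  res_self {U : X.Opens} (s : obj U) : res le_rfl s = s
  res_res {U W W' : X.Opens} (h : W ≤ U) (h' : W' ≤ W) (s : obj U) :
    res h' (res h s) = res (h'.trans h) s
  res_smul {U W : X.Opens} (h : W ≤ U) (a : Γ(X, U)) (s : obj U) :
    res h (a • s) = resO h a • res h s
  separated {U : X.Opens} (s t : obj U) :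
    (∀ x ∈ U, ∃ (W : X.Opens) (h : W ≤ U), x ∈ W ∧ res h s = res h t) → s = t
  gluing {ι : Type u} (U : ι → X.Opens) (s : ∀ i, obj (U i))
    (h : ∀ i j, res (inf_le_left : U i ⊓ U j ≤ U i) (s i) = res inf_le_right (s j)) :
    ∃ t : obj (iSup U), ∀ i, res (le_iSup U i) t = s i

namespace ModData

variable {X : Scheme.{u}}

attribute [instance] ModData.addCommGroup ModData.module

/-- The underlying presheaf of abelian groups. -/
def presheaf (M : ModData X) : TopCat.Presheaf AddCommGrpCat.{u} X where
  obj U := AddCommGrpCat.of (M.obj U.unop)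
  map h := AddCommGrpCat.ofHom (M.res h.unop.le)
  map_id U := by ext s; exact M.res_self s
  map_comp h h' := by ext s; exact (M.res_res h.unop.le h'.unop.le s).symm

lemma isSheaf (M : ModData X) : M.presheaf.IsSheaf := by
  refine (TopCat.Presheaf.isSheaf_iff_isSheafUniqueGluing _).2 fun ι U s hs => ?_
  obtain ⟨t, ht⟩ := M.gluing U s fun i j => hs i j
  refine ⟨t, fun i => ht i, fun t' ht' => M.separated _ _ fun x hx => ?_⟩
  obtain ⟨i, hi⟩ := Opens.mem_iSup.1 hx
  exact ⟨U i, le_iSup U i, hi, (ht' i).trans (ht i).symm⟩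

instance (M : ModData X) (U : (Opens X)ᵒᵖ) :
    Module (X.ringCatSheaf.obj.obj U) (M.presheaf.obj U) :=
  inferInstanceAs (Module Γ(X, U.unop) (M.obj U.unop))

/-- The associated sheaf of modules. -/
def toModules (M : ModData X) : X.Modules :=
  show SheafOfModules X.ringCatSheaf from
  { val := PresheafOfModules.ofPresheaf M.presheaf fun _ _ h a s => M.res_smul h.unop.le a s
    isSheaf := M.isSheaf }

/-- The sections of the associated sheaf. -/
def equiv (M : ModData X) (U : X.Opens) : Γ(M.toModules, U) ≃ₗ[Γ(X, U)] M.obj U where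
  toFun s := s
  invFun s := s
  map_add' _ _ := rfl
  map_smul' _ _ := rfl
  left_inv _ := rfl
  right_inv _ := rfl

end ModData

lemma app_resM {X : Scheme.{u}} {M N : X.Modules} (f : M ⟶ N) {U W : X.Opens} (h : W ≤ U)
    (v : Γ(M, U)) : f.app W (resM M h v) = resM N h (f.app U v) :=
  congr(($(f.mapPresheaf.naturality (homOfLE h).op)).hom v)

/-- Morphisms of modules given on sections. -/
def modHom {X : Scheme.{u}} (M N : X.Modules) (f : ∀ U, Γ(M, U) →ₗ[Γ(X, U)] Γ(N, U))
    (hf : ∀ (U W : X.Opens) (h : W ≤ U) v, f W (resM M h v) = resM N h (f U v)) : M ⟶ N :=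
  show SheafOfModules.Hom M N from
  ⟨PresheafOfModules.homMk
    { app := fun U => AddCommGrpCat.ofHom (f U.unop).toAddMonoidHom
      naturality := fun U W h => by ext v; exact hf U.unop W.unop h.unop.le v }
    (fun U a v => (f U.unop).map_smul a v)⟩

lemma mod_hom_ext {X : Scheme.{u}} {M N : X.Modules} {f g : M ⟶ N}
    (h : ∀ U v, f.app U v = g.app U v) : f = g :=
  Scheme.Modules.hom_ext _ _ fun U => by ext v; exact h U v

/-- Isomorphisms of modules given on sections. -/
def modIso {X : Scheme.{u}} (M N : X.Modules) (f : ∀ U, Γ(M, U) ≃ₗ[Γ(X, U)] Γ(N, U))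
    (hf : ∀ (U W : X.Opens) (h : W ≤ U) v, f W (resM M h v) = resM N h (f U v)) : M ≅ N where
  hom := modHom M N (fun U => f U) hf
  inv := modHom N M (fun U => (f U).symm) fun U W h v => by
    obtain ⟨v, rfl⟩ := (f U).surjective v
    simp only [LinearEquiv.coe_coe, LinearEquiv.symm_apply_apply, ← hf]
  hom_inv_id := mod_hom_ext fun U v => (f U).symm_apply_apply v
  inv_hom_id := mod_hom_ext fun U v => (f U).apply_symm_apply v

lemma eq_of_resM {X : Scheme.{u}} (M : X.Modules) {U : X.Opens} (v w : Γ(M, U))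
    (H : ∀ x ∈ U, ∃ (W : X.Opens) (h : W ≤ U), x ∈ W ∧ resM M h v = resM M h w) : v = w :=
  eq_of_locally_eq M.isSheaf v w H

lemma eq_of_resO {X : Scheme.{u}} {U : X.Opens} (v w : Γ(X, U))
    (H : ∀ x ∈ U, ∃ (W : X.Opens) (h : W ≤ U), x ∈ W ∧ resO h v = resO h w) : v = w :=
  eq_of_locally_eq X.IsSheaf v w H

lemma exists_glueM {X : Scheme.{u}} (M : X.Modules) (U : X.Opens) (P : ∀ W, Γ(M, W) → Prop)
    (hloc : ∀ x ∈ U, ∃ W : X.Opens, W ≤ U ∧ x ∈ W ∧ ∃ s, P W s)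
    (hres : ∀ (W W' : X.Opens) (h : W' ≤ W) s, W ≤ U → P W s → P W' (resM M h s))
    (huniq : ∀ (W : X.Opens), W ≤ U → ∀ s t, P W s → P W t → s = t) :
    ∃ s : Γ(M, U), ∀ (W : X.Opens) (h : W ≤ U) t, P W t → resM M h s = t :=
  exists_glue M.isSheaf U P hloc hres huniq

lemma exists_glueO {X : Scheme.{u}} (U : X.Opens) (P : ∀ W, Γ(X, W) → Prop)
    (hloc : ∀ x ∈ U, ∃ W : X.Opens, W ≤ U ∧ x ∈ W ∧ ∃ s, P W s)
    (hres : ∀ (W W' : X.Opens) (h : W' ≤ W) s, W ≤ U → P W s → P W' (resO h s))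
    (huniq : ∀ (W : X.Opens), W ≤ U → ∀ s t, P W s → P W t → s = t) :
    ∃ s : Γ(X, U), ∀ (W : X.Opens) (h : W ≤ U) t, P W t → resO h s = t :=
  exists_glue X.IsSheaf U P hloc hres huniq

lemma exists_gluingM {X : Scheme.{u}} (M : X.Modules) {ι : Type u} (U : ι → X.Opens)
    (s : ∀ i, Γ(M, U i))
    (h : ∀ i j, resM M (inf_le_left : U i ⊓ U j ≤ U i) (s i) = resM M inf_le_right (s j)) :
    ∃ t : Γ(M, iSup U), ∀ i, resM M (le_iSup U i) t = s i := by
  obtain ⟨t, ht, -⟩ := TopCat.Sheaf.existsUnique_gluing ⟨M.presheaf, M.isSheaf⟩ U s fun i j => h i j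
  exact ⟨t, ht⟩

lemma exists_gluingO {X : Scheme.{u}} {ι : Type u} (U : ι → X.Opens)
    (s : ∀ i, Γ(X, U i))
    (h : ∀ i j, resO (inf_le_left : U i ⊓ U j ≤ U i) (s i) = resO inf_le_right (s j)) :
    ∃ t : Γ(X, iSup U), ∀ i, resO (le_iSup U i) t = s i := by
  obtain ⟨t, ht, -⟩ := TopCat.Sheaf.existsUnique_gluing ⟨X.presheaf, X.IsSheaf⟩ U s fun i j => h i j
  exact ⟨t, ht⟩

/-- The module `W ↦ Γ(V, W ∩ U)`. -/
def meetData {X : Scheme.{u}} (V : X.Modules) (U : X.Opens) : ModData X where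
  obj W := Γ(V, W ⊓ U)
  module W := Module.compHom _ (resO (inf_le_left : W ⊓ U ≤ W))
  res h := resM V (inf_le_inf_right U h)
  res_self s := resM_self V s
  res_res h h' s := resM_resM V _ _ s
  res_smul {W W'} h a s := by
    change resM V (inf_le_inf_right U h) (resO (inf_le_left : W ⊓ U ≤ W) a • s) =
      resO (inf_le_left : W' ⊓ U ≤ W') (resO h a) • resM V (inf_le_inf_right U h) s
    rw [resM_smul, resO_resO, resO_resO]
  separated s t H := eq_of_resM V s t fun x hx => by
    obtain ⟨W, h, hxW, e⟩ := H x hx.1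
    exact ⟨W ⊓ U, inf_le_inf_right U h, ⟨hxW, hx.2⟩, e⟩
  gluing {ι} W s h := by
    have hs (i j) : resM V (inf_le_left : (W i ⊓ U) ⊓ (W j ⊓ U) ≤ W i ⊓ U) (s i) =
        resM V inf_le_right (s j) := by
      have := congrArg (resM V (show (W i ⊓ U) ⊓ (W j ⊓ U) ≤ (W i ⊓ W j) ⊓ U from
        le_inf (inf_le_inf inf_le_left inf_le_left) (inf_le_left.trans inf_le_right))) (h i j)
      rwa [resM_resM, resM_resM] at this
    obtain ⟨t, ht⟩ := exists_gluingM V _ s hs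
    have hle : iSup W ⊓ U ≤ ⨆ i, W i ⊓ U := (iSup_inf_eq W U).le
    exact ⟨resM V hle t, fun i => by rw [resM_resM, ← ht i]⟩

/-- The module `W ↦ 𝒪(W ∩ U)ⁿ`. -/
def freeData (X : Scheme.{u}) (U : X.Opens) (n : ℕ) : ModData X where
  obj W := Fin n → Γ(X, W ⊓ U)
  module W := Module.compHom _ (resO (inf_le_left : W ⊓ U ≤ W))
  res h := AddMonoidHom.mk' (fun s k => resO (inf_le_inf_right U h) (s k))
    fun s t => funext fun k => map_add (resO (inf_le_inf_right U h)) (s k) (t k)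
  res_self s := funext fun k => resO_self _
  res_res h h' s := funext fun k => resO_resO _ _ _
  res_smul h a s := funext fun k => by
    change resO _ (resO _ a * s k) = resO _ (resO _ a) * resO _ (s k)
    rw [map_mul, resO_resO, resO_resO]
  separated s t H := funext fun k => eq_of_resO _ _ fun x hx => by
    obtain ⟨W, h, hxW, e⟩ := H x hx.1
    exact ⟨W ⊓ U, inf_le_inf_right U h, ⟨hxW, hx.2⟩, congrFun e k⟩
  gluing {ι} W s h := by
    have hs (k : Fin n) (i j) : resO (inf_le_left : (W i ⊓ U) ⊓ (W j ⊓ U) ≤ W i ⊓ U) (s i k) =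
        resO inf_le_right (s j k) := by
      have := congrArg (resO (show (W i ⊓ U) ⊓ (W j ⊓ U) ≤ (W i ⊓ W j) ⊓ U from
        le_inf (inf_le_inf inf_le_left inf_le_left) (inf_le_left.trans inf_le_right)))
        (congrFun (h i j) k)
      change resO _ (resO _ (s i k)) = resO _ (resO _ (s j k)) at this
      rwa [resO_resO, resO_resO] at this
    choose t ht using fun k => exists_gluingO _ (fun i => s i k) (hs k)
    have hle : iSup W ⊓ U ≤ ⨆ i, W i ⊓ U := (iSup_inf_eq W U).le
    refine ⟨fun k => resO hle (t k), fun i => funext fun k => ?_⟩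
    change resO _ (resO _ (t k)) = _
    rw [resO_resO, ← ht k i]

end FilteredDeRham

end

section

namespace FilteredDeRham

/-! ### Pullback of ideal sheaves on affine opens -/

section IdealPullback

open Scheme

lemma comap_ideal_top_of_isOpenImmersion {X Y : Scheme.{u}} (I : Y.IdealSheafData) (f : X ⟶ Y)
    [IsOpenImmersion f] [IsAffine X] (W : Y.affineOpens) (hW : W.1 = f ''ᵁ ⊤)
    (h : ⊤ ≤ f ⁻¹ᵁ W.1) :
    (I.comap f).ideal ⟨⊤, isAffineOpen_top X⟩ = (I.ideal W).map (f.appLE W.1 ⊤ h).hom := by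
  obtain ⟨W, hWa⟩ := W
  obtain rfl : W = f ''ᵁ ⊤ := hW
  rw [IdealSheafData.ideal_comap_of_isOpenImmersion]
  have e : f.appLE (f ''ᵁ ⊤) ⊤ h = (f.appIso ⊤).hom := by
    rw [Scheme.Hom.appIso_hom', Scheme.Hom.appLE]
  rw [e]
  exact (Ideal.map_comap_of_equiv (f.appIso ⊤).commRingCatIsoToRingEquiv).symm

/-- Both inclusions come from the adjunction between `map` and `comap` of ideal sheaves: one by
testing against the ideal sheaf generated by the image of `J`, the other from the unit. -/
lemma comap_ideal_top_of_isAffine {X Y : Scheme.{u}} [IsAffine X] [IsAffine Y]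
    (J : Y.IdealSheafData) (f : X ⟶ Y) :
    (J.comap f).ideal ⟨⊤, isAffineOpen_top X⟩ =
      (J.ideal ⟨⊤, isAffineOpen_top Y⟩).map f.appTop.hom := by
  have key (K : Ideal Γ(X, ⊤)) :
      (IdealSheafData.ofIdealTop K).ideal ⟨⊤, isAffineOpen_top X⟩ = K := by simp
  refine le_antisymm ?_ ?_
  · have h : J ≤ (IdealSheafData.ofIdealTop
        ((J.ideal ⟨⊤, isAffineOpen_top Y⟩).map f.appTop.hom)).map f := by
      refine IdealSheafData.le_of_isAffine ?_
      rw [IdealSheafData.ideal_map_of_isAffineHom]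
      refine Ideal.map_le_iff_le_comap.1 ?_
      exact (key _).ge
    exact (IdealSheafData.le_map_iff_comap_le.1 h ⟨⊤, isAffineOpen_top X⟩).trans (key _).le
  · have := J.le_map_comap f ⟨⊤, isAffineOpen_top Y⟩
    rw [IdealSheafData.ideal_map_of_isAffineHom] at this
    exact Ideal.map_le_iff_le_comap.2 this

lemma isIso_presheaf_map {X : Scheme.{u}} {U W : X.Opens} (h : W ≤ U) (e : W = U) :
    IsIso (X.presheaf.map (homOfLE h).op) := by
  subst e
  exact inferInstanceAs (IsIso (X.presheaf.map (𝟙 _)))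

/-- The two affine opens are treated as affine schemes, where the previous case applies; functions
and ideals are unchanged by the passage from an affine open to the scheme it defines. -/
lemma comap_ideal {X Y : Scheme.{u}} (J : Y.IdealSheafData) (f : X ⟶ Y) (U : X.affineOpens)
    (V : Y.affineOpens) (h : U.1 ≤ f ⁻¹ᵁ V.1) :
    (J.comap f).ideal U = (J.ideal V).map (f.appLE V.1 U.1 h).hom := by
  have := U.2
  have := V.2
  have hU : (⊤ : U.1.toScheme.Opens) ≤ U.1.ι ⁻¹ᵁ U.1 := by simp
  have hV : (⊤ : V.1.toScheme.Opens) ≤ V.1.ι ⁻¹ᵁ V.1 := by simp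
  have h1 := comap_ideal_top_of_isOpenImmersion (J.comap f) U.1.ι U (by simp) hU
  have h2 := comap_ideal_top_of_isOpenImmersion J V.1.ι V (by simp) hV
  have h3 := comap_ideal_top_of_isAffine (J.comap V.1.ι) (f.resLE V.1 U.1 h)
  rw [← IdealSheafData.comap_comp, Scheme.Hom.resLE_comp_ι, h2, IdealSheafData.comap_comp, h1,
    Ideal.map_map, ← CommRingCat.hom_comp] at h3
  have e : IsIso (U.1.ι.appLE U.1 ⊤ hU) := by
    rw [Scheme.Opens.ι_appLE]
    exact isIso_presheaf_map _ (by simp)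
  have h4 : V.1.ι.appLE V.1 ⊤ hV ≫ (f.resLE V.1 U.1 h).appTop =
      f.appLE V.1 U.1 h ≫ U.1.ι.appLE U.1 ⊤ hU := by
    have e1 := Scheme.Hom.appLE_comp_appLE (f.resLE V.1 U.1 h) V.1.ι V.1 ⊤ ⊤ hV le_top
    have e2 := Scheme.Hom.appLE_comp_appLE U.1.ι f V.1 U.1 ⊤ h hU
    rw [e2]
    simp only [← Scheme.Hom.resLE_comp_ι f h]
    rw [← e1]
    congr 1
    exact Scheme.Hom.app_eq_appLE _
  rw [h4, CommRingCat.hom_comp, ← Ideal.map_map] at h3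
  have inj : Function.Injective (Ideal.map (U.1.ι.appLE U.1 ⊤ hU).hom) := by
    intro a b hab
    have hb := (ConcreteCategory.isIso_iff_bijective _).1 e
    let eq := RingEquiv.ofBijective (U.1.ι.appLE U.1 ⊤ hU).hom hb
    have := congrArg (Ideal.comap eq) (show Ideal.map eq a = Ideal.map eq b from hab)
    rwa [Ideal.comap_map_of_bijective _ eq.bijective,
      Ideal.comap_map_of_bijective _ eq.bijective] at this
  exact inj h3

end IdealPullback

/-- Belonging to the ideal means vanishing on the closed subscheme, and vanishing of a function is
local. -/
lemma mem_ideal_of_locally {X : Scheme.{u}} (D : X.IdealSheafData) (W : X.affineOpens)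
    (b : Γ(X, W.1)) (H : ∀ x ∈ W.1, ∃ (W' : X.affineOpens) (h : W'.1 ≤ W.1), x ∈ W'.1 ∧
      resO h b ∈ D.ideal W') : b ∈ D.ideal W := by
  have hk (W : X.affineOpens) : D.ideal W = RingHom.ker (D.subschemeι.app W.1).hom := by
    rw [← Scheme.Hom.ker_apply, Scheme.IdealSheafData.ker_subschemeι]
  rw [hk, RingHom.mem_ker]
  refine eq_of_resO _ _ fun y hy => ?_
  obtain ⟨W', h, hx, hb⟩ := H (D.subschemeι y) hy
  refine ⟨D.subschemeι ⁻¹ᵁ W'.1, fun z hz => h hz, hx, ?_⟩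
  rw [hk, RingHom.mem_ker] at hb
  rw [map_zero]
  exact (congr($(D.subschemeι.naturality (homOfLE h).op).hom b)).symm.trans hb

lemma exists_affine_le {X : Scheme.{u}} {U : X.Opens} {x : X} (hx : x ∈ U) :
    ∃ W : X.affineOpens, W.1 ≤ U ∧ x ∈ W.1 := by
  obtain ⟨W, hW, hxW, h⟩ := exists_isAffineOpen_mem_and_subset hx
  exact ⟨⟨W, hW⟩, h, hxW⟩

/-! ### The thickening: the ideal of X and the topology of X'. -/

namespace ThickenedPair

variable {T : ThickenedPair.{u}}

instance : IsClosedImmersion T.j := T.isClosedImmersion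

instance : IsClosedImmersion T.i :=
  MorphismProperty.of_isPullback (P := @IsClosedImmersion) T.isPullback.flip T.isClosedImmersion

variable (T) in
lemma ker_i : T.i.ker = T.j.ker.comap T.g' := by
  rw [← Scheme.IdealSheafData.ker_fst_of_isClosedImmersion, ← T.isPullback.isoPullback_hom_fst,
    Scheme.Hom.ker_comp_of_isIso]

lemma red_surjective (W : T.X'.affineOpens) : Function.Surjective (red (T := T) W.1) :=
  Scheme.Hom.app_surjective T.i W.1 W.2

lemma I_eq_map (W : T.X'.affineOpens) (V : T.S'.affineOpens) (h : W.1 ≤ T.g' ⁻¹ᵁ V.1) :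
    T.I W.1 = (T.j.ker.ideal V).map (T.g'.appLE V.1 W.1 h).hom := by
  rw [← comap_ideal, ← ker_i, Scheme.Hom.ker_apply]
  rfl

lemma exists_affine_over {U : T.X'.Opens} {x : T.X'} (hx : x ∈ U) :
    ∃ (W : T.X'.affineOpens) (V : T.S'.affineOpens), W.1 ≤ U ∧ x ∈ W.1 ∧ W.1 ≤ T.g' ⁻¹ᵁ V.1 := by
  obtain ⟨V, -, hV⟩ := exists_affine_le (show T.g' x ∈ (⊤ : T.S'.Opens) from trivial)
  obtain ⟨W, hW, hxW⟩ := exists_affine_le (show x ∈ U ⊓ T.g' ⁻¹ᵁ V.1 from ⟨hx, hV⟩)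
  exact ⟨W, V, hW.trans inf_le_left, hxW, hW.trans inf_le_right⟩

lemma resO_mem_I {U W : T.X'.Opens} (h : W ≤ U) {r : Γ(T.X', U)} (hr : r ∈ T.I U) :
    resO h r ∈ T.I W := (resI h ⟨r, hr⟩).2

/-- On small affine opens I is generated by the pullback of the ideal of S in S', whose square is
zero. -/
lemma I_mul_I {U : T.X'.Opens} {r s : Γ(T.X', U)} (hr : r ∈ T.I U) (hs : s ∈ T.I U) :
    r * s = 0 := by
  refine eq_of_resO _ _ fun x hx => ?_
  obtain ⟨W, V, hW, hxW, h⟩ := exists_affine_over hx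
  refine ⟨W.1, hW, hxW, ?_⟩
  have h0 : (T.I W.1) ^ 2 = ⊥ := by
    rw [I_eq_map W V h, ← Ideal.map_pow]
    exact (congrArg (fun J : T.S'.IdealSheafData => (J.ideal V).map _) T.sq_zero).trans
      Ideal.map_bot
  have := Ideal.mul_mem_mul (resO_mem_I hW hr) (resO_mem_I hW hs)
  rw [← pow_two, h0] at this
  rw [map_mul, map_zero]
  exact this

/-- I is generated by functions pulled back from S'. A derivation relative to S' kills these, so it
preserves I by the Leibniz rule. -/
lemma ev_mem_I {U : T.X'.Opens} (x : LogDer T.g' T.D' U) (W : T.X'.Opens) (hW : W ≤ U)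
    {r : Γ(T.X', W)} (hr : r ∈ T.I W) : x.ev W hW r ∈ T.I W := by
  change red W _ = 0
  refine eq_of_resO _ _ fun y hy => ?_
  obtain ⟨W', V, hW', hxW, h⟩ := exists_affine_over (show T.i y ∈ W from hy)
  refine ⟨T.i ⁻¹ᵁ W'.1, pre_mono hW', hxW, ?_⟩
  rw [← red_resO hW', x.res_ev, map_zero]
  change _ ∈ T.I W'.1
  have hr' := resO_mem_I hW' hr
  generalize resO hW' r = r' at hr' ⊢
  have hI := I_eq_map W' V h
  rw [hI, Ideal.map] at hr'
  induction hr' using Submodule.span_induction with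
  | mem s hs =>
    obtain ⟨k, hk, rfl⟩ := hs
    rw [show x.ev W'.1 (hW'.trans hW) ((T.g'.appLE V.1 W'.1 h).hom k) = 0 from
      x.2.2.1 ⟨W'.1, hW'.trans hW⟩ V.1 h k]
    exact zero_mem _
  | zero => rw [map_zero]; exact zero_mem _
  | add a b _ _ ha hb => rw [map_add]; exact add_mem ha hb
  | smul a s hs ih =>
    rw [smul_eq_mul, Derivation.leibniz]
    refine add_mem (Ideal.mul_mem_left _ _ ih) (Ideal.mul_mem_right _ _ ?_)
    rw [hI, Ideal.map]; exact hs

variable (T) in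
-- On the complement of the image of X the function 1 lies in I, so 1 = 1 · 1 = 0 there and the
-- complement is empty.
lemma exists_eq_i (x : T.X') : ∃ y, T.i y = x := by
  by_contra hx
  let U : T.X'.Opens := ⟨(Set.range T.i)ᶜ, T.i.isClosedEmbedding.isClosed_range.isOpen_compl⟩
  have hxU : x ∈ U := hx
  have hU : T.i ⁻¹ᵁ U = ⊥ := by
    ext y
    simp only [Opens.coe_bot, Set.mem_empty_iff_false, iff_false]
    exact fun hy => hy ⟨y, rfl⟩
  have h1 : (1 : Γ(T.X', U)) ∈ T.I U := by
    change red U 1 = 0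
    have : Subsingleton Γ(T.X, T.i ⁻¹ᵁ U) := by rw [hU]; infer_instance
    exact Subsingleton.elim _ _
  have h0 := I_mul_I h1 h1
  rw [one_mul] at h0
  have := congrArg (T.X'.presheaf.germ U x hxU).hom h0
  rw [map_one, map_zero] at this
  exact one_ne_zero this

lemma le_of_pre_le {U W : T.X'.Opens} (h : T.i ⁻¹ᵁ W ≤ T.i ⁻¹ᵁ U) : W ≤ U := fun x hx => by
  obtain ⟨y, rfl⟩ := T.exists_eq_i x
  exact h hx

lemma exists_pre_eq (W : T.X.Opens) : ∃ U : T.X'.Opens, T.i ⁻¹ᵁ U = W := by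
  obtain ⟨U, hU, h⟩ := T.i.isClosedEmbedding.isInducing.isOpen_iff.1 W.2
  exact ⟨⟨U, hU⟩, Opens.ext h⟩

/-- X and X' have the same open sets, so questions on X may be checked on traces of affine opens of
X', where functions on X lift. -/
lemma exists_affine_pre_le {U : T.X'.Opens} {W : T.X.Opens} (hW : W ≤ T.i ⁻¹ᵁ U) {y : T.X}
    (hy : y ∈ W) : ∃ W' : T.X'.affineOpens, W'.1 ≤ U ∧ T.i ⁻¹ᵁ W'.1 ≤ W ∧ y ∈ T.i ⁻¹ᵁ W'.1 := by
  obtain ⟨U', rfl⟩ := exists_pre_eq W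
  obtain ⟨W', h, hy⟩ := exists_affine_le (show T.i y ∈ U' from hy)
  exact ⟨W', h.trans (le_of_pre_le hW), pre_mono h, hy⟩

end ThickenedPair
end FilteredDeRham

end

section

namespace FilteredDeRham
namespace ThickenedPair

variable {T : ThickenedPair.{u}}

/-! ### Reduction of vector fields -/

/-- Lift the function locally, differentiate, reduce. The result does not depend on the lift because
vector fields preserve I, and therefore the local values glue. -/
lemma exists_red_der {U : T.X'.Opens} (x : LogDer T.g' T.D' U) (W' : T.X.Opens)
    (hW' : W' ≤ T.i ⁻¹ᵁ U) (a : Γ(T.X, W')) :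
    ∃ b : Γ(T.X, W'), ∀ (W : T.X'.Opens) (hW : W ≤ U) (h : T.i ⁻¹ᵁ W ≤ W') (a' : Γ(T.X', W)),
      red W a' = resO h a → resO h b = red W (x.ev W hW a') := by
  have hP : ∀ (W₁ : T.X'.Opens) (hW₁ : W₁ ≤ U) (h₁ : T.i ⁻¹ᵁ W₁ ≤ W') (a₁ : Γ(T.X', W₁)),
      red W₁ a₁ = resO h₁ a → ∀ (W₂ : T.X'.Opens) (hW₂ : W₂ ≤ U)
      (h₂ : T.i ⁻¹ᵁ W₂ ≤ T.i ⁻¹ᵁ W₁) (h₃ : T.i ⁻¹ᵁ W₂ ≤ W') (a₂ : Γ(T.X', W₂)),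
      red W₂ a₂ = resO h₃ a → resO h₂ (red W₁ (x.ev W₁ hW₁ a₁)) = red W₂ (x.ev W₂ hW₂ a₂) := by
    intro W₁ hW₁ h₁ a₁ ha₁ W₂ hW₂ h₂ h₃ a₂ ha₂
    have hle : W₂ ≤ W₁ := le_of_pre_le h₂
    rw [← red_resO hle, x.res_ev, ← sub_eq_zero, ← map_sub, ← map_sub]
    refine ev_mem_I x W₂ hW₂ ?_
    change red W₂ _ = 0
    rw [map_sub, red_resO hle, ha₁, ha₂, resO_resO, sub_self]
  let P (W₁ : T.X.Opens) (s : Γ(T.X, W₁)) : Prop := ∀ (W : T.X'.Opens) (hW : W ≤ U)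
    (h₁ : T.i ⁻¹ᵁ W ≤ W₁) (h : T.i ⁻¹ᵁ W ≤ W') (a' : Γ(T.X', W)),
      red W a' = resO h a → resO h₁ s = red W (x.ev W hW a')
  obtain ⟨b, hb⟩ : ∃ b : Γ(T.X, W'), ∀ (W₁ : T.X.Opens) (h : W₁ ≤ W') (t : Γ(T.X, W₁)),
      P W₁ t → resO h b = t := by
    refine exists_glueO W' P ?_ ?_ ?_
    · intro y hy
      obtain ⟨W, hWU, hWW', hyW⟩ := exists_affine_pre_le hW' hy
      obtain ⟨a', ha'⟩ := red_surjective W (resO hWW' a)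
      exact ⟨T.i ⁻¹ᵁ W.1, hWW', hyW, red W.1 (x.ev W.1 hWU a'), hP W.1 hWU hWW' a' ha'⟩
    · intro W₁ W₂ h s _ hs W hW h₁ h₂ a' ha'
      rw [resO_resO]
      exact hs W hW _ h₂ a' ha'
    · intro W₁ hW₁ s t hs ht
      refine eq_of_resO _ _ fun y hy => ?_
      obtain ⟨W, hWU, hWW', hyW⟩ := exists_affine_pre_le (hW₁.trans hW') hy
      obtain ⟨a', ha'⟩ := red_surjective W (resO (hWW'.trans hW₁) a)
      exact ⟨_, hWW', hyW, (hs W.1 hWU hWW' _ a' ha').trans (ht W.1 hWU hWW' _ a' ha').symm⟩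
  exact ⟨b, fun W hW h a' ha' => hb _ h _ (hP W hW h a' ha')⟩

/-- The reduction of a vector field, as a function. -/
def redDer {U : T.X'.Opens} (x : LogDer T.g' T.D' U) (W' : T.X.Opens)
    (hW' : W' ≤ T.i ⁻¹ᵁ U) (a : Γ(T.X, W')) : Γ(T.X, W') :=
  (exists_red_der x W' hW' a).choose

lemma redDer_spec {U : T.X'.Opens} (x : LogDer T.g' T.D' U) (W' : T.X.Opens)
    (hW' : W' ≤ T.i ⁻¹ᵁ U) (a : Γ(T.X, W')) (W : T.X'.Opens) (hW : W ≤ U) (h : T.i ⁻¹ᵁ W ≤ W')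
    (a' : Γ(T.X', W)) (ha' : red W a' = resO h a) :
    resO h (redDer x W' hW' a) = red W (x.ev W hW a') :=
  (exists_red_der x W' hW' a).choose_spec W hW h a' ha'

lemma redDer_res {U : T.X'.Opens} (x : LogDer T.g' T.D' U) {W₁ W₂ : T.X.Opens}
    (h₁ : W₁ ≤ T.i ⁻¹ᵁ U) (h : W₂ ≤ W₁) (a : Γ(T.X, W₁)) :
    resO h (redDer x W₁ h₁ a) = redDer x W₂ (h.trans h₁) (resO h a) := by
  refine eq_of_resO _ _ fun y hy => ?_
  obtain ⟨W, hWU, hWW', hyW⟩ := exists_affine_pre_le (h.trans h₁) hy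
  obtain ⟨a', ha'⟩ := red_surjective W (resO (hWW'.trans h) a)
  refine ⟨_, hWW', hyW, ?_⟩
  rw [resO_resO, redDer_spec x W₁ h₁ a W.1 hWU _ a' ha',
    redDer_spec x W₂ _ _ W.1 hWU hWW' a' (by rw [ha', resO_resO])]

/-- The reduction of a vector field, as a derivation. -/
def redDerivation {U : T.X'.Opens} (x : LogDer T.g' T.D' U) (W' : T.X.Opens)
    (hW' : W' ≤ T.i ⁻¹ᵁ U) : Derivation ℤ Γ(T.X, W') Γ(T.X, W') :=
  Derivation.mk' (AddMonoidHom.toIntLinearMap (AddMonoidHom.mk' (redDer x W' hW') fun a b => by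
    refine eq_of_resO _ _ fun y hy => ?_
    obtain ⟨W, hWU, hWW', hyW⟩ := exists_affine_pre_le hW' hy
    obtain ⟨a', ha'⟩ := red_surjective W (resO hWW' a)
    obtain ⟨b', hb'⟩ := red_surjective W (resO hWW' b)
    refine ⟨_, hWW', hyW, ?_⟩
    rw [map_add, redDer_spec x W' hW' a W.1 hWU _ a' ha',
      redDer_spec x W' hW' b W.1 hWU _ b' hb',
      redDer_spec x W' hW' (a + b) W.1 hWU _ (a' + b') (by rw [map_add, map_add, ha', hb']),
      map_add, map_add])) fun a b => by
    refine eq_of_resO _ _ fun y hy => ?_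
    obtain ⟨W, hWU, hWW', hyW⟩ := exists_affine_pre_le hW' hy
    obtain ⟨a', ha'⟩ := red_surjective W (resO hWW' a)
    obtain ⟨b', hb'⟩ := red_surjective W (resO hWW' b)
    refine ⟨_, hWW', hyW, ?_⟩
    change resO hWW' (redDer x W' hW' (a * b)) =
      resO hWW' (a * redDer x W' hW' b + b * redDer x W' hW' a)
    rw [map_add, map_mul, map_mul, redDer_spec x W' hW' a W.1 hWU _ a' ha',
      redDer_spec x W' hW' b W.1 hWU _ b' hb',
      redDer_spec x W' hW' (a * b) W.1 hWU _ (a' * b') (by rw [map_mul, map_mul, ha', hb']),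
      Derivation.leibniz, map_add, smul_eq_mul, smul_eq_mul, map_mul, map_mul, ha', hb']

/-- Near any point a function from S lifts to one from S', and its pullback to X' is an admissible
lift that the vector field kills. -/
lemma redDer_appLE {U : T.X'.Opens} (x : LogDer T.g' T.D' U) (W' : T.X.Opens)
    (hW' : W' ≤ T.i ⁻¹ᵁ U) (V : T.S.Opens) (h : W' ≤ T.g ⁻¹ᵁ V) (s : Γ(T.S, V)) :
    redDer x W' hW' ((T.g.appLE V W' h).hom s) = 0 := by
  refine eq_of_resO _ _ fun y hy => ?_
  obtain ⟨V₀, hV₀, hV₀'⟩ := T.j.isClosedEmbedding.isInducing.isOpen_iff.1 V.2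
  have hyV : T.j (T.g y) ∈ V₀ := (Set.ext_iff.1 hV₀' (T.g y)).2 (h hy)
  obtain ⟨V', hV', hyV'⟩ := exists_affine_le (show T.j (T.g y) ∈ (⟨V₀, hV₀⟩ : T.S'.Opens) from hyV)
  have hVV : T.j ⁻¹ᵁ V'.1 ≤ V := fun z hz => (Set.ext_iff.1 hV₀' z).1 (hV' hz)
  have hyg : T.g' (T.i y) ∈ V'.1 := by
    have e : T.g' (T.i y) = T.j (T.g y) := by
      rw [← Scheme.Hom.comp_apply, ← Scheme.Hom.comp_apply, T.isPullback.w]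
    rwa [e]
  obtain ⟨W, hWU, hWW', hyW⟩ := exists_affine_pre_le (U := U ⊓ T.g' ⁻¹ᵁ V'.1)
    (W := W' ⊓ T.i ⁻¹ᵁ (T.g' ⁻¹ᵁ V'.1)) (fun z hz => ⟨hW' hz.1, hz.2⟩) (show y ∈ _ from ⟨hy, hyg⟩)
  have hg : W.1 ≤ T.g' ⁻¹ᵁ V'.1 := hWU.trans inf_le_right
  obtain ⟨s', hs'⟩ := Scheme.Hom.app_surjective T.j V'.1 V'.2 (resO hVV s)
  refine ⟨_, hWW'.trans inf_le_left, hyW, ?_⟩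
  rw [redDer_spec x W' hW' _ W.1 (hWU.trans inf_le_left) _ ((T.g'.appLE V'.1 W.1 hg).hom s') ?_]
  · rw [show x.ev W.1 (hWU.trans inf_le_left) ((T.g'.appLE V'.1 W.1 hg).hom s') = 0 from
      x.2.2.1 ⟨W.1, hWU.trans inf_le_left⟩ V'.1 hg s', map_zero, map_zero]
  · have hg2 : T.i ⁻¹ᵁ W.1 ≤ T.g ⁻¹ᵁ (T.j ⁻¹ᵁ V'.1) := by
      rw [← Scheme.Hom.comp_preimage, ← T.isPullback.w]; exact pre_mono hg
    have e1 : T.g'.appLE V'.1 W.1 hg ≫ T.i.app W.1 =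
        T.j.app V'.1 ≫ T.g.appLE (T.j ⁻¹ᵁ V'.1) (T.i ⁻¹ᵁ W.1) hg2 := by
      rw [Scheme.Hom.app_eq_appLE, Scheme.Hom.app_eq_appLE, Scheme.Hom.appLE_comp_appLE,
        Scheme.Hom.appLE_comp_appLE]
      simp only [T.isPullback.w]
    refine (congr(($e1).hom s')).trans ?_
    change (T.g.appLE _ _ hg2).hom ((T.j.app V'.1).hom s') = _
    rw [hs']
    have e2 := Scheme.Hom.map_appLE T.g hg2 (homOfLE hVV).op
    have e3 := Scheme.Hom.appLE_map T.g h (homOfLE (hWW'.trans inf_le_left)).op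
    exact congr(($(e2.trans e3.symm)).hom s)

/-- On a small affine open the ideal of D is the image of the ideal of D', so the lift can be chosen
in the latter, which the vector field preserves. -/
lemma redDer_mem_ideal {U : T.X'.Opens} (x : LogDer T.g' T.D' U) (W' : T.X.affineOpens)
    (hW' : W'.1 ≤ T.i ⁻¹ᵁ U) (a : Γ(T.X, W'.1)) (ha : a ∈ T.D.ideal W') :
    redDer x W'.1 hW' a ∈ T.D.ideal W' := by
  refine mem_ideal_of_locally _ _ _ fun y hy => ?_
  obtain ⟨W, hWU, hWW', hyW⟩ := exists_affine_pre_le hW' hy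
  let W₁ : T.X.affineOpens := ⟨T.i ⁻¹ᵁ W.1, W.2.preimage T.i⟩
  have e : T.D.ideal W₁ = (T.D'.ideal W).map (red W.1) := by
    refine (comap_ideal T.D' T.i W₁ W le_rfl).trans ?_
    rw [← Scheme.Hom.app_eq_appLE]; rfl
  have ha1 : resO hWW' a ∈ T.D.ideal W₁ :=
    Scheme.IdealSheafData.ideal_le_comap_ideal T.D (U := W₁) (V := W') hWW' ha
  rw [e, Ideal.mem_map_iff_of_surjective _ (red_surjective W)] at ha1
  obtain ⟨a', ha', h⟩ := ha1
  refine ⟨W₁, hWW', hyW, ?_⟩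
  rw [redDer_spec x W'.1 hW' a W.1 hWU hWW' a' h, e]
  exact Ideal.mem_map_of_mem _ (x.2.2.2 W hWU a' ha')

/-- Together with `VF.ext_fst` this identifies `VF U` with the logarithmic vector fields on X', so
the forms in `DR` can be evaluated on any of these. -/
lemma exists_vf {U : T.X'.Opens} (x : LogDer T.g' T.D' U) : ∃ y : T.VF U, y.fst = x := by
  refine ⟨⟨(x, ⟨fun W => redDerivation x W.1 W.2, fun W W' h a => redDer_res x W.2 h a,
    fun W V h s => redDer_appLE x W.1 W.2 V h s, fun W h a ha => redDer_mem_ideal x W h a ha⟩),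
    fun W h a => ?_⟩, rfl⟩
  have := redDer_spec x _ (pre_mono h) (red W a) W h le_rfl a (resO_self _).symm
  rw [resO_self] at this
  exact this.symm

/-- The vector field with a given first component. -/
def toVF {U : T.X'.Opens} (x : LogDer T.g' T.D' U) : T.VF U := (exists_vf x).choose

lemma toVF_fst {U : T.X'.Opens} (x : LogDer T.g' T.D' U) : (toVF x).fst = x :=
  (exists_vf x).choose_spec

lemma VF.snd_eq {U : T.X'.Opens} {x y : T.VF U} (h : x.fst = y.fst) : x.snd = y.snd := by
  refine LogDer.ext fun W' hW' a => eq_of_resO _ _ fun z hz => ?_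
  obtain ⟨W, hWU, hWW', hyW⟩ := exists_affine_pre_le hW' hz
  obtain ⟨a', ha'⟩ := red_surjective W (resO hWW' a)
  refine ⟨_, hWW', hyW, ?_⟩
  rw [LogDer.res_ev, LogDer.res_ev, ← ha', ← VF.red_fst x W.1 hWU a', ← VF.red_fst y W.1 hWU a', h]

lemma VF.ext_fst {U : T.X'.Opens} {x y : T.VF U} (h : x.fst = y.fst) : x = y :=
  VF.ext h (VF.snd_eq h)

end ThickenedPair
end FilteredDeRham

end

section

namespace FilteredDeRham

/-! ### Frames -/

section Frames

variable {X : Scheme.{u}} {V : X.Modules} {U : X.Opens} {n : ℕ} {e : Fin n → Γ(V, U)}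

lemma resM_sum_smul {W W' : X.Opens} (h : W' ≤ W) (a : Fin n → Γ(X, W)) (v : Fin n → Γ(V, W)) :
    resM V h (∑ k, a k • v k) = ∑ k, resO h (a k) • resM V h (v k) := by
  rw [map_sum]
  exact Finset.sum_congr rfl fun k _ => resM_smul V h _ _

lemma isFrame_of (h₁ : ∀ (W : X.Opens) (h : W ≤ U) (v : Γ(V, W)), ∃ a : Fin n → Γ(X, W),
      ∑ k, a k • resM V h (e k) = v)
    (h₂ : ∀ (W : X.Opens) (h : W ≤ U) (a : Fin n → Γ(X, W)),
      ∑ k, a k • resM V h (e k) = 0 → ∀ k, a k = 0) : IsFrame V U e := fun W h => by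
  refine ⟨Fintype.linearIndependent_iff.2 fun a ha => h₂ W h a ha, ?_⟩
  refine eq_top_iff.2 fun v _ => ?_
  obtain ⟨a, rfl⟩ := h₁ W h v
  exact Submodule.sum_mem _ fun k _ => Submodule.smul_mem _ _ (Submodule.subset_span ⟨k, rfl⟩)

namespace IsFrame

/-- The coordinates with respect to a frame. -/
def coord (he : IsFrame V U e) {W : X.Opens} (h : W ≤ U) : Γ(V, W) ≃ₗ[Γ(X, W)] (Fin n → Γ(X, W)) :=
  (Module.Basis.mk (he W h).1 (he W h).2.ge).equivFun

lemma sum_coord (he : IsFrame V U e) {W : X.Opens} (h : W ≤ U) (v : Γ(V, W)) :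
    ∑ k, he.coord h v k • resM V h (e k) = v := by
  refine (Finset.sum_congr rfl fun k _ => ?_).trans
    ((Module.Basis.mk (he W h).1 (he W h).2.ge).sum_equivFun v)
  rw [Module.Basis.mk_apply]
  rfl

lemma coord_eq (he : IsFrame V U e) {W : X.Opens} (h : W ≤ U) (v : Γ(V, W)) (a : Fin n → Γ(X, W))
    (ha : ∑ k, a k • resM V h (e k) = v) : he.coord h v = a := by
  have := (Module.Basis.mk (he W h).1 (he W h).2.ge).equivFun_symm_apply a
  simp only [Module.Basis.mk_apply] at this
  rw [ha] at this
  rw [← this]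
  exact LinearEquiv.apply_symm_apply _ _

lemma coord_res (he : IsFrame V U e) {W W' : X.Opens} (h : W ≤ U) (h' : W' ≤ W) (v : Γ(V, W)) :
    he.coord (h'.trans h) (resM V h' v) = fun k => resO h' (he.coord h v k) := by
  refine he.coord_eq _ _ _ ?_
  conv_rhs => rw [← he.sum_coord h v]
  rw [resM_sum_smul]
  simp only [resM_resM]

lemma coord_self (he : IsFrame V U e) {W : X.Opens} (h : W ≤ U) (l : Fin n) :
    he.coord h (resM V h (e l)) = Pi.single l 1 := by
  refine he.coord_eq _ _ _ ?_
  rw [Finset.sum_eq_single l]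
  · rw [Pi.single_eq_same, one_smul]
  · intro k _ hk
    rw [Pi.single_eq_of_ne hk, zero_smul]
  · simp

lemma restrict (he : IsFrame V U e) {W : X.Opens} (h : W ≤ U) :
    IsFrame V W (fun k => resM V h (e k)) := fun W' h' => by
  have := he W' (h'.trans h)
  simpa only [resM_resM] using this

end IsFrame

/-! ### The ring of endomorphisms of a module, and gluing in it. -/

namespace EndSec

instance : Mul (EndSec V U) where
  mul g g' := ⟨fun W => g.1 W * g'.1 W, fun W W' h v => by
    change resM V h (g.ev W.1 W.2 (g'.ev W.1 W.2 v)) = g.ev W'.1 W'.2 (g'.ev W'.1 W'.2 (resM V h v))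
    rw [g.res_ev, g'.res_ev]⟩

instance : One (EndSec V U) where
  one := ⟨fun _ => 1, fun _ _ _ _ => rfl⟩

@[simp] lemma mul_ev (g g' : EndSec V U) (W : X.Opens) (h : W ≤ U) (v : Γ(V, W)) :
    (g * g').ev W h v = g.ev W h (g'.ev W h v) := rfl

instance : Ring (EndSec V U) :=
  { (inferInstance : AddCommGroup (EndSec V U)),
    (inferInstance : Mul (EndSec V U)), (inferInstance : One (EndSec V U)) with
    mul_assoc := fun _ _ _ => by ext; rfl
    one_mul := fun _ => by ext; rfl
    mul_one := fun _ => by ext; rfl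
    left_distrib := fun _ _ _ => by ext; simp
    right_distrib := fun _ _ _ => by ext; simp
    zero_mul := fun _ => by ext; simp
    mul_zero := fun _ => by ext; simp }

lemma res_mul {W : X.Opens} (h : W ≤ U) (g g' : EndSec V U) :
    (g * g').res h = g.res h * g'.res h := rfl

lemma res_res {W W' : X.Opens} (h : W ≤ U) (h' : W' ≤ W) (g : EndSec V U) :
    (g.res h).res h' = g.res (h'.trans h) := rfl

lemma res_smul {W : X.Opens} (h : W ≤ U) (a : Γ(X, U)) (g : EndSec V U) :
    (a • g).res h = resO h a • g.res h := by
  ext W' h' v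
  simp only [ev_res, smul_ev, resO_resO]

lemma sum_ev {ι : Type*} (s : Finset ι) (g : ι → EndSec V U) (W : X.Opens) (h : W ≤ U)
    (v : Γ(V, W)) : (∑ k ∈ s, g k).ev W h v = ∑ k ∈ s, (g k).ev W h v := by
  induction s using Finset.cons_induction with
  | empty => rfl
  | cons a s ha ih => rw [Finset.sum_cons, Finset.sum_cons, add_ev, ih]

lemma ext_local {g g' : EndSec V U}
    (H : ∀ x ∈ U, ∃ (W : X.Opens) (h : W ≤ U), x ∈ W ∧ g.res h = g'.res h) : g = g' := by
  ext W hW v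
  refine eq_of_resM V _ _ fun x hx => ?_
  obtain ⟨W', h, hx', e⟩ := H x (hW hx)
  refine ⟨W ⊓ W', inf_le_left, ⟨hx, hx'⟩, ?_⟩
  rw [res_ev, res_ev]
  exact congr(($e).ev (W ⊓ W') inf_le_right _)

lemma ext_frame (he : IsFrame V U e) {g g' : EndSec V U}
    (H : ∀ k, g.ev U le_rfl (e k) = g'.ev U le_rfl (e k)) : g = g' := by
  ext W hW v
  rw [← he.sum_coord hW v, map_sum, map_sum]
  refine Finset.sum_congr rfl fun k _ => ?_
  rw [map_smul, map_smul, ← g.res_ev le_rfl, ← g'.res_ev le_rfl, H]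

/-- Endomorphisms may be glued along an open cover. -/
lemma exists_glue {P : ∀ W : X.Opens, EndSec V W → Prop}
    (hloc : ∀ x ∈ U, ∃ W : X.Opens, W ≤ U ∧ x ∈ W ∧ ∃ s, P W s)
    (hres : ∀ (W W' : X.Opens) (h : W' ≤ W) (s : EndSec V W), W ≤ U → P W s → P W' (s.res h))
    (huniq : ∀ (W : X.Opens), W ≤ U → ∀ s t, P W s → P W t → s = t) :
    ∃ s : EndSec V U, ∀ (W : X.Opens) (h : W ≤ U) t, P W t → s.res h = t := by
  have key : ∀ (W : X.Opens) (hW : W ≤ U) (v : Γ(V, W)), ∃ w : Γ(V, W),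
      ∀ (W' : X.Opens) (h : W' ≤ W) t, P W' t → resM V h w = t.ev W' le_rfl (resM V h v) := by
    intro W hW v
    obtain ⟨w, hw⟩ := exists_glueM V W (fun W₁ s => ∀ (W' : X.Opens) (h : W' ≤ W₁) (h' : W' ≤ W) t,
        P W' t → resM V h s = t.ev W' le_rfl (resM V h' v))
      (fun x hx => by
        obtain ⟨W₁, h₁, hx₁, t, ht⟩ := hloc x (hW hx)
        refine ⟨W ⊓ W₁, inf_le_left, ⟨hx, hx₁⟩, t.ev _ inf_le_right (resM V inf_le_left v), ?_⟩
        intro W' h h' t' ht'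
        have : t.res (h.trans inf_le_right) = t' :=
          huniq W' (h'.trans hW) _ _ (hres _ _ _ _ h₁ ht) ht'
        rw [← this, res_ev, resM_resM]; rfl)
      (fun W₁ W₂ h s _ hs W' h₁ h₂ t ht => by
        rw [resM_resM]; exact hs W' _ h₂ t ht)
      (fun W₁ h₁ s t hs ht => by
        refine eq_of_resM V _ _ fun x hx => ?_
        obtain ⟨W₂, h₂, hx₂, t₂, ht₂⟩ := hloc x (hW (h₁ hx))
        refine ⟨W₁ ⊓ W₂, inf_le_left, ⟨hx, hx₂⟩, ?_⟩
        have := hres _ _ (inf_le_right : W₁ ⊓ W₂ ≤ W₂) _ h₂ ht₂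
        rw [hs _ inf_le_left (inf_le_left.trans h₁) _ this,
          ht _ inf_le_left (inf_le_left.trans h₁) _ this])
    refine ⟨w, fun W' h t ht => hw W' h _ fun W₂ h₂ h₂' t₂ ht₂ => ?_⟩
    have : t.res h₂ = t₂ := huniq W₂ (h₂'.trans hW) _ _ (hres _ _ _ _ (h.trans hW) ht) ht₂
    rw [← this, res_ev, resM_resM]; rfl
  choose f hf using key
  have uniq : ∀ (W : X.Opens) (hW : W ≤ U) (w w' : Γ(V, W)),
      (∀ (W' : X.Opens) (h : W' ≤ W) t, P W' t → resM V h w = resM V h w') → w = w' := by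
    intro W hW w w' H
    refine eq_of_resM V _ _ fun x hx => ?_
    obtain ⟨W₂, h₂, hx₂, t₂, ht₂⟩ := hloc x (hW hx)
    exact ⟨W ⊓ W₂, inf_le_left, ⟨hx, hx₂⟩,
      H _ inf_le_left _ (hres _ _ (inf_le_right : W ⊓ W₂ ≤ W₂) _ h₂ ht₂)⟩
  refine ⟨⟨fun W =>
    { toFun := f W.1 W.2
      map_add' := fun v w => uniq W.1 W.2 _ _ fun W' h t ht => by
        simp only [hf W.1 W.2 _ W' h t ht, map_add]
      map_smul' := fun a v => uniq W.1 W.2 _ _ fun W' h t ht => by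
        rw [RingHom.id_apply, hf W.1 W.2 _ W' h t ht, resM_smul, resM_smul, map_smul,
          hf W.1 W.2 _ W' h t ht] }, fun W W' h v => uniq W'.1 W'.2 _ _ fun W'' h'' t ht => by
      change resM V h'' (resM V h (f W.1 W.2 v)) = resM V h'' (f W'.1 W'.2 (resM V h v))
      rw [resM_resM, hf W.1 W.2 _ W'' (h''.trans h) t ht, hf W'.1 W'.2 _ W'' h'' t ht,
        resM_resM]⟩, ?_⟩
  intro W h t ht
  ext W' h' v
  refine uniq W' (h'.trans h) _ _ fun W'' h'' t' ht' => ?_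
  refine (hf W' _ v W'' h'' t' ht').trans ?_
  have : t.res (h''.trans h') = t' :=
    huniq W'' (h''.trans (h'.trans h)) _ _ (hres _ _ _ _ h ht) ht'
  rw [← this, res_ev]; rfl

end EndSec

/-- The endomorphism with given values on a frame. -/
def IsFrame.toEnd (he : IsFrame V U e) (w : Fin n → Γ(V, U)) : EndSec V U :=
  ⟨fun W =>
    { toFun := fun v => ∑ k, he.coord W.2 v k • resM V W.2 (w k)
      map_add' := fun v v' => by
        simp only [map_add, Pi.add_apply, add_smul, Finset.sum_add_distrib]
      map_smul' := fun a v => by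
        simp only [map_smul, Pi.smul_apply, smul_assoc, Finset.smul_sum, RingHom.id_apply] },
    fun W W' h v => by
      change resM V h (∑ k, he.coord W.2 v k • resM V W.2 (w k)) =
        ∑ k, he.coord W'.2 (resM V h v) k • resM V W'.2 (w k)
      rw [resM_sum_smul, he.coord_res W.2 h]
      simp only [resM_resM]⟩

lemma IsFrame.toEnd_ev (he : IsFrame V U e) (w : Fin n → Γ(V, U)) (W : X.Opens) (h : W ≤ U)
    (v : Γ(V, W)) : (he.toEnd w).ev W h v = ∑ k, he.coord h v k • resM V h (w k) := rfl

lemma IsFrame.toEnd_apply (he : IsFrame V U e) (w : Fin n → Γ(V, U)) (k : Fin n) :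
    (he.toEnd w).ev U le_rfl (e k) = w k := by
  have := he.coord_self le_rfl k
  rw [resM_self] at this
  rw [IsFrame.toEnd_ev, this, Finset.sum_eq_single k]
  · rw [Pi.single_eq_same, one_smul, resM_self]
  · intro l _ hl
    rw [Pi.single_eq_of_ne hl, zero_smul]
  · simp

end Frames

/-! ### Restriction of modules to `X` -/

namespace ThickenedPair

variable {T : ThickenedPair.{u}} {V' : T.X'.Modules} {V : T.X.Modules}

lemma restrictTo_res (φ : (Scheme.Modules.pullback T.i).obj V' ⟶ V) {U W : T.X'.Opens}
    (h : W ≤ U) (v : Γ(V', U)) :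
    restrictTo φ W (resM V' h v) = resM V (pre_mono h) (restrictTo φ U v) :=
  app_resM ((Scheme.Modules.pullbackPushforwardAdjunction T.i).homEquiv V' V φ) h v

lemma restrictTo_smul (φ : (Scheme.Modules.pullback T.i).obj V' ⟶ V) {U : T.X'.Opens}
    (a : Γ(T.X', U)) (v : Γ(V', U)) :
    restrictTo φ U (a • v) = red U a • restrictTo φ U v :=
  Scheme.Modules.Hom.app_smul
    ((Scheme.Modules.pullbackPushforwardAdjunction T.i).homEquiv V' V φ) a v

lemma restrictTo_comp (φ : (Scheme.Modules.pullback T.i).obj V' ⟶ V) {N : T.X.Modules} (g : V ⟶ N)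
    (U : T.X'.Opens) (v : Γ(V', U)) :
    restrictTo (φ ≫ g) U v = g.app (T.i ⁻¹ᵁ U) (restrictTo φ U v) := by
  have := (Scheme.Modules.pullbackPushforwardAdjunction T.i).homEquiv_naturality_right φ g
  exact congr((Scheme.Modules.Hom.app $this U).hom v)

lemma restrictTo_ext {φ ψ : (Scheme.Modules.pullback T.i).obj V' ⟶ V}
    (h : ∀ U v, restrictTo φ U v = restrictTo ψ U v) : φ = ψ :=
  ((Scheme.Modules.pullbackPushforwardAdjunction T.i).homEquiv V' V).injective
    (mod_hom_ext fun U v => h U v)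

lemma restrictTo_map {V'' : T.X'.Modules} (f : V'' ⟶ V')
    (φ : (Scheme.Modules.pullback T.i).obj V' ⟶ V) (U : T.X'.Opens) (v : Γ(V'', U)) :
    restrictTo ((Scheme.Modules.pullback T.i).map f ≫ φ) U v = restrictTo φ U (f.app U v) := by
  have := (Scheme.Modules.pullbackPushforwardAdjunction T.i).homEquiv_naturality_left f φ
  exact congr((Scheme.Modules.Hom.app $this U).hom v)

/-- The morphism `V'|_X → V` with given restriction map on sections. -/
def ofRestrict (ρ : ∀ U : T.X'.Opens, Γ(V', U) →+ Γ(V, T.i ⁻¹ᵁ U))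
    (h₁ : ∀ U (a : Γ(T.X', U)) v, ρ U (a • v) = red U a • ρ U v)
    (h₂ : ∀ (U W : T.X'.Opens) (h : W ≤ U) v, ρ W (resM V' h v) = resM V (pre_mono h) (ρ U v)) :
    (Scheme.Modules.pullback T.i).obj V' ⟶ V :=
  ((Scheme.Modules.pullbackPushforwardAdjunction T.i).homEquiv V' V).symm
    (modHom V' ((Scheme.Modules.pushforward T.i).obj V)
      (fun U => { ρ U with map_smul' := h₁ U }) h₂)

lemma restrictTo_ofRestrict (ρ : ∀ U : T.X'.Opens, Γ(V', U) →+ Γ(V, T.i ⁻¹ᵁ U)) (h₁ h₂)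
    (U : T.X'.Opens) (v : Γ(V', U)) : restrictTo (ofRestrict ρ h₁ h₂) U v = ρ U v := by
  unfold restrictTo ofRestrict
  rw [Equiv.apply_symm_apply]
  rfl

variable (φ : (Scheme.Modules.pullback T.i).obj V' ⟶ V) [IsIso φ]


/-- V is identified with the pullback of V', so by adjunction a map out of V is prescribed by its
values on sections restricted from V'; `hom_ext_of_restrict` is the matching uniqueness. -/
lemma exists_hom_of_restrict {N : T.X.Modules} (ρ : ∀ U : T.X'.Opens, Γ(V', U) →+ Γ(N, T.i ⁻¹ᵁ U))
    (h₁ : ∀ U (a : Γ(T.X', U)) v, ρ U (a • v) = red U a • ρ U v)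
    (h₂ : ∀ (U W : T.X'.Opens) (h : W ≤ U) v, ρ W (resM V' h v) = resM N (pre_mono h) (ρ U v)) :
    ∃ g : V ⟶ N, ∀ U v, g.app (T.i ⁻¹ᵁ U) (restrictTo φ U v) = ρ U v := by
  refine ⟨inv φ ≫ ofRestrict ρ h₁ h₂, fun U v => ?_⟩
  rw [← restrictTo_comp, IsIso.hom_inv_id_assoc, restrictTo_ofRestrict]

lemma hom_ext_of_restrict {N : T.X.Modules} {g₁ g₂ : V ⟶ N}
    (h : ∀ U v, g₁.app (T.i ⁻¹ᵁ U) (restrictTo φ U v) = g₂.app (T.i ⁻¹ᵁ U) (restrictTo φ U v)) :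
    g₁ = g₂ := by
  rw [← cancel_epi φ]
  exact restrictTo_ext fun U v => by rw [restrictTo_comp, restrictTo_comp, h]

end ThickenedPair
end FilteredDeRham

end

section

namespace FilteredDeRham

/-- A morphism to a module given by its sections. -/
def ModData.homTo {X : Scheme.{u}} (M : X.Modules) (N : ModData X) (f : ∀ U, Γ(M, U) → N.obj U)
    (h₁ : ∀ U v w, f U (v + w) = f U v + f U w)
    (h₂ : ∀ U (a : Γ(X, U)) v, f U (a • v) = a • f U v)
    (h₃ : ∀ (U W : X.Opens) (h : W ≤ U) v, f W (resM M h v) = N.res h (f U v)) :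
    M ⟶ N.toModules :=
  modHom _ _ (fun U => (N.equiv U).symm.toLinearMap.comp
    ({ toFun := f U, map_add' := h₁ U, map_smul' := h₂ U } : Γ(M, U) →ₗ[Γ(X, U)] N.obj U))
    fun U W h v => congrArg (N.equiv W).symm (h₃ U W h v)

namespace ThickenedPair

variable {T : ThickenedPair.{u}} {V' : T.X'.Modules} {V : T.X.Modules}

/-! ### Restriction of frames -/

lemma restrictTo_sum (φ : (Scheme.Modules.pullback T.i).obj V' ⟶ V) {U W : T.X'.Opens} (h : W ≤ U)
    {n : ℕ} (a : Fin n → Γ(T.X', W)) (e : Fin n → Γ(V', U)) :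
    restrictTo φ W (∑ k, a k • resM V' h (e k)) =
      ∑ k, red W (a k) • resM V (pre_mono h) (restrictTo φ U (e k)) := by
  rw [map_sum]
  exact Finset.sum_congr rfl fun k _ => by rw [restrictTo_smul, restrictTo_res]

/-- The map `v ↦ v|_{W ∩ U}`. -/
def toMeet {X : Scheme.{u}} (V : X.Modules) (U : X.Opens) : V ⟶ (meetData V U).toModules :=
  ModData.homTo _ _ (fun W v => resM V inf_le_left v) (fun W v w => map_add _ v w)
    (fun W a v => resM_smul V _ a v) fun W W' h v => by
      change resM V _ (resM V _ v) = resM V _ (resM V _ v)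
      rw [resM_resM, resM_resM]

/-- The coordinates of a section on the intersection with the domain of a frame. -/
def redCoord {U : T.X'.Opens} {n : ℕ} {e : Fin n → Γ(V', U)} (he : IsFrame V' U e)
    (W : T.X'.Opens) : Γ(V', W) →+ Γ((freeData T.X (T.i ⁻¹ᵁ U) n).toModules, T.i ⁻¹ᵁ W) :=
  AddMonoidHom.mk' (fun v => ((freeData T.X (T.i ⁻¹ᵁ U) n).equiv (T.i ⁻¹ᵁ W)).symm
    fun k => red (W ⊓ U) (he.coord inf_le_right (resM V' inf_le_left v) k)) fun v w => by
      refine (congrArg _ (funext fun k => ?_)).trans (map_add _ _ _)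
      rw [map_add, map_add, Pi.add_apply, map_add]
      rfl

lemma redCoord_smul {U : T.X'.Opens} {n : ℕ} {e : Fin n → Γ(V', U)} (he : IsFrame V' U e)
    (W : T.X'.Opens) (a : Γ(T.X', W)) (v : Γ(V', W)) :
    redCoord he W (a • v) = red W a • redCoord he W v := by
  refine ((freeData T.X (T.i ⁻¹ᵁ U) n).equiv (T.i ⁻¹ᵁ W)).injective (funext fun k => ?_)
  refine Eq.trans ?_ (congrFun (LinearEquiv.map_smul ((freeData T.X (T.i ⁻¹ᵁ U) n).equiv
    (T.i ⁻¹ᵁ W)) (red W a) (redCoord he W v)).symm k)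
  change red (W ⊓ U) (he.coord inf_le_right (resM V' inf_le_left (a • v)) k) =
    resO (pre_mono (inf_le_left : W ⊓ U ≤ W)) (red W a) *
      red (W ⊓ U) (he.coord inf_le_right (resM V' inf_le_left v) k)
  rw [resM_smul, map_smul, Pi.smul_apply, smul_eq_mul, map_mul, red_resO]

lemma redCoord_res {U : T.X'.Opens} {n : ℕ} {e : Fin n → Γ(V', U)} (he : IsFrame V' U e)
    (W W' : T.X'.Opens) (h : W' ≤ W) (v : Γ(V', W)) :
    redCoord he W' (resM V' h v) =
      resM (freeData T.X (T.i ⁻¹ᵁ U) n).toModules (pre_mono h) (redCoord he W v) := by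
  refine ((freeData T.X (T.i ⁻¹ᵁ U) n).equiv (T.i ⁻¹ᵁ W')).injective (funext fun k => ?_)
  change red (W' ⊓ U) (he.coord inf_le_right (resM V' inf_le_left (resM V' h v)) k) =
    resO (pre_mono (inf_le_inf_right U h))
      (red (W ⊓ U) (he.coord inf_le_right (resM V' inf_le_left v) k))
  have : resM V' (inf_le_left : W' ⊓ U ≤ W') (resM V' h v) =
    resM V' (inf_le_inf_right U h) (resM V' (inf_le_left : W ⊓ U ≤ W) v) := by
    rw [resM_resM, resM_resM]
  rw [this, he.coord_res inf_le_right, red_resO]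

/-- The combination of sections over `U` with given coefficients. -/
def freeComb {X : Scheme.{u}} {V : X.Modules} {U : X.Opens} {n : ℕ} (e : Fin n → Γ(V, U))
    (W : X.Opens) (s : Γ((freeData X U n).toModules, W)) : Γ(V, W ⊓ U) :=
  ∑ k, (show Γ(X, W ⊓ U) from (freeData X U n).equiv W s k) • resM V inf_le_right (e k)

lemma freeComb_add {X : Scheme.{u}} {V : X.Modules} {U : X.Opens} {n : ℕ} (e : Fin n → Γ(V, U))
    (W : X.Opens) (s t : Γ((freeData X U n).toModules, W)) :
    freeComb e W (s + t) = freeComb e W s + freeComb e W t := by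
  unfold freeComb
  refine (Finset.sum_congr rfl fun k _ => ?_).trans Finset.sum_add_distrib
  rw [map_add]
  exact add_smul _ _ _

lemma freeComb_smul {X : Scheme.{u}} {V : X.Modules} {U : X.Opens} {n : ℕ} (e : Fin n → Γ(V, U))
    (W : X.Opens) (a : Γ(X, W)) (s : Γ((freeData X U n).toModules, W)) :
    freeComb e W (a • s) = resO (inf_le_left : W ⊓ U ≤ W) a • freeComb e W s := by
  unfold freeComb
  refine (Finset.sum_congr rfl fun k _ => ?_).trans Finset.smul_sum.symm
  rw [map_smul]
  exact mul_smul (resO (inf_le_left : W ⊓ U ≤ W) a) _ _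

lemma freeComb_res {X : Scheme.{u}} {V : X.Modules} {U : X.Opens} {n : ℕ} (e : Fin n → Γ(V, U))
    {W W' : X.Opens} (h : W' ≤ W) (s : Γ((freeData X U n).toModules, W)) :
    freeComb e W' (resM (freeData X U n).toModules h s) =
      resM V (inf_le_inf_right U h) (freeComb e W s) := by
  unfold freeComb
  refine Eq.trans ?_ (resM_sum_smul (inf_le_inf_right U h) _ _).symm
  refine Finset.sum_congr rfl fun k _ => ?_
  rw [resM_resM]
  rfl

/-- Evaluation of coefficients followed by combination of sections. -/
def freeCombHom {X : Scheme.{u}} {V N : X.Modules} {U : X.Opens} {n : ℕ} (e : Fin n → Γ(V, U))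
    (g : N ⟶ (freeData X U n).toModules) : N ⟶ (meetData V U).toModules :=
  ModData.homTo _ _ (fun W v => freeComb e W (g.app W v))
    (fun W v w => by rw [map_add]; exact freeComb_add e W _ _)
    (fun W a v => by rw [Scheme.Modules.Hom.app_smul]; exact freeComb_smul e W a _)
    fun W W' h v => by rw [app_resM]; exact freeComb_res e h _

/-- The pullback is known only by its universal property. Applied to the coordinate map of V', this
yields coordinates on V; both halves of the frame property are read off from them. -/
lemma isFrame_restrictTo (φ : (Scheme.Modules.pullback T.i).obj V' ⟶ V) [IsIso φ] {U : T.X'.Opens}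
    {n : ℕ} {e : Fin n → Γ(V', U)} (he : IsFrame V' U e) :
    IsFrame V (T.i ⁻¹ᵁ U) (fun k => restrictTo φ U (e k)) := by
  obtain ⟨g, hg⟩ := exists_hom_of_restrict φ (redCoord he) (redCoord_smul he) (redCoord_res he)
  -- Taking coordinates and recombining is restriction to the domain of the frame. It suffices to
  -- check this on sections restricted from V'. This gives spanning.
  have key : toMeet V (T.i ⁻¹ᵁ U) = freeCombHom (fun k => restrictTo φ U (e k)) g := by
    refine hom_ext_of_restrict φ fun W v => ?_
    change resM V inf_le_left (restrictTo φ W v) = freeComb _ (T.i ⁻¹ᵁ W) (g.app (T.i ⁻¹ᵁ W) _)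
    rw [hg]
    refine (restrictTo_res φ (inf_le_left : W ⊓ U ≤ W) v).symm.trans ?_
    rw [← he.sum_coord inf_le_right (resM V' inf_le_left v), restrictTo_sum]
    rfl
  refine isFrame_of (fun W h v => ?_) fun W h a ha k => ?_
  · have h1 : resM V (inf_le_left : W ⊓ T.i ⁻¹ᵁ U ≤ W) v =
        freeComb (fun k => restrictTo φ U (e k)) W (g.app W v) := congr(($key).app W v)
    have h2 := congrArg (resM V (show W ≤ W ⊓ T.i ⁻¹ᵁ U from le_inf le_rfl h)) h1
    rw [resM_resM, resM_self, freeComb, resM_sum_smul] at h2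
    simp only [resM_resM] at h2
    exact ⟨_, h2.symm⟩
  -- For independence, the k-th coordinate function is applied to the relation; it takes the values
  -- 0 and 1 on the frame.
  · let c (W : T.X.Opens) (v : Γ(V, W)) : Γ(T.X, W ⊓ T.i ⁻¹ᵁ U) :=
      (freeData T.X (T.i ⁻¹ᵁ U) n).equiv W (g.app W v) k
    have c_add (v w : Γ(V, W)) : c W (v + w) = c W v + c W w := by
      change (freeData T.X (T.i ⁻¹ᵁ U) n).equiv W (g.app W (v + w)) k = _
      rw [map_add, map_add]; rfl
    have c_smul (b : Γ(T.X, W)) (v : Γ(V, W)) : c W (b • v) = resO inf_le_left b * c W v := by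
      change (freeData T.X (T.i ⁻¹ᵁ U) n).equiv W (g.app W (b • v)) k = _
      rw [Scheme.Modules.Hom.app_smul, map_smul]; rfl
    have c_e (l : Fin n) : c W (resM V h (restrictTo φ U (e l))) =
        (Pi.single l 1 : Fin n → Γ(T.X, W ⊓ T.i ⁻¹ᵁ U)) k := by
      have h1 : c (T.i ⁻¹ᵁ U) (restrictTo φ U (e l)) = (Pi.single l 1 : Fin n → _) k := by
        change (freeData T.X (T.i ⁻¹ᵁ U) n).equiv _ (g.app _ (restrictTo φ U (e l))) k = _
        rw [hg]
        change red (U ⊓ U) (he.coord inf_le_right (resM V' inf_le_left (e l)) k) = _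
        rw [he.coord_self inf_le_left l, Pi.single_apply, Pi.single_apply]
        split_ifs
        · exact map_one _
        · exact map_zero _
      have h2 : c W (resM V h (restrictTo φ U (e l))) =
          resO (inf_le_inf_right _ h) (c (T.i ⁻¹ᵁ U) (restrictTo φ U (e l))) := by
        change (freeData T.X (T.i ⁻¹ᵁ U) n).equiv _ (g.app _ (resM V h _)) k = _
        rw [app_resM]
        rfl
      rw [h2, h1, Pi.single_apply, Pi.single_apply]
      split_ifs
      · exact map_one _
      · exact map_zero _
    have h1 : ∑ l, c W (a l • resM V h (restrictTo φ U (e l))) = 0 := by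
      have := map_sum (AddMonoidHom.mk' (c W) c_add)
        (fun l => a l • resM V h (restrictTo φ U (e l))) Finset.univ
      rw [ha, map_zero] at this
      exact this.symm
    simp only [c_smul, c_e] at h1
    rw [Finset.sum_eq_single k] at h1
    · rw [Pi.single_eq_same, mul_one] at h1
      have := congrArg (resO (show W ≤ W ⊓ T.i ⁻¹ᵁ U from le_inf le_rfl h)) h1
      rwa [resO_resO, resO_self, map_zero] at this
    · intro l _ hl
      rw [Pi.single_eq_of_ne hl.symm, mul_zero]
    · simp

end ThickenedPair
end FilteredDeRham

end

section

namespace FilteredDeRham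

/-! ### Chains of idempotents in a ring with a square-zero ideal -/

section Chains

variable {R : Type*} [Ring R]

/-- A decreasing chain of idempotents from `1` to `0`. -/
structure IsChain (lo hi : ℤ) (π : ℤ → R) : Prop where
  mul (p q : ℤ) : π p * π q = π (max p q)
  one (p : ℤ) : p ≤ lo → π p = 1
  zero (p : ℤ) : hi ≤ p → π p = 0

/-- A two-sided ideal of square zero. -/
structure IsSqZero (N : AddSubgroup R) : Prop where
  mul_left (a : R) {n : R} : n ∈ N → a * n ∈ N
  mul_right (a : R) {n : R} : n ∈ N → n * a ∈ N
  sq {m n : R} : m ∈ N → n ∈ N → m * n = 0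

/-- Two chains which define the same filtration modulo `N`. -/
def SameMod (N : AddSubgroup R) (π π' : ℤ → R) : Prop :=
  ∀ p, π p * π' p - π' p ∈ N ∧ π' p * π p - π p ∈ N

/-- `α` maps the `q`-th step of the filtration to the `(q + p)`-th one. -/
def HasDeg (π : ℤ → R) (p : ℤ) (α : R) : Prop := ∀ q, π (q + p) * (α * π q) = α * π q

/-- `u` maps the filtration given by `π` to the one given by `π'`. -/
def MapsFil (π π' : ℤ → R) (u : R) : Prop := ∀ q, π' q * (u * π q) = u * π q

/-- The operator `D - K` satisfies Griffiths transversality. -/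
def IsGriff (π : ℤ → R) (D : R → R) (K : R) : Prop :=
  ∀ q w, π q * w = w → π (q - 1) * (D w - K * w) = D w - K * w

variable {lo hi : ℤ} {π π' π'' : ℤ → R} {N : AddSubgroup R}

lemma SameMod.symm (h : SameMod N π π') : SameMod N π' π := fun p => ⟨(h p).2, (h p).1⟩

namespace IsChain

lemma mul_of_le (h : IsChain lo hi π) {p q : ℤ} (hpq : p ≤ q) : π p * π q = π q := by
  rw [h.mul, max_eq_right hpq]

lemma mul_of_ge (h : IsChain lo hi π) {p q : ℤ} (hpq : q ≤ p) : π p * π q = π p := by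
  rw [h.mul, max_eq_left hpq]

lemma fix_mono (h : IsChain lo hi π) {p q : ℤ} (hpq : p ≤ q) {w : R} (hw : π q * w = w) :
    π p * w = w := by
  rw [← hw, ← mul_assoc, h.mul_of_le hpq]

lemma sum_Ico (f : ℤ → R) {a b : ℤ} (hab : a ≤ b) :
    ∑ p ∈ Finset.Ico a b, (f p - f (p + 1)) = f a - f b := by
  induction b, hab using Int.leInduction with
  | base => simp
  | succ b hb ih =>
    rw [← Finset.insert_Ico_right_eq_Ico_add_one hb, Finset.sum_insert (by simp), ih]
    abel

lemma sum_eq_one (h : IsChain lo hi π) (hlh : lo ≤ hi) :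
    ∑ p ∈ Finset.Ico lo hi, (π p - π (p + 1)) = 1 := by
  rw [sum_Ico π hlh, h.one lo le_rfl, h.zero hi le_rfl, sub_zero]

lemma proj_kappa (h : IsChain lo hi π) {q p : ℤ} (hqp : q ≤ p) :
    π q * (π p - π (p + 1)) = π p - π (p + 1) := by
  rw [mul_sub, h.mul_of_le hqp, h.mul_of_le (by lia)]

lemma kappa_proj_of_le (h : IsChain lo hi π) {q p : ℤ} (hqp : q ≤ p) :
    (π p - π (p + 1)) * π q = π p - π (p + 1) := by
  rw [sub_mul, h.mul_of_ge hqp, h.mul_of_ge (by lia)]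

lemma kappa_proj_of_lt (h : IsChain lo hi π) {q p : ℤ} (hqp : p < q) :
    (π p - π (p + 1)) * π q = 0 := by
  rw [sub_mul, h.mul_of_le hqp.le, h.mul_of_le (by lia), sub_self]

end IsChain

lemma HasDeg.zero (π : ℤ → R) (p : ℤ) : HasDeg π p 0 := fun q => by simp

lemma HasDeg.add {p : ℤ} {α β : R} (hα : HasDeg π p α) (hβ : HasDeg π p β) :
    HasDeg π p (α + β) := fun q => by rw [add_mul, mul_add, hα, hβ]

lemma HasDeg.neg {p : ℤ} {α : R} (hα : HasDeg π p α) : HasDeg π p (-α) := fun q => by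
  rw [neg_mul, mul_neg, hα]

lemma HasDeg.sub {p : ℤ} {α β : R} (hα : HasDeg π p α) (hβ : HasDeg π p β) :
    HasDeg π p (α - β) := by
  rw [sub_eq_add_neg]; exact hα.add hβ.neg

/-- An element which maps the filtration given by `π` to the one given by `π'`. -/
def chainTransition (lo hi : ℤ) (π π' : ℤ → R) : R :=
  ∑ p ∈ Finset.Ico lo hi, π' p * (π p - π (p + 1))

/-- The graded projectors κ_p = π_p − π_{p+1} sum to 1, and replacing κ_p by π'_p κ_p changes it by
an element of N, since π' fixes the image of π modulo N. -/
lemma chainTransition_mem (hlh : lo ≤ hi) (hN : IsSqZero N) (hπ : IsChain lo hi π)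
    (hs : SameMod N π π') : chainTransition lo hi π π' - 1 ∈ N := by
  rw [chainTransition, ← hπ.sum_eq_one hlh, ← Finset.sum_sub_distrib]
  refine sum_mem fun p _ => ?_
  have : π' p * (π p - π (p + 1)) - (π p - π (p + 1)) =
      (π' p * π p - π p) * (π p - π (p + 1)) := by
    rw [sub_mul, mul_assoc, hπ.proj_kappa le_rfl]
  rw [this]
  exact hN.mul_right _ (hs p).2

lemma chainTransition_mapsFil (hπ : IsChain lo hi π) (hπ' : IsChain lo hi π') :
    MapsFil π π' (chainTransition lo hi π π') := fun q => by
  rw [chainTransition, Finset.sum_mul, Finset.mul_sum]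
  refine Finset.sum_congr rfl fun p _ => ?_
  rcases le_or_gt q p with h | h
  · rw [mul_assoc, hπ.kappa_proj_of_le h, ← mul_assoc, hπ'.mul_of_le h]
  · rw [mul_assoc, hπ.kappa_proj_of_lt h, mul_zero, mul_zero]

lemma MapsFil.apply {u : R} (hu : MapsFil π π' u) {q : ℤ} {w : R} (hw : π q * w = w) :
    π' q * (u * w) = u * w := by
  rw [← hw, ← mul_assoc u, ← mul_assoc, hu q]

lemma MapsFil.of_apply (hπ : IsChain lo hi π) {u : R}
    (hu : ∀ q w, π q * w = w → π' q * (u * w) = u * w) : MapsFil π π' u := fun q =>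
  hu q _ (hπ.mul_of_le le_rfl)

lemma MapsFil.mul (hπ : IsChain lo hi π) {u v : R} (hu : MapsFil π π' u) (hv : MapsFil π' π'' v) :
    MapsFil π π'' (v * u) := MapsFil.of_apply hπ fun q w hw => by
  rw [mul_assoc]; exact hv.apply (hu.apply hw)

lemma IsSqZero.one_add_mul (hN : IsSqZero N) {m n : R} (hm : m ∈ N) (hn : n ∈ N) :
    (1 + m) * (1 + n) = 1 + (m + n) := by
  rw [mul_add, add_mul, add_mul, hN.sq hm hn]; simp; abel

lemma IsSqZero.one_sub_mul_one_add (hN : IsSqZero N) {m : R} (hm : m ∈ N) :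
    (1 - m) * (1 + m) = 1 := by
  rw [mul_add, sub_mul, sub_mul, hN.sq hm hm]; simp

lemma IsSqZero.one_add_mul_one_sub (hN : IsSqZero N) {m : R} (hm : m ∈ N) :
    (1 + m) * (1 - m) = 1 := by
  rw [mul_sub, add_mul, add_mul, hN.sq hm hm]; simp

lemma mapsFil_one_add_iff (hπ : IsChain lo hi π) {ν : R} :
    MapsFil π π (1 + ν) ↔ HasDeg π 0 ν := by
  refine forall_congr' fun q => ?_
  rw [add_zero, add_mul, mul_add, one_mul, hπ.mul_of_le le_rfl, add_right_inj]

/-- After composition with one fixed map back from π' to π, both elements preserve π. Modulo the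
square-zero ideal composition is addition of the nilpotent parts, so the fixed contribution cancels
in the difference. -/
lemma MapsFil.sub_hasDeg (hlh : lo ≤ hi) (hN : IsSqZero N) (hπ : IsChain lo hi π)
    (hπ' : IsChain lo hi π') (hs : SameMod N π π') {μ ν : R} (hμ : μ ∈ N) (hν : ν ∈ N)
    (h₁ : MapsFil π π' (1 + μ)) (h₂ : MapsFil π π' (1 + ν)) : HasDeg π 0 (μ - ν) := by
  have ht := chainTransition_mem hlh hN hπ' hs.symm
  have hτ := chainTransition_mapsFil hπ' hπ
  rw [← add_sub_cancel (1 : R) (chainTransition lo hi π' π)] at hτ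
  have a1 := h₁.mul hπ hτ
  have a2 := h₂.mul hπ hτ
  rw [hN.one_add_mul ht hμ, mapsFil_one_add_iff hπ] at a1
  rw [hN.one_add_mul ht hν, mapsFil_one_add_iff hπ] at a2
  have := a1.sub a2
  rwa [add_sub_add_left_eq_sub] at this

/-- For automorphisms of a single chain the inverse clearly preserves the filtration, as degree 0 is
stable under negation. The general case reduces to this by composing with a transition from π' back
to π. -/
lemma MapsFil.symm (hlh : lo ≤ hi) (hN : IsSqZero N) (hπ : IsChain lo hi π)
    (hπ' : IsChain lo hi π') (hs : SameMod N π π') {μ : R} (hμ : μ ∈ N)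
    (h : MapsFil π π' (1 + μ)) : MapsFil π' π (1 - μ) := by
  have ht := chainTransition_mem hlh hN hπ' hs.symm
  have hτ := chainTransition_mapsFil hπ' hπ
  rw [← add_sub_cancel (1 : R) (chainTransition lo hi π' π)] at hτ
  have a1 := h.mul hπ hτ
  rw [hN.one_add_mul ht hμ, mapsFil_one_add_iff hπ] at a1
  have a2 : MapsFil π π (1 + -(chainTransition lo hi π' π - 1 + μ)) :=
    (mapsFil_one_add_iff hπ).2 a1.neg
  have a3 := hτ.mul hπ' a2
  rw [hN.one_add_mul (neg_mem (add_mem ht hμ)) ht] at a3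
  convert a3 using 1
  abel

/-- The obstruction to Griffiths transversality of a derivation with respect to a chain. -/
def griffDefect (lo hi : ℤ) (π : ℤ → R) (D : R → R) : R :=
  ∑ p ∈ Finset.Ico lo hi, (1 - π (p - 1)) * D (π p - π (p + 1))

/-- The factor 1 − π_{p−1} annihilates everything in step p − 1. What remains of D κ_p is controlled
by D(π_p) π_p, whose part outside step p − 1 lies in N by transversality modulo N. -/
lemma griffDefect_mem (hN : IsSqZero N) (hπ : IsChain lo hi π) {D : R → R}
    (hD : ∀ a b, D (a * b) = D a * b + a * D b)
    (hG : ∀ q, (1 - π (q - 1)) * (D (π q) * π q) ∈ N) : griffDefect lo hi π D ∈ N := by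
  refine sum_mem fun p _ => ?_
  have h1 : D (π p - π (p + 1)) =
      D (π p) * π p * (π p - π (p + 1)) + π p * D (π p - π (p + 1)) := by
    conv_lhs => rw [← hπ.proj_kappa (le_refl p), hD]
    rw [mul_assoc, hπ.proj_kappa le_rfl]
  have h2 : (1 - π (p - 1)) * π p = 0 := by
    rw [sub_mul, one_mul, hπ.mul_of_le (by lia), sub_self]
  rw [h1, mul_add, ← mul_assoc _ (π p), h2, zero_mul, add_zero, ← mul_assoc]
  exact hN.mul_right _ (hG p)

/-- Subtracting the defect turns D into w ↦ ∑ π_{p−1} D(κ_p w), which lowers the filtration by at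
most one step. -/
lemma isGriff_griffDefect (hlh : lo ≤ hi) (hπ : IsChain lo hi π) {D : R →+ R}
    (hD : ∀ a b, D (a * b) = D a * b + a * D b) : IsGriff π D (griffDefect lo hi π D) := by
  intro q w hw
  have h1 : D w = ∑ p ∈ Finset.Ico lo hi, D ((π p - π (p + 1)) * w) := by
    rw [← map_sum, ← Finset.sum_mul, hπ.sum_eq_one hlh, one_mul]
  have h2 : D w - griffDefect lo hi π D * w =
      ∑ p ∈ Finset.Ico lo hi, π (p - 1) * D ((π p - π (p + 1)) * w) := by
    rw [h1, griffDefect, Finset.sum_mul, ← Finset.sum_sub_distrib]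
    refine Finset.sum_congr rfl fun p _ => ?_
    have h3 : (1 - π (p - 1)) * (π p - π (p + 1)) = 0 := by
      rw [sub_mul, one_mul, hπ.proj_kappa (by lia), sub_self]
    have h4 : (1 - π (p - 1)) * D (π p - π (p + 1)) * w =
        (1 - π (p - 1)) * D ((π p - π (p + 1)) * w) := by
      rw [hD, mul_add, ← mul_assoc _ (π p - π (p + 1)), h3, zero_mul, add_zero, mul_assoc]
    rw [h4, sub_mul 1, one_mul, sub_sub_cancel]
  rw [h2, Finset.mul_sum]
  refine Finset.sum_congr rfl fun p _ => ?_
  rcases le_or_gt q p with h | h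
  · rw [← mul_assoc, hπ.mul_of_le (by lia)]
  · rw [← hw, ← mul_assoc _ (π q), hπ.kappa_proj_of_lt h, zero_mul, map_zero, mul_zero, mul_zero]

lemma IsGriff.hasDeg (hπ : IsChain lo hi π) {D : R → R} {K K' : R} (h : IsGriff π D K)
    (h' : IsGriff π D K') : HasDeg π (-1) (K - K') := fun q => by
  have e := hπ.mul_of_le (le_refl q)
  have h1 := h q _ e
  have h2 := h' q _ e
  have h3 : (K - K') * π q = (D (π q) - K' * π q) - (D (π q) - K * π q) := by
    rw [sub_mul]; abel
  rw [h3, mul_sub, ← sub_eq_add_neg, h1, h2]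

lemma IsGriff.add_hasDeg {D : R → R} {K δ : R} (h : IsGriff π D K) (hδ : HasDeg π (-1) δ) :
    IsGriff π D (K + δ) := fun q w hw => by
  have h1 := h q w hw
  have h2 : π (q - 1) * (δ * w) = δ * w := by
    rw [← hw, ← mul_assoc δ, ← mul_assoc, sub_eq_add_neg, hδ q]
  rw [add_mul, ← sub_sub, mul_sub, h1, h2]

/-- Conjugating D − K by 1 + ν gives D − K − D ν, because all products of two elements of N vanish.
-/
lemma IsGriff.transport (hN : IsSqZero N) {D : R →+ R}
    (hD : ∀ a b, D (a * b) = D a * b + a * D b) (hDN : ∀ n ∈ N, D n ∈ N) {K ν : R} (hK : K ∈ N)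
    (hν : ν ∈ N) (h₁ : MapsFil π π' (1 + ν)) (h₂ : MapsFil π' π (1 - ν)) (h : IsGriff π D K) :
    IsGriff π' D (K + D ν) := fun q w hw => by
  have h3 := h₁.apply (h q _ (h₂.apply hw))
  have h4 : (1 + ν) * (D ((1 - ν) * w) - K * ((1 - ν) * w)) = D w - (K + D ν) * w := by
    have e1 : ν * D ν = 0 := hN.sq hν (hDN ν hν)
    have e2 : ν * ν = 0 := hN.sq hν hν
    have e3 : K * ν = 0 := hN.sq hK hν
    have e4 : ν * K = 0 := hN.sq hν hK
    have e5 : D ((1 - ν) * w) = D w - (D ν * w + ν * D w) := by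
      rw [sub_mul, one_mul, map_sub, hD]
    have e6 : K * ((1 - ν) * w) = K * w := by
      rw [← mul_assoc, mul_sub, e3, sub_zero, mul_one]
    rw [e5, e6, add_mul, one_mul, mul_sub, mul_sub, mul_add, ← mul_assoc ν (D ν), e1,
      ← mul_assoc ν ν, e2, ← mul_assoc ν K, e4, add_mul]
    simp only [zero_mul, add_zero, sub_zero]
    abel
  rwa [h4] at h3

/-- D itself is flat and the terms quadratic in K vanish, so the displayed element is minus the
curvature of D − K. The curvature is built from two successive transversal operators and one single
one, so it lowers the filtration by at most two. -/
lemma IsGriff.curvature (hN : IsSqZero N) (hπ : IsChain lo hi π) {D₁ D₂ D₃ : R →+ R}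
    (hD₁ : ∀ a b, D₁ (a * b) = D₁ a * b + a * D₁ b)
    (hD₂ : ∀ a b, D₂ (a * b) = D₂ a * b + a * D₂ b)
    (hD : ∀ a, D₁ (D₂ a) - D₂ (D₁ a) = D₃ a) {K₁ K₂ K₃ : R} (hK₁ : K₁ ∈ N) (hK₂ : K₂ ∈ N)
    (h₁ : IsGriff π D₁ K₁) (h₂ : IsGriff π D₂ K₂) (h₃ : IsGriff π D₃ K₃) :
    HasDeg π (-2) (D₁ K₂ - D₂ K₁ - K₃) := fun q => by
  have e := hπ.mul_of_le (le_refl q)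
  have a₁ := h₂ _ _ (h₁ q _ e)
  have a₂ := h₁ _ _ (h₂ q _ e)
  have a₃ := hπ.fix_mono (show q - 1 - 1 ≤ q - 1 by lia) (h₃ q _ e)
  have key : (D₁ K₂ - D₂ K₁ - K₃) * π q =
      (D₃ (π q) - K₃ * π q) - ((D₁ (D₂ (π q) - K₂ * π q) - K₁ * (D₂ (π q) - K₂ * π q)) -
        (D₂ (D₁ (π q) - K₁ * π q) - K₂ * (D₁ (π q) - K₁ * π q))) := by
    have e1 : K₁ * (K₂ * π q) = 0 := by rw [← mul_assoc, hN.sq hK₁ hK₂, zero_mul]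
    have e2 : K₂ * (K₁ * π q) = 0 := by rw [← mul_assoc, hN.sq hK₂ hK₁, zero_mul]
    rw [map_sub, map_sub, hD₁, hD₂, mul_sub, mul_sub, e1, e2, ← hD, sub_mul, sub_mul]
    abel
  rw [key, show q + -2 = q - 1 - 1 by ring]
  generalize D₃ (π q) - K₃ * π q = w₃ at a₃ ⊢
  generalize D₁ (D₂ (π q) - K₂ * π q) - K₁ * (D₂ (π q) - K₂ * π q) = w₂ at a₂ ⊢
  generalize D₂ (D₁ (π q) - K₁ * π q) - K₂ * (D₁ (π q) - K₁ * π q) = w₁ at a₁ ⊢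
  rw [mul_sub, mul_sub, a₁, a₂, a₃]

lemma IsChain.conj (hπ : IsChain lo hi π) (hN : IsSqZero N) {ν : R} (hν : ν ∈ N) :
    IsChain lo hi (fun p => (1 + ν) * π p * (1 - ν)) where
  mul p q := by
    have : (1 + ν) * π p * (1 - ν) * ((1 + ν) * π q * (1 - ν)) =
        (1 + ν) * (π p * (((1 - ν) * (1 + ν)) * π q)) * (1 - ν) := by noncomm_ring
    rw [this, hN.one_sub_mul_one_add hν, one_mul, hπ.mul]
  one p hp := by rw [hπ.one p hp, mul_one, hN.one_add_mul_one_sub hν]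
  zero p hp := by rw [hπ.zero p hp, mul_zero, zero_mul]

lemma IsChain.conj_sub_mem (π : ℤ → R) (hN : IsSqZero N) {ν : R} (hν : ν ∈ N) (p : ℤ) :
    (1 + ν) * π p * (1 - ν) - π p ∈ N := by
  have : (1 + ν) * π p * (1 - ν) - π p = ν * (π p * (1 - ν)) - π p * ν := by noncomm_ring
  rw [this]
  exact sub_mem (hN.mul_right _ hν) (hN.mul_left _ hν)

lemma MapsFil.conj (hπ : IsChain lo hi π) (hN : IsSqZero N) {ν : R} (hν : ν ∈ N) :
    MapsFil π (fun p => (1 + ν) * π p * (1 - ν)) (1 + ν) := fun q => by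
  have : (1 + ν) * π q * (1 - ν) * ((1 + ν) * π q) =
    (1 + ν) * (π q * (((1 - ν) * (1 + ν)) * π q)) := by noncomm_ring
  change (1 + ν) * π q * (1 - ν) * ((1 + ν) * π q) = _
  rw [this, hN.one_sub_mul_one_add hν, one_mul, hπ.mul_of_le le_rfl]

lemma MapsFil.conj_symm (hπ : IsChain lo hi π) (hN : IsSqZero N) {ν : R} (hν : ν ∈ N) :
    MapsFil (fun p => (1 + ν) * π p * (1 - ν)) π (1 - ν) := fun q => by
  have : (1 - ν) * ((1 + ν) * π q * (1 - ν)) = ((1 - ν) * (1 + ν)) * (π q * (1 - ν)) := by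
    noncomm_ring
  change π q * ((1 - ν) * ((1 + ν) * π q * (1 - ν))) = (1 - ν) * ((1 + ν) * π q * (1 - ν))
  rw [this, hN.one_sub_mul_one_add hν, one_mul, ← mul_assoc, hπ.mul_of_le le_rfl]

/-- An idempotent modulo a square-zero ideal can be corrected to an idempotent. -/
lemma IsSqZero.exists_idempotent (hN : IsSqZero N) {κ : R} (h : κ * κ - κ ∈ N) :
    (3 * (κ * κ) - 2 * (κ * κ * κ)) * (3 * (κ * κ) - 2 * (κ * κ * κ)) =
      3 * (κ * κ) - 2 * (κ * κ * κ) ∧ (3 * (κ * κ) - 2 * (κ * κ * κ)) - κ ∈ N := by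
  have h0 := hN.sq h h
  constructor
  -- 3κ² − 2κ³ is the Newton step for x² = x with 1/(2κ − 1) replaced by 2κ − 1; the new error
  -- contains the square of the old one.
  · have : (3 * (κ * κ) - 2 * (κ * κ * κ)) * (3 * (κ * κ) - 2 * (κ * κ * κ)) -
      (3 * (κ * κ) - 2 * (κ * κ * κ)) =
        (κ * κ - κ) * (κ * κ - κ) * (4 * (κ * κ) - 4 * κ - 3) := by noncomm_ring
    rw [h0, zero_mul, sub_eq_zero] at this
    exact this
  · have : (3 * (κ * κ) - 2 * (κ * κ * κ)) - κ = (κ * κ - κ) * (1 - 2 * κ) := by noncomm_ring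
    rw [this]
    exact hN.mul_right _ h

/-- `J` stands for the endomorphisms with image in a filtration step, `ρ` for an approximate
projector onto that step, `π` for an idempotent already constructed for a smaller step. The new
idempotent is `π` plus an idempotent orthogonal to it, which keeps the chain nested exactly and not
merely modulo N. -/
lemma exists_chain_step (hN : IsSqZero N) {J J' : AddSubgroup R}
    (hJ : ∀ (a : R), ∀ g ∈ J, g * a ∈ J) (hNJ : N ≤ J) (hJ' : J' ≤ J)
    {ρ : R} (hρ : ρ ∈ J)
    (hρ' : ∀ g ∈ J, ρ * g - g ∈ N) {π : R} (hπ : π * π = π) (hπJ : π ∈ J') :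
    ∃ π₁ ∈ J, π₁ * π₁ = π₁ ∧ π₁ * π = π ∧ π * π₁ = π ∧ ∀ g ∈ J, π₁ * g - g ∈ N := by
  have hπJ₁ := hJ' hπJ
  -- Compressing ρ to the complement of π makes it orthogonal to π. The correction to an idempotent
  -- is a polynomial in κ without constant term, so orthogonality survives.
  set κ := (1 - π) * ρ * (1 - π) with hκ
  have h1 : (1 - π) * (1 - π) = 1 - π := by rw [mul_sub, sub_mul, sub_mul, hπ]; simp
  have hcρ : (1 - π) * ρ ∈ J := by
    rw [sub_mul, one_mul]; exact sub_mem hρ (hJ _ _ hπJ₁)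
  have hκκ : κ * κ - κ ∈ N := by
    have : κ * κ - κ = (1 - π) * (ρ * ((1 - π) * ρ) - (1 - π) * ρ) * (1 - π) := by
      rw [hκ]
      have e : (1 - π) * ρ * (1 - π) * ((1 - π) * ρ * (1 - π)) =
        (1 - π) * (ρ * (((1 - π) * (1 - π)) * ρ)) * (1 - π) := by noncomm_ring
      have e' : (1 - π) * (ρ * ((1 - π) * ρ) - (1 - π) * ρ) * (1 - π) =
        (1 - π) * (ρ * ((1 - π) * ρ)) * (1 - π) - ((1 - π) * (1 - π)) * ρ * (1 - π) := by
        noncomm_ring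
      rw [e', e, h1]
    rw [this]
    exact hN.mul_right _ (hN.mul_left _ (hρ' _ hcρ))
  obtain ⟨hi, hm⟩ := hN.exists_idempotent hκκ
  set κ' := 3 * (κ * κ) - 2 * (κ * κ * κ) with hκ'
  have hπκ : π * κ = 0 := by
    have : π * κ = (π - π * π) * (ρ * (1 - π)) := by rw [hκ]; noncomm_ring
    rw [this, hπ, sub_self, zero_mul]
  have hκπ : κ * π = 0 := by
    have : κ * π = (1 - π) * ρ * (π - π * π) := by rw [hκ]; noncomm_ring
    rw [this, hπ, sub_self, mul_zero]
  have e1 : π * κ' = 0 := by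
    have : π * κ' = 3 * (π * κ * κ) - 2 * (π * κ * κ * κ) := by rw [hκ']; noncomm_ring
    rw [this, hπκ]; simp
  have e2 : κ' * π = 0 := by
    have : κ' * π = 3 * (κ * (κ * π)) - 2 * (κ * κ * (κ * π)) := by rw [hκ']; noncomm_ring
    rw [this, hκπ]; simp
  refine ⟨π + κ', ?_, ?_, ?_, ?_, ?_⟩
  · refine add_mem hπJ₁ ?_
    rw [← sub_add_cancel κ' κ]
    exact add_mem (hNJ hm) (hJ _ _ hcρ)
  · rw [mul_add, add_mul, add_mul, hπ, e1, e2, hi]; abel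
  · rw [add_mul, hπ, e2, add_zero]
  · rw [mul_add, hπ, e1, add_zero]
  · intro g hg
    have hg' : (1 - π) * g ∈ J := by
      rw [sub_mul, one_mul]; exact sub_mem hg (hJ _ _ hπJ₁)
    have : (π + κ') * g - g = (κ' - κ) * g + (1 - π) * (ρ * ((1 - π) * g) - (1 - π) * g) := by
      have e : (1 - π) * (ρ * ((1 - π) * g) - (1 - π) * g) =
        κ * g - ((1 - π) * (1 - π)) * g := by rw [hκ]; noncomm_ring
      rw [e, h1]; noncomm_ring
    rw [this]
    exact add_mem (hN.mul_right _ hm) (hN.mul_left _ (hρ' _ hg'))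

/-- The chain is built downwards from 0 at `hi`. With N the endomorphisms vanishing on X it lifts a
filtration from X; with N = 0 it splits a filtration that already exists on the lift. -/
lemma exists_chain (hlh : lo < hi) (hN : IsSqZero N) (J : ℤ → AddSubgroup R)
    (hJ : ∀ p (a : R), ∀ g ∈ J p, g * a ∈ J p) (hNJ : ∀ p, N ≤ J p) (hanti : Antitone J)
    (hlo : J lo = ⊤) (hhi : J hi = N) (ρ : ℤ → R)
    (hρ : ∀ p, ρ p ∈ J p) (hρ' : ∀ p, ∀ g ∈ J p, ρ p * g - g ∈ N) :
    ∃ π : ℤ → R, IsChain lo hi π ∧ (∀ p, π p ∈ J p) ∧ ∀ p, ∀ g ∈ J p, π p * g - g ∈ N := by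
  have step : ∀ (p : ℤ) (x : {x : R // x * x = x ∧ x ∈ J (p + 1)}),
      ∃ y : {y : R // y * y = y ∧ y ∈ J p}, y.1 * x.1 = x.1 ∧ x.1 * y.1 = x.1 ∧
        ∀ g ∈ J p, y.1 * g - g ∈ N := fun p x => by
    obtain ⟨y, h1, h2, h3, h4, h5⟩ := exists_chain_step hN (hJ p) (hNJ p)
      (hanti (by lia : p ≤ p + 1)) (hρ p) (hρ' p) x.2.1 x.2.2
    exact ⟨⟨y, h2, h1⟩, h3, h4, h5⟩
  choose f hf1 hf2 hf3 using step
  have hmem (n : ℕ) (y : R) (hy : y ∈ J (hi - n)) : y ∈ J (hi - (n + 1 : ℕ) + 1) := by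
    rwa [show hi - (n + 1 : ℕ) + 1 = hi - n by push_cast; ring]
  -- `x n` is the projector for step hi − n. The value 1 is imposed separately for p ≤ lo, and for p
  -- ≥ hi truncated subtraction returns `x 0` = 0.
  let x : ∀ n : ℕ, {x : R // x * x = x ∧ x ∈ J (hi - n)} := fun n => Nat.rec
    ⟨0, by simp, zero_mem _⟩ (fun n y => ⟨(f (hi - (n + 1 : ℕ)) ⟨y.1, y.2.1, hmem n _ y.2.2⟩).1,
      (f _ _).2⟩) n
  have x_zero : (x 0).1 = 0 := rfl
  have hx (n : ℕ) : (x (n + 1)).1 =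
    (f (hi - (n + 1 : ℕ)) ⟨(x n).1, (x n).2.1, hmem n _ (x n).2.2⟩).1 := rfl
  have hx1 (n : ℕ) : (x (n + 1)).1 * (x n).1 = (x n).1 := by
    rw [hx]; exact hf1 _ ⟨(x n).1, _⟩
  have hx2 (n : ℕ) : (x n).1 * (x (n + 1)).1 = (x n).1 := by
    rw [hx]; exact hf2 _ ⟨(x n).1, _⟩
  have hx3 (n : ℕ) : ∀ g ∈ J (hi - n), (x n).1 * g - g ∈ N := by
    cases n with
    | zero =>
      intro g hg
      rw [x_zero, zero_mul, zero_sub]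
      rw [Nat.cast_zero, sub_zero, hhi] at hg
      exact neg_mem hg
    | succ n => exact hf3 _ _
  have hle (m k : ℕ) : (x (m + k)).1 * (x m).1 = (x m).1 ∧ (x m).1 * (x (m + k)).1 = (x m).1 := by
    induction k with
    | zero => exact ⟨(x m).2.1, (x m).2.1⟩
    | succ k ih =>
      constructor
      · have : (x (m + k + 1)).1 * (x m).1 = (x (m + k + 1)).1 * ((x (m + k)).1 * (x m).1) := by
          rw [ih.1]
        change (x (m + k + 1)).1 * (x m).1 = _
        rw [this, ← mul_assoc, hx1, ih.1]
      · have : (x m).1 * (x (m + k + 1)).1 = ((x m).1 * (x (m + k)).1) * (x (m + k + 1)).1 := by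
          rw [ih.2]
        change (x m).1 * (x (m + k + 1)).1 = _
        rw [this, mul_assoc, hx2, ih.2]
  have hle' {m n : ℕ} (h : m ≤ n) : (x n).1 * (x m).1 = (x m).1 ∧ (x m).1 * (x n).1 = (x m).1 := by
    obtain ⟨k, rfl⟩ := Nat.exists_eq_add_of_le h
    exact hle m k
  have hcast {p : ℤ} (hp : p < hi) : hi - ((hi - p).toNat : ℤ) = p := by lia
  have hcast' {p : ℤ} (hp : hi ≤ p) : (hi - p).toNat = 0 := by lia
  refine ⟨fun p => if p ≤ lo then 1 else (x (hi - p).toNat).1, ⟨fun p q => ?_, fun p hp => ?_,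
    fun p hp => ?_⟩, fun p => ?_, fun p g hg => ?_⟩
  · by_cases hp : p ≤ lo
    · by_cases hq : q ≤ lo
      · simp [hp, hq]
      · rw [max_eq_right (by lia)]; simp [hp]
    · by_cases hq : q ≤ lo
      · rw [max_eq_left (by lia)]; simp [hq]
      · rcases le_total p q with h | h
        · rw [max_eq_right h]
          simp only [hp, hq, if_false]
          exact (hle' (by lia)).1
        · rw [max_eq_left h]
          simp only [hp, hq, if_false]
          exact (hle' (by lia)).2
  · exact if_pos hp
  · rw [if_neg (by lia), hcast' hp]
    exact x_zero
  · change (if p ≤ lo then (1 : R) else (x (hi - p).toNat).1) ∈ J p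
    split_ifs with h
    · exact hanti h (by rw [hlo]; trivial)
    · rcases lt_or_ge p hi with h' | h'
      · have key : ∀ q : ℤ, q = p → ∀ y ∈ J q, y ∈ J p := by
          rintro q rfl y hy
          exact hy
        exact key _ (hcast h') _ (x (hi - p).toNat).2.2
      · rw [hcast' h']; exact zero_mem _
  · change (if p ≤ lo then (1 : R) else (x (hi - p).toNat).1) * g - g ∈ N
    split_ifs with h
    · rw [one_mul, sub_self]; exact zero_mem _
    · rcases lt_or_ge p hi with h' | h'
      · exact hx3 _ g (by rwa [hcast h'])
      · rw [hcast' h']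
        exact hx3 0 g (by rw [Nat.cast_zero, sub_zero]; exact hanti h' hg)

end Chains
end FilteredDeRham

end

section

namespace FilteredDeRham

open ThickenedPair

/-! ### Endomorphisms of a lift and their reductions -/

namespace Lift

variable {T : ThickenedPair.{u}} {E : DeRhamBundle T.g T.D} (L : Lift E)

/-- The restriction map from sections of the lift. -/
abbrev r (U : T.X'.Opens) : Γ(L.E'.V, U) →+ Γ(E.V, T.i ⁻¹ᵁ U) := restrictTo L.φ.hom U

lemma isFrame_r {U : T.X'.Opens} {n : ℕ} {e : Fin n → Γ(L.E'.V, U)} (he : IsFrame L.E'.V U e) :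
    IsFrame E.V (T.i ⁻¹ᵁ U) (fun k => L.r U (e k)) := isFrame_restrictTo L.φ.hom he

/-- The bundle is trivial over `U`. -/
def Framed (U : T.X'.Opens) : Prop := ∃ (n : ℕ) (e : Fin n → Γ(L.E'.V, U)), IsFrame L.E'.V U e

variable {L}

lemma Framed.mono {U W : T.X'.Opens} (hU : L.Framed U) (h : W ≤ U) : L.Framed W := by
  obtain ⟨n, e, he⟩ := hU
  exact ⟨n, _, he.restrict h⟩

variable (L)

lemma exists_chart {U : T.X'.Opens} {x : T.X'} (hx : x ∈ U) :
    ∃ W : T.X'.affineOpens, W.1 ≤ U ∧ x ∈ W.1 ∧ L.Framed W.1 := by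
  obtain ⟨W₁, n, e, hx₁, he⟩ := L.E'.isVectorBundle x
  obtain ⟨W, h, hxW⟩ := exists_affine_le (show x ∈ U ⊓ W₁ from ⟨hx, hx₁⟩)
  exact ⟨W, h.trans inf_le_left, hxW, n, _, he.restrict (h.trans inf_le_right)⟩

variable {L}

lemma Framed.r_surjective {W : T.X'.affineOpens} (hW : L.Framed W.1) :
    Function.Surjective (L.r W.1) := fun v => by
  obtain ⟨n, e, he⟩ := hW
  choose a ha using fun k => red_surjective W ((L.isFrame_r he).coord le_rfl v k)
  refine ⟨∑ k, a k • resM L.E'.V le_rfl (e k), ?_⟩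
  rw [restrictTo_sum, ← (L.isFrame_r he).sum_coord le_rfl v]
  exact Finset.sum_congr rfl fun k _ => by rw [ha]

lemma coord_mem_I {U : T.X'.Opens} {n : ℕ} {e : Fin n → Γ(L.E'.V, U)} (he : IsFrame L.E'.V U e)
    {W : T.X'.Opens} (h : W ≤ U) {v : Γ(L.E'.V, W)} (hv : L.r W v = 0) (k : Fin n) :
    he.coord h v k ∈ T.I W := by
  have h1 : ∑ k, red W (he.coord h v k) • resM E.V (pre_mono h) (L.r U (e k)) = 0 := by
    rw [← restrictTo_sum L.φ.hom h, he.sum_coord, hv]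
  have h2 := (L.isFrame_r he).coord_eq (pre_mono h) 0 _ h1
  rw [map_zero] at h2
  exact (congrFun h2 k).symm

/-- In a local frame the coordinates of a section vanishing on X lie in I, and I² = 0. -/
lemma I_smul_eq_zero {U : T.X'.Opens} {s : Γ(T.X', U)} (hs : s ∈ T.I U) {v : Γ(L.E'.V, U)}
    (hv : L.r U v = 0) : s • v = 0 := by
  refine eq_of_resM _ _ _ fun x hx => ?_
  obtain ⟨W, h, hxW, n, e, he⟩ := L.exists_chart hx
  refine ⟨W.1, h, hxW, ?_⟩
  have hv' : L.r W.1 (resM L.E'.V h v) = 0 := by rw [restrictTo_res, hv, map_zero]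
  rw [resM_smul, map_zero, ← he.sum_coord le_rfl (resM L.E'.V h v), Finset.smul_sum]
  refine Finset.sum_eq_zero fun k _ => ?_
  rw [← mul_smul, I_mul_I (resO_mem_I h hs) (coord_mem_I he le_rfl hv' k), zero_smul]

variable (L)

/-- `g'` lifts the endomorphism `g`. -/
def Lifts {U : T.X'.Opens} (g' : EndSec L.E'.V U) (g : EndSec E.V (T.i ⁻¹ᵁ U)) : Prop :=
  ∀ (W : T.X'.Opens) (h : W ≤ U) (v : Γ(L.E'.V, W)),
    L.r W (g'.ev W h v) = g.ev (T.i ⁻¹ᵁ W) (pre_mono h) (L.r W v)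

variable {L}

namespace Lifts

variable {U : T.X'.Opens} {g' h' : EndSec L.E'.V U} {g h : EndSec E.V (T.i ⁻¹ᵁ U)}

lemma add (hg : L.Lifts g' g) (hh : L.Lifts h' h) : L.Lifts (g' + h') (g + h) := fun W hW v => by
  rw [EndSec.add_ev, EndSec.add_ev, map_add, hg, hh]

lemma neg (hg : L.Lifts g' g) : L.Lifts (-g') (-g) := fun W hW v => by
  rw [EndSec.neg_ev, EndSec.neg_ev, map_neg, hg]

lemma sub (hg : L.Lifts g' g) (hh : L.Lifts h' h) : L.Lifts (g' - h') (g - h) := by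
  rw [sub_eq_add_neg, sub_eq_add_neg]; exact hg.add hh.neg

lemma mul (hg : L.Lifts g' g) (hh : L.Lifts h' h) : L.Lifts (g' * h') (g * h) := fun W hW v => by
  rw [EndSec.mul_ev, EndSec.mul_ev, hg, hh]

lemma res (hg : L.Lifts g' g) {W : T.X'.Opens} (hW : W ≤ U) :
    L.Lifts (g'.res hW) (g.res (pre_mono hW)) := fun W' h v => hg W' (h.trans hW) v

lemma smul (hg : L.Lifts g' g) (a : Γ(T.X', U)) : L.Lifts (a • g') (a • g) := fun W hW v => by
  rw [smul_endSec, EndSec.smul_ev, EndSec.smul_ev, restrictTo_smul, hg, red_resO]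

lemma nabla (hg : L.Lifts g' g) (x : T.VF U) :
    L.Lifts (L.E'.nablaEnd U x.fst g') (E.nablaEnd _ x.snd g) := fun W hW v => by
  have h1 (w : Γ(L.E'.V, W)) : L.r W (L.E'.nabla W (x.fst.res hW) w) =
    E.nabla (T.i ⁻¹ᵁ W) (x.snd.res (pre_mono hW)) (L.r W w) := L.parallel W (x.res hW) w
  rw [DeRhamBundle.nablaEnd_ev, DeRhamBundle.nablaEnd_ev, map_sub, h1, hg, hg, h1]

lemma of_frame {n : ℕ} {e : Fin n → Γ(L.E'.V, U)} (he : IsFrame L.E'.V U e)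
    (H : ∀ k, L.r U (g'.ev U le_rfl (e k)) = g.ev _ le_rfl (L.r U (e k))) : L.Lifts g' g := by
  intro W hW v
  rw [← he.sum_coord hW v, map_sum, map_sum, map_sum, map_sum]
  refine Finset.sum_congr rfl fun k _ => ?_
  rw [map_smul, restrictTo_smul, restrictTo_smul, map_smul, ← g'.res_ev le_rfl hW, restrictTo_res,
    H, g.res_ev, restrictTo_res]

end Lifts

lemma lifts_zero (U : T.X'.Opens) : L.Lifts (0 : EndSec L.E'.V U) 0 := fun W _ _ => map_zero (L.r W)

lemma lifts_one (U : T.X'.Opens) : L.Lifts (1 : EndSec L.E'.V U) 1 := fun _ _ _ => rfl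

lemma lifts_sum {U : T.X'.Opens} {ι : Type*} (s : Finset ι) {g' : ι → EndSec L.E'.V U}
    {g : ι → EndSec E.V (T.i ⁻¹ᵁ U)} (H : ∀ k, L.Lifts (g' k) (g k)) :
    L.Lifts (∑ k ∈ s, g' k) (∑ k ∈ s, g k) := by
  induction s using Finset.cons_induction with
  | empty => exact lifts_zero U
  | cons a s ha ih => rw [Finset.sum_cons, Finset.sum_cons]; exact (H a).add ih

lemma Framed.exists_lifts {W : T.X'.affineOpens} (hW : L.Framed W.1)
    (g : EndSec E.V (T.i ⁻¹ᵁ W.1)) : ∃ g', L.Lifts g' g := by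
  have hr := hW.r_surjective
  obtain ⟨n, e, he⟩ := hW
  choose w hw using fun k => hr (g.ev _ le_rfl (L.r W.1 (e k)))
  exact ⟨he.toEnd w, .of_frame he fun k => by rw [he.toEnd_apply, hw]⟩

lemma Framed.exists_reduction {U : T.X'.Opens} (hU : L.Framed U) (g' : EndSec L.E'.V U) :
    ∃ g, L.Lifts g' g := by
  obtain ⟨n, e, he⟩ := hU
  exact ⟨(L.isFrame_r he).toEnd fun k => L.r U (g'.ev U le_rfl (e k)), .of_frame he fun k => by
    rw [(L.isFrame_r he).toEnd_apply]⟩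

lemma exists_local_lifts {U : T.X'.Opens} (g : EndSec E.V (T.i ⁻¹ᵁ U)) {x : T.X'} (hx : x ∈ U) :
    ∃ (W : T.X'.affineOpens) (h : W.1 ≤ U), x ∈ W.1 ∧ L.Framed W.1 ∧
      ∃ g' : EndSec L.E'.V W.1, L.Lifts g' (g.res (pre_mono h)) := by
  obtain ⟨W, h, hxW, hW⟩ := L.exists_chart hx
  exact ⟨W, h, hxW, hW, hW.exists_lifts _⟩

lemma Lifts.unique {U : T.X'.Opens} {g' : EndSec L.E'.V U} {g₁ g₂ : EndSec E.V (T.i ⁻¹ᵁ U)}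
    (h₁ : L.Lifts g' g₁) (h₂ : L.Lifts g' g₂) : g₁ = g₂ := by
  refine EndSec.ext_local fun x hx => ?_
  obtain ⟨W, h, hxW, n, e, he⟩ := L.exists_chart (show T.i x ∈ U from hx)
  refine ⟨T.i ⁻¹ᵁ W.1, pre_mono h, hxW, EndSec.ext_frame (L.isFrame_r he) fun k => ?_⟩
  exact ((h₁.res h) W.1 le_rfl (e k)).symm.trans ((h₂.res h) W.1 le_rfl (e k))

/-- Locally every endomorphism of the lift has a reduction, so it preserves the sections that vanish
on X. This makes `nil` a left ideal. -/
lemma r_ev_eq_zero {U : T.X'.Opens} (g' : EndSec L.E'.V U) {W : T.X'.Opens} (hW : W ≤ U)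
    {v : Γ(L.E'.V, W)} (hv : L.r W v = 0) : L.r W (g'.ev W hW v) = 0 := by
  refine eq_of_resM _ _ _ fun x hx => ?_
  obtain ⟨W', h, hxW, hW'⟩ := L.exists_chart (show T.i x ∈ W from hx)
  refine ⟨T.i ⁻¹ᵁ W'.1, pre_mono h, hxW, ?_⟩
  obtain ⟨g, hg⟩ := hW'.exists_reduction (g'.res (h.trans hW))
  have := hg W'.1 le_rfl (resM _ h v)
  rw [EndSec.ev_res, restrictTo_res, hv, map_zero, map_zero, ← g'.res_ev hW h] at this
  rw [map_zero, ← restrictTo_res L.φ.hom h, this]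

variable (L) in
/-- Endomorphisms of the lift which vanish on `X`. -/
def nil (U : T.X'.Opens) : AddSubgroup (EndSec L.E'.V U) where
  carrier := {α | L.Lifts α 0}
  zero_mem' := lifts_zero U
  add_mem' h h' := by simpa using Lifts.add h h'
  neg_mem' h := by simpa using Lifts.neg h

lemma r_nil {U : T.X'.Opens} {α : EndSec L.E'.V U} (hα : α ∈ L.nil U) (W : T.X'.Opens) (h : W ≤ U)
    (v : Γ(L.E'.V, W)) : L.r W (α.ev W h v) = 0 := hα W h v

lemma nil_res {U W : T.X'.Opens} {α : EndSec L.E'.V U} (hα : α ∈ L.nil U) (h : W ≤ U) :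
    α.res h ∈ L.nil W := Lifts.res hα h

lemma Lifts.sub_mem_nil {U : T.X'.Opens} {g₁ g₂ : EndSec L.E'.V U} {g : EndSec E.V (T.i ⁻¹ᵁ U)}
    (h₁ : L.Lifts g₁ g) (h₂ : L.Lifts g₂ g) : g₁ - g₂ ∈ L.nil U := by
  have := h₁.sub h₂
  rwa [sub_self] at this

lemma mem_nil_of_locally {U : T.X'.Opens} {α : EndSec L.E'.V U} (H : ∀ x ∈ U,
    ∃ (W : T.X'.Opens) (h : W ≤ U), x ∈ W ∧ α.res h ∈ L.nil W) : α ∈ L.nil U := fun W hW v => by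
  refine eq_of_resM _ _ _ fun x hx => ?_
  obtain ⟨W', h, hxW, hα⟩ := H (T.i x) (hW hx)
  refine ⟨T.i ⁻¹ᵁ (W ⊓ W'), pre_mono inf_le_left, ⟨hx, hxW⟩, ?_⟩
  have := hα (W ⊓ W') inf_le_right (resM _ inf_le_left v)
  rw [EndSec.ev_res, ← α.res_ev hW, restrictTo_res] at this
  rw [this]
  exact (map_zero _).symm

/-- Such a section has coordinates in I and α has values in I·V', so the result lies in I²·V' = 0.
This gives square zero for `nil`. -/
lemma nil_ev_eq_zero {U : T.X'.Opens} {α : EndSec L.E'.V U} (hα : α ∈ L.nil U) {W : T.X'.Opens}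
    (h : W ≤ U) {v : Γ(L.E'.V, W)} (hv : L.r W v = 0) : α.ev W h v = 0 := by
  refine eq_of_resM _ _ _ fun x hx => ?_
  obtain ⟨W', h', hxW, n, e, he⟩ := L.exists_chart hx
  refine ⟨W'.1, h', hxW, ?_⟩
  have hv' : L.r W'.1 (resM L.E'.V h' v) = 0 := by rw [restrictTo_res, hv, map_zero]
  rw [map_zero, α.res_ev, ← he.sum_coord le_rfl (resM L.E'.V h' v), map_sum]
  refine Finset.sum_eq_zero fun k _ => ?_
  rw [map_smul]
  exact I_smul_eq_zero (coord_mem_I he le_rfl hv' k) (r_nil hα _ _ _)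

lemma isSqZero_nil (U : T.X'.Opens) : IsSqZero (L.nil U) where
  mul_left a _ hn := fun W h v => r_ev_eq_zero a h (r_nil hn W h v)
  mul_right a _ hn := fun W h v => r_nil hn W h (a.ev W h v)
  sq {m n} hm hn := by
    ext W h v
    exact nil_ev_eq_zero hm h (r_nil hn W h v)

lemma I_smul_nil {U : T.X'.Opens} {s : Γ(T.X', U)} (hs : s ∈ T.I U) {α : EndSec L.E'.V U}
    (hα : α ∈ L.nil U) : s • α = 0 := by
  ext W h v
  exact I_smul_eq_zero (resO_mem_I h hs) (r_nil hα W h v)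

lemma I_smul_mem_nil {U : T.X'.Opens} {s : Γ(T.X', U)} (hs : s ∈ T.I U) (g' : EndSec L.E'.V U) :
    s • g' ∈ L.nil U := fun W h v => by
  rw [EndSec.smul_ev, restrictTo_smul, EndSec.zero_ev,
    show red W (resO h s) = 0 from resO_mem_I h hs, zero_smul]

lemma smul_mem_nil {U : T.X'.Opens} (a : Γ(T.X', U)) {α : EndSec L.E'.V U} (hα : α ∈ L.nil U) :
    a • α ∈ L.nil U := by
  have := Lifts.smul hα a
  rwa [smul_zero] at this

lemma nablaEnd_mem_nil {U : T.X'.Opens} (x : LogDer T.g' T.D' U) {α : EndSec L.E'.V U}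
    (hα : α ∈ L.nil U) : L.E'.nablaEnd U x α ∈ L.nil U := by
  have := Lifts.nabla hα (toVF x)
  rw [toVF_fst] at this
  have h0 : E.nablaEnd _ (toVF x).snd 0 = 0 := by
    ext W h v
    simp only [DeRhamBundle.nablaEnd_ev, EndSec.zero_ev, map_zero, sub_zero]
  rwa [h0] at this

/-! ### The action of `End(V)_I` on the lift -/

/-- Locally g has a lift g', and s g' is independent of it, since two lifts differ by an
endomorphism vanishing on X, which I kills. So the local products glue although g need not lift over
`U`. -/
lemma exists_act (U : T.X'.Opens) (g : EndSec E.V (T.i ⁻¹ᵁ U)) (s : T.I U) :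
    ∃ α : EndSec L.E'.V U, ∀ (W : T.X'.Opens) (h : W ≤ U) (g' : EndSec L.E'.V W),
      L.Lifts g' (g.res (pre_mono h)) → α.res h = resO h s.1 • g' := by
  obtain ⟨α, hα⟩ : ∃ α : EndSec L.E'.V U, ∀ (W : T.X'.Opens) (h : W ≤ U) t,
      (∃ h : W ≤ U, ∀ (W' : T.X'.Opens) (h' : W' ≤ W) (g' : EndSec L.E'.V W'),
        L.Lifts g' (g.res (pre_mono (h'.trans h))) →
          t.res h' = resO (h'.trans h) s.1 • g') → α.res h = t := by
    refine EndSec.exists_glue (P := fun W t => ∃ h : W ≤ U, ∀ (W' : T.X'.Opens) (h' : W' ≤ W)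
      (g' : EndSec L.E'.V W'), L.Lifts g' (g.res (pre_mono (h'.trans h))) →
        t.res h' = resO (h'.trans h) s.1 • g') ?_ ?_ ?_
    · intro x hx
      obtain ⟨W, h, hxW, -, g', hg'⟩ := exists_local_lifts (L := L) g hx
      refine ⟨W.1, h, hxW, resO h s.1 • g', h, fun W' h' g₁ hg₁ => ?_⟩
      rw [EndSec.res_smul, resO_resO, ← sub_eq_zero, ← smul_sub]
      exact I_smul_nil (resO_mem_I _ s.2) ((hg'.res h').sub_mem_nil hg₁)
    · rintro W W' h t - ⟨hW, ht⟩
      exact ⟨h.trans hW, fun W'' h'' g' hg' => ht W'' (h''.trans h) g' hg'⟩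
    · rintro W hW t t' ⟨_, ht⟩ ⟨_, ht'⟩
      refine EndSec.ext_local fun x hx => ?_
      obtain ⟨W', h, hxW, -, g', hg'⟩ := exists_local_lifts (L := L) (g.res (pre_mono hW)) hx
      exact ⟨W'.1, h, hxW, (ht W'.1 h g' hg').trans (ht' W'.1 h g' hg').symm⟩
  refine ⟨α, fun W h g' hg' => hα W h _ ⟨h, fun W' h' g₁ hg₁ => ?_⟩⟩
  rw [EndSec.res_smul, resO_resO, ← sub_eq_zero, ← smul_sub]
  exact I_smul_nil (resO_mem_I _ s.2) ((hg'.res h').sub_mem_nil hg₁)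

variable (L) in
/-- The endomorphism `s g` for an endomorphism `g` on `X` and `s ∈ I`. -/
def act₀ {U : T.X'.Opens} (g : EndSec E.V (T.i ⁻¹ᵁ U)) (s : T.I U) : EndSec L.E'.V U :=
  (exists_act U g s).choose

lemma act₀_res {U W : T.X'.Opens} (g : EndSec E.V (T.i ⁻¹ᵁ U)) (s : T.I U) (h : W ≤ U)
    {g' : EndSec L.E'.V W} (hg' : L.Lifts g' (g.res (pre_mono h))) :
    (L.act₀ g s).res h = resO h s.1 • g' := (exists_act U g s).choose_spec W h g' hg'

lemma act₀_add_right {U : T.X'.Opens} (g : EndSec E.V (T.i ⁻¹ᵁ U)) (s t : T.I U) :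
    L.act₀ g (s + t) = L.act₀ g s + L.act₀ g t := by
  refine EndSec.ext_local fun x hx => ?_
  obtain ⟨W, h, hxW, -, g', hg'⟩ := exists_local_lifts (L := L) g hx
  refine ⟨W.1, h, hxW, ?_⟩
  rw [map_add, act₀_res g _ h hg', act₀_res g _ h hg', act₀_res g _ h hg', ← add_smul,
    ← map_add]
  rfl

lemma act₀_add_left {U : T.X'.Opens} (g₁ g₂ : EndSec E.V (T.i ⁻¹ᵁ U)) (s : T.I U) :
    L.act₀ (g₁ + g₂) s = L.act₀ g₁ s + L.act₀ g₂ s := by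
  refine EndSec.ext_local fun x hx => ?_
  obtain ⟨W, h, hxW, hW, -⟩ := exists_local_lifts (L := L) g₁ hx
  obtain ⟨g₁', hg₁⟩ := hW.exists_lifts (g₁.res (pre_mono h))
  obtain ⟨g₂', hg₂⟩ := hW.exists_lifts (g₂.res (pre_mono h))
  refine ⟨W.1, h, hxW, ?_⟩
  rw [map_add, act₀_res g₁ _ h hg₁, act₀_res g₂ _ h hg₂,
    act₀_res (g₁ + g₂) _ h (by rw [map_add]; exact hg₁.add hg₂), smul_add]

lemma Lifts.res_smul {U W : T.X'.Opens} {g : EndSec E.V (T.i ⁻¹ᵁ U)} {h : W ≤ U}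
    {g' : EndSec L.E'.V W} (hg : L.Lifts g' (g.res (pre_mono h))) (a : Γ(T.X', U)) :
    L.Lifts (resO h a • g') ((a • g).res (pre_mono h)) := by
  have := hg.smul (resO h a)
  rwa [smul_endSec, red_resO, ← EndSec.res_smul] at this

lemma act₀_smul {U : T.X'.Opens} (a : Γ(T.X', U)) (g : EndSec E.V (T.i ⁻¹ᵁ U)) (s : T.I U) :
    L.act₀ (a • g) s = a • L.act₀ g s := by
  refine EndSec.ext_local fun x hx => ?_
  obtain ⟨W, h, hxW, -, g', hg'⟩ := exists_local_lifts (L := L) g hx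
  refine ⟨W.1, h, hxW, ?_⟩
  rw [act₀_res (a • g) _ h (hg'.res_smul a), EndSec.res_smul, act₀_res g _ h hg', smul_comm]

lemma act₀_smul_right {U : T.X'.Opens} (a : Γ(T.X', U)) (g : EndSec E.V (T.i ⁻¹ᵁ U)) (s : T.I U) :
    L.act₀ g (a • s) = a • L.act₀ g s := by
  refine EndSec.ext_local fun x hx => ?_
  obtain ⟨W, h, hxW, -, g', hg'⟩ := exists_local_lifts (L := L) g hx
  refine ⟨W.1, h, hxW, ?_⟩
  rw [act₀_res g _ h hg', EndSec.res_smul, act₀_res g _ h hg', ← mul_smul, ← map_mul]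
  rfl

variable (L) in
/-- The action of `End(V)_I` on the lift. -/
def act (U : T.X'.Opens) : Coeff E.V U →+ EndSec L.E'.V U :=
  Coeff.lift
    (AddMonoidHom.mk' (fun g => AddMonoidHom.mk' (fun s => L.act₀ g s) (act₀_add_right g))
      fun g₁ g₂ => AddMonoidHom.ext (act₀_add_left g₁ g₂))
    fun a g s => (act₀_smul a g s).trans (act₀_smul_right a g s).symm

lemma act_tmul_eq {U : T.X'.Opens} (g : EndSec E.V (T.i ⁻¹ᵁ U)) (s : T.I U) :
    L.act U (Coeff.tmul g s) = L.act₀ g s := Coeff.lift_tmul _ _ _ _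

lemma act_tmul {U : T.X'.Opens} {g : EndSec E.V (T.i ⁻¹ᵁ U)} (s : T.I U) {g' : EndSec L.E'.V U}
    (hg' : L.Lifts g' g) : L.act U (Coeff.tmul g s) = s.1 • g' := by
  have := act₀_res g s le_rfl (hg'.res le_rfl)
  rw [resO_self] at this
  exact (act_tmul_eq g s).trans this

lemma act_res {U W : T.X'.Opens} (h : W ≤ U) (m : Coeff E.V U) :
    L.act W (Coeff.res h m) = (L.act U m).res h := by
  induction m using Coeff.induction with
  | h g s =>
    rw [Coeff.res_tmul]
    refine EndSec.ext_local fun x hx => ?_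
    obtain ⟨W', h', hxW, -, g', hg'⟩ := exists_local_lifts (L := L) (g.res (pre_mono h)) hx
    refine ⟨W'.1, h', hxW, ?_⟩
    rw [act_tmul_eq, act_tmul_eq, EndSec.res_res, act₀_res _ _ _ hg', act₀_res g s (h'.trans h) hg']
    rw [resI_val, resO_resO]
  | h' m m' hm hm' => rw [map_add, map_add, map_add, map_add, hm, hm']

lemma act_mem_nil {U : T.X'.Opens} (m : Coeff E.V U) : L.act U m ∈ L.nil U := by
  induction m using Coeff.induction with
  | h g s =>
    refine mem_nil_of_locally fun x hx => ?_
    obtain ⟨W, h, hxW, -, g', hg'⟩ := exists_local_lifts (L := L) g hx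
    refine ⟨W.1, h, hxW, ?_⟩
    rw [act_tmul_eq, act₀_res g s h hg']
    exact I_smul_mem_nil (resO_mem_I h s.2) g'
  | h' m m' hm hm' => rw [map_add]; exact add_mem hm hm'

lemma act_smul {U : T.X'.Opens} (a : Γ(T.X', U)) (m : Coeff E.V U) :
    L.act U (a • m) = a • L.act U m := by
  induction m using Coeff.induction with
  | h g s => rw [Coeff.smul_tmul', act_tmul_eq, act_tmul_eq, act₀_smul]
  | h' m m' hm hm' => rw [smul_add, map_add, map_add, smul_add, hm, hm']

/-- On a chart a pure tensor acts as s g', and the Leibniz rule for s g' is the definition of the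
connection on End(V) ⊗ I. -/
lemma act_nabla {U : T.X'.Opens} (x : T.VF U) (m : Coeff E.V U) :
    L.act U (Coeff.nabla x m) = L.E'.nablaEnd U x.fst (L.act U m) := by
  refine EndSec.ext_local fun y hy => ?_
  obtain ⟨W, h, hxW, hW⟩ := L.exists_chart hy
  refine ⟨W.1, h, hxW, ?_⟩
  have key (m : Coeff E.V W.1) :
      L.act W.1 (Coeff.nabla (x.res h) m) = L.E'.nablaEnd W.1 (x.res h).fst (L.act W.1 m) := by
    induction m using Coeff.induction with
    | h g s =>
      obtain ⟨g', hg'⟩ := hW.exists_lifts g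
      rw [Coeff.nabla_tmul, map_add, act_tmul s (hg'.nabla (x.res h)), act_tmul _ hg',
        act_tmul _ hg', L.E'.nablaEnd_smul_right]
      rfl
    | h' m m' hm hm' => rw [map_add, map_add, map_add, L.E'.nablaEnd_add_right, hm, hm']
  have := key (Coeff.res h m)
  rw [act_res] at this
  rw [← act_res, ← Coeff.lie_def, Coeff.res_lie, Coeff.lie_def, this]
  rfl

/-! ### Sections of `End(V)_I` over open sets where the bundle is trivial -/

variable (L) in
/-- Sums of pure tensors of endomorphisms which lift. -/
def liftable (U : T.X'.Opens) : AddSubgroup (Coeff E.V U) :=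
  AddSubgroup.closure {m | ∃ g' g s, L.Lifts (U := U) g' g ∧ m = Coeff.tmul g s}

lemma tmul_mem_liftable {U : T.X'.Opens} {g' : EndSec L.E'.V U} {g : EndSec E.V (T.i ⁻¹ᵁ U)}
    (h : L.Lifts g' g) (s : T.I U) : Coeff.tmul g s ∈ L.liftable U :=
  AddSubgroup.subset_closure ⟨g', g, s, h, rfl⟩

lemma liftable_map {U W : T.X'.Opens} (f : Coeff E.V U →+ Coeff E.V W)
    (H : ∀ g' g s, L.Lifts g' g → f (Coeff.tmul g s) ∈ L.liftable W) :
    ∀ m ∈ L.liftable U, f m ∈ L.liftable W := by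
  change L.liftable U ≤ (L.liftable W).comap f
  refine (AddSubgroup.closure_le _).2 ?_
  rintro _ ⟨g', g, s, h, rfl⟩
  exact H g' g s h

lemma liftable_eqOn {U : T.X'.Opens} {A : Type*} [AddCommGroup A] (f f' : Coeff E.V U →+ A)
    (H : ∀ g' g s, L.Lifts g' g → f (Coeff.tmul g s) = f' (Coeff.tmul g s)) :
    ∀ m ∈ L.liftable U, f m = f' m := by
  change L.liftable U ≤ f.eqLocus f'
  refine (AddSubgroup.closure_le _).2 ?_
  rintro _ ⟨g', g, s, h, rfl⟩
  exact H g' g s h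

lemma liftable_res {U W : T.X'.Opens} (h : W ≤ U) {m : Coeff E.V U} (hm : m ∈ L.liftable U) :
    Coeff.res h m ∈ L.liftable W := by
  refine liftable_map _ (fun g' g s hg => ?_) m hm
  rw [Coeff.res_tmul]
  exact tmul_mem_liftable (hg.res h) _

lemma liftable_nabla {U : T.X'.Opens} (x : T.VF U) {m : Coeff E.V U} (hm : m ∈ L.liftable U) :
    Coeff.nabla x m ∈ L.liftable U := by
  refine liftable_map _ (fun g' g s hg => ?_) m hm
  rw [Coeff.nabla_tmul]
  exact add_mem (tmul_mem_liftable (hg.nabla x) _) (tmul_mem_liftable hg _)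

lemma liftable_smul {U : T.X'.Opens} (a : Γ(T.X', U)) {m : Coeff E.V U} (hm : m ∈ L.liftable U) :
    a • m ∈ L.liftable U := by
  refine liftable_map (DistribSMul.toAddMonoidHom _ a) (fun g' g s hg => ?_) m hm
  change a • Coeff.tmul g s ∈ _
  rw [Coeff.smul_tmul']
  exact tmul_mem_liftable (hg.smul a) _

/-- The matrix units of a frame. -/
def _root_.FilteredDeRham.IsFrame.unit {X : Scheme.{u}} {V : X.Modules} {U : X.Opens} {n : ℕ}
    {e : Fin n → Γ(V, U)} (he : IsFrame V U e) (k l : Fin n) : EndSec V U :=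
  he.toEnd (Pi.single l (e k))

lemma _root_.FilteredDeRham.IsFrame.unit_apply {X : Scheme.{u}} {V : X.Modules} {U : X.Opens}
    {n : ℕ} {e : Fin n → Γ(V, U)} (he : IsFrame V U e) (k l j : Fin n) :
    (he.unit k l).ev U le_rfl (e j) = if j = l then e k else 0 := by
  rw [IsFrame.unit, he.toEnd_apply, Pi.single_apply]

lemma _root_.FilteredDeRham.IsFrame.sum_unit {X : Scheme.{u}} {V : X.Modules} {U : X.Opens} {n : ℕ}
    {e : Fin n → Γ(V, U)} (he : IsFrame V U e) (g : EndSec V U) :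
    ∑ k, ∑ l, he.coord le_rfl (g.ev U le_rfl (e l)) k • he.unit k l = g := by
  refine EndSec.ext_frame he fun j => ?_
  rw [EndSec.sum_ev]
  refine Eq.trans (Finset.sum_congr rfl fun k _ => ?_) (he.sum_coord le_rfl (g.ev U le_rfl (e j)))
  rw [EndSec.sum_ev, Finset.sum_eq_single j]
  · rw [EndSec.smul_ev, he.unit_apply, if_pos rfl, resO_self, resM_self]
  · intro l _ hl
    rw [EndSec.smul_ev, he.unit_apply, if_neg hl.symm, smul_zero]
  · simp

lemma lifts_unit {U : T.X'.Opens} {n : ℕ} {e : Fin n → Γ(L.E'.V, U)} (he : IsFrame L.E'.V U e)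
    (k l : Fin n) : L.Lifts (he.unit k l) ((L.isFrame_r he).unit k l) :=
  .of_frame he fun j => by
    rw [he.unit_apply, (L.isFrame_r he).unit_apply]
    split_ifs
    · rfl
    · exact map_zero _

/-- The element of `End(V)_I` given by a nilpotent endomorphism and a frame. -/
def coeffOf {U : T.X'.Opens} {n : ℕ} {e : Fin n → Γ(L.E'.V, U)} (he : IsFrame L.E'.V U e) :
    L.nil U →+ Coeff E.V U :=
  AddMonoidHom.mk' (fun α => ∑ k, ∑ l, Coeff.tmul ((L.isFrame_r he).unit k l)
      ⟨he.coord le_rfl (α.1.ev U le_rfl (e l)) k, coord_mem_I he le_rfl (r_nil α.2 U le_rfl _) k⟩)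
    fun α β => by
      simp only [← Finset.sum_add_distrib, ← Coeff.tmul_add]
      refine Finset.sum_congr rfl fun k _ => Finset.sum_congr rfl fun l _ => ?_
      congr 1
      refine Subtype.ext ?_
      change he.coord le_rfl (α.1.ev U le_rfl (e l) + β.1.ev U le_rfl (e l)) k = _
      rw [map_add]
      rfl

lemma coeffOf_apply {U : T.X'.Opens} {n : ℕ} {e : Fin n → Γ(L.E'.V, U)} (he : IsFrame L.E'.V U e)
    (α : L.nil U) : coeffOf he α = ∑ k, ∑ l, Coeff.tmul ((L.isFrame_r he).unit k l)
      ⟨he.coord le_rfl (α.1.ev U le_rfl (e l)) k,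
        coord_mem_I he le_rfl (r_nil α.2 U le_rfl _) k⟩ := rfl

lemma coeffOf_mem {U : T.X'.Opens} {n : ℕ} {e : Fin n → Γ(L.E'.V, U)} (he : IsFrame L.E'.V U e)
    (α : L.nil U) : coeffOf he α ∈ L.liftable U :=
  (coeffOf_apply he α).symm ▸
    sum_mem fun k _ => sum_mem fun l _ => tmul_mem_liftable (lifts_unit he k l) _

lemma act_coeffOf {U : T.X'.Opens} {n : ℕ} {e : Fin n → Γ(L.E'.V, U)} (he : IsFrame L.E'.V U e)
    (α : L.nil U) : L.act U (coeffOf he α) = α := by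
  rw [coeffOf_apply, map_sum]
  refine Eq.trans ?_ (he.sum_unit α.1)
  refine Finset.sum_congr rfl fun k _ => ?_
  rw [map_sum]
  refine Finset.sum_congr rfl fun l _ => ?_
  rw [act_tmul _ (lifts_unit he k l)]

/-- A liftable g is the combination of matrix units with coefficients the reductions of those of g';
moving these coefficients across the tensor sign turns g ⊗ s into the expansion defining `coeffOf`.
-/
lemma coeffOf_act {U : T.X'.Opens} {n : ℕ} {e : Fin n → Γ(L.E'.V, U)} (he : IsFrame L.E'.V U e)
    {m : Coeff E.V U} (hm : m ∈ L.liftable U) : coeffOf he ⟨L.act U m, act_mem_nil m⟩ = m := by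
  let f : Coeff E.V U →+ Coeff E.V U := (coeffOf he).comp
    ((L.act U).codRestrict (L.nil U) act_mem_nil)
  refine liftable_eqOn f (AddMonoidHom.id _) (fun g' g s hg => ?_) m hm
  change coeffOf he ⟨L.act U (Coeff.tmul g s), _⟩ = Coeff.tmul g s
  have h1 : g = ∑ k, ∑ l, he.coord le_rfl (g'.ev U le_rfl (e l)) k •
      (L.isFrame_r he).unit k l := by
    refine hg.unique ?_
    conv_lhs => rw [← he.sum_unit g']
    exact lifts_sum _ fun k => lifts_sum _ fun l => (lifts_unit he k l).smul _
  let t : EndSec E.V (T.i ⁻¹ᵁ U) →+ Coeff E.V U :=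
    AddMonoidHom.mk' (fun g => Coeff.tmul g s) fun g g' => Coeff.add_tmul g g' s
  have h2 : Coeff.tmul g s = ∑ k, ∑ l, Coeff.tmul (he.coord le_rfl (g'.ev U le_rfl (e l)) k •
      (L.isFrame_r he).unit k l) s := by
    change t g = ∑ k, ∑ l, t _
    conv_lhs => rw [h1]
    simp only [map_sum]
  refine Eq.trans ?_ h2.symm
  rw [coeffOf_apply]
  refine Finset.sum_congr rfl fun k _ => Finset.sum_congr rfl fun l _ => ?_
  rw [Coeff.smul_tmul]
  congr 1
  refine Subtype.ext ?_
  change he.coord le_rfl ((L.act U (Coeff.tmul g s)).ev U le_rfl (e l)) k =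
    he.coord le_rfl (g'.ev U le_rfl (e l)) k * s.1
  rw [act_tmul s hg, EndSec.smul_ev, resO_self, map_smul, mul_comm]
  rfl

/-- With `act_coeff` this identifies the liftable tensors with `nil` where the bundle is trivial.
Identities between forms can then be checked on endomorphisms of the lift. -/
lemma act_injOn {U : T.X'.Opens} (hU : L.Framed U) {m m' : Coeff E.V U} (hm : m ∈ L.liftable U)
    (hm' : m' ∈ L.liftable U) (h : L.act U m = L.act U m') : m = m' := by
  obtain ⟨n, e, he⟩ := hU
  rw [← coeffOf_act he hm, ← coeffOf_act he hm']
  exact congrArg (coeffOf he) (Subtype.ext h)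

/-- The element of `End(V)_I` given by a nilpotent endomorphism. -/
def coeff {U : T.X'.Opens} (hU : L.Framed U) : L.nil U →+ Coeff E.V U :=
  coeffOf hU.choose_spec.choose_spec

lemma coeff_mem {U : T.X'.Opens} (hU : L.Framed U) (α : L.nil U) :
    coeff hU α ∈ L.liftable U := coeffOf_mem _ α

lemma act_coeff {U : T.X'.Opens} (hU : L.Framed U) (α : L.nil U) :
    L.act U (coeff hU α) = α := act_coeffOf _ α

lemma res_coeff {U W : T.X'.Opens} (hU : L.Framed U) (h : W ≤ U) (α : L.nil U) :
    Coeff.res h (coeff hU α) = coeff (hU.mono h) ⟨α.1.res h, nil_res α.2 h⟩ :=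
  act_injOn (hU.mono h) (liftable_res h (coeff_mem hU α)) (coeff_mem _ _) (by
    rw [act_res, act_coeff, act_coeff])

lemma smul_coeff {U : T.X'.Opens} (hU : L.Framed U) (a : Γ(T.X', U)) (α : L.nil U) :
    a • coeff hU α = coeff hU ⟨a • α.1, smul_mem_nil a α.2⟩ :=
  act_injOn hU (liftable_smul a (coeff_mem hU α)) (coeff_mem _ _) (by
    rw [act_smul, act_coeff, act_coeff])

attribute [irreducible] act coeff

end Lift
end FilteredDeRham

end

section

namespace FilteredDeRham

open ThickenedPair

/-! ### Splittings of Hodge filtrations -/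

section

variable {X S : Scheme.{u}} {V : X.Modules} {U : X.Opens}

lemma EndSec.smul_mul (a : Γ(X, U)) (g h : EndSec V U) : a • g * h = a • (g * h) := rfl

lemma EndSec.mul_smul (a : Γ(X, U)) (g h : EndSec V U) : g * a • h = a • (g * h) := by
  ext W hW v
  exact map_smul (g.ev W hW) _ _

lemma IsSubbundle.exists_projector {F : ∀ U : X.Opens, Submodule Γ(X, U) Γ(V, U)}
    (hF : IsSubbundle V F) (x : X) : ∃ (U : X.Opens) (ρ : EndSec V U), x ∈ U ∧
      (∀ (W : X.Opens) (h : W ≤ U) (v : Γ(V, W)), ρ.ev W h v ∈ F W) ∧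
      ∀ (W : X.Opens) (h : W ≤ U), ∀ v ∈ F W, ρ.ev W h v = v := by
  classical
  obtain ⟨U, n, e, A, hx, he, hA⟩ := hF.adapted x
  let ρ : EndSec V U := he.toEnd fun k => if k ∈ A then e k else 0
  have hρ (W : X.Opens) (h : W ≤ U) (k : Fin n) :
      ρ.ev W h (resM V h (e k)) = if k ∈ A then resM V h (e k) else 0 := by
    rw [← ρ.res_ev le_rfl h, he.toEnd_apply]
    split_ifs
    · rfl
    · exact map_zero _
  refine ⟨U, ρ, hx, fun W h v => ?_, fun W h v hv => ?_⟩
  · rw [← he.sum_coord h v, map_sum]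
    refine sum_mem fun k _ => ?_
    rw [map_smul, hρ]
    refine Submodule.smul_mem _ _ ?_
    split_ifs with hk
    · rw [hA W h]
      exact Submodule.subset_span ⟨k, hk, rfl⟩
    · exact zero_mem _
  · rw [hA W h] at hv
    change v ∈ LinearMap.eqLocus (ρ.ev W h) LinearMap.id
    refine (Submodule.span_le.2 ?_) hv
    rintro _ ⟨k, hk, rfl⟩
    exact (hρ W h k).trans (if_pos hk)

/-- The filtration is concentrated between `lo` and `hi`. -/
def HodgeFiltration.Bounded {f : X ⟶ S} {D : X.IdealSheafData} {E : DeRhamBundle f D}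
    (F : HodgeFiltration E) (lo hi : ℤ) : Prop := ∀ U, F.Fil lo U = ⊤ ∧ F.Fil hi U = ⊥

variable {f : X ⟶ S} {D : X.IdealSheafData} {E : DeRhamBundle f D} {F : HodgeFiltration E}
  {lo hi : ℤ}

lemma HodgeFiltration.Bounded.mono (h : F.Bounded lo hi) {lo' hi' : ℤ} (hl : lo' ≤ lo)
    (hh : hi ≤ hi') : F.Bounded lo' hi' := fun U =>
  ⟨top_le_iff.1 ((h U).1.symm.le.trans (F.antitone U hl)),
    le_bot_iff.1 ((F.antitone U hh).trans (h U).2.le)⟩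

lemma HodgeFiltration.Bounded.eq_top (h : F.Bounded lo hi) {p : ℤ} (hp : p ≤ lo) (U : X.Opens) :
    F.Fil p U = ⊤ := (h.mono hp le_rfl U).1

lemma HodgeFiltration.Bounded.eq_bot (h : F.Bounded lo hi) {p : ℤ} (hp : hi ≤ p) (U : X.Opens) :
    F.Fil p U = ⊥ := (h.mono le_rfl hp U).2

/-- Outside the open interval from `lo` to `hi` the projector is 1 or 0, so only finitely many
neighbourhoods have to be intersected. -/
lemma HodgeFiltration.exists_projectors (h : F.Bounded lo hi) (x : X) :
    ∃ (U : X.Opens) (ρ : ℤ → EndSec E.V U), x ∈ U ∧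
      (∀ (p : ℤ) (W : X.Opens) (h : W ≤ U) (v : Γ(E.V, W)), (ρ p).ev W h v ∈ F.Fil p W) ∧
      ∀ (p : ℤ) (W : X.Opens) (h : W ≤ U), ∀ v ∈ F.Fil p W, (ρ p).ev W h v = v := by
  choose U ρ hx h₁ h₂ using fun p => (F.isSubbundle p).exists_projector x
  have hU (p : ℤ) (hp : p ∈ Finset.Ioo lo hi) : (Finset.Ioo lo hi).inf U ≤ U p := Finset.inf_le hp
  have hx' : x ∈ (Finset.Ioo lo hi).inf U :=
    Finset.inf_induction (p := fun U : X.Opens => x ∈ U) trivial (fun _ h _ h' => ⟨h, h'⟩)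
      fun p _ => hx p
  have key (p : ℤ) : ∃ ρ : EndSec E.V ((Finset.Ioo lo hi).inf U),
      (∀ (W : X.Opens) (h : W ≤ _) (v : Γ(E.V, W)), ρ.ev W h v ∈ F.Fil p W) ∧
      ∀ (W : X.Opens) (h : W ≤ _), ∀ v ∈ F.Fil p W, ρ.ev W h v = v := by
    by_cases hp : p ∈ Finset.Ioo lo hi
    · exact ⟨(ρ p).res (hU p hp), fun W hW => h₁ p W (hW.trans (hU p hp)),
        fun W hW => h₂ p W (hW.trans (hU p hp))⟩
    · rcases le_or_gt p lo with hlo | hlo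
      · exact ⟨1, fun W _ v => by rw [h.eq_top hlo]; trivial, fun _ _ _ _ => rfl⟩
      · have hhi : hi ≤ p := by
          rw [Finset.mem_Ioo] at hp
          lia
        refine ⟨0, fun W _ v => zero_mem _, fun W _ v hv => ?_⟩
        rw [h.eq_bot hhi, Submodule.mem_bot] at hv
        rw [hv, map_zero]
  choose ρ' h₁' h₂' using key
  exact ⟨_, ρ', hx', h₁', h₂'⟩

end

section

variable {T : ThickenedPair.{u}} {E : DeRhamBundle T.g T.D} (F : HodgeFiltration E) (L : Lift E)

/-- A splitting, over a lift of the bundle, of a Hodge filtration. -/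
structure Splitting (lo hi : ℤ) (U : T.X'.Opens) where
  /-- the projectors -/
  π : ℤ → EndSec L.E'.V U
  /-- the reductions of the projectors -/
  red : ℤ → EndSec E.V (T.i ⁻¹ᵁ U)
  chain : IsChain lo hi π
  lifts (p : ℤ) : L.Lifts (π p) (red p)
  mem (p : ℤ) (W : T.X.Opens) (h : W ≤ T.i ⁻¹ᵁ U) (v : Γ(E.V, W)) : (red p).ev W h v ∈ F.Fil p W
  fix (p : ℤ) (W : T.X.Opens) (h : W ≤ T.i ⁻¹ᵁ U) (v : Γ(E.V, W)) :
    v ∈ F.Fil p W → (red p).ev W h v = v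

variable {F L} {lo hi : ℤ} {U : T.X'.Opens}

namespace Splitting

/-- Restriction of splittings. -/
def res (s : Splitting F L lo hi U) {W : T.X'.Opens} (h : W ≤ U) : Splitting F L lo hi W where
  π p := (s.π p).res h
  red p := (s.red p).res (pre_mono h)
  chain :=
    { mul := fun p q => by rw [← EndSec.res_mul, s.chain.mul]
      one := fun p hp => by rw [s.chain.one p hp]; rfl
      zero := fun p hp => by rw [s.chain.zero p hp]; rfl }
  lifts p := (s.lifts p).res h
  mem p W' h' := s.mem p W' (h'.trans (pre_mono h))
  fix p W' h' := s.fix p W' (h'.trans (pre_mono h))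

lemma red_chain (s : Splitting F L lo hi U) : IsChain lo hi s.red where
  mul p q := by
    have := (s.lifts p).mul (s.lifts q)
    rw [s.chain.mul] at this
    exact this.unique (s.lifts _)
  one p hp := by
    have := s.lifts p
    rw [s.chain.one p hp] at this
    exact this.unique (Lift.lifts_one U)
  zero p hp := by
    have := s.lifts p
    rw [s.chain.zero p hp] at this
    exact this.unique (Lift.lifts_zero U)

/-- On X both p-th projectors have the same image Fil^p, so each fixes the image of the other. -/
lemma sameMod (s s' : Splitting F L lo hi U) : SameMod (L.nil U) s.π s'.π := by
  have key (s s' : Splitting F L lo hi U) (p : ℤ) : s.π p * s'.π p - s'.π p ∈ L.nil U := by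
    have h1 : s.red p * s'.red p = s'.red p := by
      ext W h v
      exact s.fix p W h _ (s'.mem p W h v)
    have := ((s.lifts p).mul (s'.lifts p)).sub (s'.lifts p)
    rwa [h1, sub_self] at this
  exact fun p => ⟨key s s' p, key s' s p⟩

/-- Conjugation of a splitting by an automorphism which restricts to the identity. -/
def conj (s : Splitting F L lo hi U) {ν : EndSec L.E'.V U} (hν : ν ∈ L.nil U) :
    Splitting F L lo hi U where
  π p := (1 + ν) * s.π p * (1 - ν)
  red := s.red
  chain := s.chain.conj (Lift.isSqZero_nil U) hν
  lifts p := by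
    have h := Lift.Lifts.add (IsChain.conj_sub_mem s.π (Lift.isSqZero_nil U) hν p) (s.lifts p)
    rwa [sub_add_cancel, zero_add] at h
  mem := s.mem
  fix := s.fix

/-- For t g' the identity need only hold modulo endomorphisms vanishing on X, because t kills these;
on X it says that g raises the filtration by p. `mem_fil` is the converse for liftable elements. -/
lemma hasDeg_act (s : Splitting F L lo hi U) {p : ℤ} {m : Coeff E.V U}
    (hm : m ∈ Coeff.fil F p U) : HasDeg s.π p (L.act U m) := by
  suffices Coeff.fil F p U ≤ AddSubgroup.comap (L.act U)
      { carrier := {α | HasDeg s.π p α}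
        zero_mem' := HasDeg.zero _ _
        add_mem' := HasDeg.add
        neg_mem' := HasDeg.neg } from this hm
  refine (AddSubgroup.closure_le _).2 ?_
  rintro _ ⟨g, hg, t, rfl⟩ q
  refine EndSec.ext_local fun x hx => ?_
  obtain ⟨W, h, hxW, -, g', hg'⟩ := Lift.exists_local_lifts (L := L) g hx
  refine ⟨W.1, h, hxW, ?_⟩
  rw [EndSec.res_mul, EndSec.res_mul, Lift.act_tmul_eq, Lift.act₀_res g t h hg', EndSec.smul_mul,
    EndSec.mul_smul, ← sub_eq_zero, ← smul_sub]
  refine Lift.I_smul_nil (resO_mem_I h t.2) ?_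
  have h1 := ((s.lifts (q + p)).res h).mul (hg'.mul ((s.lifts q).res h))
  have h2 := hg'.mul ((s.lifts q).res h)
  refine Lift.Lifts.sub_mem_nil (g := g.res (pre_mono h) * (s.red q).res (pre_mono h)) ?_ h2
  convert h1 using 1
  ext W' h' v
  exact (s.fix (q + p) W' (h'.trans (pre_mono h)) _
    (hg q W' (h'.trans (pre_mono h)) _ (s.mem q W' (h'.trans (pre_mono h)) v))).symm

end Splitting

/-- The map `g ⊗ t ↦ h₁ g h₂ ⊗ t`. -/
def _root_.FilteredDeRham.ThickenedPair.Coeff.sandwich {V : T.X.Modules}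
    (h₁ h₂ : EndSec V (T.i ⁻¹ᵁ U)) : Coeff V U →+ Coeff V U :=
  Coeff.lift
    (AddMonoidHom.mk' (fun g => AddMonoidHom.mk' (fun t => Coeff.tmul (h₁ * g * h₂) t)
        (Coeff.tmul_add _))
      fun g g' => AddMonoidHom.ext fun t => by
        change Coeff.tmul (h₁ * (g + g') * h₂) t = _
        rw [mul_add, add_mul, Coeff.add_tmul]; rfl)
    fun a g t => by
      change Coeff.tmul (h₁ * a • g * h₂) t = Coeff.tmul (h₁ * g * h₂) (a • t)
      rw [← Coeff.smul_tmul, smul_endSec, smul_endSec, EndSec.mul_smul, EndSec.smul_mul]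

lemma sandwich_tmul {V : T.X.Modules} (h₁ h₂ g : EndSec V (T.i ⁻¹ᵁ U)) (t : T.I U) :
    Coeff.sandwich h₁ h₂ (Coeff.tmul g t) = Coeff.tmul (h₁ * g * h₂) t := Coeff.lift_tmul _ _ _ _

lemma sandwich_mem_liftable {h₁' h₂' : EndSec L.E'.V U} {h₁ h₂ : EndSec E.V (T.i ⁻¹ᵁ U)}
    (H₁ : L.Lifts h₁' h₁) (H₂ : L.Lifts h₂' h₂) {m : Coeff E.V U} (hm : m ∈ L.liftable U) :
    Coeff.sandwich h₁ h₂ m ∈ L.liftable U := by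
  refine Lift.liftable_map _ (fun g' g t hg => ?_) m hm
  rw [sandwich_tmul]
  exact Lift.tmul_mem_liftable ((H₁.mul hg).mul H₂) t

lemma act_sandwich {h₁' h₂' : EndSec L.E'.V U} {h₁ h₂ : EndSec E.V (T.i ⁻¹ᵁ U)}
    (H₁ : L.Lifts h₁' h₁) (H₂ : L.Lifts h₂' h₂) {m : Coeff E.V U} (hm : m ∈ L.liftable U) :
    L.act U (Coeff.sandwich h₁ h₂ m) = h₁' * L.act U m * h₂' := by
  refine Lift.liftable_eqOn ((L.act U).comp (Coeff.sandwich h₁ h₂))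
    (((AddMonoidHom.mulRight h₂').comp (AddMonoidHom.mulLeft h₁')).comp (L.act U))
    (fun g' g t hg => ?_) m hm
  change L.act U (Coeff.sandwich h₁ h₂ (Coeff.tmul g t)) = h₁' * L.act U (Coeff.tmul g t) * h₂'
  rw [sandwich_tmul, Lift.act_tmul t ((H₁.mul hg).mul H₂), Lift.act_tmul t hg, EndSec.mul_smul,
    EndSec.smul_mul]

namespace Splitting

lemma sum_sandwich (s : Splitting F L lo hi U) (hlh : lo ≤ hi) (m : Coeff E.V U) :
    ∑ b ∈ Finset.Ico lo hi, ∑ a ∈ Finset.Ico lo hi,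
      Coeff.sandwich (s.red b - s.red (b + 1)) (s.red a - s.red (a + 1)) m = m := by
  induction m using Coeff.induction with
  | h g t =>
    let f : EndSec E.V (T.i ⁻¹ᵁ U) →+ Coeff E.V U :=
      AddMonoidHom.mk' (fun g => Coeff.tmul g t) fun g g' => Coeff.add_tmul g g' t
    have h1 : ∑ b ∈ Finset.Ico lo hi, ∑ a ∈ Finset.Ico lo hi,
        (s.red b - s.red (b + 1)) * g * (s.red a - s.red (a + 1)) = g := by
      simp only [← Finset.mul_sum, ← Finset.sum_mul, s.red_chain.sum_eq_one hlh, mul_one, one_mul]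
    have h2 := congrArg f h1
    simp only [map_sum] at h2
    refine Eq.trans ?_ h2
    exact Finset.sum_congr rfl fun b _ => Finset.sum_congr rfl fun a _ => sandwich_tmul _ _ _ _
  | h' m m' hm hm' => simp only [map_add, Finset.sum_add_distrib, hm, hm']

lemma sandwich_mem_fil (s : Splitting F L lo hi U) {a b p : ℤ} (hab : a + p ≤ b)
    (m : Coeff E.V U) :
    Coeff.sandwich (s.red b - s.red (b + 1)) (s.red a - s.red (a + 1)) m ∈ Coeff.fil F p U := by
  induction m using Coeff.induction with
  | h g t =>
    rw [sandwich_tmul]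
    refine AddSubgroup.subset_closure ⟨_, fun q W h v hv => ?_, t, rfl⟩
    rcases le_or_gt q a with hqa | hqa
    · rw [EndSec.mul_ev, EndSec.mul_ev]
      refine F.antitone W (by lia : q + p ≤ b) ?_
      rw [EndSec.sub_ev]
      exact sub_mem (s.mem b W h _) (F.antitone W (by lia : b ≤ b + 1) (s.mem (b + 1) W h _))
    · have h1 : (s.red a - s.red (a + 1)).ev W h v = 0 := by
        rw [← s.fix q W h v hv]
        exact congr(($(s.red_chain.kappa_proj_of_lt hqa)).ev W h v)
      rw [EndSec.mul_ev, h1, map_zero]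
      exact zero_mem _
  | h' m m' hm hm' => rw [map_add]; exact add_mem hm hm'

/-- Decompose m into its blocks from grade a to grade b. Blocks with b ≥ a + p lie in Fil^p by
construction; the others act by zero on the lift, hence vanish by injectivity of the action. -/
lemma mem_fil (s : Splitting F L lo hi U) (hlh : lo ≤ hi) (hU : L.Framed U) {p : ℤ}
    {m : Coeff E.V U} (hm : m ∈ L.liftable U) (h : HasDeg s.π p (L.act U m)) :
    m ∈ Coeff.fil F p U := by
  rw [← s.sum_sandwich hlh m]
  refine sum_mem fun b _ => sum_mem fun a _ => ?_
  rcases le_or_gt (a + p) b with hab | hab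
  · exact s.sandwich_mem_fil hab m
  · have l (c : ℤ) := (s.lifts c).sub (s.lifts (c + 1))
    have h1 : Coeff.sandwich (s.red b - s.red (b + 1)) (s.red a - s.red (a + 1)) m = 0 := by
      refine Lift.act_injOn hU (sandwich_mem_liftable (l b) (l a) hm) (zero_mem _) ?_
      rw [act_sandwich (l b) (l a) hm, map_zero]
      have h2 : L.act U m * (s.π a - s.π (a + 1)) =
          s.π (a + p) * (L.act U m * s.π a) * (s.π a - s.π (a + 1)) := by
        rw [h a, mul_assoc, s.chain.proj_kappa le_rfl]
      rw [mul_assoc, h2, ← mul_assoc, ← mul_assoc, s.chain.kappa_proj_of_lt hab, zero_mul, zero_mul]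
    rw [h1]
    exact zero_mem _

end Splitting

/-- Endomorphisms with image in `Fil^p`. -/
def HodgeFiltration.imageIn {X S : Scheme.{u}} {f : X ⟶ S} {D : X.IdealSheafData}
    {E : DeRhamBundle f D} (F : HodgeFiltration E) (p : ℤ) (U : X.Opens) :
    AddSubgroup (EndSec E.V U) where
  carrier := {g | ∀ (W : X.Opens) (h : W ≤ U) (v : Γ(E.V, W)), g.ev W h v ∈ F.Fil p W}
  zero_mem' := fun _ _ _ => zero_mem _
  add_mem' h h' := fun W hW v => add_mem (h W hW v) (h' W hW v)
  neg_mem' h := fun W hW v => neg_mem (h W hW v)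

variable (F L) in
-- Projectors on X lift to endomorphisms near x, idempotent only modulo those vanishing on X;
-- `exists_chain` corrects them. No Hodge filtration on the lift is involved.
lemma exists_splitting (hlh : lo < hi) (hF : F.Bounded lo hi) {x : T.X'} (hx : x ∈ U) :
    ∃ W : T.X'.affineOpens, W.1 ≤ U ∧ x ∈ W.1 ∧ L.Framed W.1 ∧
      Nonempty (Splitting F L lo hi W.1) := by
  obtain ⟨y, rfl⟩ := T.exists_eq_i x
  obtain ⟨Y, ρ, hy, hρ₁, hρ₂⟩ := HodgeFiltration.exists_projectors hF y
  obtain ⟨Y', rfl⟩ := exists_pre_eq (T := T) Y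
  obtain ⟨W, hW, hyW, hWf⟩ := L.exists_chart (show T.i y ∈ U ⊓ Y' from ⟨hx, hy⟩)
  have hWY : T.i ⁻¹ᵁ W.1 ≤ T.i ⁻¹ᵁ Y' := pre_mono (hW.trans inf_le_right)
  refine ⟨W, hW.trans inf_le_left, hyW, hWf, ?_⟩
  choose ρ' hρ' using fun p => hWf.exists_lifts ((ρ p).res hWY)
  -- Endomorphisms of the lift whose reduction has image in Fil^p. At `hi` these are exactly the
  -- ones vanishing on X.
  let J (p : ℤ) : AddSubgroup (EndSec L.E'.V W.1) :=
    { carrier := {g' | ∃ g, L.Lifts g' g ∧ g ∈ F.imageIn p (T.i ⁻¹ᵁ W.1)}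
      zero_mem' := ⟨0, Lift.lifts_zero _, zero_mem _⟩
      add_mem' := fun ⟨g, hg, h⟩ ⟨g', hg', h'⟩ => ⟨_, hg.add hg', add_mem h h'⟩
      neg_mem' := fun ⟨g, hg, h⟩ => ⟨_, hg.neg, neg_mem h⟩ }
  have hJ (p : ℤ) (g' : EndSec L.E'.V W.1) (hg' : g' ∈ J p) : ρ' p * g' - g' ∈ L.nil W.1 := by
    obtain ⟨g, hg, h⟩ := hg'
    refine Lift.Lifts.sub_mem_nil (g := g) ?_ hg
    convert (hρ' p).mul hg using 1
    ext W' h' v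
    exact (hρ₂ p W' (h'.trans hWY) _ (h W' h' v)).symm
  obtain ⟨π, hπ, hπJ, hπ'⟩ := exists_chain hlh (Lift.isSqZero_nil (L := L) W.1) J
    (fun p a g' ⟨g, hg, h⟩ => by
      obtain ⟨b, hb⟩ := hWf.exists_reduction a
      exact ⟨_, hg.mul hb, fun W' h' v => h W' h' _⟩)
    (fun p g' hg' => ⟨0, hg', zero_mem _⟩)
    (fun p q hpq g' ⟨g, hg, h⟩ => ⟨g, hg, fun W' h' v => F.antitone W' hpq (h W' h' v)⟩)
    (by
      refine top_le_iff.1 fun g' _ => ?_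
      obtain ⟨g, hg⟩ := hWf.exists_reduction g'
      exact ⟨g, hg, fun W' h' v => by rw [hF.eq_top le_rfl]; trivial⟩)
    (by
      ext g'
      constructor
      · rintro ⟨g, hg, h⟩
        have : g = 0 := by
          ext W' h' v
          have := h W' h' v
          rwa [hF.eq_bot le_rfl] at this
        rwa [this] at hg
      · exact fun hg' => ⟨0, hg', zero_mem _⟩)
    ρ' (fun p => ⟨_, hρ' p, fun W' h' v => hρ₁ p W' (h'.trans hWY) v⟩) hJ
  choose π₀ hπ₀ hπ₀' using hπJ
  refine ⟨⟨π, π₀, hπ, hπ₀, fun p => hπ₀' p, fun p W' h' v hv => ?_⟩⟩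
  have h1 : π₀ p * (ρ p).res hWY - (ρ p).res hWY = 0 :=
    (((hπ₀ p).mul (hρ' p)).sub (hρ' p)).unique
      (hπ' p _ ⟨_, hρ' p, fun W' h' v => hρ₁ p W' (h'.trans hWY) v⟩)
  have h2 : (π₀ p).ev W' h' ((ρ p).ev W' (h'.trans hWY) v) = (ρ p).ev W' (h'.trans hWY) v :=
    congr(($(sub_eq_zero.1 h1)).ev W' h' v)
  rwa [hρ₂ p W' (h'.trans hWY) v hv] at h2

variable (F) in
/-- A splitting of a Hodge filtration on the lift. -/
def Splitting.Exact (s : Splitting F L lo hi U) (F' : HodgeFiltration L.E') : Prop :=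
  ∀ (p : ℤ) (W : T.X'.Opens) (h : W ≤ U) (v : Γ(L.E'.V, W)),
    v ∈ F'.Fil p W ↔ (s.π p).ev W h v = v

/-- The projectors of `F'` are exact, so the chain is built with the zero ideal in the role of N.
Its reduction splits `F` because `F'` lifts `F`. -/
lemma exists_exact_splitting {F' : HodgeFiltration L.E'} (hF' : LiftsFil F L F') (hlh : lo < hi)
    (hb : F'.Bounded lo hi) {x : T.X'} (hx : x ∈ U) :
    ∃ W : T.X'.affineOpens, W.1 ≤ U ∧ x ∈ W.1 ∧ L.Framed W.1 ∧
      ∃ s : Splitting F L lo hi W.1, s.Exact F F' := by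
  obtain ⟨Y, ρ, hy, hρ₁, hρ₂⟩ := HodgeFiltration.exists_projectors hb x
  obtain ⟨W, hW, hyW, hWf⟩ := L.exists_chart (show x ∈ U ⊓ Y from ⟨hx, hy⟩)
  have hWY : W.1 ≤ Y := hW.trans inf_le_right
  refine ⟨W, hW.trans inf_le_left, hyW, hWf, ?_⟩
  have hρJ (p : ℤ) : (ρ p).res hWY ∈ F'.imageIn p W.1 := fun W' h' v => hρ₁ p W' (h'.trans hWY) v
  obtain ⟨π, hπ, hπJ, hπ'⟩ := exists_chain (N := (⊥ : AddSubgroup (EndSec L.E'.V W.1))) hlh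
    ⟨fun a n hn => by rw [AddSubgroup.mem_bot.1 hn, mul_zero]; exact zero_mem _,
      fun a n hn => by rw [AddSubgroup.mem_bot.1 hn, zero_mul]; exact zero_mem _,
      fun {m n} hm hn => by rw [AddSubgroup.mem_bot.1 hn, mul_zero]⟩
    (fun p => F'.imageIn p W.1)
    (fun p a g' hg W' h' v => hg W' h' _)
    (fun p => bot_le)
    (fun p q hpq g' hg W' h' v => F'.antitone W' hpq (hg W' h' v))
    (top_le_iff.1 fun g' _ W' h' v => by rw [hb.eq_top le_rfl]; trivial)
    (le_bot_iff.1 fun g' hg => by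
      refine AddSubgroup.mem_bot.2 ?_
      ext W' h' v
      have := hg W' h' v
      rwa [hb.eq_bot le_rfl] at this)
    (fun p => (ρ p).res hWY) hρJ
    (fun p g hg => by
      rw [AddSubgroup.mem_bot, sub_eq_zero]
      ext W' h' v
      exact hρ₂ p W' (h'.trans hWY) _ (hg W' h' v))
  have hfix (p : ℤ) (W' : T.X'.Opens) (h' : W' ≤ W.1) (v) (hv : v ∈ F'.Fil p W') :
      (π p).ev W' h' v = v := by
    have h2 : (π p).ev W' h' ((ρ p).ev W' (h'.trans hWY) v) = (ρ p).ev W' (h'.trans hWY) v :=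
      congr(($(sub_eq_zero.1 (AddSubgroup.mem_bot.1 (hπ' p _ (hρJ p))))).ev W' h' v)
    rwa [hρ₂ p W' (h'.trans hWY) v hv] at h2
  choose π₀ hπ₀ using fun p => hWf.exists_reduction (π p)
  refine ⟨⟨π, π₀, hπ, hπ₀, fun p W' h' v => ?_, fun p W' h' v hv => ?_⟩, fun p W' h' v =>
    ⟨hfix p W' h' v, fun h => ?_⟩⟩
  · refine (F.isSubbundle p).glue W' _ fun y hy => ?_
    obtain ⟨Z, hZ, hZW, hyZ⟩ := exists_affine_pre_le h' hy
    obtain ⟨w, hw⟩ := Lift.Framed.r_surjective (hWf.mono hZ) (resM E.V hZW v)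
    refine ⟨T.i ⁻¹ᵁ Z.1, hZW, hyZ, ?_⟩
    rw [(π₀ p).res_ev, ← hw]
    exact (hπ₀ p Z.1 hZ w) ▸ hF'.le p Z.1 _ (hπJ p Z.1 hZ w)
  -- A section of Fil^p on X lifts locally to a section of `F'^p`, which the projector upstairs
  -- fixes.
  · refine eq_of_resM _ _ _ fun y hy => ?_
    obtain ⟨Z, hZ, hZW, hyZ⟩ := exists_affine_pre_le h' hy
    obtain ⟨Z', hZ', hyZ', w, hw, hwv⟩ := hF'.surj p Z.1 (resM E.V hZW v)
      ((F.isSubbundle p).res hZW v hv) _ hyZ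
    refine ⟨T.i ⁻¹ᵁ Z', (pre_mono hZ').trans hZW, hyZ', ?_⟩
    rw [resM_resM] at hwv
    rw [(π₀ p).res_ev, ← hwv]
    exact ((hπ₀ p Z' (hZ'.trans hZ) w).symm.trans (congrArg _ (hfix p Z' _ w hw)))
  · exact h ▸ hπJ p W' h' v

end

end FilteredDeRham

end

section

namespace FilteredDeRham

open ThickenedPair

/-! ### The action of sections of the de Rham complex on a lift -/

section

variable {T : ThickenedPair.{u}} {E : DeRhamBundle T.g T.D} {F : HodgeFiltration E} {L : Lift E}
  {p q : ℤ} {n : ℕ} {i : ℤ} {U W : T.X'.Opens}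

namespace ThickenedPair

/-- The value of a form of degree `0`. -/
def FormSec.val₀ : FormSec F p 0 U →+ Coeff E.V U :=
  AddMonoidHom.mk' (fun ω => (ω.1 ⟨U, le_rfl⟩ : Coeff E.V U)) fun _ _ => rfl

/-- The value of a form of degree `1` on a vector field. -/
def FormSec.val₁ (x : T.VF U) : FormSec F p 1 U →+ Coeff E.V U :=
  AddMonoidHom.mk' (fun ω => (ω.1 ⟨U, le_rfl⟩ x : Coeff E.V U)) fun _ _ => rfl

lemma FormSec.res_val₀ (h : W ≤ U) (ω : FormSec F p 0 U) :
    Coeff.res h (FormSec.val₀ ω) = FormSec.val₀ (FormSec.res F p 0 h ω) :=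
  ω.2.2.1 ⟨U, le_rfl⟩ ⟨W, h⟩ h

lemma FormSec.res_val₁ (h : W ≤ U) (x : T.VF U) (ω : FormSec F p 1 U) :
    Coeff.res h (FormSec.val₁ x ω) = FormSec.val₁ (x.res h) (FormSec.res F p 1 h ω) :=
  ω.2.2.1 ⟨U, le_rfl⟩ ⟨W, h⟩ h x

lemma FormSec.val₀_mem (ω : FormSec F p 0 U) : FormSec.val₀ ω ∈ Coeff.fil F p U := by
  have : FormSec.val₀ ω ∈ Coeff.fil F (p - (0 : ℕ)) U := ω.2.2.2 ⟨U, le_rfl⟩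
  rwa [Nat.cast_zero, sub_zero] at this

lemma FormSec.val₁_mem (x : T.VF U) (ω : FormSec F p 1 U) :
    FormSec.val₁ x ω ∈ Coeff.fil F (p - 1) U := by
  have : FormSec.val₁ x ω ∈ Coeff.fil F (p - (1 : ℕ)) U := ω.2.2.2 ⟨U, le_rfl⟩ x
  rwa [Nat.cast_one] at this

lemma FormSec.val₁_d (x : T.VF U) (ω : FormSec F p 0 U) :
    FormSec.val₁ x (FormSec.d F p 0 U ω) = Coeff.nabla x (FormSec.val₀ ω) := rfl

lemma toDR_eq_local (h : (n : ℤ) = i) {ω ω' : FormSec F p n U}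
    (H : toDR F p n i h U ω = toDR F p n i h U ω') {x : T.X'} (hx : x ∈ U) :
    ∃ (W : T.X'.Opens) (hW : W ≤ U), x ∈ W ∧ FormSec.res F p n hW ω = FormSec.res F p n hW ω' := by
  obtain ⟨W, hW, hxW, e⟩ := local_eq_zero_of_toDR_eq_zero F h (ω - ω')
    (by rw [map_sub, H, sub_self]) x hx
  rw [map_sub, sub_eq_zero] at e
  exact ⟨W, hW, hxW, e⟩

lemma toDR_proj_eq_zero (hi : (n : ℤ) = i) (h : p ≤ q) (ω : FormSec F p n U)
    (hω : ∀ W : {W : T.X'.Opens // W ≤ U},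
      ValuedIn (Coeff.fil F (q - n) W.1 : Set (Coeff E.V W.1)) n (ω.1 W)) :
    shApp ((DRProj F h).f i) U (toDR F p n i hi U ω) = 0 := by
  let ω' : FormSec F q n U := ⟨ω.1, ω.2.1, ω.2.2.1, hω⟩
  have : ω = FormSec.incl F n h U ω' := rfl
  rw [this, ← toDR_incl, ← shApp_comp, ← HomologicalComplex.comp_f,
    show DRIncl F h ≫ DRProj F h = 0 from cokernel.condition _]
  rfl

lemma exists_of_proj_eq_zero (h : p ≤ q) (s : AbSh.sec ((DR F p).X i) U)
    (hs : shApp ((DRProj F h).f i) U s = 0) :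
    ∃ t : AbSh.sec ((DR F q).X i) U, shApp ((DRIncl F h).f i) U t = s :=
  exists_lift_of_exact (DRQuot_exact F h i) s hs

end ThickenedPair

namespace Lift

lemma ext_DR (hi : (n : ℤ) = i) (s : AbSh.sec ((DR F p).X i) U) {α β : EndSec L.E'.V U}
    (H : ∀ (W : T.X'.Opens) (h : W ≤ U) (ω : FormSec F p n W),
      toDR F p n i hi W ω = AbSh.res _ h s → α.res h = β.res h) : α = β := by
  refine EndSec.ext_local fun x hx => ?_
  obtain ⟨W, h, hxW, ω, hω⟩ := exists_local_toDR F hi s x hx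
  exact ⟨W, h, hxW, H W h ω hω⟩

/-- A section of `DR` is only locally a form, and two forms representing it agree only after
shrinking. The target is a sheaf, so the local images still glue. -/
lemma exists_extend (hi : (n : ℤ) = i)
    (f : ∀ W : T.X'.Opens, W ≤ U → (FormSec F p n W →+ EndSec L.E'.V W))
    (hf : ∀ (W W' : T.X'.Opens) (hW : W ≤ U) (h : W' ≤ W) (ω : FormSec F p n W),
      (f W hW ω).res h = f W' (h.trans hW) (FormSec.res F p n h ω))
    (s : AbSh.sec ((DR F p).X i) U) :
    ∃ α : EndSec L.E'.V U, ∀ (W : T.X'.Opens) (h : W ≤ U) (ω : FormSec F p n W),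
      toDR F p n i hi W ω = AbSh.res _ h s → α.res h = f W h ω := by
  obtain ⟨α, hα⟩ : ∃ α : EndSec L.E'.V U, ∀ (W : T.X'.Opens) (h : W ≤ U) t,
      (∃ (hW : W ≤ U) (ω : FormSec F p n W),
        toDR F p n i hi W ω = AbSh.res _ hW s ∧ t = f W hW ω) → α.res h = t := by
    refine EndSec.exists_glue (P := fun W t => ∃ (hW : W ≤ U) (ω : FormSec F p n W),
        toDR F p n i hi W ω = AbSh.res _ hW s ∧ t = f W hW ω) ?_ ?_ ?_
    · intro x hx
      obtain ⟨W, h, hxW, ω, hω⟩ := exists_local_toDR F hi s x hx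
      exact ⟨W, h, hxW, _, h, ω, hω, rfl⟩
    · rintro W W' h t - ⟨hW, ω, hω, rfl⟩
      refine ⟨h.trans hW, _, ?_, hf W W' hW h ω⟩
      rw [← toDR_res, hω]
      exact resP_resP _ hW h s
    · rintro W - t t' ⟨hW, ω, hω, rfl⟩ ⟨_, ω', hω', rfl⟩
      refine EndSec.ext_local fun x hx => ?_
      obtain ⟨W', h', hxW', e⟩ := toDR_eq_local hi (hω.trans hω'.symm) hx
      exact ⟨W', h', hxW', by rw [hf W W' hW h', hf W W' hW h', e]⟩
  exact ⟨α, fun W h ω hω => hα W h _ ⟨h, ω, hω, rfl⟩⟩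

/-- The extension to the sheaf of forms of an additive map on the presheaf of forms. -/
def extend (hi : (n : ℤ) = i)
    (f : ∀ W : T.X'.Opens, W ≤ U → (FormSec F p n W →+ EndSec L.E'.V W))
    (hf : ∀ (W W' : T.X'.Opens) (hW : W ≤ U) (h : W' ≤ W) (ω : FormSec F p n W),
      (f W hW ω).res h = f W' (h.trans hW) (FormSec.res F p n h ω)) :
    AbSh.sec ((DR F p).X i) U →+ EndSec L.E'.V U :=
  AddMonoidHom.mk' (fun s => (exists_extend hi f hf s).choose) fun s t => by
    refine EndSec.ext_local fun x hx => ?_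
    obtain ⟨W, h, hxW, ω, hω⟩ := exists_local_toDR F hi s x hx
    obtain ⟨W', h', hxW', ω', hω'⟩ := exists_local_toDR F hi (AbSh.res _ h t) x hxW
    have e1 : toDR F p n i hi W' (FormSec.res F p n h' ω) = AbSh.res _ (h'.trans h) s := by
      rw [← toDR_res, hω]; exact resP_resP _ h h' s
    have e2 : toDR F p n i hi W' ω' = AbSh.res _ (h'.trans h) t := by
      rw [hω']; exact resP_resP _ h h' t
    refine ⟨W', h'.trans h, hxW', ?_⟩
    rw [map_add, (exists_extend hi f hf s).choose_spec W' _ _ e1,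
      (exists_extend hi f hf t).choose_spec W' _ _ e2, ← map_add]
    refine (exists_extend hi f hf (s + t)).choose_spec W' _ _ ?_
    rw [map_add, e1, e2, map_add]

lemma extend_res (hi : (n : ℤ) = i)
    {f : ∀ W : T.X'.Opens, W ≤ U → (FormSec F p n W →+ EndSec L.E'.V W)} (hf)
    (s : AbSh.sec ((DR F p).X i) U) (h : W ≤ U) (ω : FormSec F p n W)
    (hω : toDR F p n i hi W ω = AbSh.res _ h s) : (extend hi f hf s).res h = f W h ω :=
  (exists_extend hi f hf s).choose_spec W h ω hω

variable (F L p) in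
/-- The action on the lift of sections of the de Rham complex in degree `0`. -/
def dr₀ (U : T.X'.Opens) : AbSh.sec ((DR F p).X 0) U →+ EndSec L.E'.V U :=
  extend (n := 0) Nat.cast_zero (fun W _ => (L.act W).comp FormSec.val₀) fun W W' hW h ω => by
    change (L.act W (FormSec.val₀ ω)).res h = L.act W' (FormSec.val₀ _)
    rw [← act_res, FormSec.res_val₀]

variable (F L p) in
/-- The action on the lift of the contraction of sections of the de Rham complex in degree `1`
with a vector field. -/
def dr₁ (x : T.VF U) : AbSh.sec ((DR F p).X 1) U →+ EndSec L.E'.V U :=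
  extend (n := 1) Nat.cast_one (fun W h => (L.act W).comp (FormSec.val₁ (x.res h)))
    fun W W' hW h ω => by
      change (L.act W (FormSec.val₁ _ ω)).res h = L.act W' (FormSec.val₁ _ _)
      rw [← act_res, FormSec.res_val₁]
      rfl

lemma dr₀_res_eq (s : AbSh.sec ((DR F p).X 0) U) (h : W ≤ U) (ω : FormSec F p 0 W)
    (hω : toDR F p 0 0 Nat.cast_zero W ω = AbSh.res _ h s) :
    (L.dr₀ F p U s).res h = L.act W (FormSec.val₀ ω) := extend_res _ _ s h ω hω

lemma dr₁_res_eq (x : T.VF U) (s : AbSh.sec ((DR F p).X 1) U) (h : W ≤ U) (ω : FormSec F p 1 W)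
    (hω : toDR F p 1 1 Nat.cast_one W ω = AbSh.res _ h s) :
    (L.dr₁ F p x s).res h = L.act W (FormSec.val₁ (x.res h) ω) := extend_res _ _ s h ω hω

lemma dr₀_toDR (ω : FormSec F p 0 U) :
    L.dr₀ F p U (toDR F p 0 0 Nat.cast_zero U ω) = L.act U (FormSec.val₀ ω) :=
  dr₀_res_eq _ le_rfl ω (resP_self _ _).symm

lemma dr₁_toDR (x : T.VF U) (ω : FormSec F p 1 U) :
    L.dr₁ F p x (toDR F p 1 1 Nat.cast_one U ω) = L.act U (FormSec.val₁ x ω) :=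
  dr₁_res_eq x _ le_rfl ω (resP_self _ _).symm

lemma dr₀_res (h : W ≤ U) (s : AbSh.sec ((DR F p).X 0) U) :
    (L.dr₀ F p U s).res h = L.dr₀ F p W (AbSh.res _ h s) := by
  refine ext_DR Nat.cast_zero (AbSh.res _ h s) fun W' h' ω hω => ?_
  rw [dr₀_res_eq _ h' ω hω, EndSec.res_res]
  exact dr₀_res_eq s _ ω (hω.trans (resP_resP _ h h' s))

lemma dr₁_res (h : W ≤ U) (x : T.VF U) (s : AbSh.sec ((DR F p).X 1) U) :
    (L.dr₁ F p x s).res h = L.dr₁ F p (x.res h) (AbSh.res _ h s) := by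
  refine ext_DR Nat.cast_one (AbSh.res _ h s) fun W' h' ω hω => ?_
  rw [dr₁_res_eq _ _ h' ω hω, EndSec.res_res]
  exact dr₁_res_eq x s _ ω (hω.trans (resP_resP _ h h' s))

lemma incl_toDR_res (hi : (n : ℤ) = i) (h : p ≤ q) (s : AbSh.sec ((DR F q).X i) U) (hW : W ≤ U)
    (ω : FormSec F q n W) (hω : toDR F q n i hi W ω = AbSh.res _ hW s) :
    toDR F p n i hi W (FormSec.incl F n h W ω) =
      AbSh.res _ hW (shApp ((DRIncl F h).f i) U s) := by
  rw [← toDR_incl, hω]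
  exact (shApp_res _ _ _).symm

lemma dr₀_incl (h : p ≤ q) (s : AbSh.sec ((DR F q).X 0) U) :
    L.dr₀ F p U (shApp ((DRIncl F h).f 0) U s) = L.dr₀ F q U s := by
  refine ext_DR Nat.cast_zero s fun W hW ω hω => ?_
  rw [dr₀_res_eq s hW ω hω, dr₀_res_eq _ hW _ (incl_toDR_res _ h s hW ω hω)]
  rfl

lemma dr₁_incl (h : p ≤ q) (x : T.VF U) (s : AbSh.sec ((DR F q).X 1) U) :
    L.dr₁ F p x (shApp ((DRIncl F h).f 1) U s) = L.dr₁ F q x s := by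
  refine ext_DR Nat.cast_one s fun W hW ω hω => ?_
  rw [dr₁_res_eq x s hW ω hω, dr₁_res_eq x _ hW _ (incl_toDR_res _ h s hW ω hω)]
  rfl

lemma dr₀_mem_nil (s : AbSh.sec ((DR F p).X 0) U) : L.dr₀ F p U s ∈ L.nil U := by
  refine mem_nil_of_locally fun x hx => ?_
  obtain ⟨W, h, hxW, ω, hω⟩ := exists_local_toDR F Nat.cast_zero s x hx
  exact ⟨W, h, hxW, dr₀_res_eq (L := L) s h ω hω ▸ act_mem_nil _⟩

lemma dr₁_mem_nil (x : T.VF U) (s : AbSh.sec ((DR F p).X 1) U) : L.dr₁ F p x s ∈ L.nil U := by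
  refine mem_nil_of_locally fun y hy => ?_
  obtain ⟨W, h, hyW, ω, hω⟩ := exists_local_toDR F Nat.cast_one s y hy
  exact ⟨W, h, hyW, dr₁_res_eq (L := L) x s h ω hω ▸ act_mem_nil _⟩

lemma dr₀_hasDeg {lo hi : ℤ} (σ : Splitting F L lo hi U) (s : AbSh.sec ((DR F p).X 0) U) :
    HasDeg σ.π p (L.dr₀ F p U s) := fun k =>
  ext_DR Nat.cast_zero s fun W h ω hω => by
    rw [EndSec.res_mul, EndSec.res_mul, dr₀_res_eq s h ω hω]
    exact (σ.res h).hasDeg_act (FormSec.val₀_mem ω) k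

lemma dr₁_hasDeg {lo hi : ℤ} (σ : Splitting F L lo hi U) (x : T.VF U)
    (s : AbSh.sec ((DR F p).X 1) U) : HasDeg σ.π (p - 1) (L.dr₁ F p x s) := fun k =>
  ext_DR Nat.cast_one s fun W h ω hω => by
    rw [EndSec.res_mul, EndSec.res_mul, dr₁_res_eq x s h ω hω]
    exact (σ.res h).hasDeg_act (FormSec.val₁_mem _ ω) k

lemma nablaEnd_res (x : T.VF U) (h : W ≤ U) (α : EndSec L.E'.V U) :
    (L.E'.nablaEnd U x.fst α).res h = L.E'.nablaEnd W (x.res h).fst (α.res h) := rfl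

lemma dr₁_d (x : T.VF U) (s : AbSh.sec ((DR F p).X 0) U) :
    L.dr₁ F p x (shApp ((DR F p).d 0 1) U s) = L.E'.nablaEnd U x.fst (L.dr₀ F p U s) := by
  refine ext_DR Nat.cast_zero s fun W h ω hω => ?_
  rw [dr₁_res_eq x _ h (FormSec.d F p 0 W ω), nablaEnd_res, dr₀_res_eq s h ω hω,
    FormSec.val₁_d, act_nabla]
  rw [← toDR_d F Nat.cast_zero, hω]
  exact (shApp_res _ _ _).symm

lemma dr₁_add_left (x y : T.VF U) (s : AbSh.sec ((DR F p).X 1) U) :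
    L.dr₁ F p (x + y) s = L.dr₁ F p x s + L.dr₁ F p y s := by
  refine ext_DR Nat.cast_one s fun W h ω hω => ?_
  rw [map_add, dr₁_res_eq _ s h ω hω, dr₁_res_eq _ s h ω hω, dr₁_res_eq _ s h ω hω, ← map_add]
  exact congrArg (L.act W) ((ω.2.1 ⟨W, le_rfl⟩).map_add (x.res h) (y.res h))

lemma dr₁_smul_left (a : Γ(T.X', U)) (x : T.VF U) (s : AbSh.sec ((DR F p).X 1) U) :
    L.dr₁ F p (a • x) s = a • L.dr₁ F p x s := by
  refine ext_DR Nat.cast_one s fun W h ω hω => ?_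
  have h1 : (a • x).res h = resO h a • x.res h :=
    VF.ext (LogDer.res_smul h a x.fst) ((LogDer.res_smul (pre_mono h) _ x.snd).trans (by
      rw [← red_resO]; rfl))
  rw [EndSec.res_smul, dr₁_res_eq _ s h ω hω, dr₁_res_eq _ s h ω hω, ← act_smul, h1]
  exact congrArg (L.act W) ((ω.2.1 ⟨W, le_rfl⟩).map_smul (resO h a) (x.res h))

/-- Closedness of `s` is the condition under which changing a connection by `s` keeps it flat, since
quadratic terms vanish on the lift. -/
lemma dr₁_flat (s : AbSh.sec ((DR F p).X 1) U) (hs : shApp ((DR F p).d 1 2) U s = 0)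
    (x y : T.VF U) : L.E'.nablaEnd U x.fst (L.dr₁ F p y s) -
      L.E'.nablaEnd U y.fst (L.dr₁ F p x s) - L.dr₁ F p ⁅x, y⁆ s = 0 := by
  refine EndSec.ext_local fun z hz => ?_
  obtain ⟨W, h, hzW, ω, hω⟩ := exists_local_toDR F Nat.cast_one s z hz
  have h1 : toDR F p 2 2 rfl W (FormSec.d F p 1 W ω) = 0 := by
    rw [← toDR_d F Nat.cast_one, hω, ← shApp_res, hs, map_zero]
  obtain ⟨W', h', hzW', e⟩ := local_eq_zero_of_toDR_eq_zero F rfl _ h1 z hzW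
  have hω' : toDR F p 1 1 Nat.cast_one W' (FormSec.res F p 1 h' ω) =
      AbSh.res _ (h'.trans h) s := by
    rw [← toDR_res, hω]
    exact resP_resP _ h h' s
  have e' : FormSec.d F p 1 W' (FormSec.res F p 1 h' ω) = 0 := e
  set η := FormSec.res F p 1 h' ω
  refine ⟨W', h'.trans h, hzW', ?_⟩
  rw [map_sub, map_sub, nablaEnd_res, nablaEnd_res, dr₁_res_eq x s _ η hω',
    dr₁_res_eq y s _ η hω', dr₁_res_eq ⁅x, y⁆ s _ η hω', ← act_nabla, ← act_nabla, ← map_sub,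
    ← map_sub, map_zero]
  have h2 : ((FormSec.d F p 1 W' η).1 ⟨W', le_rfl⟩ (x.res (h'.trans h)) (y.res (h'.trans h)) :
      Coeff E.V W') = 0 := by rw [e']; rfl
  refine (congrArg (L.act W') (Eq.trans ?_ h2)).trans (map_zero _)
  -- Cartan's formula gives dη(x, y) in the order ∇_x η(y) − η([x, y]) − ∇_y η(x).
  exact sub_right_comm (Coeff.nabla _ _) (Coeff.nabla _ _) _

/-! ### Forms given by nilpotent endomorphisms -/

lemma form₀_mem (hp : ∀ U, Coeff.fil F p U = ⊤) (hU : L.Framed U) (α : L.nil U) :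
    (fun W => coeff (hU.mono W.2) ⟨α.1.res W.2, nil_res α.2 W.2⟩ :
      ∀ W : {W : T.X'.Opens // W ≤ U}, Cochain (T.VF W.1) (Coeff E.V W.1) 0) ∈ formSec F p 0 U := by
  refine ⟨fun _ => trivial, fun W W' h => ?_, fun W => ?_⟩
  · change Coeff.res h (coeff (hU.mono W.2) _) = coeff (hU.mono W'.2) _
    rw [res_coeff]
    rfl
  · change coeff (hU.mono W.2) _ ∈ Coeff.fil F (p - (0 : ℕ)) W.1
    rw [Nat.cast_zero, sub_zero, hp]
    trivial

variable (F p) in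
/-- A nilpotent endomorphism as a form of degree `0`. -/
def form₀ (hp : ∀ U, Coeff.fil F p U = ⊤) (hU : L.Framed U) (α : L.nil U) : FormSec F p 0 U :=
  ⟨_, form₀_mem hp hU α⟩

lemma form₀_res (hp : ∀ U, Coeff.fil F p U = ⊤) (hU : L.Framed U) (h : W ≤ U) (α : L.nil U) :
    FormSec.res F p 0 h (form₀ F p hp hU α) =
      form₀ F p hp (hU.mono h) ⟨α.1.res h, nil_res α.2 h⟩ := rfl

lemma act_form₀ (hp : ∀ U, Coeff.fil F p U = ⊤) (hU : L.Framed U) (α : L.nil U) :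
    L.act U (FormSec.val₀ (form₀ F p hp hU α)) = α.1 := act_coeff _ _

variable (L U) in
/-- A form of degree `1` with values in nilpotent endomorphisms. -/
structure NilForm where
  /-- the values -/
  val (W : T.X'.Opens) (h : W ≤ U) : T.VF W → EndSec L.E'.V W
  mem (W : T.X'.Opens) (h : W ≤ U) (x : T.VF W) : val W h x ∈ L.nil W
  add (W : T.X'.Opens) (h : W ≤ U) (x y : T.VF W) : val W h (x + y) = val W h x + val W h y
  smul (W : T.X'.Opens) (h : W ≤ U) (a : Γ(T.X', W)) (x : T.VF W) :
    val W h (a • x) = a • val W h x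
  res (W W' : T.X'.Opens) (h : W ≤ U) (h' : W' ≤ W) (x : T.VF W) :
    (val W h x).res h' = val W' (h'.trans h) (x.res h')

lemma form₁_mem (hp : ∀ U, Coeff.fil F (p - (1 : ℕ)) U = ⊤) (hU : L.Framed U) (κ : L.NilForm U) :
    (fun W x => coeff (hU.mono W.2) ⟨κ.val W.1 W.2 x, κ.mem W.1 W.2 x⟩ :
      ∀ W : {W : T.X'.Opens // W ≤ U}, Cochain (T.VF W.1) (Coeff E.V W.1) 1) ∈ formSec F p 1 U := by
  refine ⟨fun W => ⟨fun x y => ?_, fun a x => ?_⟩, fun W W' h x => ?_, fun W x => ?_⟩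
  · change coeff (hU.mono W.2) _ = coeff (hU.mono W.2) _ + coeff (hU.mono W.2) _
    rw [← map_add]
    exact congrArg (coeff (hU.mono W.2)) (Subtype.ext (κ.add W.1 W.2 x y))
  · change coeff (hU.mono W.2) _ = a • coeff (hU.mono W.2) _
    rw [smul_coeff]
    exact congrArg (coeff (hU.mono W.2)) (Subtype.ext (κ.smul W.1 W.2 a x))
  · change Coeff.res h (coeff (hU.mono W.2) _) = coeff (hU.mono W'.2) _
    rw [res_coeff]
    exact congrArg (coeff (hU.mono W'.2)) (Subtype.ext (κ.res W.1 W'.1 W.2 h x))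
  · change coeff (hU.mono W.2) _ ∈ Coeff.fil F (p - (1 : ℕ)) W.1
    rw [hp]
    trivial

variable (F p) in
/-- The section of the de Rham complex of degree `1` given by a form with nilpotent values. -/
def form₁ (hp : ∀ U, Coeff.fil F (p - (1 : ℕ)) U = ⊤) (hU : L.Framed U) (κ : L.NilForm U) :
    FormSec F p 1 U := ⟨_, form₁_mem hp hU κ⟩

lemma act_form₁ (hp : ∀ U, Coeff.fil F (p - (1 : ℕ)) U = ⊤) (hU : L.Framed U) (κ : L.NilForm U)
    (x : T.VF U) : L.act U (FormSec.val₁ x (form₁ F p hp hU κ)) = κ.val U le_rfl x :=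
  act_coeff _ _

/-- The test used for every identity in the quotient complex: it suffices that the values act on the
lift with the right degree for some splitting. -/
lemma proj_toDR_eq_zero {lo hi : ℤ} (hlh : lo ≤ hi) (σ : Splitting F L lo hi U)
    (hU : L.Framed U) (hi' : (n : ℤ) = i) (h : p ≤ q) (ω : FormSec F p n U)
    (hω : ∀ W : {W : T.X'.Opens // W ≤ U}, ValuedIn {m : Coeff E.V W.1 | m ∈ L.liftable W.1 ∧
      HasDeg (σ.res W.2).π (q - n) (L.act W.1 m)} n (ω.1 W)) :
    shApp ((DRProj F h).f i) U (toDR F p n i hi' U ω) = 0 :=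
  toDR_proj_eq_zero hi' h ω fun W => (hω W).mono fun _ hm =>
    (σ.res W.2).mem_fil hlh (hU.mono W.2) hm.1 hm.2

end Lift

end

/-- All endomorphisms lie in sufficiently small steps of the filtration. -/
lemma ThickenedPair.Coeff.fil_eq_top {T : ThickenedPair.{u}} {E : DeRhamBundle T.g T.D}
    {F : HodgeFiltration E} {lo hi p : ℤ} (hF : F.Bounded lo hi) (hp : p ≤ lo - hi)
    (U : T.X'.Opens) : Coeff.fil F p U = ⊤ := by
  refine top_le_iff.1 fun m _ => ?_
  induction m using Coeff.induction with
  | h g t =>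
    refine AddSubgroup.subset_closure ⟨g, fun a W h v hv => ?_, t, rfl⟩
    rcases le_or_gt (a + p) lo with h' | h'
    · rw [hF.eq_top h']
      trivial
    · rw [hF.eq_bot (by lia), Submodule.mem_bot] at hv
      rw [hv, map_zero]
      exact zero_mem _
  | h' m m' hm hm' => exact add_mem (hm trivial) (hm' trivial)

end FilteredDeRham

end

section

namespace FilteredDeRham

open ThickenedPair

attribute [local instance] HasDerivedCategory.standard

/-! ### Uniqueness of filtered lifts -/

section

variable {X S : Scheme.{u}} {f : X ⟶ S} {D : X.IdealSheafData} (E : DeRhamBundle f D) {U : X.Opens}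

lemma DeRhamBundle.nablaEnd_mul (x : LogDer f D U) (g h : EndSec E.V U) :
    E.nablaEnd U x (g * h) = E.nablaEnd U x g * h + g * E.nablaEnd U x h := by
  ext W hW v
  simp only [DeRhamBundle.nablaEnd_ev, EndSec.add_ev, EndSec.mul_ev, map_sub]
  abel

/-- The covariant derivative of endomorphisms as an additive map. -/
def DeRhamBundle.nablaEndHom (x : LogDer f D U) : EndSec E.V U →+ EndSec E.V U :=
  AddMonoidHom.mk' (E.nablaEnd U x) (E.nablaEnd_add_right x)

/-- The automorphism of a module given by an invertible endomorphism. -/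
def EndSec.toIso {V : X.Modules} (g h : EndSec V ⊤) (hg : g * h = 1) (gh : h * g = 1) : V ≅ V :=
  modIso V V
    (fun U => { g.ev U le_top with
      invFun := h.ev U le_top
      left_inv := fun v => congr(($gh).ev U le_top v)
      right_inv := fun v => congr(($hg).ev U le_top v) })
    fun _ _ hW v => (g.res_ev le_top hW v).symm

lemma EndSec.toIso_hom_app {V : X.Modules} (g h : EndSec V ⊤) (hg : g * h = 1) (gh : h * g = 1)
    (U : X.Opens) (v : Γ(V, U)) : (EndSec.toIso g h hg gh).hom.app U v = g.ev U le_top v := rfl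

lemma HodgeFiltration.exists_bounded (F : HodgeFiltration E) :
    ∃ N : ℤ, ∀ lo hi, lo ≤ -N → N ≤ hi → F.Bounded lo hi := by
  obtain ⟨a, b, hab⟩ := F.finite
  exact ⟨max (-a) b, fun lo hi hl hh =>
    HodgeFiltration.Bounded.mono (F := F) (lo := a) (hi := b) hab (by lia) (by lia)⟩

end

section

variable {T : ThickenedPair.{u}} {E : DeRhamBundle T.g T.D} {F : HodgeFiltration E} {L : Lift E}
  {lo hi : ℤ} {U W : T.X'.Opens}

lemma HasDeg.res {X : Scheme.{u}} {V : X.Modules} {U W : X.Opens} {π : ℤ → EndSec V U} {p : ℤ}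
    {α : EndSec V U} (h : HasDeg π p α) (hW : W ≤ U) :
    HasDeg (fun q => (π q).res hW) p (α.res hW) := fun q => by
  have := congrArg (EndSec.res hW) (h q)
  rwa [EndSec.res_mul, EndSec.res_mul] at this

lemma MapsFil.res {X : Scheme.{u}} {V : X.Modules} {U W : X.Opens} {π π' : ℤ → EndSec V U}
    {u : EndSec V U} (h : MapsFil π π' u) (hW : W ≤ U) :
    MapsFil (fun q => (π q).res hW) (fun q => (π' q).res hW) (u.res hW) := fun q => by
  have := congrArg (EndSec.res hW) (h q)
  rwa [EndSec.res_mul, EndSec.res_mul] at this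

lemma Lift.proj_toDR_eq_zero₀ (hlh : lo ≤ hi) (σ : Splitting F L lo hi U) (hU : L.Framed U)
    {p q : ℤ} (h : p ≤ q) (ω : FormSec F p 0 U)
    (hω : ∀ W : {W : T.X'.Opens // W ≤ U}, (ω.1 W : Coeff E.V W.1) ∈ L.liftable W.1)
    (hd : HasDeg σ.π q (L.act U (FormSec.val₀ ω))) :
    shApp ((DRProj F h).f 0) U (toDR F p 0 0 Nat.cast_zero U ω) = 0 :=
  Lift.proj_toDR_eq_zero hlh σ hU Nat.cast_zero h ω fun W => ⟨hω W, by
    have := hd.res W.2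
    rw [← Lift.act_res, FormSec.res_val₀] at this
    rwa [Nat.cast_zero, sub_zero]⟩

namespace Splitting.Exact

variable {F' F'' : HodgeFiltration L.E'} {s s' : Splitting F L lo hi U}

lemma res (h : s.Exact F F') (hW : W ≤ U) : (s.res hW).Exact F F' :=
  fun p W' h' v => h p W' (h'.trans hW) v

lemma mapsFil_one (h : s.Exact F F') (h' : s'.Exact F F') : MapsFil s.π s'.π 1 := fun q => by
  rw [one_mul]
  ext W hW v
  refine (h' q W hW _).1 ((h q W hW _).2 ?_)
  exact congr(($(s.chain.mul_of_le (le_refl q))).ev W hW v)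

/-- For w with image in Fil^q the derivative of w is ∇ w − w ∇. The first term lies in Fil^(q−1) by
transversality, the second in Fil^q. -/
lemma isGriff (h : s.Exact F F') (x : LogDer T.g' T.D' U) :
    IsGriff s.π (L.E'.nablaEndHom x) 0 := fun q w hw => by
  have key (W : T.X'.Opens) (hW : W ≤ U) (v : Γ(L.E'.V, W)) : w.ev W hW v ∈ F'.Fil q W :=
    (h q W hW _).2 congr(($hw).ev W hW v)
  rw [zero_mul, sub_zero]
  ext W hW v
  refine (h (q - 1) W hW _).1 (sub_mem (F'.griffiths q W _ _ (key W hW v)) ?_)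
  exact F'.antitone W (by lia : q - 1 ≤ q) (key W hW _)

lemma mem_of_mapsFil (h : s.Exact F F') (h' : s'.Exact F F'') {u : EndSec L.E'.V U}
    (hu : MapsFil s.π s'.π u) (p : ℤ) (hW : W ≤ U) {v : Γ(L.E'.V, W)} (hv : v ∈ F'.Fil p W) :
    u.ev W hW v ∈ F''.Fil p W := by
  refine (h' p W hW _).2 ?_
  have h1 := congr(($(hu p)).ev W hW v)
  rw [EndSec.mul_ev, EndSec.mul_ev, (h p W hW v).1 hv] at h1
  exact h1

end Splitting.Exact

/-- Two Hodge filtrations on a lift which lift the same filtration are exchanged by an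
automorphism of the lift. -/
theorem nonempty_iso_of_lifts (hE : HodgeDeRhamDegenerates F) (F₁ F₂ : HodgeFiltration L.E')
    (hF₁ : LiftsFil F L F₁) (hF₂ : LiftsFil F L F₂) :
    Nonempty (FilLift.Iso (F := F) ⟨L, F₁, hF₁⟩ ⟨L, F₂, hF₂⟩) := by
  obtain ⟨N₀, hN₀⟩ := F.exists_bounded
  obtain ⟨N₁, hN₁⟩ := F₁.exists_bounded
  obtain ⟨N₂, hN₂⟩ := F₂.exists_bounded
  obtain ⟨lo, hi, hlh, b₀, b₁, b₂⟩ : ∃ lo hi : ℤ, lo < hi ∧ F.Bounded lo hi ∧ F₁.Bounded lo hi ∧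
      F₂.Bounded lo hi :=
    ⟨-max 0 (max N₀ (max N₁ N₂)) - 1, max 0 (max N₀ (max N₁ N₂)) + 1, by lia,
      hN₀ _ _ (by lia) (by lia), hN₁ _ _ (by lia) (by lia), hN₂ _ _ (by lia) (by lia)⟩
  have hp : lo - hi ≤ 0 := by lia
  -- Step lo − hi of the filtration is everything, so `Fil^(lo-hi) DR` plays the part of the whole
  -- complex and all forms below belong to it.
  have htop : ∀ U, Coeff.fil F (lo - hi) U = ⊤ := Coeff.fil_eq_top b₀ le_rfl
  have hex (x : T.X') : ∃ U : T.X'.Opens, x ∈ U ∧ L.Framed U ∧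
      ∃ s₁ s₂ : Splitting F L lo hi U, s₁.Exact F F₁ ∧ s₂.Exact F F₂ := by
    obtain ⟨W₁, -, hx₁, -, s₁, h₁⟩ := exists_exact_splitting (U := ⊤) hF₁ hlh b₁
      (show x ∈ (⊤ : T.X'.Opens) from trivial)
    obtain ⟨W₂, h, hx₂, hW₂, s₂, h₂⟩ := exists_exact_splitting hF₂ hlh b₂ hx₁
    exact ⟨W₂.1, hx₂, hW₂, s₁.res h, s₂, h₁.res h, h₂⟩
  choose U hxU hU s₁ s₂ h₁ h₂ using hex
  have hmod (x) := (s₁ x).sameMod (s₂ x)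
  let φ (x : T.X') : L.nil (U x) := ⟨chainTransition lo hi (s₁ x).π (s₂ x).π - 1,
    chainTransition_mem hlh.le (Lift.isSqZero_nil _) (s₁ x).chain (hmod x)⟩
  have hφ (x) : MapsFil (s₁ x).π (s₂ x).π (1 + (φ x).1) := by
    rw [show 1 + (φ x).1 = _ from add_sub_cancel _ _]
    exact chainTransition_mapsFil (s₁ x).chain (s₂ x).chain
  let ω (x : T.X') : FormSec F (lo - hi) 0 (U x) := Lift.form₀ F _ htop (hU x) (φ x)
  let S (x : T.X') := shApp ((DRProj F hp).f 0) (U x) (toDR F _ 0 0 Nat.cast_zero (U x) (ω x))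
  -- The element φ exchanging the two filtrations is unique up to degree 0, so its class modulo Fil⁰
  -- is global.
  obtain ⟨σ, hσ⟩ := AbSh.exists_gluing ((DRQuot F hp).X 0) U (fun x => ⟨x, hxU x⟩) S fun x y => by
    rw [← sub_eq_zero, shApp_res, shApp_res, toDR_res, toDR_res, ← map_sub, ← map_sub]
    refine Lift.proj_toDR_eq_zero₀ hlh.le ((s₁ x).res inf_le_left) ((hU x).mono inf_le_left) hp _
      (fun W => sub_mem (Lift.coeff_mem _ _) (Lift.coeff_mem _ _)) ?_
    rw [map_sub, map_sub, ← FormSec.res_val₀, ← FormSec.res_val₀, Lift.act_res, Lift.act_res,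
      Lift.act_form₀, Lift.act_form₀]
    refine MapsFil.sub_hasDeg hlh.le (Lift.isSqZero_nil _) ((s₁ x).res inf_le_left).chain
      ((s₂ x).res inf_le_left).chain (Splitting.sameMod _ _) (Lift.nil_res (φ x).2 _)
      (Lift.nil_res (φ y).2 _) ((hφ x).res inf_le_left) ?_
    -- The splittings at x and y cut out the same filtrations F₁ and F₂, so the identity maps one to
    -- the other and φ y can be read with the splittings at x.
    have h3 := (((h₁ x).res inf_le_left).mapsFil_one ((h₁ y).res inf_le_right)).mul
      ((s₁ x).res inf_le_left).chain ((hφ y).res inf_le_right)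
    have h4 := h3.mul ((s₁ x).res inf_le_left).chain
      (((h₂ y).res inf_le_right).mapsFil_one ((h₂ x).res inf_le_left))
    rwa [one_mul, mul_one, map_add] at h4
  have hdσ : shApp ((DRQuot F hp).d 0 1) ⊤ σ = 0 := by
    refine eq_of_locally_eq (AbSh.isSheaf _) _ _ fun x _ => ⟨U x, le_top, hxU x, ?_⟩
    rw [map_zero]
    refine (shApp_res _ _ _).trans ?_
    rw [hσ, ← shApp_comp, (DRProj F hp).comm, shApp_comp, toDR_d F Nat.cast_zero Nat.cast_one]
    refine Lift.proj_toDR_eq_zero hlh.le (s₂ x) (hU x) Nat.cast_one hp _ fun W ξ => ⟨?_, ?_⟩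
    · exact Lift.liftable_nabla ξ (Lift.coeff_mem _ _)
    · change HasDeg ((s₂ x).res W.2).π (0 - (1 : ℕ)) (L.act W.1 (Coeff.nabla ξ (Lift.coeff _ _)))
      rw [Lift.act_nabla, Lift.act_coeff, Nat.cast_one, zero_sub]
      have hN := Lift.isSqZero_nil (L := L) W.1
      -- Moving the transversality of F₁ to F₂ by 1 + φ shows that ∇ − ∇φ is transversal for F₂. So
      -- is ∇ itself, hence ∇φ has degree −1, which is Fil⁰ of the complex in degree 1.
      have h5 := IsGriff.transport hN (L.E'.nablaEnd_mul ξ.fst)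
        (fun n hn => Lift.nablaEnd_mem_nil ξ.fst hn) (zero_mem _) (Lift.nil_res (φ x).2 W.2)
        ((hφ x).res W.2) (MapsFil.symm hlh.le hN ((s₁ x).res W.2).chain ((s₂ x).res W.2).chain
          (Splitting.sameMod _ _) (Lift.nil_res (φ x).2 W.2) ((hφ x).res W.2))
        (((h₁ x).res W.2).isGriff ξ.fst)
      have h6 := h5.hasDeg ((s₂ x).res W.2).chain (((h₂ x).res W.2).isGriff ξ.fst)
      rwa [zero_add, sub_zero] at h6
  -- Degeneration, through surjectivity on ℍ⁰, supplies a horizontal global endomorphism with the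
  -- given class.
  obtain ⟨β, hβ, hβσ⟩ := exists_cycle_lift (DRProj F hp) (fun i => isZero_DR_neg F _ i)
    (fun i => isZero_DRQuot_neg F hp i) (Q_map_DRProj_surjective_zero hE hp) σ hdσ
  let b := L.dr₀ F (lo - hi) ⊤ β
  have hb : b ∈ L.nil ⊤ := Lift.dr₀_mem_nil β
  have hN := Lift.isSqZero_nil (L := L) ⊤
  have hflat (W : T.X'.Opens) (x : LogDer T.g' T.D' W) :
      L.E'.nablaEnd W x (b.res le_top) = 0 := by
    rw [← toVF_fst x, Lift.dr₀_res, ← Lift.dr₁_d, ← shApp_res, hβ, map_zero, map_zero]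
  -- Locally b differs from φ by an element of degree 0, which preserves F₁; so 1 + b carries F₁ to
  -- F₂ as 1 + φ does.
  have hmaps (x) : MapsFil (s₁ x).π (s₂ x).π (1 + b.res le_top) := by
    have h7 : shApp ((DRProj F hp).f 0) (U x)
        (AbSh.res _ le_top β - toDR F _ 0 0 Nat.cast_zero (U x) (ω x)) = 0 := by
      rw [map_sub, ← shApp_res, hβσ, hσ, sub_self]
    obtain ⟨t, ht⟩ := exists_of_proj_eq_zero hp _ h7
    have h8 : b.res le_top - (φ x).1 = L.dr₀ F 0 (U x) t := by
      rw [← Lift.dr₀_incl hp, ht, map_sub, ← Lift.dr₀_res, Lift.dr₀_toDR, Lift.act_form₀]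
    have h9 := (Lift.dr₀_hasDeg (s₁ x) t)
    have h10 := ((mapsFil_one_add_iff (s₁ x).chain).2 h9).mul (s₁ x).chain (hφ x)
    rwa [(Lift.isSqZero_nil _).one_add_mul (φ x).2 (Lift.dr₀_mem_nil t), ← h8,
      add_sub_cancel] at h10
  have hmaps' (x) : MapsFil (s₂ x).π (s₁ x).π (1 - b.res le_top) :=
    MapsFil.symm hlh.le (Lift.isSqZero_nil _) (s₁ x).chain (s₂ x).chain (hmod x)
      (Lift.nil_res hb _) (hmaps x)
  have e₁ := hN.one_add_mul_one_sub hb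
  have e₂ := hN.one_sub_mul_one_add hb
  refine ⟨⟨⟨EndSec.toIso (1 + b) (1 - b) e₁ e₂, fun W x v => ?_, ?_⟩, fun p W v => ?_⟩⟩
  · have h11 := congr(($(hflat W x)).ev W le_rfl v)
    rw [DeRhamBundle.nablaEnd_ev, EndSec.zero_ev, sub_eq_zero] at h11
    rw [EndSec.toIso_hom_app, EndSec.toIso_hom_app, EndSec.add_ev, EndSec.add_ev, map_add]
    exact congrArg (L.E'.nabla W x v + ·) h11.symm
  · refine restrictTo_ext fun W v => ?_
    rw [restrictTo_map, EndSec.toIso_hom_app, EndSec.add_ev, map_add, Lift.r_nil hb, add_zero]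
    rfl
  · rw [EndSec.toIso_hom_app]
    have loc (v : Γ(L.E'.V, W)) (G₁ G₂ : HodgeFiltration L.E') (u : EndSec L.E'.V ⊤)
        (h : ∀ x (W' : T.X'.Opens) (hW' : W' ≤ U x) (w : Γ(L.E'.V, W')), w ∈ G₁.Fil p W' →
          (u.res le_top : EndSec L.E'.V (U x)).ev W' hW' w ∈ G₂.Fil p W')
        (hv : v ∈ G₁.Fil p W) : u.ev W le_top v ∈ G₂.Fil p W := by
      refine (G₂.isSubbundle p).glue W _ fun x hx => ⟨W ⊓ U x, inf_le_left, ⟨hx, hxU x⟩, ?_⟩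
      rw [u.res_ev]
      exact h x _ inf_le_right _ ((G₁.isSubbundle p).res inf_le_left v hv)
    constructor
    · exact loc v F₁ F₂ (1 + b) fun x W' hW' w hw =>
        (h₁ x).mem_of_mapsFil (h₂ x) (hmaps x) p hW' hw
    · intro hv
      have h12 := loc _ F₂ F₁ (1 - b) (fun x W' hW' w hw =>
        (h₂ x).mem_of_mapsFil (h₁ x) (hmaps' x) p hW' hw) hv
      have h13 : (1 - b).ev W le_top ((1 + b).ev W le_top v) = v := congr(($e₂).ev W le_top v)
      rwa [h13] at h12

end

/-! ### Transport of filtrations along isomorphisms of lifts -/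

section

variable {T : ThickenedPair.{u}} {E : DeRhamBundle T.g T.D} {F : HodgeFiltration E}

/-- Transport of a frame along an isomorphism. -/
lemma IsFrame.map {X : Scheme.{u}} {V N : X.Modules} (e : V ≅ N) {U : X.Opens} {n : ℕ}
    {w : Fin n → Γ(V, U)} (hw : IsFrame V U w) : IsFrame N U (fun k => e.hom.app U (w k)) := by
  have hi (W : X.Opens) (v : Γ(N, W)) : e.hom.app W (e.inv.app W v) = v :=
    congr((Scheme.Modules.Hom.app $(e.inv_hom_id) W).hom v)
  have ih (W : X.Opens) (v : Γ(V, W)) : e.inv.app W (e.hom.app W v) = v :=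
    congr((Scheme.Modules.Hom.app $(e.hom_inv_id) W).hom v)
  have hs (W : X.Opens) (h : W ≤ U) (a : Fin n → Γ(X, W)) :
      ∑ k, a k • resM N h (e.hom.app U (w k)) = e.hom.app W (∑ k, a k • resM V h (w k)) := by
    rw [map_sum]
    refine Finset.sum_congr rfl fun k _ => ?_
    rw [Scheme.Modules.Hom.app_smul, app_resM]
  refine isFrame_of (fun W h v => ⟨fun k => hw.coord h (e.inv.app W v) k, ?_⟩) fun W h a ha k => ?_
  · rw [hs, hw.sum_coord, hi]
  · rw [hs] at ha
    have := congrArg (e.inv.app W) ha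
    rw [ih, map_zero] at this
    rw [← hw.coord_eq h 0 a this, map_zero]
    rfl

/-- The preimage of a filtration under an isomorphism of lifts. -/
def Lift.Iso.comapFil {L₁ L₂ : Lift E} (e : L₁.Iso L₂) (F₂ : HodgeFiltration L₂.E') :
    HodgeFiltration L₁.E' where
  Fil p U :=
    { carrier := {v | e.e.hom.app U v ∈ F₂.Fil p U}
      zero_mem' := by
        rw [Set.mem_ofPred, map_zero]
        exact zero_mem _
      add_mem' := fun {v w} hv hw => by
        rw [Set.mem_ofPred, map_add]
        exact add_mem hv hw
      smul_mem' := fun a v hv => by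
        rw [Set.mem_ofPred, Scheme.Modules.Hom.app_smul]
        exact Submodule.smul_mem _ a hv }
  isSubbundle p :=
    { res := fun h v hv => by
        change e.e.hom.app _ _ ∈ F₂.Fil p _
        rw [app_resM]
        exact (F₂.isSubbundle p).res h _ hv
      glue := fun U v h => (F₂.isSubbundle p).glue U _ fun x hx => by
        obtain ⟨W, hW, hxW, hv⟩ := h x hx
        refine ⟨W, hW, hxW, ?_⟩
        rw [← app_resM]
        exact hv
      adapted := fun x => by
        obtain ⟨U, n, w, A, hx, hw, hA⟩ := (F₂.isSubbundle p).adapted x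
        refine ⟨U, n, _, A, hx, hw.map e.e.symm, fun W h => ?_⟩
        ext v
        change e.e.hom.app W v ∈ F₂.Fil p W ↔ _
        rw [hA W h]
        let ι : Γ(L₁.E'.V, W) →ₗ[Γ(T.X', W)] Γ(L₂.E'.V, W) :=
          { toFun := e.e.hom.app W
            map_add' := map_add _
            map_smul' := fun a v => Scheme.Modules.Hom.app_smul _ _ _ }
        let κ : Γ(L₂.E'.V, W) →ₗ[Γ(T.X', W)] Γ(L₁.E'.V, W) :=
          { toFun := e.e.inv.app W
            map_add' := map_add _
            map_smul' := fun a v => Scheme.Modules.Hom.app_smul _ _ _ }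
        have hres (k) : resM L₁.E'.V h (e.e.inv.app U (w k)) = κ (resM L₂.E'.V h (w k)) :=
          (app_resM e.e.inv h (w k)).symm
        have himg : (fun k => resM L₁.E'.V h (e.e.inv.app U (w k))) '' A =
            κ '' ((fun k => resM L₂.E'.V h (w k)) '' A) := by
          rw [Set.image_image]
          exact Set.image_congr fun k _ => hres k
        change _ ↔ v ∈ Submodule.span _ ((fun k => resM L₁.E'.V h (e.e.inv.app U (w k))) '' A)
        rw [himg, ← Submodule.map_span]
        constructor
        · exact fun hv => ⟨_, hv, e.inv_hom W v⟩
        · rintro ⟨y, hy, rfl⟩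
          exact (e.hom_inv W y).symm ▸ hy }
  antitone U _ _ h := fun v hv => F₂.antitone U h hv
  finite := by
    obtain ⟨a, b, hab⟩ := F₂.finite
    refine ⟨a, b, fun U => ⟨top_le_iff.1 fun v _ => ?_, le_bot_iff.1 fun v hv => ?_⟩⟩
    · change e.e.hom.app U v ∈ F₂.Fil a U
      rw [(hab U).1]
      trivial
    · have hv : e.e.hom.app U v ∈ F₂.Fil b U := hv
      rw [(hab U).2, Submodule.mem_bot] at hv
      rw [Submodule.mem_bot, ← e.inv_hom U v, hv, map_zero]
  griffiths p U x v hv := by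
    change e.e.hom.app U _ ∈ F₂.Fil (p - 1) U
    rw [e.parallel]
    exact F₂.griffiths p U x _ hv

lemma Lift.Iso.restrictTo_hom {L₁ L₂ : Lift E} (e : L₁.Iso L₂) (U : T.X'.Opens)
    (v : Γ(L₁.E'.V, U)) : L₂.r U (e.e.hom.app U v) = L₁.r U v := by
  rw [← restrictTo_map, e.restrict]

lemma Lift.Iso.liftsFil_comapFil {L₁ L₂ : Lift E} (e : L₁.Iso L₂) {F₂ : HodgeFiltration L₂.E'}
    (h : LiftsFil F L₂ F₂) : LiftsFil F L₁ (e.comapFil F₂) where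
  le p U v hv := by
    rw [← e.restrictTo_hom]
    exact h.le p U _ hv
  surj p U v hv x hx := by
    obtain ⟨W, hW, hxW, w, hw, hwv⟩ := h.surj p U v hv x hx
    refine ⟨W, hW, hxW, e.e.inv.app W w, ?_, ?_⟩
    · change e.e.hom.app W _ ∈ F₂.Fil p W
      rwa [e.hom_inv]
    · rw [← e.restrictTo_hom, e.hom_inv, hwv]

/-- An isomorphism of the underlying lifts pulls the second filtration back to the first lift. There
are then two filtrations on one lift, and `nonempty_iso_of_lifts` applies. -/
theorem DefFil.forget_injective (hE : HodgeDeRhamDegenerates F) :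
    Function.Injective (DefFil.forget F) := by
  rintro ⟨L₁⟩ ⟨L₂⟩ h
  obtain ⟨e⟩ : Nonempty (L₁.L.Iso L₂.L) := _root_.Quotient.exact h
  obtain ⟨e'⟩ := nonempty_iso_of_lifts hE L₁.F' (e.comapFil L₂.F') L₁.lifts
    (e.liftsFil_comapFil L₂.lifts)
  refine _root_.Quotient.sound ⟨{ e'.toIso.trans e with fil := fun p U v => ?_ }⟩
  exact e'.fil p U v

end

end FilteredDeRham

end

section

namespace FilteredDeRham

open ThickenedPair

/-! ### Lifting frames -/

/-- A morphism of modules which locally maps frames to frames is an isomorphism. -/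
lemma isIso_of_isFrame {X : Scheme.{u}} {M N : X.Modules} (ψ : M ⟶ N)
    (H : ∀ x : X, ∃ (U : X.Opens) (n : ℕ) (e : Fin n → Γ(M, U)), x ∈ U ∧ IsFrame M U e ∧
      IsFrame N U (fun k => ψ.app U (e k))) : IsIso ψ := by
  have hlin {U W : X.Opens} (h : W ≤ U) {n : ℕ} (e : Fin n → Γ(M, U)) (a : Fin n → Γ(X, W)) :
      ψ.app W (∑ k, a k • resM M h (e k)) = ∑ k, a k • resM N h (ψ.app U (e k)) := by
    rw [map_sum]
    refine Finset.sum_congr rfl fun k _ => ?_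
    rw [Scheme.Modules.Hom.app_smul, app_resM]
  have loc (x : X) : ∃ U : X.Opens, x ∈ U ∧ ∀ W ≤ U, Function.Bijective (ψ.app W) := by
    obtain ⟨U, n, e, hx, he, hN⟩ := H x
    refine ⟨U, hx, fun W h => ⟨(injective_iff_map_eq_zero _).2 fun v hv => ?_, fun w => ?_⟩⟩
    · rw [← he.sum_coord h v, hlin] at hv
      have := hN.coord_eq h 0 _ hv
      rw [map_zero] at this
      rw [← he.sum_coord h v, ← this]
      exact Finset.sum_eq_zero fun k _ => zero_smul _ _
    · exact ⟨∑ k, hN.coord h w k • resM M h (e k), by rw [hlin, hN.sum_coord h w]⟩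
  have inj (W : X.Opens) : Function.Injective (ψ.app W) := fun v w hvw =>
    eq_of_resM _ _ _ fun x hx => by
      obtain ⟨U, hxU, hU⟩ := loc x
      refine ⟨W ⊓ U, inf_le_left, ⟨hx, hxU⟩, (hU _ inf_le_right).1 ?_⟩
      rw [app_resM, app_resM, hvw]
  have surj (W : X.Opens) : Function.Surjective (ψ.app W) := fun w => by
    obtain ⟨s, hs⟩ := exists_glueM M W (fun W' s => ∀ h : W' ≤ W, ψ.app W' s = resM N h w)
      (fun x hx => by
        obtain ⟨U, hxU, hU⟩ := loc x
        obtain ⟨s, hs⟩ := (hU _ inf_le_right).2 (resM N (inf_le_left : W ⊓ U ≤ W) w)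
        exact ⟨W ⊓ U, inf_le_left, ⟨hx, hxU⟩, s, fun _ => hs⟩)
      (fun W₁ W₂ h s hW₁ hs h' => by rw [app_resM, hs hW₁, resM_resM])
      (fun W' h s t hs ht => inj _ ((hs h).trans (ht h).symm))
    refine ⟨s, eq_of_resM _ _ _ fun x hx => ?_⟩
    obtain ⟨U, hxU, hU⟩ := loc x
    obtain ⟨t, ht⟩ := (hU _ inf_le_right).2 (resM N (inf_le_left : W ⊓ U ≤ W) w)
    refine ⟨W ⊓ U, inf_le_left, ⟨hx, hxU⟩, ?_⟩
    rw [← app_resM, hs _ inf_le_left t fun _ => ht, ht]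
  have : ψ = (modIso M N (fun U => LinearEquiv.ofBijective
      ({ toFun := ψ.app U, map_add' := map_add _, map_smul' := fun a v =>
        Scheme.Modules.Hom.app_smul ψ a v } : Γ(M, U) →ₗ[Γ(X, U)] Γ(N, U)) ⟨inj U, surj U⟩)
      fun U W h v => app_resM ψ h v).hom := mod_hom_ext fun _ _ => rfl
  rw [this]
  infer_instance

section

variable {T : ThickenedPair.{u}} {E : DeRhamBundle T.g T.D} {L : Lift E}

/-- A frame of V' induces a frame of its pullback, and the hypothesis says that ψ carries it to a
frame of V. -/
lemma isIso_of_isFrame_restrictTo {V' : T.X'.Modules} {V : T.X.Modules}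
    (ψ : (Scheme.Modules.pullback T.i).obj V' ⟶ V)
    (H : ∀ x : T.X', ∃ (U : T.X'.Opens) (n : ℕ) (e : Fin n → Γ(V', U)), x ∈ U ∧ IsFrame V' U e ∧
      IsFrame V (T.i ⁻¹ᵁ U) (fun k => restrictTo ψ U (e k))) : IsIso ψ := by
  refine isIso_of_isFrame ψ fun x => ?_
  obtain ⟨U, n, e, hx, he, hV⟩ := H (T.i x)
  refine ⟨T.i ⁻¹ᵁ U, n, _, hx, isFrame_restrictTo (𝟙 _) he, ?_⟩
  convert hV using 2 with k
  rw [← restrictTo_comp, Category.id_comp]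

/-- Sections of a lift whose reductions form a frame form a frame. -/
lemma Lift.Framed.isFrame_of_r {Z : T.X'.affineOpens} (hZ : L.Framed Z.1) {n : ℕ}
    {w : Fin n → Γ(L.E'.V, Z.1)} (hw : IsFrame E.V (T.i ⁻¹ᵁ Z.1) (fun k => L.r Z.1 (w k))) :
    IsFrame L.E'.V Z.1 w := by
  obtain ⟨m, e, he⟩ := hZ
  choose b hb using fun l k => red_surjective Z (hw.coord le_rfl (L.r Z.1 (e l)) k)
  -- `A` forms combinations of the w k, and `B` is an approximate inverse obtained by lifting
  -- coordinates from X. Their composite A B is the identity modulo I and exactly the identity on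
  -- sections vanishing on X.
  let A {W : T.X'.Opens} (h : W ≤ Z.1) : (Fin n → Γ(T.X', W)) →ₗ[Γ(T.X', W)] Γ(L.E'.V, W) :=
    Fintype.linearCombination Γ(T.X', W) (fun k => resM L.E'.V h (w k))
  let B {W : T.X'.Opens} (h : W ≤ Z.1) : Γ(L.E'.V, W) →ₗ[Γ(T.X', W)] (Fin n → Γ(T.X', W)) :=
    (Fintype.linearCombination Γ(T.X', W) (fun l k => resO h (b l k))).comp
      (he.coord h).toLinearMap
  have hA {W : T.X'.Opens} (h : W ≤ Z.1) (a : Fin n → Γ(T.X', W)) :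
      A h a = ∑ k, a k • resM L.E'.V h (w k) := Fintype.linearCombination_apply _ _ _
  have hAb {W : T.X'.Opens} (h : W ≤ Z.1) (l : Fin m) :
      L.r W (A h fun k => resO h (b l k)) = L.r W (resM L.E'.V h (e l)) := by
    have h1 := hw.sum_coord le_rfl (L.r Z.1 (e l))
    rw [hA, restrictTo_sum L.φ.hom h, restrictTo_res, ← h1, resM_sum_smul]
    refine Finset.sum_congr rfl fun k _ => ?_
    rw [red_resO, hb, resM_resM]
  have hAB {W : T.X'.Opens} (h : W ≤ Z.1) (v : Γ(L.E'.V, W)) :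
      A h (B h v) = ∑ l, he.coord h v l • A h fun k => resO h (b l k) := by
    refine (congrArg (A h) (Fintype.linearCombination_apply Γ(T.X', W)
      (fun l k => resO h (b l k)) (he.coord h v))).trans ?_
    rw [map_sum]
    exact Finset.sum_congr rfl fun l _ => map_smul (A h) _ _
  have hr {W : T.X'.Opens} (h : W ≤ Z.1) (v : Γ(L.E'.V, W)) : L.r W (A h (B h v)) = L.r W v := by
    conv_rhs => rw [← he.sum_coord h v]
    rw [hAB, map_sum, map_sum]
    exact Finset.sum_congr rfl fun l _ => by rw [restrictTo_smul, restrictTo_smul, hAb]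
  have hn {W : T.X'.Opens} (h : W ≤ Z.1) (v : Γ(L.E'.V, W)) (hv : L.r W v = 0) :
      A h (B h v) = v := by
    conv_rhs => rw [← he.sum_coord h v]
    rw [hAB]
    refine Finset.sum_congr rfl fun l _ => ?_
    rw [← sub_eq_zero, ← smul_sub]
    refine I_smul_eq_zero (coord_mem_I he h hv l) ?_
    rw [map_sub, hAb, sub_self]
  -- The error v − A B v vanishes on X, where A B is exact, so one correction step suffices.
  refine isFrame_of (fun W h v => ⟨B h (v + (v - A h (B h v))), ?_⟩) fun W h a ha j => ?_
  · rw [← hA, map_add, map_add, hn h (v - A h (B h v)) (by rw [map_sub, hr, sub_self]), add_sub_cancel]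
  · have h1 (v : Γ(L.E'.V, W)) : hw.coord (pre_mono h) (L.r W v) = fun k => red W (B h v k) := by
      refine hw.coord_eq _ _ _ ?_
      rw [← restrictTo_sum L.φ.hom h, ← hA, hr]
    have h2 (k : Fin n) : a k ∈ T.I W := by
      have := hw.coord_eq (pre_mono h) 0 (fun k => red W (a k)) (by
        rw [← restrictTo_sum L.φ.hom h, ha, map_zero])
      rw [map_zero] at this
      exact (congrFun this k).symm
    have h3 : ∑ k, a k * B h (resM L.E'.V h (w k)) j = 0 := by
      have := congrFun (congrArg (B h) ha) j
      rw [map_zero, map_sum, Finset.sum_apply] at this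
      refine (Finset.sum_congr rfl fun k _ => ?_).trans this
      rw [map_smul]
      rfl
    -- The coefficients of a relation lie in I, and B(w k) is the k-th unit vector modulo I; since
    -- I² = 0 the products see only the unit vector.
    have h4 (k : Fin n) : a k * B h (resM L.E'.V h (w k)) j =
        a k * (Pi.single k 1 : Fin n → Γ(T.X', W)) j := by
      rw [← sub_eq_zero, ← mul_sub]
      refine I_mul_I (h2 k) ?_
      have h5 := congrFun (h1 (resM L.E'.V h (w k))) j
      rw [restrictTo_res, hw.coord_self] at h5
      change red W (_ - _) = 0
      rw [map_sub, ← h5, sub_eq_zero]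
      rcases eq_or_ne j k with rfl | hjk
      · rw [Pi.single_eq_same, Pi.single_eq_same, map_one]
      · rw [Pi.single_eq_of_ne hjk, Pi.single_eq_of_ne hjk, map_zero]
    rw [Finset.sum_congr rfl fun k _ => h4 k, Finset.sum_eq_single j] at h3
    · rwa [Pi.single_eq_same, mul_one] at h3
    · intro k _ hk
      rw [Pi.single_eq_of_ne hk.symm, mul_zero]
    · simp

end

/-- A frame of the lift adapted to a step of the filtration. -/
lemma Splitting.exists_adapted {T : ThickenedPair.{u}} {E : DeRhamBundle T.g T.D}
    {F : HodgeFiltration E} {L : Lift E} {lo hi : ℤ} {U : T.X'.Opens} (s : Splitting F L lo hi U)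
    (p : ℤ) {x : T.X'} (hx : x ∈ U) :
    ∃ (Z : T.X'.Opens) (hZ : Z ≤ U) (n : ℕ) (w : Fin n → Γ(L.E'.V, Z)) (A : Set (Fin n)),
      x ∈ Z ∧ IsFrame L.E'.V Z w ∧ (∀ k ∈ A, (s.π p).ev Z hZ (w k) = w k) ∧
      ∀ (W : T.X'.Opens) (h : W ≤ Z) (v : Γ(L.E'.V, W)),
        (s.π p).ev W (h.trans hZ) v = v → ∃ a : Fin n → Γ(T.X', W), (∀ k ∉ A, a k = 0) ∧
          ∑ k, a k • resM L.E'.V h (w k) = v := by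
  classical
  obtain ⟨y, rfl⟩ := T.exists_eq_i x
  obtain ⟨Y, n, e, A, hy, he, hA⟩ := (F.isSubbundle p).adapted y
  obtain ⟨Y', rfl⟩ := exists_pre_eq (T := T) Y
  obtain ⟨Z, hZ, hyZ, hZf⟩ := L.exists_chart (show T.i y ∈ U ⊓ Y' from ⟨hx, hy⟩)
  have hZU : Z.1 ≤ U := hZ.trans inf_le_left
  have hZY : T.i ⁻¹ᵁ Z.1 ≤ T.i ⁻¹ᵁ Y' := pre_mono (hZ.trans inf_le_right)
  choose w₀ hw₀ using fun k => hZf.r_surjective (resM E.V hZY (e k))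
  have hmem {W : T.X.Opens} (h : W ≤ T.i ⁻¹ᵁ Y') {k : Fin n} (hk : k ∈ A) :
      resM E.V h (e k) ∈ F.Fil p W := by
    rw [hA W h]
    exact Submodule.subset_span ⟨k, hk, rfl⟩
  -- Projecting the lifts of the basis vectors of Fil^p puts them in the image of the projector
  -- without changing their reductions.
  let w (k : Fin n) : Γ(L.E'.V, Z.1) := if k ∈ A then (s.π p).ev Z.1 hZU (w₀ k) else w₀ k
  have hwr (k : Fin n) : L.r Z.1 (w k) = resM E.V hZY (e k) := by
    by_cases hk : k ∈ A
    · rw [show w k = _ from if_pos hk, s.lifts p Z.1 hZU, hw₀]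
      exact s.fix p _ _ _ (hmem hZY hk)
    · rw [show w k = _ from if_neg hk, hw₀]
  have hwf : IsFrame L.E'.V Z.1 w := hZf.isFrame_of_r (by
    simp only [hwr]
    exact he.restrict hZY)
  have hπ (W : T.X'.Opens) (h : W ≤ U) (v : Γ(L.E'.V, W)) :
      (s.π p).ev W h ((s.π p).ev W h v) = (s.π p).ev W h v :=
    congr(($(s.chain.mul_of_le (le_refl p))).ev W h v)
  have hcoord {W : T.X'.Opens} (h : W ≤ Z.1) {v : Γ(E.V, T.i ⁻¹ᵁ W)}
      (hv : v ∈ F.Fil p (T.i ⁻¹ᵁ W)) :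
      ∃ c : Fin n → Γ(T.X, T.i ⁻¹ᵁ W), (∀ k ∉ A, c k = 0) ∧
        ∑ k, c k • resM E.V (pre_mono h) (L.r Z.1 (w k)) = v := by
    rw [hA _ ((pre_mono h).trans hZY)] at hv
    refine Submodule.span_induction ?_ ⟨0, fun _ _ => rfl, ?_⟩ ?_ ?_ hv
    · rintro _ ⟨k, hk, rfl⟩
      refine ⟨Pi.single k 1, fun l hl => Pi.single_eq_of_ne (M := fun _ => Γ(T.X, T.i ⁻¹ᵁ W))
        (fun h : l = k => hl (h.symm ▸ hk)) _, ?_⟩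
      rw [Finset.sum_eq_single k, Pi.single_eq_same, one_smul, hwr, resM_resM]
      · intro l _ hl
        rw [Pi.single_eq_of_ne hl, zero_smul]
      · simp
    · exact Finset.sum_eq_zero fun k _ => zero_smul _ _
    · rintro _ _ - - ⟨c, hc, rfl⟩ ⟨c', hc', rfl⟩
      refine ⟨c + c', fun k hk => by rw [Pi.add_apply, hc k hk, hc' k hk, add_zero], ?_⟩
      rw [← Finset.sum_add_distrib]
      exact Finset.sum_congr rfl fun k _ => add_smul _ _ _
    · rintro a _ - ⟨c, hc, rfl⟩
      refine ⟨a • c, fun k hk => by rw [Pi.smul_apply, hc k hk, smul_zero], ?_⟩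
      rw [Finset.smul_sum]
      exact Finset.sum_congr rfl fun k _ => mul_smul a (c k) _
  have hb (k : Fin n) : ∃ b : Fin n → Γ(T.X', Z.1), (∀ l ∉ A, b l = 0) ∧
      L.r Z.1 (∑ l, b l • resM L.E'.V le_rfl (w l)) = L.r Z.1 ((s.π p).ev Z.1 hZU (w k)) := by
    have h1 : L.r Z.1 ((s.π p).ev Z.1 hZU (w k)) ∈ F.Fil p (T.i ⁻¹ᵁ Z.1) := by
      rw [s.lifts p Z.1 hZU]
      exact s.mem p _ _ _
    obtain ⟨c, hc, hcs⟩ := hcoord le_rfl h1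
    choose b hb using fun l => red_surjective Z (c l)
    refine ⟨fun l => if l ∈ A then b l else 0, fun l hl => if_neg hl, ?_⟩
    rw [restrictTo_sum L.φ.hom le_rfl, ← hcs]
    refine Finset.sum_congr rfl fun l _ => ?_
    by_cases hl : l ∈ A
    · rw [if_pos hl, hb]
    · rw [if_neg hl, hc l hl, map_zero]
  choose b hbA hbr using hb
  refine ⟨Z.1, hZU, n, w, A, hyZ, hwf, fun k hk => ?_, fun W h v hv => ?_⟩
  · rw [show w k = _ from if_pos hk, hπ]
  · have h1 : L.r W v ∈ F.Fil p (T.i ⁻¹ᵁ W) := by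
      rw [← hv, s.lifts p W (h.trans hZU)]
      exact s.mem p _ _ _
    obtain ⟨c, hc, hcs⟩ := hcoord h h1
    have h2 (k : Fin n) : c k = ThickenedPair.red W (hwf.coord h v k) := by
      have h3 : ∑ k, ThickenedPair.red W (hwf.coord h v k) •
          resM E.V (pre_mono h) (L.r Z.1 (w k)) = L.r W v := by
        rw [← restrictTo_sum L.φ.hom h, hwf.sum_coord]
      exact congrFun (((L.isFrame_r hwf).coord_eq (pre_mono h) _ _ hcs).symm.trans
        ((L.isFrame_r hwf).coord_eq (pre_mono h) _ _ h3)) k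
    -- Apply the projector to v = ∑ c_k w_k. For k outside A the coefficient lies in I, so the
    -- projection of w_k may be replaced by any combination of the w_j with j in A having the same
    -- reduction, which is what `b k` provides.
    let β (k : Fin n) : Fin n → Γ(T.X', Z.1) := if k ∈ A then Pi.single k 1 else b k
    have hβA (k j : Fin n) (hj : j ∉ A) : β k j = 0 := by
      by_cases hk : k ∈ A
      · rw [show β k = _ from if_pos hk, Pi.single_eq_of_ne (fun e : j = k => hj (e.symm ▸ hk))]
      · rw [show β k = _ from if_neg hk, hbA k j hj]
    have hβ (k : Fin n) : hwf.coord h v k • resM L.E'.V h ((s.π p).ev Z.1 hZU (w k)) =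
        hwf.coord h v k • ∑ j, resO h (β k j) • resM L.E'.V h (w j) := by
      by_cases hk : k ∈ A
      · rw [show β k = _ from if_pos hk, show w k = _ from if_pos hk, hπ,
          Finset.sum_eq_single k, Pi.single_eq_same, map_one, one_smul,
          show w k = _ from if_pos hk]
        · intro j _ hj
          rw [Pi.single_eq_of_ne hj, map_zero, zero_smul]
        · simp
      · rw [show β k = _ from if_neg hk, ← sub_eq_zero, ← smul_sub]
        refine Lift.I_smul_eq_zero ((h2 k).symm.trans (hc k hk)) ?_
        have h4 := congrArg (resM E.V (pre_mono h)) (hbr k)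
        rw [← restrictTo_res L.φ.hom h, ← restrictTo_res L.φ.hom h, resM_sum_smul] at h4
        simp only [resM_resM] at h4
        rw [map_sub, h4, sub_self]
    refine ⟨fun j => ∑ k, hwf.coord h v k * resO h (β k j), fun j hj => ?_, ?_⟩
    · exact Finset.sum_eq_zero fun k _ => by rw [hβA k j hj, map_zero, mul_zero]
    · conv_rhs => rw [← hv, ← hwf.sum_coord h v, map_sum]
      simp only [Finset.sum_smul, map_smul, ← (s.π p).res_ev hZU h, hβ, mul_smul, Finset.smul_sum]
      exact Finset.sum_comm

end FilteredDeRham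

end

section

namespace FilteredDeRham

open ThickenedPair

/-! ### Twisting a lift by a cocycle -/

variable {T : ThickenedPair.{u}} {E : DeRhamBundle T.g T.D}

/-- A hypercocycle with values in the de Rham complex of nilpotent endomorphisms of a lift. -/
structure Gluing (L : Lift E) where
  /-- the open cover -/
  W : T.X' → T.X'.Opens
  mem_W (x : T.X') : x ∈ W x
  /-- the change of the connection -/
  K (x : T.X') {U : T.X'.Opens} (h : U ≤ W x) : LogDer T.g' T.D' U → EndSec L.E'.V U
  K_mem (x : T.X') {U : T.X'.Opens} (h : U ≤ W x) (ξ) : K x h ξ ∈ L.nil U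
  K_add (x : T.X') {U : T.X'.Opens} (h : U ≤ W x) (ξ η) : K x h (ξ + η) = K x h ξ + K x h η
  K_smul (x : T.X') {U : T.X'.Opens} (h : U ≤ W x) (a : Γ(T.X', U)) (ξ) :
    K x h (a • ξ) = a • K x h ξ
  K_res (x : T.X') {U Z : T.X'.Opens} (h : U ≤ W x) (hZ : Z ≤ U) (ξ) :
    (K x h ξ).res hZ = K x (hZ.trans h) (ξ.res hZ)
  K_flat (x : T.X') {U : T.X'.Opens} (h : U ≤ W x) (ξ η) :
    L.E'.nablaEnd U ξ (K x h η) - L.E'.nablaEnd U η (K x h ξ) - K x h ⁅ξ, η⁆ = 0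
  /-- the change of the gluing -/
  n (x y : T.X') : EndSec L.E'.V (W x ⊓ W y)
  n_mem (x y : T.X') : n x y ∈ L.nil (W x ⊓ W y)
  n_add (x y z : T.X') {U : T.X'.Opens} (hx : U ≤ W x) (hy : U ≤ W y) (hz : U ≤ W z) :
    (n x y).res (le_inf hx hy) + (n y z).res (le_inf hy hz) = (n x z).res (le_inf hx hz)
  n_nabla (x y : T.X') {U : T.X'.Opens} (hx : U ≤ W x) (hy : U ≤ W y) (ξ) :
    K x hx ξ - K y hy ξ = L.E'.nablaEnd U ξ ((n x y).res (le_inf hx hy))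

namespace Gluing

variable {L : Lift E} (G : Gluing L) {U Z : T.X'.Opens}

/-- The transition maps. -/
def tr (x y : T.X') (hx : U ≤ G.W x) (hy : U ≤ G.W y) :
    Γ(L.E'.V, U) →ₗ[Γ(T.X', U)] Γ(L.E'.V, U) := LinearMap.id + (G.n x y).ev U (le_inf hx hy)

lemma tr_apply (x y : T.X') (hx : U ≤ G.W x) (hy : U ≤ G.W y) (v : Γ(L.E'.V, U)) :
    G.tr x y hx hy v = v + (G.n x y).ev U (le_inf hx hy) v := rfl

lemma resM_tr (x y : T.X') (hx : U ≤ G.W x) (hy : U ≤ G.W y) (h : Z ≤ U) (v : Γ(L.E'.V, U)) :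
    resM L.E'.V h (G.tr x y hx hy v) = G.tr x y (h.trans hx) (h.trans hy) (resM L.E'.V h v) := by
  rw [tr_apply, tr_apply, map_add, EndSec.res_ev]

lemma r_tr (x y : T.X') (hx : U ≤ G.W x) (hy : U ≤ G.W y) (v : Γ(L.E'.V, U)) :
    L.r U (G.tr x y hx hy v) = L.r U v := by
  rw [tr_apply, map_add, Lift.r_nil (G.n_mem x y), add_zero]

/-- (1 + n_xy)(1 + n_yz) = 1 + n_xy + n_yz since N² = 0, so the additive cocycle is a multiplicative
one. -/
lemma tr_tr (x y z : T.X') (hx : U ≤ G.W x) (hy : U ≤ G.W y) (hz : U ≤ G.W z)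
    (v : Γ(L.E'.V, U)) : G.tr x y hx hy (G.tr y z hy hz v) = G.tr x z hx hz v := by
  have h1 := congr(($(G.n_add x y z hx hy hz)).ev U le_rfl v)
  rw [EndSec.add_ev, EndSec.ev_res, EndSec.ev_res, EndSec.ev_res] at h1
  rw [tr_apply, tr_apply, tr_apply, map_add,
    Lift.nil_ev_eq_zero (G.n_mem x y) _ (Lift.r_nil (G.n_mem y z) _ _ v), ← h1]
  abel

lemma tr_self (x : T.X') (hx : U ≤ G.W x) (v : Γ(L.E'.V, U)) : G.tr x x hx hx v = v := by
  have h1 := G.n_add x x x hx hx hx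
  have h2 := congr(($(add_eq_left.1 h1)).ev U le_rfl v)
  rw [tr_apply]
  exact (congrArg (v + ·) h2).trans (add_zero v)

/-- The changed connection. -/
def cov (x : T.X') (hx : U ≤ G.W x) (ξ : LogDer T.g' T.D' U) : Γ(L.E'.V, U) →+ Γ(L.E'.V, U) :=
  L.E'.nabla U ξ - ((G.K x hx ξ).ev U le_rfl).toAddMonoidHom

lemma cov_apply (x : T.X') (hx : U ≤ G.W x) (ξ : LogDer T.g' T.D' U) (v : Γ(L.E'.V, U)) :
    G.cov x hx ξ v = L.E'.nabla U ξ v - (G.K x hx ξ).ev U le_rfl v := rfl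

lemma cov_add (x : T.X') (hx : U ≤ G.W x) (ξ η : LogDer T.g' T.D' U) (v : Γ(L.E'.V, U)) :
    G.cov x hx (ξ + η) v = G.cov x hx ξ v + G.cov x hx η v := by
  simp only [cov_apply, G.K_add, L.E'.nabla_add, EndSec.add_ev]
  abel

lemma cov_smul (x : T.X') (hx : U ≤ G.W x) (a : Γ(T.X', U)) (ξ : LogDer T.g' T.D' U)
    (v : Γ(L.E'.V, U)) : G.cov x hx (a • ξ) v = a • G.cov x hx ξ v := by
  simp only [cov_apply, G.K_smul, L.E'.nabla_smul, EndSec.smul_ev, resO_self, smul_sub]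

lemma cov_leibniz (x : T.X') (hx : U ≤ G.W x) (ξ : LogDer T.g' T.D' U) (a : Γ(T.X', U))
    (v : Γ(L.E'.V, U)) :
    G.cov x hx ξ (a • v) = a • G.cov x hx ξ v + ξ.ev U le_rfl a • v := by
  simp only [cov_apply, L.E'.leibniz, map_smul, smul_sub]
  abel

lemma resM_cov (x : T.X') (hx : U ≤ G.W x) (ξ : LogDer T.g' T.D' U) (h : Z ≤ U)
    (v : Γ(L.E'.V, U)) :
    resM L.E'.V h (G.cov x hx ξ v) = G.cov x (h.trans hx) (ξ.res h) (resM L.E'.V h v) := by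
  rw [cov_apply, cov_apply, map_sub, L.E'.res_nabla, EndSec.res_ev, ← G.K_res x hx h,
    EndSec.ev_res]

/-- The curvature changes only by the terms linear in K, which cancel by `K_flat`; the quadratic
ones vanish. -/
lemma cov_flat (x : T.X') (hx : U ≤ G.W x) (ξ η : LogDer T.g' T.D' U) (v : Γ(L.E'.V, U)) :
    G.cov x hx ⁅ξ, η⁆ v = G.cov x hx ξ (G.cov x hx η v) - G.cov x hx η (G.cov x hx ξ v) := by
  have h1 := congr(($(G.K_flat x hx ξ η)).ev U le_rfl v)
  have h2 (ξ η) : (G.K x hx ξ).ev U le_rfl ((G.K x hx η).ev U le_rfl v) = 0 :=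
    Lift.nil_ev_eq_zero (G.K_mem x hx ξ) _ (Lift.r_nil (G.K_mem x hx η) _ _ v)
  have h3 (ξ : LogDer T.g' T.D' U) : ξ.res le_rfl = ξ := rfl
  simp only [EndSec.sub_ev, EndSec.zero_ev, DeRhamBundle.nablaEnd_ev, h3] at h1
  simp only [cov_apply, map_sub, h2, L.E'.flat, sub_zero]
  rw [← sub_eq_zero, ← h1]
  abel

lemma cov_tr (x y : T.X') (hx : U ≤ G.W x) (hy : U ≤ G.W y) (ξ : LogDer T.g' T.D' U)
    (v : Γ(L.E'.V, U)) :
    G.cov x hx ξ (G.tr x y hx hy v) = G.tr x y hx hy (G.cov y hy ξ v) := by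
  have h1 := congr(($(G.n_nabla x y hx hy ξ)).ev U le_rfl v)
  have h2 : (G.K x hx ξ).ev U le_rfl ((G.n x y).ev U (le_inf hx hy) v) = 0 :=
    Lift.nil_ev_eq_zero (G.K_mem x hx ξ) _ (Lift.r_nil (G.n_mem x y) _ _ v)
  have h3 : (G.n x y).ev U (le_inf hx hy) ((G.K y hy ξ).ev U le_rfl v) = 0 :=
    Lift.nil_ev_eq_zero (G.n_mem x y) _ (Lift.r_nil (G.K_mem y hy ξ) _ _ v)
  have h4 : ξ.res le_rfl = ξ := rfl
  simp only [EndSec.sub_ev, DeRhamBundle.nablaEnd_ev, h4, EndSec.ev_res] at h1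
  simp only [cov_apply, tr_apply, map_add, map_sub, h2, h3, add_zero, sub_zero]
  rw [← sub_eq_zero] at h1 ⊢
  rw [← neg_eq_zero, ← h1]
  abel

lemma r_cov (x : T.X') (hx : U ≤ G.W x) (ξ : T.VF U) (v : Γ(L.E'.V, U)) :
    L.r U (G.cov x hx ξ.fst v) = E.nabla _ ξ.snd (L.r U v) := by
  rw [cov_apply, map_sub, Lift.r_nil (G.K_mem x hx ξ.fst), sub_zero]
  exact L.parallel U ξ v

/-- The sections of the twisted bundle. -/
def secs (U : T.X'.Opens) : Submodule Γ(T.X', U) (∀ x, (meetData L.E'.V (G.W x)).obj U) where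
  carrier := {v | ∀ (x y : T.X') (Z : T.X'.Opens) (h : Z ≤ U) (hx : Z ≤ G.W x) (hy : Z ≤ G.W y),
    resM L.E'.V (le_inf h hx) (v x) = G.tr x y hx hy (resM L.E'.V (le_inf h hy) (v y))}
  zero_mem' x y Z h hx hy :=
    (map_zero (resM L.E'.V (le_inf h hx))).trans ((congrArg (G.tr x y hx hy)
      (map_zero (resM L.E'.V (le_inf h hy)))).trans (map_zero _)).symm
  add_mem' {v w} hv hw x y Z h hx hy :=
    (map_add (resM L.E'.V (le_inf h hx)) (v x) (w x)).trans (((congrArg (G.tr x y hx hy)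
      (map_add (resM L.E'.V (le_inf h hy)) (v y) (w y))).trans (map_add _ _ _)).trans
        (congrArg₂ (· + ·) (hv x y Z h hx hy).symm (hw x y Z h hx hy).symm)).symm
  smul_mem' a v hv x y Z h hx hy := by
    have e (z : T.X') (hz : Z ≤ G.W z) : resM L.E'.V (le_inf h hz)
        (resO (inf_le_left : U ⊓ G.W z ≤ U) a • (show Γ(L.E'.V, U ⊓ G.W z) from v z)) =
        resO h a • resM L.E'.V (le_inf h hz) (v z) :=
      (resM_smul L.E'.V _ _ _).trans (congrArg (· • _) (resO_resO _ _ a))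
    exact (e x hx).trans (((congrArg (G.tr x y hx hy) (e y hy)).trans (map_smul _ _ _)).trans
      (congrArg (resO h a • ·) (hv x y Z h hx hy).symm)).symm

lemma res_mem {v : ∀ x, (meetData L.E'.V (G.W x)).obj U} (hv : v ∈ G.secs U) (h : Z ≤ U) :
    (fun x => (meetData L.E'.V (G.W x)).res h (v x)) ∈ G.secs Z := by
  intro x y Z' h' hx hy
  exact (resM_resM L.E'.V _ _ _).trans ((hv x y Z' (h'.trans h) hx hy).trans
    (congrArg (G.tr x y hx hy) (resM_resM L.E'.V _ _ _).symm))

/-- The twisted bundle, as a sheaf given by its sections. -/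
def data : ModData T.X' where
  obj U := G.secs U
  res h := AddMonoidHom.mk' (fun v => ⟨_, G.res_mem v.2 h⟩) fun v w =>
    Subtype.ext (funext fun x => map_add ((meetData L.E'.V (G.W x)).res h) (v.1 x) (w.1 x))
  res_self v := Subtype.ext (funext fun x => (meetData L.E'.V (G.W x)).res_self _)
  res_res h h' v := Subtype.ext (funext fun x => (meetData L.E'.V (G.W x)).res_res _ _ _)
  res_smul h a v := Subtype.ext (funext fun x => (meetData L.E'.V (G.W x)).res_smul _ _ _)
  separated v w H := Subtype.ext (funext fun x => (meetData L.E'.V (G.W x)).separated _ _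
    fun y hy => by
      obtain ⟨Z, h, hyZ, e⟩ := H y hy
      exact ⟨Z, h, hyZ, congrFun (congrArg Subtype.val e) x⟩)
  gluing {ι} U s hs := by
    choose t ht using fun x => (meetData L.E'.V (G.W x)).gluing U (fun i => (s i).1 x)
      fun i j => congrFun (congrArg Subtype.val (hs i j)) x
    refine ⟨⟨t, fun x y Z h hx hy => eq_of_resM _ _ _ fun z hz => ?_⟩, fun i =>
      Subtype.ext (funext fun x => ht x i)⟩
    obtain ⟨i, hi⟩ := Opens.mem_iSup.1 (h hz)
    refine ⟨Z ⊓ U i, inf_le_left, ⟨hz, hi⟩, ?_⟩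
    have key (w : T.X') (hw : Z ≤ G.W w) : resM L.E'.V (inf_le_left : Z ⊓ U i ≤ Z)
        (resM L.E'.V (le_inf h hw) (t w)) =
          resM L.E'.V (le_inf inf_le_right (inf_le_left.trans hw)) ((s i).1 w) := by
      refine (resM_resM L.E'.V _ _ _).trans (Eq.trans ?_ (congrArg (resM L.E'.V _) (ht w i)))
      exact (resM_resM L.E'.V _ _ _).symm
    rw [resM_tr]
    exact (key x hx).trans (((s i).2 x y _ inf_le_right _ _).trans
      (congrArg (G.tr x y _ _) (key y hy).symm))

/-- The twisted bundle. -/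
def mod : T.X'.Modules := G.data.toModules

/-- The component of a section. -/
def comp (x : T.X') (h : Z ≤ U) (hx : Z ≤ G.W x) : Γ(G.mod, U) →+ Γ(L.E'.V, Z) :=
  AddMonoidHom.mk' (fun v => resM L.E'.V (le_inf h hx) ((G.data.equiv U v).1 x)) fun v w =>
    map_add (resM L.E'.V (le_inf h hx)) ((G.data.equiv U v).1 x) ((G.data.equiv U w).1 x)

lemma comp_smul (x : T.X') (h : Z ≤ U) (hx : Z ≤ G.W x) (a : Γ(T.X', U)) (v : Γ(G.mod, U)) :
    G.comp x h hx (a • v) = resO h a • G.comp x h hx v :=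
  (resM_smul L.E'.V (le_inf h hx) (resO inf_le_left a) ((G.data.equiv U v).1 x)).trans
    (congrArg (· • _) (resO_resO _ _ a))

lemma comp_resM (x : T.X') {U' : T.X'.Opens} (h : Z ≤ U) (hx : Z ≤ G.W x) (h' : U ≤ U')
    (v : Γ(G.mod, U')) : G.comp x h hx (resM G.mod h' v) = G.comp x (h.trans h') hx v :=
  resM_resM L.E'.V (inf_le_inf_right _ h') (le_inf h hx) ((G.data.equiv U' v).1 x)

lemma resM_comp (x : T.X') {Z' : T.X'.Opens} (h : Z ≤ U) (hx : Z ≤ G.W x) (h' : Z' ≤ Z)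
    (v : Γ(G.mod, U)) :
    resM L.E'.V h' (G.comp x h hx v) = G.comp x (h'.trans h) (h'.trans hx) v :=
  resM_resM L.E'.V (le_inf h hx) h' ((G.data.equiv U v).1 x)

lemma tr_comp (x y : T.X') (h : Z ≤ U) (hx : Z ≤ G.W x) (hy : Z ≤ G.W y) (v : Γ(G.mod, U)) :
    G.tr x y hx hy (G.comp y h hy v) = G.comp x h hx v :=
  ((G.data.equiv U v).2 x y Z h hx hy).symm

variable {G} in
lemma comp_ext {v w : Γ(G.mod, U)}
    (H : ∀ (x : T.X') (Z : T.X'.Opens) (h : Z ≤ U) (hx : Z ≤ G.W x),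
      G.comp x h hx v = G.comp x h hx w) : v = w :=
  (G.data.equiv U).injective (Subtype.ext (funext fun x =>
    ((resM_self L.E'.V _).symm.trans (H x _ inf_le_left inf_le_right)).trans (resM_self L.E'.V _)))

/-- The transition maps recover every component from the one at x. Hence over `G.W x` the twisted
bundle is V' itself, with `ofComp` as inverse. -/
lemma comp_injective (x : T.X') (hx : U ≤ G.W x) : Function.Injective (G.comp x le_rfl hx) :=
  fun v w e => comp_ext fun y Z h hy => by
    rw [← G.tr_comp y x h hy (h.trans hx), ← G.tr_comp y x h hy (h.trans hx) w,
      ← G.resM_comp x le_rfl hx h, ← G.resM_comp x le_rfl hx h, e]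

lemma exists_mk (c : ∀ (x : T.X') (Z : T.X'.Opens), Z ≤ U → Z ≤ G.W x → Γ(L.E'.V, Z))
    (hres : ∀ (x : T.X') (Z Z' : T.X'.Opens) (h : Z ≤ U) (hx : Z ≤ G.W x) (h' : Z' ≤ Z),
      resM L.E'.V h' (c x Z h hx) = c x Z' (h'.trans h) (h'.trans hx))
    (htr : ∀ (x y : T.X') (Z : T.X'.Opens) (h : Z ≤ U) (hx : Z ≤ G.W x) (hy : Z ≤ G.W y),
      c x Z h hx = G.tr x y hx hy (c y Z h hy)) :
    ∃ v : Γ(G.mod, U), ∀ (x : T.X') (Z : T.X'.Opens) (h : Z ≤ U) (hx : Z ≤ G.W x),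
      G.comp x h hx v = c x Z h hx := by
  have hmem : (fun x => c x (U ⊓ G.W x) inf_le_left inf_le_right :
      ∀ x, (meetData L.E'.V (G.W x)).obj U) ∈ G.secs U := fun x y Z h hx hy =>
    (hres x _ _ inf_le_left inf_le_right _).trans ((htr x y Z h hx hy).trans
      (congrArg (G.tr x y hx hy) (hres y _ _ inf_le_left inf_le_right _).symm))
  exact ⟨(G.data.equiv U).symm ⟨_, hmem⟩, fun x Z h hx =>
    hres x _ _ inf_le_left inf_le_right (le_inf h hx)⟩

lemma exists_ofComp (x : T.X') (hx : U ≤ G.W x) (v : Γ(L.E'.V, U)) :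
    ∃ w : Γ(G.mod, U), G.comp x le_rfl hx w = v := by
  obtain ⟨w, hw⟩ := G.exists_mk (U := U)
    (fun y Z h hy => G.tr y x hy (h.trans hx) (resM L.E'.V h v))
    (fun y Z Z' h hy h' => by rw [resM_tr, resM_resM])
    (fun y z Z h hy hz => by rw [tr_tr])
  exact ⟨w, by rw [hw, tr_self, resM_self]⟩

/-- The section with a given component. -/
def ofComp (x : T.X') (hx : U ≤ G.W x) (v : Γ(L.E'.V, U)) : Γ(G.mod, U) :=
  (G.exists_ofComp x hx v).choose

lemma comp_ofComp (x : T.X') (hx : U ≤ G.W x) (v : Γ(L.E'.V, U)) :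
    G.comp x le_rfl hx (G.ofComp x hx v) = v := (G.exists_ofComp x hx v).choose_spec

lemma comp_ofComp_le (x : T.X') (hx : U ≤ G.W x) (v : Γ(L.E'.V, U)) (h : Z ≤ U) :
    G.comp x h (h.trans hx) (G.ofComp x hx v) = resM L.E'.V h v := by
  rw [← G.resM_comp x le_rfl hx h, comp_ofComp]

lemma comp_sum_smul (x : T.X') (hx : U ≤ G.W x) (h : Z ≤ U) {n : ℕ} (a : Fin n → Γ(T.X', Z))
    (w : Fin n → Γ(L.E'.V, U)) :
    G.comp x le_rfl (h.trans hx) (∑ k, a k • resM G.mod h (G.ofComp x hx (w k))) =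
      ∑ k, a k • resM L.E'.V h (w k) := by
  rw [map_sum]
  refine Finset.sum_congr rfl fun k _ => ?_
  rw [comp_smul, resO_self, comp_resM, comp_ofComp_le]

lemma isFrame_ofComp (x : T.X') (hx : U ≤ G.W x) {n : ℕ} {w : Fin n → Γ(L.E'.V, U)}
    (hw : IsFrame L.E'.V U w) : IsFrame G.mod U (fun k => G.ofComp x hx (w k)) := by
  refine isFrame_of (fun Z h v => ⟨hw.coord h (G.comp x le_rfl (h.trans hx) v), ?_⟩)
    fun Z h a ha k => ?_
  · refine G.comp_injective x (h.trans hx) ?_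
    rw [comp_sum_smul, hw.sum_coord]
  · have h1 := congrArg (G.comp x le_rfl (h.trans hx)) ha
    rw [comp_sum_smul, map_zero] at h1
    rw [← hw.coord_eq h 0 a h1, map_zero]
    rfl

lemma exists_frame (x : T.X') : ∃ (U : T.X'.Opens) (_ : U ≤ G.W x) (n : ℕ)
    (e : Fin n → Γ(L.E'.V, U)), x ∈ U ∧ IsFrame L.E'.V U e := by
  obtain ⟨W, h, hxW, n, e, he⟩ := L.exists_chart (G.mem_W x)
  exact ⟨W.1, h, n, e, hxW, he⟩

/-! ### The connection of the twisted bundle -/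

lemma exists_nabla (ξ : LogDer T.g' T.D' U) (v : Γ(G.mod, U)) : ∃ w : Γ(G.mod, U),
    ∀ (x : T.X') (Z : T.X'.Opens) (h : Z ≤ U) (hx : Z ≤ G.W x),
      G.comp x h hx w = G.cov x hx (ξ.res h) (G.comp x h hx v) :=
  G.exists_mk (fun x Z h hx => G.cov x hx (ξ.res h) (G.comp x h hx v))
    (fun x Z Z' h hx h' => by rw [resM_cov, resM_comp]; rfl)
    fun x y Z h hx hy => by rw [← cov_tr, tr_comp]

/-- The connection of the twisted bundle. -/
def nabla (ξ : LogDer T.g' T.D' U) : Γ(G.mod, U) →+ Γ(G.mod, U) :=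
  AddMonoidHom.mk' (fun v => (G.exists_nabla ξ v).choose) fun v w => comp_ext fun x Z h hx => by
    rw [map_add, (G.exists_nabla ξ v).choose_spec, (G.exists_nabla ξ w).choose_spec,
      (G.exists_nabla ξ (v + w)).choose_spec, map_add, map_add]

lemma comp_nabla (ξ : LogDer T.g' T.D' U) (v : Γ(G.mod, U)) (x : T.X') (h : Z ≤ U)
    (hx : Z ≤ G.W x) : G.comp x h hx (G.nabla ξ v) = G.cov x hx (ξ.res h) (G.comp x h hx v) :=
  (G.exists_nabla ξ v).choose_spec x Z h hx

/-- The twisted bundle with its connection. -/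
def bundle : DeRhamBundle T.g' T.D' where
  V := G.mod
  isVectorBundle x := by
    obtain ⟨U, hU, n, e, hx, he⟩ := G.exists_frame x
    exact ⟨U, n, _, hx, G.isFrame_ofComp x hU he⟩
  nabla U ξ := G.nabla ξ
  nabla_add U ξ η v := comp_ext fun x Z h hx => by
    rw [map_add, comp_nabla, comp_nabla, comp_nabla, LogDer.res_add, cov_add]
  nabla_smul U a ξ v := comp_ext fun x Z h hx => by
    rw [comp_smul, comp_nabla, comp_nabla, LogDer.res_smul, cov_smul]
  leibniz U ξ a v := comp_ext fun x Z h hx => by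
    rw [map_add, comp_smul, comp_smul, comp_nabla, comp_nabla, comp_smul, cov_leibniz,
      LogDer.ev_res, ξ.res_ev]
  res_nabla h ξ v := comp_ext fun x Z h' hx => by
    rw [comp_resM, comp_nabla, comp_nabla, comp_resM]
    rfl
  flat U ξ η v := comp_ext fun x Z h hx => by
    rw [map_sub, comp_nabla, comp_nabla, comp_nabla, comp_nabla, comp_nabla, LogDer.res_lie,
      cov_flat]

/-! ### The reduction of the twisted bundle -/

lemma red_ext {v w : Γ(E.V, T.i ⁻¹ᵁ U)} (H : ∀ (x : T.X') (Z : T.X'.Opens) (h : Z ≤ U),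
    Z ≤ G.W x → resM E.V (pre_mono h) v = resM E.V (pre_mono h) w) : v = w :=
  eq_of_resM _ _ _ fun y hy => ⟨T.i ⁻¹ᵁ (U ⊓ G.W (T.i y)), pre_mono inf_le_left,
    ⟨hy, G.mem_W _⟩, H _ _ inf_le_left inf_le_right⟩

/-- The transition maps are the identity on X, so the reductions of the components agree and glue.
-/
lemma exists_red (v : Γ(G.mod, U)) : ∃ w : Γ(E.V, T.i ⁻¹ᵁ U), ∀ (x : T.X') (Z : T.X'.Opens)
    (h : Z ≤ U) (hx : Z ≤ G.W x), resM E.V (pre_mono h) w = L.r Z (G.comp x h hx v) := by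
  obtain ⟨w, hw⟩ := exists_glueM E.V (T.i ⁻¹ᵁ U)
    (fun Y s => ∀ (x : T.X') (Z : T.X'.Opens) (hU : Z ≤ U) (hx : Z ≤ G.W x) (h : T.i ⁻¹ᵁ Z ≤ Y),
      resM E.V h s = L.r Z (G.comp x hU hx v))
    (fun y hy => by
      refine ⟨T.i ⁻¹ᵁ (U ⊓ G.W (T.i y)), pre_mono inf_le_left, ⟨hy, G.mem_W _⟩,
        L.r _ (G.comp (T.i y) inf_le_left inf_le_right v), fun x Z hU hx h => ?_⟩
      have hZ := le_of_pre_le h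
      refine (restrictTo_res L.φ.hom hZ _).symm.trans ?_
      rw [resM_comp, ← G.tr_comp x (T.i y) hU hx (hZ.trans inf_le_right), r_tr])
    (fun Y Y' h s hY hs x Z hU hx h' => by rw [resM_resM]; exact hs x Z hU hx _)
    (fun Y hY s t hs ht => by
      refine eq_of_resM _ _ _ fun y hy => ?_
      obtain ⟨Y', rfl⟩ := exists_pre_eq Y
      refine ⟨T.i ⁻¹ᵁ (Y' ⊓ G.W (T.i y)), pre_mono inf_le_left, ⟨hy, G.mem_W _⟩, ?_⟩
      have hZ : Y' ⊓ G.W (T.i y) ≤ U := inf_le_left.trans (le_of_pre_le hY)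
      rw [hs (T.i y) _ hZ inf_le_right, ht (T.i y) _ hZ inf_le_right])
  refine ⟨w, fun x Z h hx => hw (T.i ⁻¹ᵁ Z) (pre_mono h) _ fun y Z' hU hy h' => ?_⟩
  have hZ := le_of_pre_le h'
  refine (restrictTo_res L.φ.hom hZ _).symm.trans ?_
  rw [resM_comp, ← G.tr_comp y x hU hy (hZ.trans hx), r_tr]

/-- The restriction map of the twisted bundle. -/
def red (U : T.X'.Opens) : Γ(G.mod, U) →+ Γ(E.V, T.i ⁻¹ᵁ U) :=
  AddMonoidHom.mk' (fun v => (G.exists_red v).choose) fun v w => G.red_ext fun x Z h hx => by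
    rw [map_add, (G.exists_red v).choose_spec x Z h hx, (G.exists_red w).choose_spec x Z h hx,
      (G.exists_red (v + w)).choose_spec x Z h hx, map_add, map_add]

lemma resM_red (v : Γ(G.mod, U)) (x : T.X') (h : Z ≤ U) (hx : Z ≤ G.W x) :
    resM E.V (pre_mono h) (G.red U v) = L.r Z (G.comp x h hx v) :=
  (G.exists_red v).choose_spec x Z h hx

lemma red_eq (v : Γ(G.mod, U)) (x : T.X') (hx : U ≤ G.W x) :
    G.red U v = L.r U (G.comp x le_rfl hx v) := by
  rw [← G.resM_red v x le_rfl hx, resM_self]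

lemma red_smul (a : Γ(T.X', U)) (v : Γ(G.mod, U)) :
    G.red U (a • v) = ThickenedPair.red U a • G.red U v := G.red_ext fun x Z h hx => by
  rw [resM_smul, G.resM_red _ x h hx, G.resM_red _ x h hx, comp_smul, restrictTo_smul, red_resO]

lemma red_resM (h : Z ≤ U) (v : Γ(G.mod, U)) :
    G.red Z (resM G.mod h v) = resM E.V (pre_mono h) (G.red U v) := G.red_ext fun x Z' h' hx => by
  rw [G.resM_red _ x h' hx, resM_resM, comp_resM]
  exact (G.resM_red v x (h'.trans h) hx).symm

/-- The reduction of the twisted bundle. -/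
def φ : (Scheme.Modules.pullback T.i).obj G.mod ⟶ E.V :=
  ofRestrict G.red (fun _ => G.red_smul) fun _ _ h => G.red_resM h

lemma restrictTo_φ (v : Γ(G.mod, U)) : restrictTo G.φ U v = G.red U v :=
  restrictTo_ofRestrict _ _ _ _ _

instance : IsIso G.φ := isIso_of_isFrame_restrictTo _ fun x => by
  obtain ⟨U, hU, n, e, hx, he⟩ := G.exists_frame x
  refine ⟨U, n, _, hx, G.isFrame_ofComp x hU he, ?_⟩
  convert L.isFrame_r he using 2 with k
  rw [restrictTo_φ, G.red_eq _ x hU, comp_ofComp]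

lemma φ_parallel (ξ : T.VF U) (v : Γ(G.mod, U)) :
    restrictTo G.φ U (G.nabla ξ.fst v) = E.nabla _ ξ.snd (restrictTo G.φ U v) := by
  rw [restrictTo_φ, restrictTo_φ]
  refine G.red_ext fun x Z h hx => ?_
  rw [G.resM_red _ x h hx, comp_nabla, E.res_nabla, G.resM_red _ x h hx]
  exact G.r_cov x hx (ξ.res h) _

/-- The twisted lift. -/
def lift : Lift E where
  E' := G.bundle
  φ := (asIso G.φ : (Scheme.Modules.pullback T.i).obj G.mod ≅ E.V)
  parallel _ ξ v := G.φ_parallel ξ v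

end Gluing

end FilteredDeRham

end

section

namespace FilteredDeRham

open ThickenedPair

/-! ### The filtration of a twisted lift -/

variable {T : ThickenedPair.{u}} {E : DeRhamBundle T.g T.D} {F : HodgeFiltration E} {L : Lift E}
  {lo hi : ℤ} {U Z : T.X'.Opens}

/-- The ring-theoretic condition tests endomorphisms. Taking the projector π_p as test element and
evaluating at a section it fixes gives transversality for sections; the extra term from the
commutator lies in step p. -/
lemma IsGriff.ev {s : Splitting F L lo hi U} {K : EndSec L.E'.V U} {ξ : LogDer T.g' T.D' U}
    (h : IsGriff s.π (L.E'.nablaEndHom ξ) K) {p : ℤ} {v : Γ(L.E'.V, U)}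
    (hv : (s.π p).ev U le_rfl v = v) :
    (s.π (p - 1)).ev U le_rfl (L.E'.nabla U ξ v - K.ev U le_rfl v) =
      L.E'.nabla U ξ v - K.ev U le_rfl v := by
  have h0 : ξ.res le_rfl = ξ := rfl
  have h1 : (L.E'.nablaEndHom ξ (s.π p)).ev U le_rfl v =
      L.E'.nabla U ξ v - (s.π p).ev U le_rfl (L.E'.nabla U ξ v) := by
    refine (DeRhamBundle.nablaEnd_ev _ _ _ _ _ _ _).trans ?_
    rw [h0, hv]
  have h2 := congr(($(h p _ (s.chain.mul_of_le (le_refl p)))).ev U le_rfl v)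
  rw [EndSec.mul_ev, EndSec.sub_ev, EndSec.mul_ev, hv, h1] at h2
  have h3 : (s.π (p - 1)).ev U le_rfl ((s.π p).ev U le_rfl (L.E'.nabla U ξ v)) =
      (s.π p).ev U le_rfl (L.E'.nabla U ξ v) :=
    congr(($(s.chain.mul_of_le (by lia : p - 1 ≤ p))).ev U le_rfl (L.E'.nabla U ξ v))
  rw [sub_right_comm, map_sub, h3] at h2
  exact sub_left_inj.1 h2

/-- Splittings compatible with a hypercocycle. -/
structure Gluing.Adapted (G : Gluing L) (s : ∀ x, Splitting F L lo hi (G.W x)) : Prop where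
  mapsFil (x y : T.X') : MapsFil ((s y).res inf_le_right).π ((s x).res inf_le_left).π (1 + G.n x y)
  griff (x : T.X') {U : T.X'.Opens} (h : U ≤ G.W x) (ξ : LogDer T.g' T.D' U) :
    IsGriff ((s x).res h).π (L.E'.nablaEndHom ξ) (G.K x h ξ)

namespace Gluing

variable (G : Gluing L) (s : ∀ x, Splitting F L lo hi (G.W x))

/-- The steps of the filtration. -/
def filSec (p : ℤ) (U : T.X'.Opens) : Submodule Γ(T.X', U) Γ(G.mod, U) where
  carrier := {v | ∀ (x : T.X') (Z : T.X'.Opens) (h : Z ≤ U) (hx : Z ≤ G.W x),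
    ((s x).π p).ev Z hx (G.comp x h hx v) = G.comp x h hx v}
  zero_mem' x Z h hx := by rw [map_zero, map_zero]
  add_mem' hv hw x Z h hx := by rw [map_add, map_add, hv x Z h hx, hw x Z h hx]
  smul_mem' a v hv x Z h hx := by rw [comp_smul, map_smul, hv x Z h hx]

variable {G s}

/-- The transition maps respect the local filtrations, so one component decides membership for all.
-/
lemma Adapted.mem_filSec (H : G.Adapted s) {p : ℤ} (x : T.X') (hx : U ≤ G.W x) {v : Γ(G.mod, U)}
    (hv : ((s x).π p).ev U hx (G.comp x le_rfl hx v) = G.comp x le_rfl hx v) :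
    v ∈ G.filSec s p U := fun y Z h hy => by
  have h1 := congrArg (resM L.E'.V h) hv
  rw [EndSec.res_ev, resM_comp] at h1
  have h2 := congr(($(H.mapsFil y x p)).ev Z (le_inf hy (h.trans hx))
    (G.comp x h (h.trans hx) v))
  rw [EndSec.mul_ev, EndSec.mul_ev] at h2
  rw [← G.tr_comp y x h hy (h.trans hx)]
  refine Eq.trans ?_ (h2.trans ?_)
  · exact congrArg (fun w => ((s y).π p).ev Z hy (G.tr y x hy (h.trans hx) w)) h1.symm
  · exact congrArg (G.tr y x hy (h.trans hx)) h1

lemma Adapted.isSubbundle (H : G.Adapted s) (p : ℤ) : IsSubbundle G.mod (G.filSec s p) where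
  res h v hv x Z h' hx := by
    rw [comp_resM]
    exact hv x Z _ hx
  glue U v hv x Z h hx := eq_of_resM _ _ _ fun z hz => by
    obtain ⟨W, hW, hzW, hvW⟩ := hv z (h hz)
    refine ⟨Z ⊓ W, inf_le_left, ⟨hz, hzW⟩, ?_⟩
    have h1 := hvW x (Z ⊓ W) inf_le_right (inf_le_left.trans hx)
    rw [comp_resM] at h1
    rwa [EndSec.res_ev, resM_comp]
  adapted x := by
    obtain ⟨Z, hZ, n, w, A, hx, hw, hA, ha⟩ := (s x).exists_adapted p (G.mem_W x)
    refine ⟨Z, n, _, A, hx, G.isFrame_ofComp x hZ hw, fun W h => le_antisymm (fun v hv => ?_) ?_⟩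
    · obtain ⟨a, ha₀, hav⟩ := ha W h (G.comp x le_rfl (h.trans hZ) v) (hv x W le_rfl (h.trans hZ))
      have h1 : ∑ k, a k • resM G.mod h (G.ofComp x hZ (w k)) = v := by
        refine G.comp_injective x (h.trans hZ) ?_
        rw [comp_sum_smul, hav]
      rw [← h1]
      refine Submodule.sum_mem _ fun k _ => ?_
      by_cases hk : k ∈ A
      · exact Submodule.smul_mem _ _ (Submodule.subset_span ⟨k, hk, rfl⟩)
      · rw [ha₀ k hk, zero_smul]
        exact zero_mem _
    · refine Submodule.span_le.2 ?_
      rintro _ ⟨k, hk, rfl⟩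
      refine H.mem_filSec x (h.trans hZ) ?_
      rw [comp_resM, comp_ofComp_le, ← EndSec.res_ev _ hZ h, hA k hk]

/-- The filtration of the twisted bundle. -/
def Adapted.fil (H : G.Adapted s) : HodgeFiltration G.bundle where
  Fil := G.filSec s
  isSubbundle := H.isSubbundle
  antitone U p q h v hv x Z hZ hx := by
    rw [← hv x Z hZ hx]
    exact congr(($((s x).chain.mul_of_le h)).ev Z hx (G.comp x hZ hx v))
  finite := ⟨lo, hi, fun U => ⟨top_le_iff.1 fun v _ x Z h hx =>
      congr(($((s x).chain.one lo le_rfl)).ev Z hx (G.comp x h hx v)),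
    le_bot_iff.1 fun v hv => (Submodule.mem_bot _).2 (comp_ext fun x Z h hx =>
      ((hv x Z h hx).symm.trans
        congr(($((s x).chain.zero hi le_rfl)).ev Z hx (G.comp x h hx v))).trans
          (map_zero (G.comp x h hx)).symm)⟩⟩
  griffiths p U ξ v hv x Z h hx := by
    refine (congrArg (((s x).π (p - 1)).ev Z hx) (G.comp_nabla ξ v x h hx)).trans
      (Eq.trans ?_ (G.comp_nabla ξ v x h hx).symm)
    exact (H.griff x hx (ξ.res h)).ev (hv x Z h hx)

lemma Adapted.liftsFil (H : G.Adapted s) : LiftsFil F G.lift H.fil where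
  le p U v hv := by
    refine (F.isSubbundle p).glue _ _ fun y hy => ?_
    refine ⟨T.i ⁻¹ᵁ (U ⊓ G.W (T.i y)), pre_mono inf_le_left, ⟨hy, G.mem_W _⟩, ?_⟩
    have h1 : restrictTo G.lift.φ.hom U v = G.red U v := G.restrictTo_φ v
    rw [h1, G.resM_red v (T.i y) inf_le_left inf_le_right, ← hv (T.i y) _ inf_le_left inf_le_right,
      (s (T.i y)).lifts p]
    exact (s (T.i y)).mem p _ _ _
  surj p U v hv x hx := by
    obtain ⟨Z, h, hxZ, hZ⟩ := L.exists_chart (show x ∈ U ⊓ G.W x from ⟨hx, G.mem_W x⟩)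
    have hZU := h.trans inf_le_left
    have hZW := h.trans inf_le_right
    obtain ⟨w, hw⟩ := hZ.r_surjective (resM E.V (pre_mono hZU) v)
    refine ⟨Z.1, hZU, hxZ, G.ofComp x hZW (((s x).π p).ev Z.1 hZW w), ?_, ?_⟩
    · refine H.mem_filSec x hZW ?_
      rw [comp_ofComp]
      exact congr(($((s x).chain.mul_of_le (le_refl p))).ev Z.1 hZW w)
    · refine (G.restrictTo_φ _).trans ?_
      rw [G.red_eq _ x hZW, comp_ofComp, (s x).lifts p, hw]
      exact (s x).fix p _ _ _ ((F.isSubbundle p).res _ _ hv)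

/-- The twisted filtered lift. -/
def Adapted.filLift (H : G.Adapted s) : FilLift F := ⟨G.lift, H.fil, H.liftsFil⟩

end Gluing

end FilteredDeRham

end

section

namespace FilteredDeRham

open ThickenedPair

attribute [local instance] HasDerivedCategory.standard

/-! ### Existence of filtered lifts -/

variable {T : ThickenedPair.{u}} {E : DeRhamBundle T.g T.D} {F : HodgeFiltration E} {L : Lift E}
  {lo hi p q : ℤ} {U W : T.X'.Opens}

lemma ThickenedPair.toVF_add (ξ η : LogDer T.g' T.D' U) : toVF (ξ + η) = toVF ξ + toVF η :=
  VF.ext_fst ((toVF_fst _).trans (congrArg₂ (· + ·) (toVF_fst ξ) (toVF_fst η)).symm)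

lemma ThickenedPair.toVF_smul (a : Γ(T.X', U)) (ξ : LogDer T.g' T.D' U) :
    toVF (a • ξ) = a • toVF ξ :=
  VF.ext_fst ((toVF_fst _).trans (congrArg (a • ·) (toVF_fst ξ)).symm)

lemma ThickenedPair.toVF_lie (ξ η : LogDer T.g' T.D' U) : toVF ⁅ξ, η⁆ = ⁅toVF ξ, toVF η⁆ :=
  VF.ext_fst ((toVF_fst _).trans (congrArg₂ (⁅·, ·⁆) (toVF_fst ξ) (toVF_fst η)).symm)

lemma ThickenedPair.toVF_res (h : W ≤ U) (ξ : LogDer T.g' T.D' U) :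
    (toVF ξ).res h = toVF (ξ.res h) :=
  VF.ext_fst (Eq.trans (b := ξ.res h) (congrArg (LogDer.res h) (toVF_fst ξ)) (toVF_fst _).symm)

namespace Splitting

/-- The change of connection which makes the connection Griffiths transversal. -/
def griff (s : Splitting F L lo hi U) (ξ : LogDer T.g' T.D' U) : EndSec L.E'.V U :=
  griffDefect lo hi s.π (L.E'.nablaEndHom ξ)

lemma isGriff_griff (s : Splitting F L lo hi U) (hlh : lo ≤ hi) (ξ : LogDer T.g' T.D' U) :
    IsGriff s.π (L.E'.nablaEndHom ξ) (s.griff ξ) :=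
  isGriff_griffDefect hlh s.chain (L.E'.nablaEnd_mul ξ)

/-- On X the filtration is transversal, so the defect vanishes after reduction. -/
lemma griff_mem (s : Splitting F L lo hi U) (ξ : T.VF U) : s.griff ξ.fst ∈ L.nil U := by
  refine griffDefect_mem (Lift.isSqZero_nil U) s.chain (L.E'.nablaEnd_mul ξ.fst) fun p => ?_
  have h1 := ((Lift.lifts_one U).sub (s.lifts (p - 1))).mul
    (((s.lifts p).nabla ξ).mul (s.lifts p))
  have h2 : (1 - s.red (p - 1)) * (E.nablaEnd _ ξ.snd (s.red p) * s.red p) = 0 := by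
    ext W h v
    have hv := s.mem p W h v
    rw [EndSec.mul_ev, EndSec.mul_ev, DeRhamBundle.nablaEnd_ev, s.fix p W h _ hv, EndSec.sub_ev,
      EndSec.zero_ev, sub_eq_zero]
    exact (s.fix (p - 1) W h _ (sub_mem (F.griffiths p W _ _ hv)
      (F.antitone W (by lia : p - 1 ≤ p) (s.mem p W h _)))).symm
  rw [h2] at h1
  exact h1

lemma griff_add (s : Splitting F L lo hi U) (ξ η : LogDer T.g' T.D' U) :
    s.griff (ξ + η) = s.griff ξ + s.griff η := by
  unfold griff griffDefect
  rw [← Finset.sum_add_distrib]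
  refine Finset.sum_congr rfl fun p _ => ?_
  rw [← mul_add]
  exact congrArg _ (L.E'.nablaEnd_add_left ξ η _)

lemma griff_smul (s : Splitting F L lo hi U) (a : Γ(T.X', U)) (ξ : LogDer T.g' T.D' U) :
    s.griff (a • ξ) = a • s.griff ξ := by
  unfold griff griffDefect
  rw [Finset.smul_sum]
  refine Finset.sum_congr rfl fun p _ => ?_
  rw [← EndSec.mul_smul]
  exact congrArg _ (L.E'.nablaEnd_smul_left a ξ _)

lemma griff_res (s : Splitting F L lo hi U) (ξ : LogDer T.g' T.D' U) (h : W ≤ U) :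
    (s.griff ξ).res h = (s.res h).griff (ξ.res h) := by
  exact map_sum (EndSec.res h) _ _

/-- The change of connection as a form with nilpotent values. -/
def griffForm (s : Splitting F L lo hi U) : L.NilForm U where
  val _ h ξ := (s.res h).griff ξ.fst
  mem _ h ξ := (s.res h).griff_mem ξ
  add _ h ξ η := (s.res h).griff_add ξ.fst η.fst
  smul _ h a ξ := (s.res h).griff_smul a ξ.fst
  res _ _ h h' ξ := (s.res h).griff_res ξ.fst h'

/-- A nilpotent endomorphism `φ` such that `1 + φ` maps the filtration given by `s'` to the one
given by `s`. -/
def transition (hlh : lo ≤ hi) (s s' : Splitting F L lo hi U) : L.nil U :=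
  ⟨chainTransition lo hi s'.π s.π - 1,
    chainTransition_mem hlh (Lift.isSqZero_nil _) s'.chain (s'.sameMod s)⟩

lemma transition_mapsFil (hlh : lo ≤ hi) (s s' : Splitting F L lo hi U) :
    MapsFil s'.π s.π (1 + (s.transition hlh s').1) := by
  rw [show 1 + (s.transition hlh s').1 = _ from add_sub_cancel _ _]
  exact chainTransition_mapsFil s'.chain s.chain

lemma sub_hasDeg (hlh : lo ≤ hi) (s s' : Splitting F L lo hi U) {μ ν : EndSec L.E'.V U}
    (hμ : μ ∈ L.nil U) (hν : ν ∈ L.nil U) (h : MapsFil s.π s'.π (1 + μ))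
    (h' : MapsFil s.π s'.π (1 + ν)) : HasDeg s.π 0 (μ - ν) :=
  MapsFil.sub_hasDeg hlh (Lift.isSqZero_nil _) s.chain s'.chain (s.sameMod s') hμ hν h h'

lemma mapsFil_add (s s' s'' : Splitting F L lo hi U) {μ ν : EndSec L.E'.V U} (hμ : μ ∈ L.nil U)
    (hν : ν ∈ L.nil U) (h : MapsFil s.π s'.π (1 + μ)) (h' : MapsFil s'.π s''.π (1 + ν)) :
    MapsFil s.π s''.π (1 + (ν + μ)) := by
  rw [← (Lift.isSqZero_nil U).one_add_mul hν hμ]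
  exact h.mul s.chain h'

/-- The correction for s', transported by 1 + ν, is another correction for s, and two corrections
for the same chain differ by degree −1. This is the relation ω_x − ω_y = d φ_xy modulo Fil⁰. -/
lemma griff_sub_hasDeg (hlh : lo ≤ hi) (s s' : Splitting F L lo hi U) {ν : EndSec L.E'.V U}
    (hν : ν ∈ L.nil U) (h : MapsFil s'.π s.π (1 + ν)) (ξ : T.VF U) :
    HasDeg s.π (-1) (s.griff ξ.fst - s'.griff ξ.fst - L.E'.nablaEnd U ξ.fst ν) := by
  have hN := Lift.isSqZero_nil (L := L) U
  have h1 := IsGriff.transport hN (L.E'.nablaEnd_mul ξ.fst)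
    (fun n hn => Lift.nablaEnd_mem_nil ξ.fst hn) (s'.griff_mem ξ) hν h
    (MapsFil.symm hlh hN s'.chain s.chain (s'.sameMod s) hν h) (s'.isGriff_griff hlh ξ.fst)
  rw [sub_sub]
  exact (s.isGriff_griff hlh ξ.fst).hasDeg s.chain h1

lemma griff_curvature (hlh : lo ≤ hi) (s : Splitting F L lo hi U) (ξ η : T.VF U) :
    HasDeg s.π (-2) (L.E'.nablaEnd U ξ.fst (s.griff η.fst) -
      L.E'.nablaEnd U η.fst (s.griff ξ.fst) - s.griff ⁅ξ.fst, η.fst⁆) :=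
  IsGriff.curvature (D₁ := L.E'.nablaEndHom ξ.fst) (D₂ := L.E'.nablaEndHom η.fst)
    (D₃ := L.E'.nablaEndHom ⁅ξ.fst, η.fst⁆) (Lift.isSqZero_nil U) s.chain
    (L.E'.nablaEnd_mul ξ.fst) (L.E'.nablaEnd_mul η.fst)
    (fun g => sub_eq_of_eq_add (L.E'.nablaEnd_lie ξ.fst η.fst g)) (s.griff_mem ξ) (s.griff_mem η)
    (s.isGriff_griff hlh _) (s.isGriff_griff hlh _) (s.isGriff_griff hlh _)

/-- Modulo a degree-0 term δ, n is the transition plus t − t'. Accordingly 1 + n factors through s'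
and s: undo the conjugation by t', apply 1 + δ and the transition, then conjugate by t. -/
lemma mapsFil_of_proj (hlh : lo ≤ hi) (hp : p ≤ 0) (htop : ∀ U, Coeff.fil F p U = ⊤)
    (hU : L.Framed U) (s s' : Splitting F L lo hi U) (n t t' : AbSh.sec ((DR F p).X 0) U)
    (h : shApp ((DRProj F hp).f 0) U n = shApp ((DRProj F hp).f 0) U
      (toDR F p 0 0 Nat.cast_zero U (Lift.form₀ F p htop hU (s.transition hlh s'))) +
      (shApp ((DRProj F hp).f 0) U t - shApp ((DRProj F hp).f 0) U t')) :
    MapsFil (s'.conj (Lift.dr₀_mem_nil t')).π (s.conj (Lift.dr₀_mem_nil t)).π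
      (1 + L.dr₀ F p U n) := by
  have hN := Lift.isSqZero_nil (L := L) U
  rw [← map_sub, ← map_add, ← sub_eq_zero, ← map_sub] at h
  obtain ⟨δ, hδ⟩ := exists_of_proj_eq_zero hp _ h
  have h1 : L.dr₀ F p U n = L.dr₀ F p U t + (s.transition hlh s').1 + L.dr₀ F 0 U δ -
      L.dr₀ F p U t' := by
    rw [← Lift.dr₀_incl hp, hδ, map_sub, map_add, map_sub, Lift.dr₀_toDR, Lift.act_form₀]
    abel
  have h2 : MapsFil (s'.conj (Lift.dr₀_mem_nil t')).π s'.π (1 + -L.dr₀ F p U t') := by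
    rw [← sub_eq_add_neg]
    exact MapsFil.conj_symm s'.chain hN (Lift.dr₀_mem_nil t')
  have h3 : MapsFil s'.π s'.π (1 + L.dr₀ F 0 U δ) :=
    (mapsFil_one_add_iff s'.chain).2 (Lift.dr₀_hasDeg s' δ)
  have h4 := MapsFil.conj s.chain hN (Lift.dr₀_mem_nil t)
  have m₁ := neg_mem (Lift.dr₀_mem_nil (L := L) t')
  have m₂ := Lift.dr₀_mem_nil (L := L) δ
  have m₃ := (s.transition hlh s').2
  have m₄ := Lift.dr₀_mem_nil (L := L) t
  have h5 := mapsFil_add (s'.conj (Lift.dr₀_mem_nil t')) s' s' m₁ m₂ h2 h3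
  have h6 := mapsFil_add _ s' s (add_mem m₂ m₁) m₃ h5 (s.transition_mapsFil hlh s')
  have h7 := mapsFil_add _ s (s.conj (Lift.dr₀_mem_nil t)) (add_mem m₃ (add_mem m₂ m₁)) m₄ h6 h4
  rw [h1]
  convert h7 using 2
  abel

/-- The coboundary dt in k is exactly the change of the defect under conjugation by 1 + t, and the
remaining error has degree −1, which transversality tolerates. -/
lemma isGriff_of_proj (hlh : lo ≤ hi) (hp : p ≤ 0)
    (htop : ∀ U, Coeff.fil F (p - (1 : ℕ)) U = ⊤) (hU : L.Framed U) (s : Splitting F L lo hi U)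
    (k : AbSh.sec ((DR F p).X 1) U) (t : AbSh.sec ((DR F p).X 0) U)
    (h : shApp ((DRProj F hp).f 1) U k = shApp ((DRProj F hp).f 1) U
      (toDR F p 1 1 Nat.cast_one U (Lift.form₁ F p htop hU s.griffForm)) +
      shApp ((DRProj F hp).f 1) U (shApp ((DR F p).d 0 1) U t)) (ξ : T.VF U) :
    IsGriff (s.conj (Lift.dr₀_mem_nil t)).π (L.E'.nablaEndHom ξ.fst) (L.dr₁ F p ξ k) := by
  have hN := Lift.isSqZero_nil (L := L) U
  rw [← map_add, ← sub_eq_zero, ← map_sub] at h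
  obtain ⟨δ, hδ⟩ := exists_of_proj_eq_zero hp _ h
  have h1 : L.dr₁ F p ξ k = s.griff ξ.fst + L.E'.nablaEnd U ξ.fst (L.dr₀ F p U t) +
      L.dr₁ F 0 ξ δ := by
    rw [← Lift.dr₁_incl hp, hδ, map_sub, map_add, Lift.dr₁_toDR, Lift.act_form₁, Lift.dr₁_d]
    exact (add_sub_cancel _ _).symm
  have h2 := IsGriff.transport hN (L.E'.nablaEnd_mul ξ.fst)
    (fun n hn => Lift.nablaEnd_mem_nil ξ.fst hn) (s.griff_mem ξ) (Lift.dr₀_mem_nil t)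
    (MapsFil.conj s.chain hN (Lift.dr₀_mem_nil t)) (MapsFil.conj_symm s.chain hN
      (Lift.dr₀_mem_nil t)) (s.isGriff_griff hlh ξ.fst)
  have h3 := Lift.dr₁_hasDeg (s.conj (Lift.dr₀_mem_nil t)) ξ δ
  rw [zero_sub] at h3
  rw [h1]
  exact h2.add_hasDeg h3

end Splitting

/-- The hypercocycle of endomorphisms given by a hypercocycle in the de Rham complex. -/
def Gluing.ofDR (F : HodgeFiltration E) (L : Lift E) (p : ℤ) (W W₀ : T.X' → T.X'.Opens)
    (hW : ∀ x, x ∈ W x) (hWW : ∀ x, W x ≤ W₀ x) (k : ∀ x, AbSh.sec ((DR F p).X 1) (W₀ x))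
    (n : ∀ x y, AbSh.sec ((DR F p).X 0) (W₀ x ⊓ W₀ y))
    (hk : ∀ x, shApp ((DR F p).d 1 2) (W₀ x) (k x) = 0)
    (hn : ∀ x y z, AbSh.res _ (le_inf (inf_le_left.trans inf_le_left)
        (inf_le_left.trans inf_le_right)) (n x y) +
      AbSh.res _ (le_inf (inf_le_left.trans inf_le_right) inf_le_right) (n y z) =
      AbSh.res ((DR F p).X 0) (W := W₀ x ⊓ W₀ y ⊓ W₀ z)
        (le_inf (inf_le_left.trans inf_le_left) inf_le_right) (n x z))
    (hkn : ∀ x y, AbSh.res _ inf_le_left (k x) - AbSh.res _ inf_le_right (k y) =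
      shApp ((DR F p).d 0 1) (W₀ x ⊓ W₀ y) (n x y)) : Gluing L where
  W := W
  mem_W := hW
  K x _ h ξ := L.dr₁ F p (toVF ξ) (AbSh.res _ (h.trans (hWW x)) (k x))
  K_mem x _ h ξ := Lift.dr₁_mem_nil _ _
  K_add x _ h ξ η := by
    rw [← Lift.dr₁_add_left]
    rw [toVF_add]
  K_smul x _ h a ξ := by
    rw [← Lift.dr₁_smul_left]
    rw [toVF_smul]
  K_res x _ _ h hZ ξ := by
    rw [Lift.dr₁_res, toVF_res]
    exact congrArg (L.dr₁ F p _) (resP_resP _ _ _ _)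
  K_flat x _ h ξ η := by
    have h1 := Lift.dr₁_flat (L := L) (AbSh.res _ (h.trans (hWW x)) (k x))
      (by rw [← shApp_res, hk, map_zero]) (toVF ξ) (toVF η)
    rwa [← toVF_lie, toVF_fst, toVF_fst] at h1
  n x y := L.dr₀ F p _ (AbSh.res _ (inf_le_inf (hWW x) (hWW y)) (n x y))
  n_mem x y := Lift.dr₀_mem_nil _
  n_add x y z U hx hy hz := by
    have h1 := congrArg (fun s => L.dr₀ F p U (AbSh.res _ (le_inf (le_inf (hx.trans (hWW x))
      (hy.trans (hWW y))) (hz.trans (hWW z))) s)) (hn x y z)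
    simp only [map_add] at h1
    rw [Lift.dr₀_res, Lift.dr₀_res, Lift.dr₀_res]
    refine Eq.trans ?_ (h1.trans ?_)
    · refine congrArg₂ (fun a b => L.dr₀ F p U a + L.dr₀ F p U b) ?_ ?_ <;>
      exact (resP_resP _ _ _ _).trans (resP_resP _ _ _ _).symm
    · exact congrArg (L.dr₀ F p U) ((resP_resP _ _ _ _).trans (resP_resP _ _ _ _).symm)
  n_nabla x y U hx hy ξ := by
    have h1 := congrArg (fun s => L.dr₁ F p (toVF ξ) (AbSh.res _ (le_inf (hx.trans (hWW x))
      (hy.trans (hWW y))) s)) (hkn x y)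
    simp only [map_sub, shApp_res, Lift.dr₁_d, toVF_fst] at h1
    rw [Lift.dr₀_res]
    refine Eq.trans ?_ (h1.trans ?_)
    · refine congrArg₂ (fun a b => L.dr₁ F p (toVF ξ) a - L.dr₁ F p (toVF ξ) b) ?_ ?_ <;>
      exact (resP_resP _ _ _ _).symm
    · exact congrArg (fun s => L.E'.nablaEnd U ξ (L.dr₀ F p U s)) (resP_resP _ _ _ _).symm

end FilteredDeRham

end

section

namespace FilteredDeRham

open ThickenedPair

/-! ### The obstruction hypercocycle and the construction of a filtered lift. -/

section

attribute [local instance] HasDerivedCategory.standard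

variable {T : ThickenedPair.{u}} {E : DeRhamBundle T.g T.D} {F : HodgeFiltration E} {L : Lift E}
  {lo hi p q : ℤ} {U W : T.X'.Opens}

namespace Splitting

lemma transition_res (hlh : lo ≤ hi) (s s' : Splitting F L lo hi U) (h : W ≤ U) :
    (⟨(s.transition hlh s').1.res h, Lift.nil_res (s.transition hlh s').2 h⟩ : L.nil W) =
      (s.res h).transition hlh (s'.res h) :=
  Subtype.ext ((map_sub (EndSec.res h) _ _).trans
    (congrArg (· - (1 : EndSec L.E'.V W)) (map_sum (EndSec.res h) _ _)))

/-- The differential of the defect is, up to sign, the curvature of the corrected connection. It has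
degree −2, which is Fil⁰ of the complex in degree 2. -/
lemma proj_form₁_closed (hlh : lo ≤ hi) (hp : p ≤ 0)
    (htop : ∀ U, Coeff.fil F (p - (1 : ℕ)) U = ⊤) (hU : L.Framed U) (s : Splitting F L lo hi U) :
    shApp ((DRQuot F hp).d 1 2) U (shApp ((DRProj F hp).f 1) U
      (toDR F p 1 1 Nat.cast_one U (Lift.form₁ F p htop hU s.griffForm))) = 0 := by
  rw [← shApp_comp, (DRProj F hp).comm, shApp_comp, toDR_d F Nat.cast_one (j := 2) rfl]
  refine Lift.proj_toDR_eq_zero hlh s hU rfl hp _ fun V ξ η => ⟨?_, ?_⟩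
  · exact sub_mem (sub_mem (Lift.liftable_nabla ξ (Lift.coeff_mem _ _)) (Lift.coeff_mem _ _))
      (Lift.liftable_nabla η (Lift.coeff_mem _ _))
  · change HasDeg (s.res V.2).π (0 - (2 : ℕ)) (L.act V.1
      (Coeff.nabla ξ (Lift.coeff _ _) - Lift.coeff _ _ - Coeff.nabla η (Lift.coeff _ _)))
    rw [map_sub, map_sub, Lift.act_nabla, Lift.act_nabla, Lift.act_coeff, Lift.act_coeff,
      Lift.act_coeff, sub_right_comm]
    exact (s.res V.2).griff_curvature hlh ξ η

lemma proj_form₁_sub (hlh : lo ≤ hi) (hp : p ≤ 0) (htop : ∀ U, Coeff.fil F p U = ⊤)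
    (htop' : ∀ U, Coeff.fil F (p - (1 : ℕ)) U = ⊤) (hU : L.Framed U)
    (s s' : Splitting F L lo hi U) :
    shApp ((DRProj F hp).f 1) U
      (toDR F p 1 1 Nat.cast_one U (Lift.form₁ F p htop' hU s.griffForm)) -
    shApp ((DRProj F hp).f 1) U
      (toDR F p 1 1 Nat.cast_one U (Lift.form₁ F p htop' hU s'.griffForm)) =
    shApp ((DRQuot F hp).d 0 1) U (shApp ((DRProj F hp).f 0) U
      (toDR F p 0 0 Nat.cast_zero U (Lift.form₀ F p htop hU (s.transition hlh s')))) := by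
  rw [← shApp_comp, (DRProj F hp).comm, shApp_comp, toDR_d F Nat.cast_zero Nat.cast_one,
    ← sub_eq_zero, ← map_sub, ← map_sub, ← map_sub, ← map_sub]
  refine Lift.proj_toDR_eq_zero hlh s hU Nat.cast_one hp _ fun V ξ => ⟨?_, ?_⟩
  · exact sub_mem (sub_mem (Lift.coeff_mem _ _) (Lift.coeff_mem _ _))
      (Lift.liftable_nabla ξ (Lift.coeff_mem _ _))
  · change HasDeg (s.res V.2).π (0 - (1 : ℕ)) (L.act V.1
      (Lift.coeff _ _ - Lift.coeff _ _ - Coeff.nabla ξ (Lift.coeff _ _)))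
    rw [map_sub, map_sub, Lift.act_nabla, Lift.act_coeff, Lift.act_coeff, Lift.act_coeff]
    exact (s.res V.2).griff_sub_hasDeg hlh (s'.res V.2) (Lift.nil_res (s.transition hlh s').2 V.2)
      ((s.transition_mapsFil hlh s').res V.2) ξ

/-- The composite of two transitions and the direct one carry the same filtration to the same
filtration, so they differ by degree 0. This is the Čech cocycle identity modulo Fil⁰. -/
lemma proj_form₀_add (hlh : lo ≤ hi) (hp : p ≤ 0) (htop : ∀ U, Coeff.fil F p U = ⊤)
    (hU : L.Framed U) (s s' s'' : Splitting F L lo hi U) {μ μ' μ'' : L.nil U}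
    (h : MapsFil s'.π s.π (1 + μ.1)) (h' : MapsFil s''.π s'.π (1 + μ'.1))
    (h'' : MapsFil s''.π s.π (1 + μ''.1)) :
    shApp ((DRProj F hp).f 0) U (toDR F p 0 0 Nat.cast_zero U (Lift.form₀ F p htop hU μ)) +
    shApp ((DRProj F hp).f 0) U (toDR F p 0 0 Nat.cast_zero U (Lift.form₀ F p htop hU μ')) =
    shApp ((DRProj F hp).f 0) U (toDR F p 0 0 Nat.cast_zero U (Lift.form₀ F p htop hU μ'')) := by
  rw [← sub_eq_zero, ← map_add, ← map_add, ← map_sub, ← map_sub]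
  refine Lift.proj_toDR_eq_zero₀ hlh s'' hU hp _ (fun V => sub_mem
    (add_mem (Lift.coeff_mem _ _) (Lift.coeff_mem _ _)) (Lift.coeff_mem _ _)) ?_
  rw [map_sub, map_sub, map_add, map_add, Lift.act_form₀, Lift.act_form₀, Lift.act_form₀]
  exact s''.sub_hasDeg hlh s (add_mem μ.2 μ'.2) μ''.2 (s''.mapsFil_add s' s μ'.2 μ.2 h' h) h''

end Splitting

/-- If the Hodge–de Rham spectral sequence degenerates, then a filtered de Rham bundle has a lift
as soon as the underlying de Rham bundle has one. -/
theorem nonempty_filLift (hE : HodgeDeRhamDegenerates F) (L : Lift E) : Nonempty (FilLift F) := by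
  obtain ⟨N, hN⟩ := F.exists_bounded
  obtain ⟨lo, hi, hlh, hF⟩ : ∃ lo hi : ℤ, lo < hi ∧ F.Bounded lo hi :=
    ⟨-max 0 N - 1, max 0 N + 1, by lia, hN _ _ (by lia) (by lia)⟩
  have hp : lo - hi ≤ 0 := by lia
  have htop : ∀ U, Coeff.fil F (lo - hi) U = ⊤ := Coeff.fil_eq_top hF le_rfl
  have htop' : ∀ U, Coeff.fil F (lo - hi - (1 : ℕ)) U = ⊤ := Coeff.fil_eq_top hF (by lia)
  have hex (x : T.X') : ∃ U : T.X'.Opens, x ∈ U ∧ L.Framed U ∧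
      Nonempty (Splitting F L lo hi U) := by
    obtain ⟨W, -, hx, hW, s⟩ := exists_splitting F L (U := ⊤) hlh hF
      (show x ∈ (⊤ : T.X'.Opens) from trivial)
    exact ⟨W.1, hx, hW, s⟩
  choose U hxU hU s using hex
  replace s := fun x => (s x).some
  let φ (x y : T.X') : L.nil (U x ⊓ U y) :=
    ((s x).res inf_le_left).transition hlh.le ((s y).res inf_le_right)
  have hφ (x y) := ((s x).res inf_le_left).transition_mapsFil hlh.le
    ((s y).res (inf_le_right : U x ⊓ U y ≤ U y))
  let q (x y : T.X') := shApp ((DRProj F hp).f 0) (U x ⊓ U y) (toDR F _ 0 0 Nat.cast_zero _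
    (Lift.form₀ F _ htop ((hU x).mono inf_le_left) (φ x y)))
  let ω (x : T.X') := shApp ((DRProj F hp).f 1) (U x) (toDR F _ 1 1 Nat.cast_one _
    (Lift.form₁ F _ htop' (hU x) (s x).griffForm))
  have hresω (x : T.X') {V : T.X'.Opens} (h : V ≤ U x) : AbSh.res _ h (ω x) =
      shApp ((DRProj F hp).f 1) V (toDR F _ 1 1 Nat.cast_one _
        (Lift.form₁ F _ htop' ((hU x).mono h) ((s x).res h).griffForm)) := by
    rw [shApp_res, toDR_res]
    rfl
  have hresq (x y : T.X') {V : T.X'.Opens} (h : V ≤ U x ⊓ U y) : AbSh.res _ h (q x y) =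
      shApp ((DRProj F hp).f 0) V (toDR F _ 0 0 Nat.cast_zero _
        (Lift.form₀ F _ htop ((hU x).mono (h.trans inf_le_left))
          ⟨(φ x y).1.res h, Lift.nil_res (φ x y).2 h⟩)) := by
    rw [shApp_res, toDR_res, Lift.form₀_res]
  have hφres (x y : T.X') {V : T.X'.Opens} (h : V ≤ U x ⊓ U y) :
      (⟨(φ x y).1.res h, Lift.nil_res (φ x y).2 h⟩ : L.nil V) =
        ((s x).res (h.trans inf_le_left)).transition hlh.le ((s y).res (h.trans inf_le_right)) := by
    exact Splitting.transition_res hlh.le _ _ h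
  -- Degeneration, through surjectivity on ℍ¹, lifts the obstruction hypercocycle (ω, q) to a
  -- hypercocycle (k, n) of the whole complex, up to the coboundary of t.
  obtain ⟨W, i, hxW, hW, k, n, t, hk, hn, hkn, hkω, hnq⟩ := exists_cech_lift (DRProj F hp)
    (fun i => isZero_DR_neg F _ i) (fun i => isZero_DRQuot_neg F hp i)
    (Q_map_DRProj_surjective_one hE hp) U (fun x => ⟨x, hxU x⟩) q
    (fun x y z => by
      have hx : U x ⊓ U y ⊓ U z ≤ U x := inf_le_left.trans inf_le_left
      have hy : U x ⊓ U y ⊓ U z ≤ U y := inf_le_left.trans inf_le_right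
      have hz : U x ⊓ U y ⊓ U z ≤ U z := inf_le_right
      rw [hresq, hresq, hresq]
      exact Splitting.proj_form₀_add hlh.le hp htop ((hU x).mono hx) ((s x).res hx) ((s y).res hy)
        ((s z).res hz) ((hφ x y).res (le_inf hx hy)) ((hφ y z).res (le_inf hy hz))
        ((hφ x z).res (le_inf hx hz)))
    ω (fun x => (s x).proj_form₁_closed hlh.le hp htop' (hU x))
    (fun x y => by
      rw [hresω, hresω]
      exact Splitting.proj_form₁_sub hlh.le hp htop htop' ((hU x).mono inf_le_left) _ _)
  -- t lives in the quotient sheaf; a further shrinking represents it by endomorphisms.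
  choose W' hWW hxW' t' ht' using fun x =>
    exists_local_lift ((DRProj F hp).f 0) (t x) x (hxW x)
  let G : Gluing L := Gluing.ofDR F L (lo - hi) W' W hxW' hWW k n hk hn hkn
  -- Conjugation by 1 + t' absorbs the coboundary, so that the modified splittings match the
  -- transition maps and the connection of the twisted lift exactly.
  let σ (x : T.X') : Splitting F L lo hi (W' x) :=
    ((s (i x)).res ((hWW x).trans (hW x))).conj (Lift.dr₀_mem_nil (t' x))
  have hσ (x : T.X') {V : T.X'.Opens} (h : V ≤ W' x) : ((σ x).res h).π =
      (((s (i x)).res (h.trans ((hWW x).trans (hW x)))).conj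
        (Lift.dr₀_mem_nil (AbSh.res _ h (t' x)))).π := by
    change (fun p => ((1 + L.dr₀ F _ _ (t' x)) * _ * (1 - L.dr₀ F _ _ (t' x))).res h) = fun p =>
      (1 + L.dr₀ F _ _ (AbSh.res _ h (t' x))) * _ * (1 - L.dr₀ F _ _ (AbSh.res _ h (t' x)))
    rw [← Lift.dr₀_res]
    rfl
  have htres (x : T.X') {V : T.X'.Opens} (h : V ≤ W' x) :
      shApp ((DRProj F hp).f 0) V (AbSh.res _ h (t' x)) = AbSh.res _ (h.trans (hWW x)) (t x) := by
    rw [← shApp_res, ht']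
    exact resP_resP _ _ _ _
  have hmaps (x y : T.X') : MapsFil ((σ y).res inf_le_right).π
      ((σ x).res (inf_le_left : W' x ⊓ W' y ≤ W' x)).π
      (1 + L.dr₀ F _ _ (AbSh.res _ (inf_le_inf (hWW x) (hWW y)) (n x y))) := by
    rw [hσ, hσ]
    refine Splitting.mapsFil_of_proj hlh.le hp htop
      ((hU (i x)).mono (inf_le_left.trans ((hWW x).trans (hW x)))) _ _ _ _ _ ?_
    rw [← shApp_res, hnq, map_add, map_sub, htres, htres, ← hφres (i x) (i y)
      (inf_le_inf ((hWW x).trans (hW x)) ((hWW y).trans (hW y))), ← hresq]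
    refine congrArg₂ (· + ·) (resP_resP _ _ _ _) (congrArg₂ (· - ·) ?_ ?_) <;>
    exact resP_resP _ _ _ _
  have hgriff (x : T.X') {V : T.X'.Opens} (h : V ≤ W' x) (ξ : T.VF V) :
      IsGriff ((σ x).res h).π (L.E'.nablaEndHom ξ.fst)
        (L.dr₁ F _ ξ (AbSh.res _ (h.trans (hWW x)) (k x))) := by
    rw [hσ]
    refine Splitting.isGriff_of_proj hlh.le hp htop'
      ((hU (i x)).mono (h.trans ((hWW x).trans (hW x)))) _ _ _ ?_ _
    rw [← shApp_res, hkω, map_add, ← hresω, ← shApp_comp ((DR F _).d 0 1), ← (DRProj F hp).comm,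
      shApp_comp, htres, ← shApp_res]
    exact congrArg (· + _) (resP_resP _ _ _ _)
  refine ⟨Gluing.Adapted.filLift (G := G) (s := σ) ⟨hmaps, fun x V h ξ => ?_⟩⟩
  have := hgriff x h (toVF ξ)
  rw [toVF_fst] at this
  exact this

end

end FilteredDeRham

end

end

theorem mainTheorem4 (T : FilteredDeRham.ThickenedPair.{u})
    (E : FilteredDeRham.DeRhamBundle T.g T.D) (F : FilteredDeRham.HodgeFiltration E)
    (hE₁ : FilteredDeRham.ThickenedPair.HodgeDeRhamDegenerates F) :
    (Nonempty (FilteredDeRham.Lift E) → Nonempty (FilteredDeRham.FilLift F)) ∧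
    Function.Injective (FilteredDeRham.DefFil.forget F) ∧
    ∀ (L : FilteredDeRham.Lift E) (F₁ F₂ : FilteredDeRham.HodgeFiltration L.E')
      (h₁ : FilteredDeRham.LiftsFil F L F₁) (h₂ : FilteredDeRham.LiftsFil F L F₂),
      Nonempty (FilteredDeRham.FilLift.Iso (F := F) ⟨L, F₁, h₁⟩ ⟨L, F₂, h₂⟩) :=
  ⟨fun ⟨L⟩ => FilteredDeRham.nonempty_filLift hE₁ L,
    FilteredDeRham.DefFil.forget_injective hE₁,
    fun _ F₁ F₂ h₁ h₂ => FilteredDeRham.nonempty_iso_of_lifts hE₁ F₁ F₂ h₁ h₂⟩
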